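/- **Setting.** Fix distinct points $y_1,y_2\in\mathbb R^3$ and lengths $s_1,s_2>0$. For $a\in\{1,2\}$ put $r_a=|x-y_a|$ and $n_a=(x-y_a)/r_a\in S^2$; write $d\Omega$ for the solid angle on $S^2$ and, for a multi-index $L=i_1\cdots i_l$, $n^L=n^{i_1}\cdots n^{i_l}$ and $\partial_L=\partial_{i_1}\cdots\partial_{i_l}$; repeated multi-indices are summed. Let $\mathcal F$ be the real vector space of functions $F\in C^\infty(\mathbb R^3\setminus\{y_1,y_2\})$ such that $F$ and each of its partial derivatives $\partial_LF$ has, at each $y_a$, an expansion in integer powers bounded from below: $F=\sum_{k_0\le k\le N}r_a^k\,{}_af_k(n_a)+o(r_a^N)$ as $r_a\to0$, for all $N\in\mathbb N$. The ${}_af_k$ with $k<0$ are the *singular coefficients* of $F$. Their symmetric trace-free (STF) tensors are ${}_a\hat f_k^L=\frac{(2l+1)!!}{l!}\int\frac{d\Omega}{4\pi}\,\hat n^L\,{}_af_k(n)$, where $\hat n^L$ is the STF projection of $n^L$. The partie finie of $F$ at $y_a$ is $(F)_a=\int\frac{d\Omega}{4\pi}\,{}_af_0$, and, for $F$ integrable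 near infinity, $$\mathrm{Pf}\!\int F=\lim_{s\to0^+}\Big\{\int_{r_1>s,\,r_2>s}F\,d^3x+\sum_{a=1,2}\Big[\sum_{k+3<0}\frac{s^{k+3}}{k+3}\int d\Omega\,{}_af_k+\ln\frac{s}{s_a}\int d\Omega\,{}_af_{-3}\Big]\Big\}.$$ The pseudo-functions $\mathrm{Pf}F$ and $\mathrm{Pf}(H\delta_a)$, for $F,H\in\mathcal F$, are the linear forms $\langle\mathrm{Pf}F,G\rangle=\mathrm{Pf}\!\int FG$ and $\langle\mathrm{Pf}(H\delta_a),G\rangle=(HG)_a$ of $G\in\mathcal F$, the first being defined when $FG$ is integrable near infinity. A *derivative operator* is $\partial_i(\mathrm{Pf}F)=\mathrm{Pf}(\partial_iF)+D_i[F]$, $i=1,2,3$, where $D_i$ is linear in $F$ with values in the linear forms on $\mathcal F$. *Multi-derivatives* extending it are $\partial_L(\mathrm{Pf}F)=\mathrm{Pf}(\partial_LF)+D_L[F]$, one for each finite sequence $L$ of indices, with $D_L$ linear in $F$, each $D_L[F]$ of the form $\mathrm{Pf}(H_1\delta_1)+\mathrm{Pf}(H_2\delta_2)$ with $H_1,H_2\in\mathcal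 F$, with the given $D_i$ for $L=i$, and with $D_\emptyset=0$. Put $$\langle\partial_P(\mathrm{Pf}F),\partial_Q(\mathrm{Pf}G)\rangle=\mathrm{Pf}\!\int\partial_PF\,\partial_QG+\langle D_P[F],\partial_QG\rangle+\langle D_Q[G],\partial_PF\rangle .$$ Consider the following conditions. (i) $D_i[F]$ *depends only on the singular coefficients of $F$*, in this sense: $D_i=D_i^{(1)}+D_i^{(2)}$, where, for $a=1,2$, $D_i^{(a)}$ is linear; $D^{(a)}_i[F]=\mathrm{Pf}(H\delta_a)$ for some $H\in\mathcal F$ depending on $i$ and $F$; $D_i^{(a)}[F]$ depends only on the singular coefficients of $F$ at $y_a$; and $D_i^{(a)}$ prefers no direction and no unit of length: for every $R\in O(3)$ and $c>0$, if ${}_af'_k(Rn)=c^{-k}{}_af_k(n)$ for all $k<0$ and ${}_ag'_k(Rn)=c^{-k}{}_ag_k(n)$ for all $k$, then $\langle D_i^{(a)}[F'],G'\rangle=c^2\sum_jR_{ij}\langle D_j^{(a)}[F],G\rangle$. (ii) All multi-derivatives satisfy the rule of integration by parts: for every $l\ge1$, every $i_1,\dots,i_l$ and every $1\le k\le l$,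 $$\langle\partial_{i_1\cdots i_l}(\mathrm{Pf}F),G\rangle=(-1)^k\langle\partial_{i_{k+1}\cdots i_l}(\mathrm{Pf}F),\partial_{i_k\cdots i_1}(\mathrm{Pf}G)\rangle$$ for all $F,G\in\mathcal F$ such that $\partial_{i_{j+1}\cdots i_l}F\,\partial_{i_j\cdots i_1}G$ is integrable near infinity for $0\le j\le k$ and $\partial_{i_{j+2}\cdots i_l}F\,\partial_{i_j\cdots i_1}G=o(|x|^{-2})$ at infinity for $0\le j<k$. (ii$'$) The same as (ii), but only for $k=1$. (iii) All multi-derivatives commute: $D_{i_1\cdots i_l}[F]$ is symmetric in $i_1,\dots,i_l$. **Theorem.** Let $D_i$ be a derivative operator. The following are equivalent: (1) (i) holds, and there are multi-derivatives extending $D_i$ that satisfy (ii) and (iii); (2) (i) holds, and there are multi-derivatives extending $D_i$ that satisfy (ii$'$) and (iii); (3) there are constants $K_1,K_2\in\mathbb R$ such that, for all $i$ and $F$, $$D_i[F]=4\pi\sum_{a=1,2}\ \sum_{l=0}^{\infty}\mathrm{Pf}\Big(C_l^{(a)}\big[n_a^{iL}\,{}_a\hat f_{-1}^{L}-n_a^{L}\,{}_a\hat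 f_{-1}^{iL}\big]r_a\delta_a+\sum_{k\ge0}\frac{n_a^{iL}}{r_a^k}\,{}_a\hat f_{-2-k}^{L}\,\delta_a\Big),\qquad C_l^{(a)}=(l+1)\Big[K_a+\sum_{j=1}^l\frac1{j+1}\Big],$$ where the series in $l$ (of the sum over $a$ of the terms) converges absolutely when applied to any $G\in\mathcal F$. If, moreover, (i) is required with the same rule at the two singularities (that is, $\langle D^{(1)}_i[F],G\rangle=\langle D^{(2)}_i[F'],G'\rangle$ whenever ${}_1f_k={}_2f'_k$ for all $k<0$ and ${}_1g_k={}_2g'_k$ for all $k$), the same equivalences hold with $K_1=K_2=K$ in (3), so that $D_i$ depends on a single constant $K$. The constants are arbitrary: for all $K_1,K_2\in\mathbb R$ there is exactly one derivative operator given by the formula in (3). -/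

import Mathlib

open MeasureTheory Filter Topology Asymptotics
open scoped ContDiff Nat

namespace Hadamard

noncomputable section

/-- Three-dimensional Euclidean space. -/
abbrev E : Type := EuclideanSpace ℝ (Fin 3)

/-- The unit sphere of directions. -/
abbrev S2 : Type := Metric.sphere (0 : E) 1

/-- The direction `v / |v|` of a nonzero vector (a fixed unit vector for `v = 0`). -/
def dir (v : E) : S2 :=
  if h : v = 0 then ⟨EuclideanSpace.single 0 1, by simp⟩
  else ⟨‖v‖⁻¹ • v, by simp [norm_smul, h]⟩

/-! ### The class of singular functions -/

/-- `F` has, at the point `y`, the asymptotic expansion `∑ r ^ k * f k (n)` in integer powers,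
bounded from below, of `r = |x - y|`, where `n = (x - y) / r`. -/
def HasExpansion (y : E) (F : E → ℝ) (f : ℤ → S2 → ℝ) : Prop :=
  ∃ m : ℤ, (∀ k < m, f k = 0) ∧ ∀ N : ℕ,
    (fun x => F x - ∑ k ∈ Finset.Icc m (N : ℤ), ‖x - y‖ ^ k * f k (dir (x - y)))
      =o[𝓝[≠] y] fun x => ‖x - y‖ ^ N

open Classical in
/-- The coefficient (a function of the direction) of `r ^ k` in the expansion of `F` at `y`. -/
def coef (y : E) (F : E → ℝ) (k : ℤ) : S2 → ℝ :=
  if h : ∃ f, HasExpansion y F f then h.choose k else 0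

open Classical in
/-- The ordinary partial derivative, taken outside the singular points. -/
def pd (y₁ y₂ : E) (i : Fin 3) (F : E → ℝ) : E → ℝ := fun x =>
  if x = y₁ ∨ x = y₂ then 0 else fderiv ℝ F x (EuclideanSpace.single i 1)

/-- The ordinary multiple derivative `∂_{i₁} ⋯ ∂_{iₗ}`. -/
def pdL (y₁ y₂ : E) (L : List (Fin 3)) (F : E → ℝ) : E → ℝ :=
  L.foldr (pd y₁ y₂) F

/-- `F` is smooth outside `y₁, y₂` and has, together with all its derivatives, expansions at
`y₁` and at `y₂`. -/
def IsSingular (y₁ y₂ : E) (F : E → ℝ) : Prop :=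
  ContDiffOn ℝ ∞ F {x | ¬ (x = y₁ ∨ x = y₂)} ∧
    ∀ L : List (Fin 3), (∃ f, HasExpansion y₁ (pdL y₁ y₂ L F) f) ∧
      ∃ f, HasExpansion y₂ (pdL y₁ y₂ L F) f

theorem HasExpansion.of_le {y : E} {F : E → ℝ} {f : ℤ → S2 → ℝ} {m m' : ℤ} (hm : m' ≤ m)
    (h0 : ∀ k < m, f k = 0)
    (h : ∀ N : ℕ,
      (fun x => F x - ∑ k ∈ Finset.Icc m (N : ℤ), ‖x - y‖ ^ k * f k (dir (x - y)))
        =o[𝓝[≠] y] fun x => ‖x - y‖ ^ N) (N : ℕ) :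
    (fun x => F x - ∑ k ∈ Finset.Icc m' (N : ℤ), ‖x - y‖ ^ k * f k (dir (x - y)))
      =o[𝓝[≠] y] fun x => ‖x - y‖ ^ N := by
  refine (h N).congr_left fun x => ?_
  congr 1
  refine Finset.sum_subset (Finset.Icc_subset_Icc_left hm) fun k hk hk' => ?_
  have : k < m := by
    simp only [Finset.mem_Icc] at hk hk'
    omega
  simp [h0 k this]

theorem HasExpansion.add {y : E} {F G : E → ℝ} {f g : ℤ → S2 → ℝ}
    (hF : HasExpansion y F f) (hG : HasExpansion y G g) : HasExpansion y (F + G) (f + g) := by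
  obtain ⟨m, h0, h⟩ := hF
  obtain ⟨m', h0', h'⟩ := hG
  refine ⟨min m m', fun k hk => ?_, fun N => ?_⟩
  · simp [h0 k (by omega), h0' k (by omega)]
  · refine ((HasExpansion.of_le (min_le_left m m') h0 h N).add
      (HasExpansion.of_le (min_le_right m m') h0' h' N)).congr_left fun x => ?_
    simp only [Pi.add_apply, mul_add, Finset.sum_add_distrib]
    ring

theorem HasExpansion.smul {y : E} {F : E → ℝ} {f : ℤ → S2 → ℝ} (c : ℝ)
    (hF : HasExpansion y F f) : HasExpansion y (c • F) (c • f) := by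
  obtain ⟨m, h0, h⟩ := hF
  refine ⟨m, fun k hk => by simp [h0 k hk], fun N => ?_⟩
  refine ((h N).const_mul_left c).congr_left fun x => ?_
  simp only [Pi.smul_apply, smul_eq_mul, mul_sub, Finset.mul_sum]
  congr 1
  exact Finset.sum_congr rfl fun k _ => by ring

theorem hasExpansion_zero (y : E) : HasExpansion y 0 0 :=
  ⟨0, fun _ _ => rfl, fun N => by simp⟩

theorem isOpen_regular (y₁ y₂ : E) : IsOpen {x : E | ¬ (x = y₁ ∨ x = y₂)} := by
  have : {x : E | ¬ (x = y₁ ∨ x = y₂)} = ({y₁, y₂} : Set E)ᶜ := by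
    ext x
    simp
  rw [this]
  exact ((Set.finite_singleton y₂).insert y₁).isClosed.isOpen_compl

theorem contDiffOn_pd {y₁ y₂ : E} {F : E → ℝ} (i : Fin 3)
    (hF : ContDiffOn ℝ ∞ F {x | ¬ (x = y₁ ∨ x = y₂)}) :
    ContDiffOn ℝ ∞ (pd y₁ y₂ i F) {x | ¬ (x = y₁ ∨ x = y₂)} := by
  have h := (hF.fderiv_of_isOpen (isOpen_regular y₁ y₂) (m := ∞) (by simp)).clm_apply
    (contDiffOn_const (c := (EuclideanSpace.single i 1 : E)))
  refine h.congr fun x hx => ?_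
  have hx' : ¬ (x = y₁ ∨ x = y₂) := hx
  simp only [pd, if_neg hx']

theorem contDiffOn_pdL {y₁ y₂ : E} {F : E → ℝ} (L : List (Fin 3))
    (hF : ContDiffOn ℝ ∞ F {x | ¬ (x = y₁ ∨ x = y₂)}) :
    ContDiffOn ℝ ∞ (pdL y₁ y₂ L F) {x | ¬ (x = y₁ ∨ x = y₂)} := by
  induction L with
  | nil => exact hF
  | cons i L ih => exact contDiffOn_pd i ih

theorem differentiableAt_regular {y₁ y₂ : E} {F : E → ℝ}
    (hF : ContDiffOn ℝ ∞ F {x | ¬ (x = y₁ ∨ x = y₂)}) {x : E} (hx : ¬ (x = y₁ ∨ x = y₂)) :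
    DifferentiableAt ℝ F x :=
  (hF.contDiffAt ((isOpen_regular y₁ y₂).mem_nhds hx)).differentiableAt (by simp)

theorem pd_add {y₁ y₂ : E} {F G : E → ℝ} (i : Fin 3)
    (hF : ContDiffOn ℝ ∞ F {x | ¬ (x = y₁ ∨ x = y₂)})
    (hG : ContDiffOn ℝ ∞ G {x | ¬ (x = y₁ ∨ x = y₂)}) :
    pd y₁ y₂ i (F + G) = pd y₁ y₂ i F + pd y₁ y₂ i G := by
  funext x
  by_cases hx : x = y₁ ∨ x = y₂
  · simp [pd, hx]
  · simp only [pd, if_neg hx, Pi.add_apply]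
    rw [fderiv_add (differentiableAt_regular hF hx) (differentiableAt_regular hG hx)]
    rfl

theorem pd_smul {y₁ y₂ : E} {F : E → ℝ} (i : Fin 3) (c : ℝ)
    (hF : ContDiffOn ℝ ∞ F {x | ¬ (x = y₁ ∨ x = y₂)}) :
    pd y₁ y₂ i (c • F) = c • pd y₁ y₂ i F := by
  funext x
  by_cases hx : x = y₁ ∨ x = y₂
  · simp [pd, hx]
  · simp only [pd, if_neg hx, Pi.smul_apply]
    rw [fderiv_const_smul (differentiableAt_regular hF hx)]
    rfl

theorem pdL_add {y₁ y₂ : E} {F G : E → ℝ} (L : List (Fin 3))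
    (hF : ContDiffOn ℝ ∞ F {x | ¬ (x = y₁ ∨ x = y₂)})
    (hG : ContDiffOn ℝ ∞ G {x | ¬ (x = y₁ ∨ x = y₂)}) :
    pdL y₁ y₂ L (F + G) = pdL y₁ y₂ L F + pdL y₁ y₂ L G := by
  induction L with
  | nil => rfl
  | cons i L ih =>
    change pd y₁ y₂ i (pdL y₁ y₂ L (F + G)) = _
    rw [ih]
    exact pd_add i (contDiffOn_pdL L hF) (contDiffOn_pdL L hG)

theorem pdL_smul {y₁ y₂ : E} {F : E → ℝ} (L : List (Fin 3)) (c : ℝ)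
    (hF : ContDiffOn ℝ ∞ F {x | ¬ (x = y₁ ∨ x = y₂)}) :
    pdL y₁ y₂ L (c • F) = c • pdL y₁ y₂ L F := by
  induction L with
  | nil => rfl
  | cons i L ih =>
    change pd y₁ y₂ i (pdL y₁ y₂ L (c • F)) = _
    rw [ih]
    exact pd_smul i c (contDiffOn_pdL L hF)

theorem pdL_zero (y₁ y₂ : E) (L : List (Fin 3)) : pdL y₁ y₂ L 0 = 0 := by
  induction L with
  | nil => rfl
  | cons i L ih =>
    change pd y₁ y₂ i (pdL y₁ y₂ L 0) = _
    rw [ih]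
    funext x
    simp [pd]

/-- The class `𝓕` of functions singular at `y₁` and `y₂`, as a real vector space. -/
def singularSpace (y₁ y₂ : E) : Submodule ℝ (E → ℝ) where
  carrier := {F | IsSingular y₁ y₂ F}
  zero_mem' := ⟨contDiffOn_const, fun L => by
    rw [pdL_zero]
    exact ⟨⟨0, hasExpansion_zero y₁⟩, ⟨0, hasExpansion_zero y₂⟩⟩⟩
  add_mem' := by
    rintro F G ⟨hF, hF'⟩ ⟨hG, hG'⟩
    refine ⟨hF.add hG, fun L => ?_⟩
    obtain ⟨⟨f, hf⟩, ⟨f', hf'⟩⟩ := hF' L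
    obtain ⟨⟨g, hg⟩, ⟨g', hg'⟩⟩ := hG' L
    rw [pdL_add L hF hG]
    exact ⟨⟨_, hf.add hg⟩, ⟨_, hf'.add hg'⟩⟩
  smul_mem' := by
    rintro c F ⟨hF, hF'⟩
    refine ⟨contDiffOn_const.smul hF, fun L => ?_⟩
    obtain ⟨⟨f, hf⟩, ⟨f', hf'⟩⟩ := hF' L
    rw [pdL_smul L c hF]
    exact ⟨⟨_, hf.smul c⟩, ⟨_, hf'.smul c⟩⟩

theorem pdL_mem {y₁ y₂ : E} {F : E → ℝ} (L : List (Fin 3)) (hF : F ∈ singularSpace y₁ y₂) :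
    pdL y₁ y₂ L F ∈ singularSpace y₁ y₂ := by
  refine ⟨contDiffOn_pdL L hF.1, fun M => ?_⟩
  have : pdL y₁ y₂ M (pdL y₁ y₂ L F) = pdL y₁ y₂ (M ++ L) F := by
    simp [pdL, List.foldr_append]
  rw [this]
  exact hF.2 (M ++ L)

/-- The ordinary multiple derivative as a map of the class `𝓕` to itself. -/
def ordDeriv {y₁ y₂ : E} (L : List (Fin 3)) (F : singularSpace y₁ y₂) : singularSpace y₁ y₂ :=
  ⟨pdL y₁ y₂ L F, pdL_mem L F.2⟩

/-- Linear forms on `𝓕`. -/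
abbrev Form (y₁ y₂ : E) : Type := Module.Dual ℝ (singularSpace y₁ y₂)

/-! ### Hadamard parties finies -/

/-- Integral over the unit sphere with respect to the solid angle element. -/
def sphereInt (h : S2 → ℝ) : ℝ := ∫ n, h n ∂(volume : Measure E).toSphere

/-- Average over the unit sphere. -/
def sphereAvg (h : S2 → ℝ) : ℝ := (4 * Real.pi)⁻¹ * sphereInt h

/-- The partie finie of `F` at the point `y`. The value at `G` of the pseudo-function
`Pf(H δ_y)` is `pfAt y (H * G)`. -/
def pfAt (y : E) (F : E → ℝ) : ℝ := sphereAvg (coef y F 0)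

/-- The divergent terms at the point `y`, for balls of radius `s` and length scale `s₀`. -/
def divergentPart (y : E) (s₀ : ℝ) (F : E → ℝ) (s : ℝ) : ℝ :=
  (∑ᶠ (a : ℤ) (_ : a + 3 < 0), s ^ (a + 3) / ((a : ℝ) + 3) * sphereInt (coef y F a)) +
    Real.log (s / s₀) * sphereInt (coef y F (-3))

/-- The partie finie of the integral of `F` over the whole space. -/
def pfIntegral (y₁ y₂ : E) (s₁ s₂ : ℝ) (F : E → ℝ) : ℝ :=
  limUnder (𝓝[>] (0 : ℝ)) fun s =>
    (∫ x in (Metric.closedBall y₁ s ∪ Metric.closedBall y₂ s)ᶜ, F x) +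
      divergentPart y₁ s₁ F s + divergentPart y₂ s₂ F s

/-! ### Symmetric trace-free tensors -/

/-- Cartesian tensors with `l` indices. -/
abbrev Tensor (l : ℕ) : Type := EuclideanSpace ℝ (Fin l → Fin 3)

/-- The subspace of symmetric trace-free tensors. -/
def stfSubspace (l : ℕ) : Submodule ℝ (Tensor l) where
  carrier := {T | (∀ (σ : Equiv.Perm (Fin l)) (I : Fin l → Fin 3), T (I ∘ σ) = T I) ∧
    ∀ p q : Fin l, p ≠ q → ∀ I : Fin l → Fin 3,
      ∑ c : Fin 3, T (Function.update (Function.update I p c) q c) = 0}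
  zero_mem' := by simp
  add_mem' := by
    rintro T U ⟨hT, hT'⟩ ⟨hU, hU'⟩
    refine ⟨fun σ I => by simp [hT σ I, hU σ I], fun p q hpq I => ?_⟩
    simp [Finset.sum_add_distrib, hT' p q hpq I, hU' p q hpq I]
  smul_mem' := by
    rintro c T ⟨hT, hT'⟩
    refine ⟨fun σ I => by simp [hT σ I], fun p q hpq I => ?_⟩
    simp [← Finset.mul_sum, hT' p q hpq I]

/-- The symmetric trace-free projection. -/
def stf {l : ℕ} (T : Tensor l) : Tensor l := (stfSubspace l).starProjection T

/-- The tensor `n^L = n^{i₁} ⋯ n^{iₗ}`. -/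
def nPow (l : ℕ) (n : S2) : Tensor l :=
  WithLp.toLp 2 fun I : Fin l → Fin 3 => ∏ j, (n : E) (I j)

/-- The symmetric trace-free tensor with `l` indices of the coefficient of `r ^ a` in the
expansion of `F` at `y`. -/
def stfCoef (y : E) (F : E → ℝ) (a : ℤ) (l : ℕ) (I : Fin l → Fin 3) : ℝ :=
  ((2 * l + 1)‼ : ℝ) / (l ! : ℝ) * sphereAvg fun n => stf (nPow l n) I * coef y F a n

/-! ### Distributional derivatives -/

/-- A family `T i F` of linear forms which are proportional to the Dirac pseudo-function at `y`
(that is, of the form `Pf(H δ_y)`), which depend only on the coefficients of the negative powers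
in the expansion of `F` at `y`, and in which no direction and no unit of length is preferred:
a rotation or reflection `R` and a dilation by `c` about `y` of the expansions of `F` and `G`
turn `⟨T i F, G⟩` into `c ^ 2 * ∑ j, R i j * ⟨T j F, G⟩`, as they do with `∫ ∂_i F G`. -/
structure IsLocalTerm {y₁ y₂ : E} (y : E) (T : Fin 3 → singularSpace y₁ y₂ →ₗ[ℝ] Form y₁ y₂) :
    Prop where
  dirac : ∀ i F, ∃ H : singularSpace y₁ y₂, ∀ G : singularSpace y₁ y₂,
    T i F G = pfAt y ((H : E → ℝ) * G)
  singular : ∀ F F' : singularSpace y₁ y₂, (∀ k < 0, coef y F k = coef y F' k) →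
    ∀ i, T i F = T i F'
  covariant : ∀ (R : E ≃ₗᵢ[ℝ] E) (c : ℝ), 0 < c → ∀ F F' G G' : singularSpace y₁ y₂,
    (∀ k < 0, ∀ n m : S2, (m : E) = R n → coef y F' k m = c ^ (-k) * coef y F k n) →
    (∀ k, ∀ n m : S2, (m : E) = R n → coef y G' k m = c ^ (-k) * coef y G k n) →
    ∀ i, T i F' G' = c ^ 2 * ∑ j, R (EuclideanSpace.single j 1) i * T j F G

/-- The distributional term `D i F` depends only on the singular coefficients of `F`: it is the
sum of one term for each singular point. -/
def SingularOnly {y₁ y₂ : E} (D : Fin 3 → singularSpace y₁ y₂ →ₗ[ℝ] Form y₁ y₂) : Prop :=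
  ∃ T₁ T₂ : Fin 3 → singularSpace y₁ y₂ →ₗ[ℝ] Form y₁ y₂,
    IsLocalTerm y₁ T₁ ∧ IsLocalTerm y₂ T₂ ∧ ∀ i F, D i F = T₁ i F + T₂ i F

/-- As `SingularOnly`, with the same rule at the two singular points. -/
def SingularOnlyAlike {y₁ y₂ : E} (D : Fin 3 → singularSpace y₁ y₂ →ₗ[ℝ] Form y₁ y₂) : Prop :=
  ∃ T₁ T₂ : Fin 3 → singularSpace y₁ y₂ →ₗ[ℝ] Form y₁ y₂,
    IsLocalTerm y₁ T₁ ∧ IsLocalTerm y₂ T₂ ∧ (∀ i F, D i F = T₁ i F + T₂ i F) ∧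
    ∀ F F' G G' : singularSpace y₁ y₂, (∀ k < 0, coef y₁ F k = coef y₂ F' k) →
      (∀ k, coef y₁ G k = coef y₂ G' k) → ∀ i, T₁ i F G = T₂ i F' G'

/-- Distributional terms `M L` of multi-derivatives `∂_L (Pf F) = Pf (∂_L F) + M L F` of all
orders (none at order zero), of the form `Pf(H₁ δ₁) + Pf(H₂ δ₂)`, which are `D i` at order one. -/
structure IsMultiDeriv {y₁ y₂ : E} (D : Fin 3 → singularSpace y₁ y₂ →ₗ[ℝ] Form y₁ y₂)
    (M : List (Fin 3) → singularSpace y₁ y₂ →ₗ[ℝ] Form y₁ y₂) : Prop where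
  nil : M [] = 0
  single : ∀ i, M [i] = D i
  dirac : ∀ L F, ∃ H₁ H₂ : singularSpace y₁ y₂, ∀ G : singularSpace y₁ y₂,
    M L F G = pfAt y₁ ((H₁ : E → ℝ) * G) + pfAt y₂ ((H₂ : E → ℝ) * G)

/-- The bracket `⟨∂_P (Pf F), ∂_Q (Pf G)⟩`; the product of two distributional terms is zero.
For `Q = []` and `M [] = 0` it is the value of `∂_P (Pf F)` at `G`. -/
def bracket {y₁ y₂ : E} (s₁ s₂ : ℝ) (M : List (Fin 3) → singularSpace y₁ y₂ →ₗ[ℝ] Form y₁ y₂)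
    (P : List (Fin 3)) (F : singularSpace y₁ y₂) (Q : List (Fin 3))
    (G : singularSpace y₁ y₂) : ℝ :=
  pfIntegral y₁ y₂ s₁ s₂ (pdL y₁ y₂ P F * pdL y₁ y₂ Q G) +
    M P F (ordDeriv Q G) + M Q G (ordDeriv P F)

/-- The rule of integration by parts for the first `k` derivatives of `∂_L`, namely
`⟨∂_{i₁ ⋯ iₗ} (Pf F), G⟩ = (-1) ^ k ⟨∂_{i_{k+1} ⋯ iₗ} (Pf F), ∂_{i_k ⋯ i₁} (Pf G)⟩`, for all `F`
and `G` such that the integrals converge, and the surface terms vanish, at infinity. -/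
def ByParts {y₁ y₂ : E} (s₁ s₂ : ℝ) (M : List (Fin 3) → singularSpace y₁ y₂ →ₗ[ℝ] Form y₁ y₂)
    (L : List (Fin 3)) (k : ℕ) : Prop :=
  ∀ F G : singularSpace y₁ y₂,
    (∀ j ≤ k, IntegrableAtFilter
      (pdL y₁ y₂ (L.drop j) F * pdL y₁ y₂ (L.take j).reverse G) (cocompact E) volume) →
    (∀ j < k, (pdL y₁ y₂ (L.drop (j + 1)) F * pdL y₁ y₂ (L.take j).reverse G)
      =o[cocompact E] fun x => ‖x‖ ^ (-2 : ℤ)) →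
    bracket s₁ s₂ M L F [] G =
      (-1) ^ k * bracket s₁ s₂ M (L.drop k) F (L.take k).reverse G

/-- All multi-derivatives satisfy the rule of integration by parts, for the first index. -/
def ByPartsFirst {y₁ y₂ : E} (s₁ s₂ : ℝ)
    (M : List (Fin 3) → singularSpace y₁ y₂ →ₗ[ℝ] Form y₁ y₂) : Prop :=
  ∀ L : List (Fin 3), L ≠ [] → ByParts s₁ s₂ M L 1

/-- All multi-derivatives satisfy the general rule of integration by parts. -/
def ByPartsAll {y₁ y₂ : E} (s₁ s₂ : ℝ)
    (M : List (Fin 3) → singularSpace y₁ y₂ →ₗ[ℝ] Form y₁ y₂) : Prop :=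
  ∀ (L : List (Fin 3)) (k : ℕ), 1 ≤ k → k ≤ L.length → ByParts s₁ s₂ M L k

/-- All multi-derivatives commute. -/
def Commuting {y₁ y₂ : E} (M : List (Fin 3) → singularSpace y₁ y₂ →ₗ[ℝ] Form y₁ y₂) : Prop :=
  ∀ L L' : List (Fin 3), L.Perm L' → M L = M L'

/-- The coefficients `C_l = (l + 1) (K + ∑_{j=1}^l 1 / (j + 1))`. -/
def Ccoef (K : ℝ) (l : ℕ) : ℝ :=
  ((l : ℝ) + 1) * (K + ∑ j ∈ Finset.Icc 1 l, 1 / ((j : ℝ) + 1))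

/-- The factor of `δ_y` in the term of order `l` of the distributional derivative:
`C_l (n^{iL} f_{-1}^L - n^L f_{-1}^{iL}) r + ∑_{k ≥ 0} n^{iL} r^{-k} f_{-2-k}^L`, with
summation over `L`, where `f_a^L` are the symmetric trace-free tensors of `F` at `y`. -/
def derivTerm (y : E) (K : ℝ) (i : Fin 3) (F : E → ℝ) (l : ℕ) : E → ℝ := fun x =>
  Ccoef K l *
      (∑ I : Fin l → Fin 3, (dir (x - y) : E) i * nPow l (dir (x - y)) I * stfCoef y F (-1) l I -
        ∑ I : Fin l → Fin 3,
          nPow l (dir (x - y)) I * stfCoef y F (-1) (l + 1) (Fin.cons i I)) * ‖x - y‖ +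
    ∑ᶠ k : ℕ, ∑ I : Fin l → Fin 3,
      (dir (x - y) : E) i * nPow l (dir (x - y)) I / ‖x - y‖ ^ k * stfCoef y F (-2 - (k : ℤ)) l I

/-- The distributional term is given by the series
`D_i[F] = 4π ∑_l Pf(derivTerm y₁ K₁ δ₁) + 4π ∑_l Pf(derivTerm y₂ K₂ δ₂)`. -/
def IsGivenBy {y₁ y₂ : E} (D : Fin 3 → singularSpace y₁ y₂ →ₗ[ℝ] Form y₁ y₂) (K₁ K₂ : ℝ) :
    Prop :=
  ∀ (i : Fin 3) (F G : singularSpace y₁ y₂),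
    HasSum (fun l : ℕ => 4 * Real.pi *
      (pfAt y₁ (derivTerm y₁ K₁ i F l * (G : E → ℝ)) +
        pfAt y₂ (derivTerm y₂ K₂ i F l * (G : E → ℝ)))) (D i F G)

end

end Hadamard

open Hadamard

/-! ### Calculus and integration on the unit sphere -/

namespace Hadamard

noncomputable section

/-! ### Smooth functions on the sphere -/

/-! Near a singular point an element of the class is a Laurent series `∑ r ^ k f_k` whose
coefficients turn out to be smooth on the sphere (`hasFDerivAt_coeff`, `ls`), and everything local
becomes algebra in these series. A Dirac pseudo-function reads the mean of the coefficient of order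
0 of a product. By Gauss's theorem, `Pf ∫ ∂_i X` is minus the sum over the singular points of `∫ n_i
X_{-2}` (`pfIntegral_dd`). Integration by parts at order one therefore says that `D_i[F](G) +
D_i[G](F)` is the sum of the `∫ n_i (FG)_{-2}`. At order two it forces the term of `∂_i ∂_j` to be
`D_i[∂_j F](G) - D_j[F](∂_i G)`, so commutation is a condition on `D` alone.

Necessity. Invariance under dilations makes a local term vanish on `r ^ k f`, `r ^ m g` unless `k +
m = -2`. If `k ≤ -2` then `m ≥ 0`, the second monomial is invisible as a first argument, and the sum
rule gives the value `∫ n_i f g`. Only `k = m = -1` remains, where the Dirac form produces an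
operator `B_i` with value `∫ B_i(f) g`. The conditions become `B_i + B_i^* = n_i`, `B_i ∂_j = B_j
∂_i` with tangential gradients `∂_i`, and covariance under `O(3)`. With `T_i = ∂_i - n_i` and `H`
the multiplication of harmonics of degree `l` by `1 + ⋯ + 1/l`, the operator `T_i` is antisymmetric,
`H` is symmetric, `T_i ∂_j` is symmetric in the indices, and `[T_i, H] = n_i` (`sphT_hop`). Hence
`bop K i`, that is `n_i - T_i (K - 1 + H)`, is a solution for each `K`. The difference of two
solutions, taken through adjoints, is a curl-free field on the sphere, hence equals `T_i S`, where
`S` commutes with `O(3)`. Such an `S` preserves the degree of harmonics, and antisymmetry makes it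
one scalar for all degrees (`exists_eq_smul_sphT`). One constant per singular point is left.

Sufficiency. Multi-derivatives are defined by iterating integration by parts (`multi`). Since the
sum rule holds for all `F`, `G`, each step of integration by parts is exact, and commutation reduces
to two adjacent indices, where both sides are sums of rotation generators paired with coefficients
(`locD_comm`).

The series. Expanding `bop K i f` in spherical harmonics and shifting the index by one in the
degree-lowering part yields the stated `C_l` (`hasSum_bop`). Convergence follows from the rapid
decay of the harmonics of a smooth function. -/

theorem dir_coe {x : E} (hx : x ≠ 0) : (dir x : E) = ‖x‖⁻¹ • x := by
  simp [dir, hx]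

theorem norm_sphere (n : S2) : ‖(n : E)‖ = 1 := by
  simp

theorem sphere_ne_zero (n : S2) : (n : E) ≠ 0 := by
  intro h
  have := norm_sphere n
  simp [h] at this

theorem dir_sphere (n : S2) : dir (n : E) = n := by
  apply Subtype.ext
  rw [dir_coe (sphere_ne_zero n), norm_sphere]
  simp

theorem dir_smul {c : ℝ} (hc : 0 < c) (x : E) : dir (c • x) = dir x := by
  by_cases hx : x = 0
  · simp [hx]
  · apply Subtype.ext
    rw [dir_coe hx, dir_coe (smul_ne_zero hc.ne' hx), norm_smul, Real.norm_of_nonneg hc.le,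
      smul_smul, mul_inv, mul_right_comm, inv_mul_cancel₀ hc.ne', one_mul]

theorem norm_smul_dir (x : E) : ‖x‖ • (dir x : E) = x := by
  by_cases hx : x = 0
  · simp [hx]
  · rw [dir_coe hx, smul_smul, mul_inv_cancel₀ (norm_ne_zero_iff.2 hx), one_smul]

theorem dir_smul_sphere {c : ℝ} (hc : 0 < c) (n : S2) : dir (c • (n : E)) = n := by
  rw [dir_smul hc, dir_sphere]

theorem isOpen_punctured : IsOpen ({0}ᶜ : Set E) := isOpen_compl_singleton

theorem contDiffOn_norm_zpow (k : ℤ) : ContDiffOn ℝ ∞ (fun x : E => ‖x‖ ^ k) {0}ᶜ := by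
  have h : ContDiffOn ℝ ∞ (fun x : E => ‖x‖) {0}ᶜ := fun x hx =>
    (contDiffAt_norm ℝ hx).contDiffWithinAt
  intro x hx
  have hx' : ‖x‖ ≠ 0 := norm_ne_zero_iff.2 hx
  cases k with
  | ofNat k => simpa using (h x hx).pow k
  | negSucc k =>
    simp only [zpow_negSucc]
    exact ((h x hx).pow (k + 1)).inv (pow_ne_zero _ hx')

theorem contDiffOn_dir : ContDiffOn ℝ ∞ (fun x : E => (dir x : E)) {0}ᶜ := by
  have h := (contDiffOn_norm_zpow (-1)).smul (contDiffOn_id (𝕜 := ℝ) (E := E) (s := {0}ᶜ) (n := ∞))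
  refine h.congr fun x hx => ?_
  rw [dir_coe hx]
  simp

/-- The algebra of smooth functions on the sphere. -/
def smoothSphere : Subalgebra ℝ (S2 → ℝ) where
  carrier := {f | ContDiffOn ℝ ∞ (fun x => f (dir x)) {0}ᶜ}
  mul_mem' := fun hf hg => hf.mul hg
  add_mem' := fun hf hg => hf.add hg
  algebraMap_mem' := fun _ => contDiffOn_const

/-- Smooth functions on the sphere. -/
abbrev SM : Type := smoothSphere

theorem SM.ext' {f g : SM} (h : ∀ n, f.1 n = g.1 n) : f = g :=
  Subtype.ext (funext h)

theorem SM.continuous (f : SM) : Continuous f.1 := by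
  have h : Continuous fun n : S2 => f.1 (dir (n : E)) :=
    f.2.continuousOn.comp_continuous continuous_subtype_val fun n => sphere_ne_zero n
  simpa only [dir_sphere] using h

/-- The function `r ^ k * f (n)`. -/
def hom (k : ℤ) (f : S2 → ℝ) (x : E) : ℝ := ‖x‖ ^ k * f (dir x)

theorem contDiffOn_hom (k : ℤ) (f : SM) : ContDiffOn ℝ ∞ (hom k f.1) {0}ᶜ :=
  (contDiffOn_norm_zpow k).mul f.2

/-- The `i`-th basis vector. -/
abbrev ee (i : Fin 3) : E := EuclideanSpace.single i 1

theorem differentiableAt_of_contDiffOn {g : E → ℝ} (hg : ContDiffOn ℝ ∞ g {0}ᶜ) {x : E}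
    (hx : x ≠ 0) : DifferentiableAt ℝ g x :=
  (hg.contDiffAt (isOpen_punctured.mem_nhds hx)).differentiableAt (by simp)

theorem SM.differentiableAt (f : SM) {x : E} (hx : x ≠ 0) :
    DifferentiableAt ℝ (fun x => f.1 (dir x)) x :=
  differentiableAt_of_contDiffOn f.2 hx

/-- Differentiate the invariance of `f ∘ dir` under dilations: derivatives of a function of degree 0
have degree -1. The gradient is thus known from its values on the sphere, which makes `sphD` an
operator on `SM`. -/
theorem fderiv_dir_smul (f : SM) {c : ℝ} (hc : 0 < c) {x : E} (hx : x ≠ 0) (v : E) :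
    c * fderiv ℝ (fun x => f.1 (dir x)) (c • x) v = fderiv ℝ (fun x => f.1 (dir x)) x v := by
  have h1 : (fun x : E => f.1 (dir x)) = (fun x : E => f.1 (dir x)) ∘ fun x => c • x := by
    funext x
    simp [dir_smul hc]
  have h2 := (f.differentiableAt (smul_ne_zero hc.ne' hx)).hasFDerivAt.comp x
    ((hasFDerivAt_id (𝕜 := ℝ) x).const_smul c)
  have h3 := h2.fderiv
  rw [Function.comp_def] at h3
  simp only [dir_smul hc] at h3
  rw [h3]
  simp

theorem fderiv_dir (f : SM) {x : E} (hx : x ≠ 0) (v : E) :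
    fderiv ℝ (fun x => f.1 (dir x)) (dir x) v = ‖x‖ * fderiv ℝ (fun x => f.1 (dir x)) x v := by
  have h := fderiv_dir_smul f (norm_pos_iff.2 hx) (x := dir x) (sphere_ne_zero _) v
  rw [norm_smul_dir] at h
  exact h.symm

/-- The tangential gradient on the sphere. -/
def sphD (i : Fin 3) : SM →ₗ[ℝ] SM where
  toFun f := ⟨fun n => fderiv ℝ (fun x => f.1 (dir x)) n (ee i), by
    have h := (contDiffOn_norm_zpow 1).mul
      ((f.2.fderiv_of_isOpen isOpen_punctured (m := ∞) (by simp)).clm_apply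
        (contDiffOn_const (c := ee i)))
    refine ContDiffOn.congr h fun x hx => ?_
    simpa using fderiv_dir f hx (ee i)⟩
  map_add' f g := SM.ext' fun n => by
    have := fderiv_add (f.differentiableAt (sphere_ne_zero n))
      (g.differentiableAt (sphere_ne_zero n))
    exact congrArg (fun L => L (ee i)) this
  map_smul' c f := SM.ext' fun n => by
    have := fderiv_const_smul (f.differentiableAt (sphere_ne_zero n)) c
    exact congrArg (fun L => L (ee i)) this

theorem fderiv_sphD (f : SM) {x : E} (hx : x ≠ 0) (i : Fin 3) :
    fderiv ℝ (fun x => f.1 (dir x)) x (ee i) = ‖x‖⁻¹ * (sphD i f).1 (dir x) := by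
  change _ = ‖x‖⁻¹ * fderiv ℝ (fun x => f.1 (dir x)) (dir x) (ee i)
  rw [fderiv_dir f hx, ← mul_assoc, inv_mul_cancel₀ (norm_ne_zero_iff.2 hx), one_mul]

/-- The coordinate functions on the sphere. -/
def nn (i : Fin 3) : SM := ⟨fun n => (n : E) i, by
  have h : ContDiff ℝ ∞ fun x : E => x i := (EuclideanSpace.proj (𝕜 := ℝ) i).contDiff
  exact h.comp_contDiffOn contDiffOn_dir⟩

theorem sphD_mul (i : Fin 3) (f g : SM) : sphD i (f * g) = sphD i f * g + f * sphD i g := by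
  refine SM.ext' fun n => ?_
  have := fderiv_mul (f.differentiableAt (sphere_ne_zero n))
    (g.differentiableAt (sphere_ne_zero n))
  have h2 := congrArg (fun L => L (ee i)) this
  simp only [dir_sphere, _root_.add_apply, _root_.smul_apply,
    smul_eq_mul] at h2
  change fderiv ℝ (fun x => f.1 (dir x) * g.1 (dir x)) n (ee i) =
    fderiv ℝ (fun x => f.1 (dir x)) n (ee i) * g.1 n +
      f.1 n * fderiv ℝ (fun x => g.1 (dir x)) n (ee i)
  refine h2.trans ?_
  ring

theorem sphD_algebraMap (i : Fin 3) (c : ℝ) : sphD i (algebraMap ℝ SM c) = 0 := by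
  refine SM.ext' fun n => ?_
  change fderiv ℝ (fun x : E => c) n (ee i) = 0
  simp

theorem hasFDerivAt_norm' {x : E} (hx : x ≠ 0) :
    HasFDerivAt (fun x : E => ‖x‖) (‖x‖⁻¹ • innerSL ℝ x) x := by
  have h := (hasStrictFDerivAt_norm_sq x).hasFDerivAt.sqrt (by positivity)
  simp only [Real.sqrt_sq (norm_nonneg _)] at h
  refine h.congr_fderiv ?_
  ext v
  simp
  field_simp

theorem fderiv_norm_zpow (k : ℤ) {x : E} (hx : x ≠ 0) (i : Fin 3) :
    fderiv ℝ (fun x : E => ‖x‖ ^ k) x (ee i) = k * ‖x‖ ^ (k - 1) * (dir x : E) i := by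
  have h := (hasDerivAt_zpow k ‖x‖ (Or.inl (norm_ne_zero_iff.2 hx))).comp_hasFDerivAt x
    (hasFDerivAt_norm' hx)
  rw [Function.comp_def] at h
  rw [h.fderiv, dir_coe hx]
  simp [EuclideanSpace.inner_single_right]

theorem fderiv_hom (k : ℤ) (f : SM) {x : E} (hx : x ≠ 0) (i : Fin 3) :
    fderiv ℝ (hom k f.1) x (ee i) = hom (k - 1) (sphD i f + (k : ℝ) • (nn i * f)).1 x := by
  have h1 := differentiableAt_of_contDiffOn (contDiffOn_norm_zpow k) hx
  have h := fderiv_fun_mul h1 (f.differentiableAt hx)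
  have h2 : fderiv ℝ (hom k f.1) x (ee i) =
    ‖x‖ ^ k * fderiv ℝ (fun x => f.1 (dir x)) x (ee i) +
      f.1 (dir x) * fderiv ℝ (fun x : E => ‖x‖ ^ k) x (ee i) := by
    unfold hom
    rw [h]
    simp
  rw [h2, fderiv_sphD f hx, fderiv_norm_zpow k hx]
  change _ = ‖x‖ ^ (k - 1) * ((sphD i f).1 (dir x) + k * ((dir x : E) i * f.1 (dir x)))
  rw [zpow_sub_one₀ (norm_ne_zero_iff.2 hx)]
  ring

theorem sphD_nn (i j : Fin 3) :
    sphD i (nn j) = algebraMap ℝ SM (if i = j then 1 else 0) - nn i * nn j := by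
  refine SM.ext' fun n => ?_
  have hn := sphere_ne_zero n
  have h1 : (fun x : E => (nn j).1 (dir x)) =ᶠ[𝓝 (n : E)] fun x => ‖x‖ ^ (-1 : ℤ) * x j := by
    filter_upwards [isOpen_punctured.mem_nhds hn] with x hx
    change (dir x : E) j = _
    rw [dir_coe hx]
    simp
  change fderiv ℝ (fun x => (nn j).1 (dir x)) n (ee i) =
    (if i = j then 1 else 0) - (n : E) i * (n : E) j
  rw [h1.fderiv_eq]
  have h3 : HasFDerivAt (fun x : E => x j) (EuclideanSpace.proj (𝕜 := ℝ) j) (n : E) :=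
    (EuclideanSpace.proj (𝕜 := ℝ) j).hasFDerivAt
  have h2 := differentiableAt_of_contDiffOn (contDiffOn_norm_zpow (-1)) hn
  rw [fderiv_fun_mul h2 h3.differentiableAt, h3.fderiv]
  simp only [_root_.add_apply, _root_.smul_apply, smul_eq_mul]
  rw [fderiv_norm_zpow (-1) hn, norm_sphere, dir_sphere]
  by_cases hij : i = j
  · subst hij
    simp
    ring
  · have hij' : ¬ j = i := fun h => hij h.symm
    simp [hij, hij']
    ring

theorem sum_nn_sq : ∑ i, nn i * nn i = 1 := by
  refine SM.ext' fun n => ?_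
  have h := EuclideanSpace.real_norm_sq_eq (n : E)
  rw [norm_sphere] at h
  simp only [Fin.sum_univ_three] at h ⊢
  change (n : E) 0 * (n : E) 0 + (n : E) 1 * (n : E) 1 + (n : E) 2 * (n : E) 2 = 1
  linarith

theorem sum_smul_ee (x : E) : ∑ i, x i • ee i = x := by
  ext j
  fin_cases j <;> simp [Fin.sum_univ_three]

/-- Euler's relation: the extension of degree 0 is constant on rays. -/
theorem sum_nn_sphD (f : SM) : ∑ i, nn i * sphD i f = 0 := by
  refine SM.ext' fun n => ?_
  have h1 : HasDerivAt (fun t : ℝ => f.1 (dir (t • (n : E)))) 0 1 := by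
    have : (fun t : ℝ => f.1 (dir (t • (n : E)))) =ᶠ[𝓝 1] fun _ => f.1 n := by
      filter_upwards [lt_mem_nhds (zero_lt_one' ℝ)] with t ht
      rw [dir_smul_sphere ht]
    exact (hasDerivAt_const _ _).congr_of_eventuallyEq this
  have h2 : HasDerivAt (fun t : ℝ => t • (n : E)) ((1 : ℝ) • (n : E)) 1 :=
    (hasDerivAt_id 1).smul_const _
  have h3 : HasFDerivAt (fun x => f.1 (dir x)) (fderiv ℝ (fun x => f.1 (dir x)) n)
      ((1 : ℝ) • (n : E)) := by
    simpa using (f.differentiableAt (sphere_ne_zero n)).hasFDerivAt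
  have h4 := h3.comp_hasDerivAt _ h2
  have h5 := h4.unique h1
  rw [one_smul] at h5
  conv at h5 => lhs; arg 2; rw [← sum_smul_ee (n : E)]
  rw [map_sum] at h5
  simp only [Fin.sum_univ_three, map_smul, smul_eq_mul] at h5 ⊢
  exact h5

/-- Second derivatives of the extension of degree 0 commute. The first derivative has degree -1, so
differentiating it again brings in the correction `-nn j`; the tangential gradients by themselves do
not commute. -/
theorem sphD_sphD_symm (f : SM) (i j : Fin 3) :
    sphD j (sphD i f) - nn j * sphD i f = sphD i (sphD j f) - nn i * sphD j f := by
  have key : ∀ i j : Fin 3, ∀ n : S2, fderiv ℝ (fderiv ℝ (fun x => f.1 (dir x))) n (ee j) (ee i) =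
      (sphD j (sphD i f) - nn j * sphD i f).1 n := by
    intro i j n
    have hn := sphere_ne_zero n
    have h1 : DifferentiableAt ℝ (fderiv ℝ (fun x => f.1 (dir x))) (n : E) :=
      ((f.2.contDiffAt (isOpen_punctured.mem_nhds hn)).fderiv_right (m := 1) (by
        exact WithTop.coe_le_coe.2 le_top)).differentiableAt (by simp)
    have h2 : fderiv ℝ (fun x => fderiv ℝ (fun x => f.1 (dir x)) x (ee i)) n (ee j) =
        fderiv ℝ (fderiv ℝ (fun x => f.1 (dir x))) n (ee j) (ee i) := by
      rw [fderiv_clm_apply h1 (differentiableAt_const _)]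
      simp
    rw [← h2]
    have h3 : (fun x => fderiv ℝ (fun x => f.1 (dir x)) x (ee i)) =ᶠ[𝓝 (n : E)]
        hom (-1) (sphD i f).1 := by
      filter_upwards [isOpen_punctured.mem_nhds hn] with x hx
      rw [fderiv_sphD f hx]
      simp [hom]
    rw [h3.fderiv_eq, fderiv_hom _ _ hn]
    simp only [hom, norm_sphere, dir_sphere, one_zpow, one_mul]
    change (sphD j (sphD i f)).1 n + ((-1 : ℤ) : ℝ) * ((nn j * sphD i f).1 n) =
      (sphD j (sphD i f)).1 n - (nn j * sphD i f).1 n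
    push_cast
    ring
  refine SM.ext' fun n => ?_
  rw [← key i j, ← key j i]
  exact ((f.2.contDiffAt (isOpen_punctured.mem_nhds (sphere_ne_zero n))).isSymmSndFDerivAt
    (by simp; exact WithTop.coe_le_coe.2 le_top)) _ _

end

end Hadamard


namespace Hadamard

noncomputable section

/-! ### Integration over the sphere -/

/-- The solid angle measure. -/
abbrev sigma : Measure S2 := (volume : Measure E).toSphere

theorem integrable_sphere {f : S2 → ℝ} (hf : Continuous f) : Integrable f sigma :=
  hf.integrable_of_hasCompactSupport (HasCompactSupport.of_compactSpace f)

/-- Integration over the sphere as a linear form on smooth functions. -/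
def sInt : SM →ₗ[ℝ] ℝ where
  toFun f := sphereInt f.1
  map_add' f g := integral_add (integrable_sphere f.continuous) (integrable_sphere g.continuous)
  map_smul' c _ := integral_const_mul c _

theorem sInt_apply (f : SM) : sInt f = ∫ n, f.1 n ∂sigma := rfl

theorem sigma_univ : sigma.real Set.univ = 4 * Real.pi := by
  rw [Measure.toSphere_real_apply_univ]
  have h := EuclideanSpace.volume_ball_fin_three (0 : E) 1
  rw [measureReal_def, h]
  simp
  rw [ENNReal.toReal_ofReal (by positivity)]
  ring

theorem sInt_algebraMap (c : ℝ) : sInt (algebraMap ℝ SM c) = 4 * Real.pi * c := by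
  change ∫ _ : S2, c ∂sigma = _
  rw [integral_const, sigma_univ, smul_eq_mul]

theorem sInt_mul_self_eq_zero {f : SM} (h : sInt (f * f) = 0) : f = 0 := by
  have hc : Continuous fun n => f.1 n * f.1 n := f.continuous.mul f.continuous
  have h1 : (fun n => f.1 n * f.1 n) =ᵐ[sigma] 0 :=
    (integral_eq_zero_iff_of_nonneg (fun n => mul_self_nonneg _) (integrable_sphere hc)).1 h
  have h2 := (hc.ae_eq_iff_eq sigma continuous_zero).1 h1
  refine SM.ext' fun n => ?_
  exact mul_self_eq_zero.1 (congrFun h2 n)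

theorem sInt_eq_of_forall {f g : SM} (h : ∀ u : SM, sInt (f * u) = sInt (g * u)) : f = g := by
  rw [← sub_eq_zero]
  refine sInt_mul_self_eq_zero ?_
  have := h (f - g)
  rw [sub_mul, map_sub, this, sub_self]

/-- Boundedness of smooth functions on the sphere. -/
theorem SM.exists_bound (f : SM) : ∃ C, ∀ n, |f.1 n| ≤ C := by
  obtain ⟨C, hC⟩ := isCompact_univ.exists_bound_of_continuousOn f.continuous.continuousOn
  exact ⟨C, fun n => hC n (Set.mem_univ n)⟩

theorem abs_sInt_le (f : SM) {C : ℝ} (h : ∀ n, |f.1 n| ≤ C) : |sInt f| ≤ 4 * Real.pi * C := by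
  have := norm_integral_le_of_norm_le_const (μ := sigma) (f := f.1) (C := C)
    (Filter.Eventually.of_forall h)
  rw [sigma_univ, mul_comm] at this
  exact this

/-! ### Polar coordinates -/

/-- The measure `r ^ 2 dr` on the half-line. -/
def radial : Measure ℝ := (volume.restrict (Set.Ioi 0)).withDensity fun r => ENNReal.ofReal (r ^ 2)

theorem integral_radial (f : ℝ → ℝ) : ∫ r, f r ∂radial = ∫ r in Set.Ioi (0 : ℝ), r ^ 2 * f r := by
  unfold radial
  rw [integral_withDensity_eq_integral_toReal_smul (by fun_prop) (by simp)]
  refine integral_congr_ae (Eventually.of_forall fun r => ?_)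
  simp [ENNReal.toReal_ofReal (sq_nonneg r)]

theorem integrable_radial {f : ℝ → ℝ} :
    Integrable f radial ↔ IntegrableOn (fun r => r ^ 2 * f r) (Set.Ioi 0) := by
  unfold radial
  rw [integrable_withDensity_iff_integrable_smul' (by fun_prop) (by simp)]
  refine integrable_congr (Eventually.of_forall fun r => ?_)
  simp [ENNReal.toReal_ofReal (sq_nonneg r)]

instance : SFinite radial := by unfold radial; infer_instance

theorem map_volumeIoiPow : (Measure.volumeIoiPow 2).map Subtype.val = radial := by
  unfold radial Measure.volumeIoiPow
  ext s hs
  rw [Measure.map_apply measurable_subtype_coe hs, withDensity_apply _ (measurable_subtype_coe hs),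
    withDensity_apply _ hs, ← lintegral_indicator hs, ← lintegral_indicator
      (measurable_subtype_coe hs), ← lintegral_subtype_comap measurableSet_Ioi]
  rfl

theorem measurePreserving_polar :
    MeasurePreserving (fun p : S2 × ℝ => p.2 • (p.1 : E)) (sigma.prod radial) volume := by
  have h1 := (volume : Measure E).measurePreserving_homeomorphUnitSphereProd
  have hd : Module.finrank ℝ E - 1 = 2 := by simp
  rw [hd] at h1
  have h2 : MeasurePreserving (Prod.map id Subtype.val)
      (sigma.prod (Measure.volumeIoiPow 2)) (sigma.prod radial) :=
    (MeasurePreserving.id sigma).prod ⟨measurable_subtype_coe, map_volumeIoiPow⟩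
  have hmeas : Measurable (fun p : S2 × ℝ => p.2 • (p.1 : E)) := by fun_prop
  refine ⟨hmeas, ?_⟩
  rw [← h2.map_eq, Measure.map_map hmeas h2.measurable, ← h1.map_eq,
    Measure.map_map (hmeas.comp h2.measurable) h1.measurable]
  have : ((fun p : S2 × ℝ => p.2 • (p.1 : E)) ∘ Prod.map id Subtype.val) ∘
      homeomorphUnitSphereProd E = Subtype.val := by
    funext x
    have := (homeomorphUnitSphereProd E).symm_apply_apply x
    exact congrArg Subtype.val this
  rw [this, (MeasurableEmbedding.subtype_coe (measurableSet_singleton _).compl).map_comap,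
    Subtype.range_coe, restrict_compl_singleton]

theorem integral_polar' {w : E → ℝ} (hw : Integrable w) :
    ∫ x, w x = ∫ p, w (p.2 • (p.1 : E)) ∂(sigma.prod radial) := by
  rw [← measurePreserving_polar.map_eq]
  refine integral_map measurePreserving_polar.measurable.aemeasurable ?_
  rw [measurePreserving_polar.map_eq]
  exact hw.1

theorem integrable_polar {w : E → ℝ} (hw : Integrable w) :
    Integrable (fun p : S2 × ℝ => w (p.2 • (p.1 : E))) (sigma.prod radial) :=
  measurePreserving_polar.integrable_comp_of_integrable hw

theorem integral_polar {w : E → ℝ} (hw : Integrable w) :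
    ∫ x, w x = ∫ r in Set.Ioi (0 : ℝ), r ^ 2 * ∫ n : S2, w (r • (n : E)) ∂sigma := by
  rw [integral_polar' hw, integral_prod_symm _ (integrable_polar hw), integral_radial]

theorem integrableOn_polar {w : E → ℝ} (hw : Integrable w) :
    IntegrableOn (fun r : ℝ => r ^ 2 * ∫ n : S2, w (r • (n : E)) ∂sigma) (Set.Ioi 0) := by
  have := (integrable_polar hw).integral_prod_right
  exact integrable_radial.1 this

/-! ### The divergence theorem on the sphere -/

theorem hom_smul_sphere (k : ℤ) (f : S2 → ℝ) {r : ℝ} (hr : 0 < r) (n : S2) :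
    hom k f (r • (n : E)) = r ^ k * f n := by
  rw [hom, dir_smul_sphere hr, norm_smul, norm_sphere, Real.norm_of_nonneg hr.le, mul_one]

/-- A radial cutoff function supported in the annulus `1 < r < 3`. -/
def cutBump : ContDiffBump (2 : ℝ) := ⟨1 / 2, 1, by norm_num, by norm_num⟩

theorem cutBump_eq_zero {r : ℝ} (hr : r ≤ 1 ∨ 3 ≤ r) : cutBump r = 0 := by
  refine cutBump.zero_of_le_dist ?_
  change 1 ≤ dist r 2
  rw [Real.dist_eq, le_abs]
  rcases hr with h | h
  · right; linarith
  · left; linarith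

theorem contDiff_cutBump_norm_mul {g : E → ℝ} (hg : ContDiffOn ℝ ∞ g {0}ᶜ) :
    ContDiff ℝ ∞ fun x : E => cutBump ‖x‖ * g x := by
  rw [contDiff_iff_contDiffAt]
  intro x
  by_cases hx : x = 0
  · subst hx
    have : (fun x : E => cutBump ‖x‖ * g x) =ᶠ[𝓝 0] fun _ => 0 := by
      filter_upwards [Metric.ball_mem_nhds (0 : E) zero_lt_one] with x hx
      rw [cutBump_eq_zero (Or.inl (by simpa using (mem_ball_zero_iff.1 hx).le)), zero_mul]
    exact contDiffAt_const.congr_of_eventuallyEq this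
  · exact (cutBump.contDiff.contDiffAt.comp x (contDiffAt_norm ℝ hx)).mul
      (hg.contDiffAt (isOpen_punctured.mem_nhds hx))

theorem hasCompactSupport_cutBump_norm_mul (g : E → ℝ) :
    HasCompactSupport fun x : E => cutBump ‖x‖ * g x := by
  refine HasCompactSupport.intro (isCompact_closedBall (0 : E) 3) fun x hx => ?_
  rw [cutBump_eq_zero (Or.inr (by
    rw [mem_closedBall_zero_iff, not_le] at hx
    exact hx.le)), zero_mul]

theorem integral_fderiv_eq_zero {w : E → ℝ} (hw : ContDiff ℝ 1 w) (hc : HasCompactSupport w)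
    (v : E) : ∫ x, fderiv ℝ w x v = 0 := by
  have hi : Integrable fun x => fderiv ℝ w x v :=
    ((hw.continuous_fderiv (by simp)).clm_apply continuous_const).integrable_of_hasCompactSupport
      (hc.fderiv_apply (𝕜 := ℝ) v)
  have h := integral_mul_fderiv_eq_neg_fderiv_mul_of_integrable (μ := (volume : Measure E))
    (f := fun _ => (1 : ℝ)) (g := w) (v := v) (by simp) (by simpa using hi)
    (by simpa using hw.continuous.integrable_of_hasCompactSupport hc)
    (fun x _ => differentiableAt_const _) (fun x _ => hw.differentiable (by simp) x)
  simpa using h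

/-- Integrate `∂_i (χ(r) r⁻² f)` over space, with `χ` a radial cutoff off the origin. The total is
0. In polar coordinates it splits into `∫ χ'`, which vanishes, and the positive number `∫ χ / r`
times `∫ (∂_i f - 2 n_i f)`. -/
theorem sInt_sphD (i : Fin 3) (f : SM) : sInt (sphD i f) = 2 * sInt (nn i * f) := by
  -- The power -2 compensates the Jacobian `r ^ 2`, so that the term with the derivative of the
  -- cutoff is an exact derivative in `r`.
  set w : E → ℝ := fun x => cutBump ‖x‖ * hom (-2) f.1 x with hwdef
  have hw : ContDiff ℝ ∞ w := contDiff_cutBump_norm_mul (contDiffOn_hom (-2) f)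
  have hc : HasCompactSupport w := hasCompactSupport_cutBump_norm_mul _
  have hw1 : ContDiff ℝ 1 w := hw.of_le (WithTop.coe_le_coe.2 le_top)
  have h0 := integral_fderiv_eq_zero hw1 hc (ee i)
  have hi : Integrable fun x => fderiv ℝ w x (ee i) :=
    ((hw1.continuous_fderiv (by simp)).clm_apply continuous_const).integrable_of_hasCompactSupport
      (hc.fderiv_apply (𝕜 := ℝ) _)
  rw [integral_polar hi] at h0
  have hd : ∀ r > 0, ∀ n : S2, fderiv ℝ w (r • (n : E)) (ee i) =
      deriv cutBump r * r ^ (-2 : ℤ) * (nn i * f).1 n +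
        cutBump r * r ^ (-3 : ℤ) * (sphD i f - (2 : ℝ) • (nn i * f)).1 n := by
    intro r hr n
    have hx : r • (n : E) ≠ 0 := smul_ne_zero (ne_of_gt hr) (sphere_ne_zero n)
    have hnorm : ‖r • (n : E)‖ = r := by
      rw [norm_smul, norm_sphere, Real.norm_of_nonneg (le_of_lt hr), mul_one]
    have h1 : HasFDerivAt (fun x : E => cutBump ‖x‖)
        (deriv cutBump r • (‖r • (n : E)‖⁻¹ • innerSL ℝ (r • (n : E)))) (r • (n : E)) := by
      have hb : HasDerivAt cutBump (deriv cutBump r) ‖r • (n : E)‖ := by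
        rw [hnorm]
        exact ((cutBump.contDiff (n := 1)).differentiable (by simp) r).hasDerivAt
      exact hb.comp_hasFDerivAt _ (hasFDerivAt_norm' hx)
    have h2 := (differentiableAt_of_contDiffOn (contDiffOn_hom (-2) f) hx).hasFDerivAt
    have h3 := (h1.mul h2).fderiv
    have h4 : fderiv ℝ w (r • (n : E)) = _ := h3
    rw [h4]
    simp only [_root_.add_apply, _root_.smul_apply, smul_eq_mul]
    rw [fderiv_hom _ _ hx, hom_smul_sphere _ _ hr, hom_smul_sphere _ _ hr, hnorm]
    simp only [innerSL_apply_apply, EuclideanSpace.inner_single_right]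
    have h5 : r⁻¹ * (1 * (starRingEnd ℝ) ((r • (n : E)).ofLp i)) = (n : E) i := by
      simp
      field_simp
    have h6 : (sphD i f + ((-2 : ℤ) : ℝ) • (nn i * f)).1 n =
        (sphD i f - (2 : ℝ) • (nn i * f)).1 n := by
      rw [sub_eq_add_neg, ← neg_smul]
      norm_num
    rw [h5, h6]
    change _ = deriv cutBump r * r ^ (-2 : ℤ) * ((n : E) i * f.1 n) + _
    norm_num
    ring
  have h1 : ∀ r ∈ Set.Ioi (0 : ℝ), r ^ 2 * ∫ n : S2, fderiv ℝ w (r • (n : E)) (ee i) ∂sigma =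
      deriv cutBump r * sInt (nn i * f) +
        cutBump r * r⁻¹ * sInt (sphD i f - (2 : ℝ) • (nn i * f)) := by
    intro r hr
    have hr' : (0 : ℝ) < r := hr
    rw [integral_congr_ae (Eventually.of_forall (hd r hr)), integral_add, integral_const_mul,
      integral_const_mul, ← sInt_apply, ← sInt_apply]
    · field_simp
    · exact (integrable_sphere (nn i * f).continuous).const_mul _
    · exact (integrable_sphere (sphD i f - (2 : ℝ) • (nn i * f)).continuous).const_mul _
  rw [setIntegral_congr_fun measurableSet_Ioi h1] at h0
  have hcb : HasCompactSupport cutBump := cutBump.hasCompactSupport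
  have hd1 : Integrable (deriv cutBump) :=
    ((cutBump.contDiff (n := 1)).continuous_deriv (by simp)).integrable_of_hasCompactSupport
      hcb.deriv
  have hcont : Continuous fun r : ℝ => cutBump r * r⁻¹ := by
    rw [continuous_iff_continuousAt]
    intro r
    by_cases hr : r = 0
    · subst hr
      have : (fun r : ℝ => cutBump r * r⁻¹) =ᶠ[𝓝 0] fun _ => 0 := by
        filter_upwards [gt_mem_nhds (zero_lt_one' ℝ)] with r hr
        rw [cutBump_eq_zero (Or.inl hr.le), zero_mul]
      exact continuousAt_const.congr this.symm
    · exact cutBump.continuous.continuousAt.mul (continuousAt_inv₀ hr)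
  have hi2 : Integrable fun r : ℝ => cutBump r * r⁻¹ :=
    hcont.integrable_of_hasCompactSupport hcb.mul_right
  rw [integral_add (hd1.integrableOn.mul_const _) (hi2.integrableOn.mul_const _),
    integral_mul_const, integral_mul_const] at h0
  have hz : ∫ r in Set.Ioi (0 : ℝ), deriv cutBump r = 0 := by
    rw [hcb.integral_Ioi_deriv_eq (cutBump.contDiff (n := 1)) 0, cutBump_eq_zero (Or.inl zero_le_one),
      neg_zero]
  have hpos : 0 < ∫ r in Set.Ioi (0 : ℝ), cutBump r * r⁻¹ := by
    refine (integral_pos_iff_support_of_nonneg_ae ?_ hi2.integrableOn).2 ?_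
    · filter_upwards [ae_restrict_mem measurableSet_Ioi] with r hr
      exact mul_nonneg cutBump.nonneg (inv_nonneg.2 (le_of_lt hr))
    · rw [Measure.restrict_apply' measurableSet_Ioi]
      have hsub : Set.Ioo (3 / 2 : ℝ) 2 ⊆
          (Function.support fun r : ℝ => cutBump r * r⁻¹) ∩ Set.Ioi 0 := by
        rintro r ⟨h1, h2⟩
        have hr : 0 < r := by linarith
        refine ⟨?_, hr⟩
        rw [Function.mem_support, cutBump.one_of_mem_closedBall, one_mul]
        · exact inv_ne_zero hr.ne'
        · rw [Metric.mem_closedBall, Real.dist_eq, abs_le]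
          change -(1 / 2) ≤ _ ∧ _ ≤ (1 / 2 : ℝ)
          constructor <;> linarith
      refine lt_of_lt_of_le ?_ (measure_mono hsub)
      simp
      norm_num
  rw [hz, zero_mul, zero_add] at h0
  have h3 := (mul_eq_zero.1 h0).resolve_left hpos.ne'
  rw [map_sub, map_smul, smul_eq_mul] at h3
  linarith

theorem sInt_sphD_mul (i : Fin 3) (f g : SM) :
    sInt (sphD i f * g) = 2 * sInt (nn i * f * g) - sInt (f * sphD i g) := by
  have h := sInt_sphD i (f * g)
  rw [sphD_mul, map_add, ← mul_assoc] at h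
  linarith

/-- The operator `T_i`; the derivative of `f / r` is `T_i f / r ^ 2`. -/
def sphT (i : Fin 3) : SM →ₗ[ℝ] SM := sphD i - LinearMap.mulLeft ℝ (nn i)

theorem sphT_apply (i : Fin 3) (f : SM) : sphT i f = sphD i f - nn i * f := rfl

/-- A product of two functions of degree -1 has degree -2, where the two sides of `sInt_sphD`
cancel: the subtraction of `n_i` in `sphT` shares the term `2 n_i` equally between the factors. -/
theorem sInt_sphT_mul (i : Fin 3) (f g : SM) :
    sInt (sphT i f * g) = - sInt (f * sphT i g) := by
  rw [sphT_apply, sphT_apply, sub_mul, mul_sub, map_sub, map_sub, sInt_sphD_mul,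
    show f * (nn i * g) = nn i * f * g by ring]
  ring

theorem sphT_sphD_symm (f : SM) (i j : Fin 3) : sphT j (sphD i f) = sphT i (sphD j f) :=
  sphD_sphD_symm f i j

/-! ### Rotations -/

/-- The action of an isometry on the sphere. -/
def rot (R : E ≃ₗᵢ[ℝ] E) (n : S2) : S2 := ⟨R n, by simp⟩

/-- The measure of a set of directions is, up to a factor, the volume of the cone over it, and an
isometry maps cones to cones of equal volume. -/
theorem measurePreserving_rot (R : E ≃ₗᵢ[ℝ] E) : MeasurePreserving (rot R) sigma sigma := by
  have hc : Continuous (rot R) := by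
    unfold rot
    exact (R.continuous.comp continuous_subtype_val).subtype_mk _
  refine ⟨hc.measurable, ?_⟩
  ext s hs
  rw [Measure.map_apply hc.measurable hs, Measure.toSphere_apply' _ (hc.measurable hs),
    Measure.toSphere_apply' _ hs]
  congr 1
  conv_rhs => rw [← R.measurePreserving.measure_preimage_emb R.toHomeomorph.measurableEmbedding]
  congr 1
  ext x
  simp only [Set.mem_smul, Set.mem_preimage, Set.mem_image]
  constructor
  · rintro ⟨c, hc, _, ⟨n, hn, rfl⟩, rfl⟩
    exact ⟨c, hc, _, ⟨rot R n, hn, rfl⟩, by simp [rot]⟩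
  · rintro ⟨c, hc, _, ⟨n, hn, rfl⟩, h⟩
    refine ⟨c, hc, R.symm n, ⟨rot R.symm n, ?_, rfl⟩, ?_⟩
    · have : rot R (rot R.symm n) = n := Subtype.ext (by simp [rot])
      rwa [this]
    · rw [← map_smul, h]
      simp

theorem dir_map (R : E ≃ₗᵢ[ℝ] E) {x : E} (hx : x ≠ 0) : dir (R x) = rot R (dir x) := by
  apply Subtype.ext
  have : R x ≠ 0 := by simpa using hx
  rw [dir_coe this]
  change _ = R (dir x)
  rw [dir_coe hx]
  simp

/-- Composition of a function on the sphere with an isometry. -/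
def comp (R : E ≃ₗᵢ[ℝ] E) : SM →ₐ[ℝ] SM where
  toFun f := ⟨fun n => f.1 (rot R n), by
    have h := f.2.comp (R.contDiff (n := ∞)).contDiffOn (s := {0}ᶜ) (fun x hx => by simpa using hx)
    refine ContDiffOn.congr h fun x hx => ?_
    simp [dir_map R hx]⟩
  map_one' := rfl
  map_mul' _ _ := rfl
  map_zero' := rfl
  map_add' _ _ := rfl
  commutes' _ := rfl

theorem sInt_comp (R : E ≃ₗᵢ[ℝ] E) (f : SM) : sInt (comp R f) = sInt f := by
  have hc : Continuous (rot R) := by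
    unfold rot
    exact (R.continuous.comp continuous_subtype_val).subtype_mk _
  have := (measurePreserving_rot R).map_eq
  rw [sInt_apply, sInt_apply]
  conv_rhs => rw [← this]
  exact (integral_map hc.measurable.aemeasurable f.continuous.aestronglyMeasurable).symm

theorem nn_comp (R : E ≃ₗᵢ[ℝ] E) (i : Fin 3) : comp R (nn i) = ∑ j, R (ee j) i • nn j := by
  refine SM.ext' fun n => ?_
  have h : R (n : E) = ∑ j, (n : E) j • R (ee j) := by
    conv_lhs => rw [← sum_smul_ee (n : E)]
    simp
  change (R (n : E)) i = _
  rw [h]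
  simp only [Fin.sum_univ_three]
  change (n : E) 0 * R (ee 0) i + (n : E) 1 * R (ee 1) i + (n : E) 2 * R (ee 2) i =
    R (ee 0) i * (n : E) 0 + R (ee 1) i * (n : E) 1 + R (ee 2) i * (n : E) 2
  ring

theorem sphD_comp (R : E ≃ₗᵢ[ℝ] E) (j : Fin 3) (f : SM) :
    sphD j (comp R f) = ∑ i, R (ee j) i • comp R (sphD i f) := by
  refine SM.ext' fun n => ?_
  have hn := sphere_ne_zero n
  have hRn : R (n : E) ≠ 0 := by simpa using hn
  have h1 : (fun x : E => (comp R f).1 (dir x)) =ᶠ[𝓝 (n : E)] (fun x => f.1 (dir x)) ∘ R := by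
    filter_upwards [isOpen_punctured.mem_nhds hn] with x hx
    simp only [Function.comp, dir_map R hx]
    rfl
  change fderiv ℝ (fun x : E => (comp R f).1 (dir x)) n (ee j) = _
  rw [h1.fderiv_eq, fderiv_comp _ (f.differentiableAt hRn) R.differentiableAt]
  simp only [Fin.sum_univ_three]
  rw [ContinuousLinearMap.comp_apply, LinearIsometryEquiv.fderiv]
  have h2 : R (ee j) = ∑ i, R (ee j) i • ee i := (sum_smul_ee _).symm
  change fderiv ℝ (fun x => f.1 (dir x)) (R n) (R (ee j)) = _
  conv_lhs => rw [h2]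
  simp only [map_add, map_smul, smul_eq_mul, Fin.sum_univ_three]
  rfl

end

end Hadamard


/-! ### Spherical harmonics and symmetric trace-free tensors -/

namespace Hadamard

noncomputable section

/-! ### The Laplacian on the sphere and its eigenfunctions -/

/-- The Laplace operator on the sphere. -/
def lap : SM →ₗ[ℝ] SM := ∑ i, sphD i ∘ₗ sphD i

theorem lap_apply (f : SM) : lap f = ∑ i, sphD i (sphD i f) := by
  simp [lap]

/-- The restriction to the sphere of the derivative of `r ^ k * f`. -/
def low (k : ℝ) (i : Fin 3) : SM →ₗ[ℝ] SM := sphD i + k • LinearMap.mulLeft ℝ (nn i)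

theorem low_apply (k : ℝ) (i : Fin 3) (f : SM) : low k i f = sphD i f + k • (nn i * f) := rfl

theorem sphD_nn_mul (i j : Fin 3) (f : SM) : sphD i (nn j * f) =
    (if i = j then (1 : ℝ) else 0) • f - nn i * nn j * f + nn j * sphD i f := by
  rw [sphD_mul, sphD_nn, sub_mul, Algebra.smul_def]

/-- Commutation of the second derivatives of `r ^ k f`. -/
theorem low_comm (k : ℝ) (i j : Fin 3) (f : SM) :
    low (k - 1) j (low k i f) = low (k - 1) i (low k j f) := by
  have h := sphD_sphD_symm f i j
  have h' : sphD j (sphD i f) = sphD i (sphD j f) - nn i * sphD j f + nn j * sphD i f := by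
    rw [← h]; ring
  simp only [low_apply, map_add, map_smul, sphD_nn_mul, h', eq_comm (a := j)]
  simp only [smul_add, smul_sub, sub_smul, one_smul]
  ring_nf

theorem sum_nn_mul_low (k : ℝ) (f : SM) : ∑ i, nn i * low k i f = k • f := by
  have h1 := sum_nn_sphD f
  have h2 := sum_nn_sq
  calc ∑ i, nn i * low k i f = ∑ i, nn i * sphD i f + k • ((∑ i, nn i * nn i) * f) := by
        simp only [low_apply, mul_add, Finset.sum_add_distrib, Finset.sum_mul, Finset.smul_sum,
          mul_smul_comm, mul_assoc]
    _ = k • f := by rw [h1, h2, one_mul, zero_add]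

/-- This is the Laplacian of `r ^ k f`. Consequently `Eig k` consists of the `f` for which `r ^ k f`
is harmonic, which explains the degree-changing lemmas below. -/
theorem sum_low_low (k : ℝ) (f : SM) :
    ∑ i, low (k - 1) i (low k i f) = lap f + (k * (k + 1)) • f := by
  have h1 := sum_nn_sphD f
  have h2 := sum_nn_sq
  have h : ∀ i, low (k - 1) i (low k i f) = sphD i (sphD i f) + k • f +
      (2 * k - 1) • (nn i * sphD i f) + (k * (k - 1) - k) • (nn i * nn i * f) := by
    intro i
    simp only [low_apply, map_add, map_smul, sphD_nn_mul, if_true, one_smul,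
      ← mul_assoc]
    module
  simp only [h, Finset.sum_add_distrib, ← Finset.smul_sum, h1, ← Finset.sum_mul, h2, lap_apply]
  simp only [Finset.sum_const, Finset.card_univ, Fintype.card_fin, one_mul]
  module

theorem sInt_lap_mul (f g : SM) : sInt (lap f * g) = - ∑ i, sInt (sphD i f * sphD i g) := by
  rw [lap_apply, Finset.sum_mul, map_sum]
  simp only [sInt_sphD_mul, Finset.sum_sub_distrib, ← Finset.mul_sum]
  rw [← map_sum, ← Finset.sum_mul, sum_nn_sphD]
  simp

theorem sInt_lap_symm (f g : SM) : sInt (lap f * g) = sInt (f * lap g) := by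
  rw [mul_comm f, sInt_lap_mul, sInt_lap_mul]
  simp only [mul_comm]

/-- Eigenfunctions of the Laplacian: spherical harmonics of degree `k`. -/
def Eig (k : ℝ) : Submodule ℝ SM := LinearMap.ker (lap + (k * (k + 1)) • LinearMap.id)

theorem mem_Eig {k : ℝ} {f : SM} : f ∈ Eig k ↔ lap f = -(k * (k + 1)) • f := by
  rw [Eig, LinearMap.mem_ker, neg_smul, ← add_eq_zero_iff_eq_neg]
  rfl

/-- A derivative of the harmonic function `r ^ k f` is harmonic, because the Laplacian commutes with
derivatives. -/
theorem low_mem {k : ℝ} {f : SM} (hf : f ∈ Eig k) (i : Fin 3) : low k i f ∈ Eig (k - 1) := by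
  have h1 := sum_low_low (k - 1) (low k i f)
  have h2 : ∑ j, low (k - 1 - 1) j (low (k - 1) j (low k i f)) = 0 := by
    simp_rw [low_comm k i, low_comm (k - 1) i]
    rw [← map_sum, sum_low_low, mem_Eig.1 hf]
    simp
  rw [h2] at h1
  rw [mem_Eig, neg_smul]
  exact (eq_neg_of_add_eq_zero_left h1.symm)

theorem lap_nn_mul (i : Fin 3) (f : SM) :
    lap (nn i * f) = nn i * lap f + (2 : ℝ) • sphD i f - (2 : ℝ) • (nn i * f) := by
  have h1 := sum_nn_sphD f
  have h2 := sum_nn_sq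
  have h : ∀ j, sphD j (sphD j (nn i * f)) = nn i * sphD j (sphD j f) +
      (if j = i then (2 : ℝ) else 0) • sphD j f - (if j = i then (1 : ℝ) else 0) • (nn j * f)
        - (2 : ℝ) • (nn i * (nn j * sphD j f)) - nn i * f + (2 : ℝ) • (nn i * (nn j * nn j * f)) := by
    intro j
    simp only [map_add, map_sub, map_smul, sphD_nn_mul, mul_assoc, if_true]
    split_ifs with hij
    · subst hij
      simp only [mul_sub, mul_add, one_smul]
      simp only [← one_add_one_eq_two, add_smul, one_smul]
      ring
    · simp only [mul_sub, mul_add, one_smul, zero_smul]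
      simp only [← one_add_one_eq_two, add_smul, one_smul]
      ring
  rw [lap_apply]
  simp only [h, Finset.sum_add_distrib, Finset.sum_sub_distrib, Finset.sum_const, Finset.card_univ,
    Fintype.card_fin]
  simp only [← Finset.smul_sum, ← Finset.mul_sum, h1, ← Finset.sum_mul, h2, lap_apply]
  simp only [ite_smul, zero_smul, Finset.sum_ite_eq', Finset.mem_univ, if_true, one_smul, mul_zero,
    smul_zero, one_mul]
  module

/-- If `h` is harmonic of degree `k`, subtracting `r ^ 2 ∂_i h / (2k + 1)` from `x_i h` makes it
harmonic. Together with `low_mem`, this splits `n_i f` into a part of degree `k + 1` and a part of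
degree `k - 1`. -/
theorem raise_mem {k : ℝ} {f : SM} (hf : f ∈ Eig k) (hk : 2 * k + 1 ≠ 0) (i : Fin 3) :
    nn i * f - (2 * k + 1)⁻¹ • low k i f ∈ Eig (k + 1) := by
  have h1 := mem_Eig.1 (low_mem hf i)
  rw [mem_Eig, map_sub, map_smul, lap_nn_mul, h1, mem_Eig.1 hf]
  have h2 : sphD i f = low k i f - k • (nn i * f) := by rw [low_apply]; abel
  rw [h2, mul_smul_comm]
  match_scalars
  · ring
  · field_simp
    ring

theorem sInt_Eig_orth {k m : ℝ} (h : k * (k + 1) ≠ m * (m + 1)) {f g : SM} (hf : f ∈ Eig k)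
    (hg : g ∈ Eig m) : sInt (f * g) = 0 := by
  have h1 := sInt_lap_symm f g
  rw [mem_Eig.1 hf, mem_Eig.1 hg, smul_mul_assoc, mul_smul_comm, map_smul, map_smul, smul_eq_mul,
    smul_eq_mul] at h1
  have h2 : (k * (k + 1) - m * (m + 1)) * sInt (f * g) = 0 := by linarith
  exact (mul_eq_zero.1 h2).resolve_left (sub_ne_zero.2 h)

theorem natDegree_ne {l m : ℕ} (h : l ≠ m) : (l : ℝ) * (l + 1) ≠ m * (m + 1) := by
  intro h'
  have h2 : ((l : ℝ) - m) * (l + m + 1) = 0 := by linarith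
  rcases mul_eq_zero.1 h2 with h3 | h3
  · exact h (by exact_mod_cast sub_eq_zero.1 h3)
  · have : (0 : ℝ) < l + m + 1 := by positivity
    linarith

/-- The mixed terms vanish by Euler's relation and the gradients give the eigenvalue, so the
constant is `k (k + 1) + k ^ 2`. It relates `L²` products in degree `k` to products in degree `k -
1`. -/
theorem sum_sInt_low_mul_low {k : ℝ} {f g : SM} (hf : f ∈ Eig k) :
    ∑ i, sInt (low k i f * low k i g) = k * (2 * k + 1) * sInt (f * g) := by
  have h : ∀ i, low k i f * low k i g = sphD i f * sphD i g + k • ((nn i * sphD i f) * g) +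
      k • ((nn i * sphD i g) * f) + (k ^ 2) • ((nn i * nn i) * (f * g)) := by
    intro i
    simp only [low_apply, mul_add, add_mul, mul_smul_comm, smul_mul_assoc]
    rw [show sphD i f * (nn i * g) = nn i * sphD i f * g by ring,
      show nn i * f * sphD i g = nn i * sphD i g * f by ring,
      show nn i * f * (nn i * g) = nn i * nn i * (f * g) by ring]
    module
  have h3 := sInt_lap_mul f g
  rw [mem_Eig.1 hf, smul_mul_assoc, map_smul, smul_eq_mul] at h3
  simp only [h, map_add, Finset.sum_add_distrib]
  simp only [← map_sum, ← Finset.smul_sum, ← Finset.sum_mul, sum_nn_sphD, sum_nn_sq]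
  simp only [map_sum, map_smul, zero_mul, smul_zero, map_zero, one_mul, smul_eq_mul]
  linarith

/-- The eigenvalue is 0, so the Dirichlet energy vanishes, and it is a sum of squares. -/
theorem sphD_eq_zero_of_mem {f : SM} (hf : f ∈ Eig 0) (i : Fin 3) : sphD i f = 0 := by
  have h := sInt_lap_mul f f
  rw [mem_Eig.1 hf] at h
  simp only [zero_mul, neg_zero, zero_smul, map_zero] at h
  have h1 : ∑ j, sInt (sphD j f * sphD j f) = 0 := by linarith
  refine sInt_mul_self_eq_zero ?_
  exact (Finset.sum_eq_zero_iff_of_nonneg (fun j _ =>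
    integral_nonneg fun n => mul_self_nonneg ((sphD j f).1 n))).1 h1 i (Finset.mem_univ i)

theorem eq_algebraMap_of_sphD_eq_zero {f : SM} (hf : ∀ i, sphD i f = 0) (n₀ : S2) :
    f = algebraMap ℝ SM (f.1 n₀) := by
  have hd : Set.EqOn (fderiv ℝ (fun x => f.1 (dir x))) 0 {0}ᶜ := by
    intro x hx
    ext v
    rw [← sum_smul_ee v, map_sum]
    refine Finset.sum_eq_zero fun i _ => ?_
    rw [map_smul, fderiv_sphD f hx, hf i]
    simp
  have hp : IsPreconnected ({0}ᶜ : Set E) :=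
    (isConnected_compl_singleton_of_one_lt_rank (by
      rw [← Module.finrank_eq_rank]; simp) 0).isPreconnected
  have hdiff : DifferentiableOn ℝ (fun x => f.1 (dir x)) {0}ᶜ := fun x hx =>
    (f.differentiableAt hx).differentiableWithinAt
  refine SM.ext' fun n => ?_
  have := isOpen_punctured.is_const_of_fderiv_eq_zero hp hdiff hd (sphere_ne_zero n)
    (sphere_ne_zero n₀)
  simp only [dir_sphere] at this
  exact this

theorem eq_algebraMap_of_mem {f : SM} (hf : f ∈ Eig 0) (n₀ : S2) :
    f = algebraMap ℝ SM (f.1 n₀) :=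
  eq_algebraMap_of_sphD_eq_zero (sphD_eq_zero_of_mem hf) n₀

theorem algebraMap_mem_Eig (c : ℝ) : algebraMap ℝ SM c ∈ Eig 0 := by
  rw [mem_Eig, lap_apply]
  simp [sphD_algebraMap]

end

end Hadamard


namespace Hadamard

noncomputable section

/-! ### Tensors and spherical harmonics -/

/-- The function `∑ T_L n^L` on the sphere. -/
def pol {l : ℕ} : Tensor l →ₗ[ℝ] SM where
  toFun T := ∑ I, T I • ∏ k, nn (I k)
  map_add' T U := by simp [add_smul, Finset.sum_add_distrib]
  map_smul' c T := by simp [mul_smul, Finset.smul_sum]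

theorem pol_apply {l : ℕ} (T : Tensor l) : pol T = ∑ I, T I • ∏ k, nn (I k) := rfl

/-- Evaluation at a point of the sphere. -/
def evalAt (n : S2) : SM →ₐ[ℝ] ℝ where
  toFun f := f.1 n
  map_one' := rfl
  map_mul' _ _ := rfl
  map_zero' := rfl
  map_add' _ _ := rfl
  commutes' _ := rfl

theorem evalAt_apply (n : S2) (f : SM) : evalAt n f = f.1 n := rfl

theorem pol_val {l : ℕ} (T : Tensor l) (n : S2) :
    (pol T).1 n = ∑ I, nPow l n I * T I := by
  rw [← evalAt_apply, pol_apply, map_sum]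
  refine Finset.sum_congr rfl fun I _ => ?_
  rw [map_smul, map_prod, smul_eq_mul, mul_comm]
  rfl

theorem pol_val_inner {l : ℕ} (T : Tensor l) (n : S2) : (pol T).1 n = inner ℝ (nPow l n) T := by
  rw [pol_val, PiLp.inner_apply]
  refine Finset.sum_congr rfl fun I _ => ?_
  simp [mul_comm]

/-- Fixing the first index of a tensor. -/
def contr {l : ℕ} (i : Fin 3) : Tensor (l + 1) →ₗ[ℝ] Tensor l where
  toFun T := WithLp.toLp 2 fun I => T (Fin.cons i I)
  map_add' _ _ := rfl
  map_smul' _ _ := rfl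

theorem contr_apply {l : ℕ} (i : Fin 3) (T : Tensor (l + 1)) (I : Fin l → Fin 3) :
    contr i T I = T (Fin.cons i I) := rfl

theorem sum_cons {M : Type*} [AddCommMonoid M] {l : ℕ} (F : (Fin (l + 1) → Fin 3) → M) :
    ∑ I, F I = ∑ i, ∑ I : Fin l → Fin 3, F (Fin.cons i I) := by
  rw [← Fintype.sum_prod_type']
  exact (Fintype.sum_equiv (Fin.consEquiv fun _ => Fin 3) _ _ fun _ => rfl).symm

theorem pol_succ {l : ℕ} (T : Tensor (l + 1)) : pol T = ∑ i, nn i * pol (contr i T) := by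
  rw [pol_apply, sum_cons]
  refine Finset.sum_congr rfl fun i _ => ?_
  rw [pol_apply, Finset.mul_sum]
  refine Finset.sum_congr rfl fun I _ => ?_
  rw [Fin.prod_univ_succ, contr_apply, mul_smul_comm]
  simp

theorem sum_inner_contr {l : ℕ} (T U : Tensor (l + 1)) :
    ∑ i, inner ℝ (contr i T) (contr i U) = inner ℝ T U := by
  simp only [PiLp.inner_apply]
  rw [sum_cons]
  rfl

theorem contr_mem {l : ℕ} {T : Tensor (l + 1)} (hT : T ∈ stfSubspace (l + 1)) (i : Fin 3) :
    contr i T ∈ stfSubspace l := by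
  refine ⟨fun σ I => ?_, fun p q hpq I => ?_⟩
  · rw [contr_apply, contr_apply, ← hT.1 (Equiv.Perm.decomposeFin.symm (0, σ)) (Fin.cons i I)]
    refine congrArg T.ofLp ?_
    funext k
    refine Fin.cases ?_ (fun k => ?_) k
    · simp
    · simp [Equiv.Perm.decomposeFin]
  · have h := hT.2 p.succ q.succ (fun h => hpq (Fin.succ_injective _ h)) (Fin.cons i I)
    rw [← h]
    refine Finset.sum_congr rfl fun c _ => ?_
    rw [contr_apply, Fin.cons_update, Fin.cons_update]

theorem contr_comm {l : ℕ} {T : Tensor (l + 2)} (hT : T ∈ stfSubspace (l + 2)) (i j : Fin 3) :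
    contr j (contr i T) = contr i (contr j T) := by
  ext I
  rw [contr_apply, contr_apply, contr_apply, contr_apply,
    ← hT.1 (Equiv.swap 0 1) (Fin.cons i (Fin.cons j I))]
  refine congrArg T.ofLp ?_
  funext k
  refine Fin.cases ?_ (fun k => Fin.cases ?_ (fun k => ?_) k) k
  · simp [Equiv.swap_apply_left]
  · simp
  · rw [Function.comp_apply, Equiv.swap_apply_of_ne_of_ne]
    · simp
    · exact Fin.succ_ne_zero _
    · intro h
      exact Fin.succ_ne_zero _ (Fin.succ_injective _ h)

theorem sum_contr_contr {l : ℕ} {T : Tensor (l + 2)} (hT : T ∈ stfSubspace (l + 2)) :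
    ∑ i, contr i (contr i T) = 0 := by
  ext I
  have h := hT.2 0 1 (by simp) (Fin.cons 0 (Fin.cons 0 I))
  simp only [WithLp.ofLp_sum, Finset.sum_apply]
  rw [WithLp.ofLp_zero, Pi.zero_apply, ← h]
  refine Finset.sum_congr rfl fun c _ => ?_
  rw [contr_apply, contr_apply]
  refine congrArg T.ofLp ?_
  funext k
  refine Fin.cases ?_ (fun k => Fin.cases ?_ (fun k => ?_) k) k
  · simp
  · simp
  · rw [Function.update_of_ne, Function.update_of_ne]
    · simp
    · exact Fin.succ_ne_zero _
    · intro h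
      exact Fin.succ_ne_zero _ (Fin.succ_injective _ h)

theorem pol_zero (T : Tensor 0) : pol T = algebraMap ℝ SM (T Fin.elim0) := by
  rw [pol_apply, Fintype.sum_subsingleton _ Fin.elim0]
  simp [Algebra.algebraMap_eq_smul_one]

/-- The derivative of the homogeneous polynomial `T_L x^L` with symmetric coefficients. The
induction splits off one factor `x_i`; symmetry lets the two contractions be exchanged, and Euler's
relation resums the result. -/
theorem low_pol : ∀ {l : ℕ} {T : Tensor (l + 1)}, T ∈ stfSubspace (l + 1) → ∀ j : Fin 3,
    low ((l : ℝ) + 1) j (pol T) = ((l : ℝ) + 1) • pol (contr j T) := by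
  have gen : ∀ {l : ℕ} {T : Tensor (l + 1)} (j : Fin 3),
      (∑ i, nn i * low l j (pol (contr i T)) = (l : ℝ) • pol (contr j T)) →
      low ((l : ℝ) + 1) j (pol T) = ((l : ℝ) + 1) • pol (contr j T) := by
    intro l T j h
    have h1 : ∀ i, low ((l : ℝ) + 1) j (nn i * pol (contr i T)) =
        (if j = i then (1 : ℝ) else 0) • pol (contr i T) + nn i * low l j (pol (contr i T)) := by
      intro i
      rw [low_apply, sphD_nn_mul, low_apply, mul_add, mul_smul_comm,
        show nn i * (nn j * pol (contr i T)) = nn j * (nn i * pol (contr i T)) by ring,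
        show nn j * nn i * pol (contr i T) = nn j * (nn i * pol (contr i T)) by ring]
      module
    rw [pol_succ, map_sum]
    simp only [h1, Finset.sum_add_distrib, h, ite_smul, one_smul, zero_smul, Finset.sum_ite_eq,
      Finset.mem_univ, if_true]
    module
  intro l
  induction l with
  | zero =>
    intro T _ j
    refine gen j ?_
    simp [pol_zero, low_apply, sphD_algebraMap]
  | succ l ih =>
    intro T hT j
    refine gen j ?_
    have h2 : ∀ i, low ((l + 1 : ℕ) : ℝ) j (pol (contr i T)) =
        ((l : ℝ) + 1) • pol (contr i (contr j T)) := by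
      intro i
      rw [contr_comm hT j i]
      push_cast
      exact ih (contr_mem hT i) j
    simp only [h2, mul_smul_comm, ← Finset.smul_sum]
    rw [← pol_succ]
    push_cast
    rfl

/-- Two derivatives contract two indices of the tensor, so the Laplacian of `T_L x^L` is a multiple
of a trace, which is zero. -/
theorem pol_mem_Eig {l : ℕ} {T : Tensor l} (hT : T ∈ stfSubspace l) : pol T ∈ Eig l := by
  have h := sum_low_low (l : ℝ) (pol T)
  have h0 : ∑ i, low ((l : ℝ) - 1) i (low l i (pol T)) = 0 := by
    cases l with
    | zero => simp [pol_zero, low_apply, sphD_algebraMap]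
    | succ l =>
      push_cast
      simp only [low_pol hT, map_smul]
      cases l with
      | zero => simp [pol_zero, low_apply, sphD_algebraMap]
      | succ l =>
        have : ∀ i, low (((l + 1 : ℕ) : ℝ) + 1 - 1) i (pol (contr i T)) =
            ((l : ℝ) + 1) • pol (contr i (contr i T)) := by
          intro i
          rw [← low_pol (contr_mem hT i)]
          push_cast
          ring_nf
        simp only [this]
        rw [← Finset.smul_sum, ← Finset.smul_sum, ← map_sum, sum_contr_contr hT]
        simp
  rw [h0] at h
  rw [mem_Eig, neg_smul]
  exact eq_neg_of_add_eq_zero_left h.symm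

/-- The normalization of the `L²` product of spherical harmonics. -/
def kk (l : ℕ) : ℝ := (l ! : ℝ) / ((2 * l + 1)‼ : ℝ)

theorem kk_pos (l : ℕ) : 0 < kk l := by
  unfold kk
  have := Nat.doubleFactorial_pos (2 * l + 1)
  positivity

theorem kk_succ (l : ℕ) : (2 * (l : ℝ) + 3) * kk (l + 1) = ((l : ℝ) + 1) * kk l := by
  unfold kk
  have h1 : 2 * (l + 1) + 1 = (2 * l + 1) + 2 := by ring
  have h2 := Nat.doubleFactorial_pos (2 * l + 1)
  rw [h1, Nat.doubleFactorial_add_two, Nat.factorial_succ]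
  have h3 : ((2 * l + 1)‼ : ℝ) ≠ 0 := by positivity
  push_cast
  have h4 : (2 * (l : ℝ) + 1 + 2) ≠ 0 := by positivity
  field_simp
  ring

/-- Induction on the degree: `sum_sInt_low_mul_low` reduces the product to those of the contracted
tensors, with ratio `(l + 1) / (2l + 3)`, which is also the ratio of consecutive `kk`. -/
theorem sInt_pol_mul_pol {l : ℕ} {T U : Tensor l} (hT : T ∈ stfSubspace l)
    (hU : U ∈ stfSubspace l) :
    sInt (pol T * pol U) = 4 * Real.pi * kk l * inner ℝ T U := by
  induction l with
  | zero =>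
    rw [pol_zero, pol_zero, ← map_mul, sInt_algebraMap, PiLp.inner_apply,
      Fintype.sum_subsingleton _ Fin.elim0]
    simp [kk, mul_comm]
  | succ l ih =>
    have h := sum_sInt_low_mul_low (g := pol U) (pol_mem_Eig hT)
    push_cast at h
    simp only [low_pol hT, low_pol hU, smul_mul_assoc, mul_smul_comm, map_smul, smul_eq_mul] at h
    have h1 : ∀ i, sInt (pol (contr i T) * pol (contr i U)) = 4 * Real.pi * kk l *
        inner ℝ (contr i T) (contr i U) := fun i => ih (contr_mem hT i) (contr_mem hU i)
    simp only [h1, ← Finset.mul_sum, sum_inner_contr] at h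
    have h2 := kk_succ l
    have h3 : (l : ℝ) + 1 ≠ 0 := by positivity
    have h4 : 2 * (l : ℝ) + 3 ≠ 0 := by positivity
    apply mul_left_cancel₀ h4
    apply mul_left_cancel₀ h3
    linear_combination (-1) * h - (4 * Real.pi * inner ℝ T U) * (l + 1) * h2

theorem pol_injOn {l : ℕ} {T : Tensor l} (hT : T ∈ stfSubspace l) (h : pol T = 0) : T = 0 := by
  have h1 := sInt_pol_mul_pol hT hT
  rw [h, mul_zero, map_zero] at h1
  have h2 : 4 * Real.pi * kk l ≠ 0 := by
    have := kk_pos l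
    positivity
  exact inner_self_eq_zero.1 ((mul_eq_zero.1 h1.symm).resolve_left h2)

/-! ### Every eigenfunction comes from a symmetric trace-free tensor -/

/-- Iterated derivatives of `r ^ k * f`, restricted to the sphere. -/
def lowL (k : ℝ) : List (Fin 3) → SM → SM
  | [], f => f
  | i :: L, f => low (k - L.length) i (lowL k L f)

theorem lowL_perm (k : ℝ) (f : SM) {L L' : List (Fin 3)} (h : L.Perm L') :
    lowL k L f = lowL k L' f := by
  induction h with
  | nil => rfl
  | cons i h ih => simp only [lowL, ih, h.length_eq]
  | swap i j L =>
    simp only [lowL, List.length_cons, Nat.cast_add, Nat.cast_one, ← sub_sub]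
    exact low_comm _ _ _ _
  | trans _ _ h1 h2 => rw [h1, h2]

theorem lowL_mem {k : ℝ} {f : SM} (hf : f ∈ Eig k) (L : List (Fin 3)) :
    lowL k L f ∈ Eig (k - L.length) := by
  induction L with
  | nil => simpa [lowL] using hf
  | cons i L ih =>
    simp only [lowL, List.length_cons, Nat.cast_add, Nat.cast_one, ← sub_sub]
    exact low_mem ih i

/-- Euler's relation applied `j` times, the degree dropping by one each time. -/
theorem sum_prod_mul_lowL {k : ℝ} (f : SM) (j : ℕ) :
    ∑ I : Fin j → Fin 3, (∏ p, nn (I p)) * lowL k (List.ofFn I) f =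
      (∏ p ∈ Finset.range j, (k - p)) • f := by
  induction j with
  | zero => simp [lowL]
  | succ j ih =>
    rw [sum_cons, Finset.sum_comm, Finset.prod_range_succ, mul_comm, mul_smul, ← ih, Finset.smul_sum]
    refine Finset.sum_congr rfl fun I _ => ?_
    have h := sum_nn_mul_low (k - j) (lowL k (List.ofFn I) f)
    rw [← mul_smul_comm, ← h, Finset.mul_sum]
    refine Finset.sum_congr rfl fun i _ => ?_
    rw [Fin.prod_univ_succ, List.ofFn_cons]
    simp only [Fin.cons_zero, Fin.cons_succ, lowL, List.length_ofFn]
    ring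

/-- A point of the sphere. -/
def northPole : S2 := ⟨ee 0, by simp⟩

/-- The derivatives of order `l` of the harmonic function `r ^ l h` are harmonic of degree 0, hence
constant. Divided by `l!` they are its Taylor coefficients; they are symmetric because derivatives
commute and trace-free because the function is harmonic. -/
theorem exists_pol_eq {l : ℕ} {h : SM} (hh : h ∈ Eig l) : ∃ T ∈ stfSubspace l, pol T = h := by
  have hconst : ∀ I : Fin l → Fin 3, lowL l (List.ofFn I) h =
      algebraMap ℝ SM ((lowL l (List.ofFn I) h).1 northPole) := by
    intro I
    refine eq_algebraMap_of_mem ?_ _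
    have := lowL_mem hh (List.ofFn I)
    simpa using this
  -- The derivatives are constant functions, so any point of evaluation would do.
  let T : Tensor l := WithLp.toLp 2 fun I => (l ! : ℝ)⁻¹ * (lowL l (List.ofFn I) h).1 northPole
  have hT : ∀ I, T I = (l ! : ℝ)⁻¹ * (lowL l (List.ofFn I) h).1 northPole := fun _ => rfl
  refine ⟨T, ⟨fun σ I => ?_, fun p q hpq I => ?_⟩, ?_⟩
  · rw [hT, hT, lowL_perm _ _ (σ.ofFn_comp_perm I)]
  · have hperm : ∀ c : Fin 3,
        (List.ofFn (Function.update (Function.update I p c) q c)).Perm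
          (c :: c :: (((List.finRange l).erase p).erase q).map I) := by
      intro c
      rw [List.ofFn_eq_map]
      have h1 : (List.finRange l).Perm (p :: q :: ((List.finRange l).erase p).erase q) := by
        refine (List.perm_cons_erase (List.mem_finRange p)).trans (List.Perm.cons _ ?_)
        refine List.perm_cons_erase ?_
        rw [(List.nodup_finRange l).mem_erase_iff]
        exact ⟨hpq.symm, List.mem_finRange q⟩
      refine (h1.map _).trans (List.Perm.of_eq ?_)
      rw [List.map_cons, List.map_cons, Function.update_of_ne hpq, Function.update_self,
        Function.update_self]
      congr 2
      refine List.map_congr_left fun a ha => ?_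
      rw [((List.nodup_finRange l).erase p).mem_erase_iff, (List.nodup_finRange l).mem_erase_iff] at ha
      rw [Function.update_of_ne ha.1, Function.update_of_ne ha.2.1]
    simp only [hT, lowL_perm _ _ (hperm _)]
    rw [← Finset.mul_sum]
    set M := (((List.finRange l).erase p).erase q).map I with hM
    have h2 := sum_low_low ((l : ℝ) - M.length) (lowL l M h)
    rw [mem_Eig.1 (lowL_mem hh M), neg_smul, neg_add_cancel] at h2
    have h3 := congrArg (fun f : SM => evalAt northPole f) h2
    simp only [map_sum, map_zero] at h3
    simp only [lowL, List.length_cons, Nat.cast_add, Nat.cast_one, ← sub_sub]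
    simp only [evalAt_apply] at h3
    rw [h3, mul_zero]
  · have h1 := sum_prod_mul_lowL (k := l) h l
    have h2 : ∏ p ∈ Finset.range l, ((l : ℝ) - p) = (l ! : ℝ) := by
      rw [← Finset.prod_range_reflect, ← Finset.prod_range_add_one_eq_factorial]
      push_cast
      refine Finset.prod_congr rfl fun p hp => ?_
      rw [Finset.mem_range] at hp
      rw [Nat.cast_sub (by omega), Nat.cast_sub (by omega)]
      push_cast
      ring
    rw [h2] at h1
    have h3 : (l ! : ℝ) ≠ 0 := by positivity
    rw [← inv_smul_smul₀ h3 h, ← h1, pol_apply, Finset.smul_sum]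
    refine Finset.sum_congr rfl fun I _ => ?_
    conv_rhs => rw [hconst I, Algebra.algebraMap_eq_smul_one, mul_smul_comm, mul_one, smul_smul]

end

end Hadamard


namespace Hadamard

noncomputable section

/-! ### Projection to spherical harmonics -/

theorem inner_stf_left {l : ℕ} (T U : Tensor l) : inner ℝ (stf T) U = inner ℝ T (stf U) :=
  Submodule.inner_starProjection_left_eq_right _ T U

theorem stf_mem {l : ℕ} (T : Tensor l) : stf T ∈ stfSubspace l :=
  Submodule.starProjection_apply_mem _ T

theorem stf_of_mem {l : ℕ} {T : Tensor l} (hT : T ∈ stfSubspace l) : stf T = T :=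
  Submodule.starProjection_eq_self_iff.2 hT

/-- The symmetric trace-free projection as a linear map. -/
def stfL (l : ℕ) : Tensor l →ₗ[ℝ] Tensor l := (stfSubspace l).starProjection.toLinearMap

theorem stfL_apply {l : ℕ} (T : Tensor l) : stfL l T = stf T := rfl

theorem stf_nPow_apply {l : ℕ} (n : S2) (I : Fin l → Fin 3) :
    stf (nPow l n) I = (pol (stf (EuclideanSpace.single I 1))).1 n := by
  rw [pol_val_inner, ← inner_stf_left, EuclideanSpace.inner_single_right]
  simp

/-- The tensors of the spherical harmonics of a function. -/
def fhat (l : ℕ) : SM →ₗ[ℝ] Tensor l where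
  toFun f := WithLp.toLp 2 fun I =>
    ((2 * l + 1)‼ : ℝ) / (l ! : ℝ) *
      ((4 * Real.pi)⁻¹ * sInt (pol (stf (EuclideanSpace.single I 1)) * f))
  map_add' f g := by
    ext I
    simp [mul_add]
  map_smul' c f := by
    ext I
    simp
    ring

theorem fhat_apply (l : ℕ) (f : SM) (I : Fin l → Fin 3) :
    fhat l f I = ((2 * l + 1)‼ : ℝ) / (l ! : ℝ) *
      ((4 * Real.pi)⁻¹ * sInt (pol (stf (EuclideanSpace.single I 1)) * f)) := rfl

theorem inner_fhat (l : ℕ) (f : SM) (U : Tensor l) :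
    4 * Real.pi * kk l * inner ℝ (fhat l f) U = sInt (pol (stf U) * f) := by
  have hU : U = ∑ I, U I • (EuclideanSpace.single I 1 : Tensor l) := by
    ext J
    simp [Pi.single_apply]
  have h1 : pol (stf U) = ∑ I, U I • pol (stf (EuclideanSpace.single I 1 : Tensor l)) := by
    conv_lhs => rw [hU]
    rw [← stfL_apply, map_sum, map_sum]
    simp only [map_smul, stfL_apply]
  rw [h1, Finset.sum_mul, map_sum, PiLp.inner_apply, Finset.mul_sum]
  refine Finset.sum_congr rfl fun I _ => ?_
  rw [smul_mul_assoc, map_smul, fhat_apply, kk]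
  have h2 : ((2 * l + 1)‼ : ℝ) ≠ 0 := by
    have := Nat.doubleFactorial_pos (2 * l + 1)
    positivity
  have h3 : (l ! : ℝ) ≠ 0 := by positivity
  simp
  field_simp

theorem fhat_mem (l : ℕ) (f : SM) : fhat l f ∈ stfSubspace l := by
  rw [← Submodule.orthogonal_orthogonal (stfSubspace l), Submodule.mem_orthogonal']
  intro U hU
  have h := inner_fhat l f U
  have h0 : stf U = 0 := (Submodule.starProjection_apply_eq_zero_iff _).2 hU
  rw [h0, map_zero, zero_mul, map_zero] at h
  have := kk_pos l
  exact (mul_eq_zero.1 h).resolve_left (by positivity)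

/-- The projection to the spherical harmonics of degree `l`. -/
def harm (l : ℕ) : SM →ₗ[ℝ] SM := pol ∘ₗ fhat l

theorem harm_apply (l : ℕ) (f : SM) : harm l f = pol (fhat l f) := rfl

theorem harm_mem (l : ℕ) (f : SM) : harm l f ∈ Eig l := pol_mem_Eig (fhat_mem l f)

/-- The factor `(2l + 1)‼ / l!` in `fhat` inverts the normalization in `sInt_pol_mul_pol`, and all
harmonics of degree `l` come from tensors. So `harm l` is the `L²`-orthogonal projection onto `Eig
l`. -/
theorem sInt_harm_mul {l : ℕ} (f : SM) {h : SM} (hh : h ∈ Eig l) :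
    sInt (harm l f * h) = sInt (f * h) := by
  obtain ⟨U, hU, rfl⟩ := exists_pol_eq hh
  rw [harm_apply, sInt_pol_mul_pol (fhat_mem l f) hU, inner_fhat, stf_of_mem hU, mul_comm]

theorem eq_of_mem_Eig {k : ℝ} {f g : SM} (hf : f ∈ Eig k) (hg : g ∈ Eig k)
    (h : ∀ u ∈ Eig k, sInt (f * u) = sInt (g * u)) : f = g := by
  rw [← sub_eq_zero]
  refine sInt_mul_self_eq_zero ?_
  have := h (f - g) (sub_mem hf hg)
  rw [sub_mul, map_sub, this, sub_self]

theorem eq_harm {l : ℕ} {f g : SM} (hg : g ∈ Eig l)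
    (h : ∀ u ∈ Eig l, sInt (g * u) = sInt (f * u)) : g = harm l f :=
  eq_of_mem_Eig hg (harm_mem l f) fun u hu => by rw [h u hu, sInt_harm_mul f hu]

theorem harm_of_mem {l : ℕ} {f : SM} (hf : f ∈ Eig l) : harm l f = f :=
  (eq_harm hf fun _ _ => rfl).symm

theorem harm_of_mem_ne {l m : ℕ} (hlm : l ≠ m) {f : SM} (hf : f ∈ Eig m) : harm l f = 0 := by
  refine (eq_harm (zero_mem _) fun u hu => ?_).symm
  rw [zero_mul, map_zero, sInt_Eig_orth (natDegree_ne hlm.symm) hf hu]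

theorem sInt_harm_symm (l : ℕ) (f g : SM) : sInt (harm l f * g) = sInt (f * harm l g) := by
  rw [← sInt_harm_mul f (harm_mem l g), mul_comm, ← sInt_harm_mul g (harm_mem l f), mul_comm]

theorem harm_lap (l : ℕ) (f : SM) : harm l (lap f) = -((l : ℝ) * (l + 1)) • harm l f := by
  refine (eq_harm (Submodule.smul_mem _ _ (harm_mem l f)) fun u hu => ?_).symm
  rw [smul_mul_assoc, map_smul, sInt_harm_mul f hu, sInt_lap_symm, mem_Eig.1 hu, mul_smul_comm,
    map_smul]

/-! ### Rotation generators -/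

/-- The generators of rotations. -/
def rotL (i j : Fin 3) : SM →ₗ[ℝ] SM :=
  LinearMap.mulLeft ℝ (nn i) ∘ₗ sphD j - LinearMap.mulLeft ℝ (nn j) ∘ₗ sphD i

theorem rotL_apply (i j : Fin 3) (f : SM) : rotL i j f = nn i * sphD j f - nn j * sphD i f := rfl

/-- The gradient changes the degree of harmonics, while the rotation generators preserve it and
commute with `harm l`. Writing gradients through them allows series of harmonics to be
differentiated without loss of decay. -/
theorem sphD_eq_sum_rotL (j : Fin 3) (f : SM) : sphD j f = ∑ i, nn i * rotL i j f := by
  have h1 := sum_nn_sphD f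
  have h2 := sum_nn_sq
  calc sphD j f = (∑ i, nn i * nn i) * sphD j f - nn j * ∑ i, nn i * sphD i f := by
        rw [h1, h2]; ring
    _ = ∑ i, nn i * rotL i j f := by
        rw [Finset.sum_mul, Finset.mul_sum, ← Finset.sum_sub_distrib]
        refine Finset.sum_congr rfl fun i _ => ?_
        rw [rotL_apply]
        ring

theorem sInt_rotL_mul (i j : Fin 3) (f g : SM) :
    sInt (rotL i j f * g) = - sInt (f * rotL i j g) := by
  have h1 := sInt_sphD_mul j f (nn i * g)
  have h2 := sInt_sphD_mul i f (nn j * g)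
  rw [sphD_nn_mul] at h1 h2
  rw [rotL_apply, rotL_apply, sub_mul, mul_sub,
    show nn i * sphD j f * g = sphD j f * (nn i * g) by ring,
    show nn j * sphD i f * g = sphD i f * (nn j * g) by ring, map_sub, map_sub, h1, h2]
  simp only [mul_add, mul_sub, map_add, map_sub, mul_smul_comm, map_smul, smul_eq_mul]
  rw [show nn j * f * (nn i * g) = nn i * f * (nn j * g) by ring,
    show f * (nn i * nn j * g) = f * (nn j * nn i * g) by ring]
  simp only [eq_comm (a := i)]
  ring

theorem rotL_mem {k : ℝ} {f : SM} (hf : f ∈ Eig k) (i j : Fin 3) : rotL i j f ∈ Eig k := by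
  have h0 : rotL i j f = nn i * low k j f - nn j * low k i f := by
    rw [rotL_apply, low_apply, low_apply, mul_add, mul_add, mul_smul_comm, mul_smul_comm,
      show nn i * (nn j * f) = nn j * (nn i * f) by ring]
    abel
  have h1 := mem_Eig.1 (low_mem hf i)
  have h2 := mem_Eig.1 (low_mem hf j)
  have h3 := low_comm k i j f
  rw [low_apply, low_apply (k - 1) i] at h3
  have h4 : sphD i (low k j f) = sphD j (low k i f) + (k - 1) • (nn j * low k i f) -
      (k - 1) • (nn i * low k j f) := by
    rw [h3]
    abel
  rw [mem_Eig, h0, map_sub, lap_nn_mul, lap_nn_mul, h1, h2, h4, mul_smul_comm, mul_smul_comm]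
  module

theorem harm_rotL (l : ℕ) (i j : Fin 3) (f : SM) : harm l (rotL i j f) = rotL i j (harm l f) := by
  refine (eq_harm (rotL_mem (harm_mem l f) i j) fun u hu => ?_).symm
  rw [sInt_rotL_mul, sInt_harm_mul f (rotL_mem hu i j), sInt_rotL_mul]

/-! ### Rotation covariance -/

theorem sum_isometry_mul (R : E ≃ₗᵢ[ℝ] E) (i j : Fin 3) :
    ∑ k, R (ee k) i * R (ee k) j = if i = j then 1 else 0 := by
  have h : ∀ k i, R (ee k) i = (R.symm (ee i)) k := by
    intro k i
    have h1 : inner ℝ (ee i) (R (ee k)) = inner ℝ (R.symm (ee i)) (ee k) := by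
      rw [← R.inner_map_map (R.symm (ee i)), R.apply_symm_apply]
    simpa [EuclideanSpace.inner_single_left, EuclideanSpace.inner_single_right] using h1
  simp only [h]
  have h2 : inner ℝ (R.symm (ee j)) (R.symm (ee i)) = inner ℝ (ee j) (ee i) :=
    R.symm.inner_map_map _ _
  rw [PiLp.inner_apply] at h2
  simp only [RCLike.inner_apply, conj_trivial] at h2
  rw [h2]
  simp [EuclideanSpace.inner_single_left, eq_comm]

theorem lap_comp (R : E ≃ₗᵢ[ℝ] E) (f : SM) : lap (comp R f) = comp R (lap f) := by
  rw [lap_apply]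
  have h : ∀ j, sphD j (sphD j (comp R f)) =
      ∑ i, ∑ i', (R (ee j) i * R (ee j) i') • comp R (sphD i' (sphD i f)) := by
    intro j
    simp only [sphD_comp, map_sum, map_smul, Finset.smul_sum, smul_smul]
  simp only [h]
  rw [Finset.sum_comm, lap_apply, map_sum]
  refine Finset.sum_congr rfl fun i _ => ?_
  rw [Finset.sum_comm]
  simp only [← Finset.sum_smul, sum_isometry_mul, ite_smul, one_smul, zero_smul, Finset.sum_ite_eq,
    Finset.mem_univ, if_true]

theorem comp_mem_Eig {k : ℝ} {f : SM} (hf : f ∈ Eig k) (R : E ≃ₗᵢ[ℝ] E) : comp R f ∈ Eig k := by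
  rw [mem_Eig, lap_comp, mem_Eig.1 hf, map_smul]

theorem comp_comp_symm (R : E ≃ₗᵢ[ℝ] E) (f : SM) : comp R (comp R.symm f) = f := by
  refine SM.ext' fun n => ?_
  have : rot R.symm (rot R n) = n := Subtype.ext (by simp [rot])
  change f.1 (rot R.symm (rot R n)) = f.1 n
  rw [this]

theorem harm_comp (l : ℕ) (R : E ≃ₗᵢ[ℝ] E) (f : SM) : harm l (comp R f) = comp R (harm l f) := by
  refine (eq_harm (comp_mem_Eig (harm_mem l f) R) fun u hu => ?_).symm
  rw [← comp_comp_symm R u, ← map_mul, ← map_mul, sInt_comp, sInt_comp,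
    sInt_harm_mul f (comp_mem_Eig hu R.symm)]

theorem sphT_comp (R : E ≃ₗᵢ[ℝ] E) (j : Fin 3) (f : SM) :
    ∑ i, R (ee i) j • sphT i (comp R f) = comp R (sphT j f) := by
  have h1 : ∑ i, R (ee i) j • sphD i (comp R f) = comp R (sphD j f) := by
    simp only [sphD_comp, Finset.smul_sum, smul_smul]
    rw [Finset.sum_comm]
    simp only [← Finset.sum_smul, sum_isometry_mul, ite_smul, one_smul, zero_smul,
      Finset.sum_ite_eq, Finset.mem_univ, if_true]
  simp only [sphT_apply, smul_sub, Finset.sum_sub_distrib, h1, map_sub, map_mul, nn_comp,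
    Finset.sum_mul, smul_mul_assoc]

/-! ### Zonal harmonics and the bound for the projections -/

/-- The zonal harmonic of degree `l` with axis `e`. -/
def zonal (l : ℕ) (e : S2) : SM := pol (stf (nPow l e))

theorem zonal_mem (l : ℕ) (e : S2) : zonal l e ∈ Eig l := pol_mem_Eig (stf_mem _)

/-- The projection in `zonal` can be moved to the tensor of `h`, where it does nothing, and
contraction with `n^L` at `e` evaluates there: zonal harmonics are reproducing kernels. -/
theorem sInt_zonal_mul {l : ℕ} (e : S2) {h : SM} (hh : h ∈ Eig l) :
    sInt (zonal l e * h) = 4 * Real.pi * kk l * h.1 e := by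
  obtain ⟨U, hU, rfl⟩ := exists_pol_eq hh
  rw [zonal, sInt_pol_mul_pol (stf_mem _) hU, inner_stf_left, stf_of_mem hU, pol_val_inner]

/-- Both sides have degree `l + 1`, so it suffices to pair them with `h` of that degree. Once `n_i`
is moved onto `h`, orthogonality leaves only the lowered part of `n_i h`, which Euler's relation at
`e` sums to a multiple of `h` at `e`. -/
theorem zonal_succ (l : ℕ) (e : S2) :
    zonal (l + 1) e = ∑ i, (e : E) i • (nn i * zonal l e -
      (2 * (l : ℝ) + 1)⁻¹ • low l i (zonal l e)) := by
  have hl : 2 * (l : ℝ) + 1 ≠ 0 := by positivity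
  have hmem : ∑ i, (e : E) i • (nn i * zonal l e -
      (2 * (l : ℝ) + 1)⁻¹ • low l i (zonal l e)) ∈ Eig ((l + 1 : ℕ) : ℝ) := by
    refine Submodule.sum_mem _ fun i _ => Submodule.smul_mem _ _ ?_
    push_cast
    exact raise_mem (zonal_mem l e) hl i
  refine eq_of_mem_Eig (zonal_mem _ e) hmem fun h hh => ?_
  rw [sInt_zonal_mul e hh, Finset.sum_mul, map_sum]
  have h1 : ∀ i, sInt ((e : E) i • (nn i * zonal l e -
      (2 * (l : ℝ) + 1)⁻¹ • low l i (zonal l e)) * h) =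
      (2 * (l : ℝ) + 3)⁻¹ * (4 * Real.pi * kk l) *
        ((e : E) i * (low ((l : ℝ) + 1) i h).1 e) := by
    intro i
    have hh' : h ∈ Eig ((l : ℝ) + 1) := by simpa using hh
    have hl3 : 2 * ((l : ℝ) + 1) + 1 ≠ 0 := by positivity
    have a1 : sInt (low l i (zonal l e) * h) = 0 := by
      refine sInt_Eig_orth ?_ (low_mem (zonal_mem l e) i) hh'
      intro h
      have : 4 * (l : ℝ) + 2 = 0 := by linarith
      have : (0 : ℝ) < 4 * (l : ℝ) + 2 := by positivity
      linarith
    have a2 : sInt (zonal l e * (nn i * h - (2 * ((l : ℝ) + 1) + 1)⁻¹ • low ((l : ℝ) + 1) i h))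
        = 0 := by
      refine sInt_Eig_orth ?_ (zonal_mem l e) (raise_mem hh' hl3 i)
      intro h
      have : 4 * (l : ℝ) + 6 = 0 := by linarith
      have : (0 : ℝ) < 4 * (l : ℝ) + 6 := by positivity
      linarith
    have hlow : low ((l : ℝ) + 1) i h ∈ Eig l := by
      have := low_mem hh' i
      rwa [add_sub_cancel_right] at this
    have a3 := sInt_zonal_mul e hlow
    rw [mul_sub, mul_smul_comm, map_sub, map_smul, a3, smul_eq_mul] at a2
    rw [smul_mul_assoc, sub_mul, smul_mul_assoc, map_smul, map_sub, map_smul, a1,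
      show nn i * zonal l e * h = zonal l e * (nn i * h) by ring, sub_eq_zero.1 a2]
    simp only [smul_eq_mul]
    rw [show 2 * ((l : ℝ) + 1) + 1 = 2 * l + 3 by ring]
    ring
  have h2 : ∑ i, (e : E) i * (low ((l : ℝ) + 1) i h).1 e = ((l : ℝ) + 1) * h.1 e := by
    have := congrArg (evalAt e) (sum_nn_mul_low ((l : ℝ) + 1) h)
    rw [map_sum, map_smul] at this
    simp only [map_mul] at this
    exact this
  simp only [h1, ← Finset.mul_sum, h2]
  have h3 := kk_succ l
  have h4 : 2 * (l : ℝ) + 3 ≠ 0 := by positivity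
  field_simp
  linear_combination (h.1 e) * h3

theorem zonal_self (l : ℕ) (e : S2) : (zonal l e).1 e = (2 * (l : ℝ) + 1) * kk l := by
  induction l with
  | zero =>
    have h : (zonal 0 e).1 e = ∑ I, nPow 0 e I * (stf (nPow 0 e)) I := pol_val _ _
    have hmem : nPow 0 e ∈ stfSubspace 0 :=
      ⟨fun σ I => by rw [Subsingleton.elim (I ∘ σ) I], fun p => p.elim0⟩
    rw [h, stf_of_mem hmem, Fintype.sum_subsingleton _ Fin.elim0]
    simp [nPow, kk]
  | succ l ih =>
    have h := congrArg (evalAt e) (zonal_succ l e)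
    have h1 := congrArg (evalAt e) (sum_nn_mul_low (l : ℝ) (zonal l e))
    have h2 := congrArg (evalAt e) sum_nn_sq
    simp only [map_sum, map_smul, map_sub, map_mul, map_one, smul_eq_mul] at h h1 h2
    have h0 : ∀ i, evalAt e (nn i) = (e : E) i := fun _ => rfl
    simp only [h0] at h h1 h2
    have h3 : ∑ x, (e : E) x * ((e : E) x * evalAt e (zonal l e) -
        (2 * (l : ℝ) + 1)⁻¹ * evalAt e (low l x (zonal l e))) =
        (∑ x, (e : E) x * (e : E) x) * evalAt e (zonal l e) -
          (2 * (l : ℝ) + 1)⁻¹ * ∑ x, (e : E) x * evalAt e (low l x (zonal l e)) := by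
      rw [Finset.sum_mul, Finset.mul_sum, ← Finset.sum_sub_distrib]
      exact Finset.sum_congr rfl fun i _ => by ring
    rw [h3, h1, h2, evalAt_apply, evalAt_apply, ih] at h
    rw [h]
    have h4 := kk_succ l
    have h5 : 2 * (l : ℝ) + 1 ≠ 0 := by positivity
    push_cast
    rw [show 2 * ((l : ℝ) + 1) + 1 = 2 * l + 3 by ring, h4]
    field_simp
    ring

theorem norm_stf_nPow_sq (l : ℕ) (e : S2) : ‖stf (nPow l e)‖ ^ 2 = (2 * (l : ℝ) + 1) * kk l := by
  rw [← zonal_self l e, zonal, pol_val_inner, ← real_inner_self_eq_norm_sq, inner_stf_left,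
    stf_of_mem (stf_mem _)]

/-- Cauchy–Schwarz for tensors, since the norm of the projected `n^L` does not depend on the
direction. Through the reproducing property this bounds the projections in the supremum norm. -/
theorem abs_zonal_le (l : ℕ) (e n : S2) : |(zonal l e).1 n| ≤ (2 * (l : ℝ) + 1) * kk l := by
  rw [zonal, pol_val_inner, ← stf_of_mem (stf_mem (nPow l e)), ← inner_stf_left]
  refine (abs_real_inner_le_norm _ _).trans (le_of_eq ?_)
  have h1 : ‖stf (nPow l n)‖ = ‖stf (nPow l e)‖ := by
    rw [← sq_eq_sq₀ (norm_nonneg _) (norm_nonneg _), norm_stf_nPow_sq, norm_stf_nPow_sq]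
  rw [h1, ← norm_stf_nPow_sq l e, pow_two]

theorem harm_val (l : ℕ) (f : SM) (n : S2) :
    4 * Real.pi * kk l * (harm l f).1 n = sInt (zonal l n * f) := by
  rw [harm_apply, pol_val_inner, real_inner_comm, inner_fhat, zonal]

theorem abs_harm_le (l : ℕ) (f : SM) {C : ℝ} (h : ∀ n, |f.1 n| ≤ C) (n : S2) :
    |(harm l f).1 n| ≤ (2 * (l : ℝ) + 1) * C := by
  have hk := kk_pos l
  have h1 : |sInt (zonal l n * f)| ≤ 4 * Real.pi * ((2 * (l : ℝ) + 1) * kk l * C) := by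
    refine abs_sInt_le _ fun m => ?_
    change |(zonal l n).1 m * f.1 m| ≤ _
    rw [abs_mul]
    exact mul_le_mul (abs_zonal_le l n m) (h m) (abs_nonneg _) (by positivity)
  rw [← harm_val, abs_mul, abs_of_pos (by positivity : 0 < 4 * Real.pi * kk l)] at h1
  have h2 : 0 < 4 * Real.pi * kk l := by positivity
  refine le_of_mul_le_mul_left (h1.trans (le_of_eq ?_)) h2
  ring

/-- Each power of `1 - lap` gains a factor `1 + l (l + 1)`. Two of them outweigh the growth `2l + 1`
of the sup-norm bound and leave decay of order 3, enough for multipliers of linear growth to give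
summable series. -/
theorem exists_harm_le (f : SM) : ∃ C, ∀ l n, |(harm l f).1 n| ≤ C / ((l : ℝ) + 1) ^ 3 := by
  -- The function bounded here is `(1 - lap)` applied twice to `f`.
  obtain ⟨C, hC⟩ := (f - lap f - lap (f - lap f)).exists_bound
  have hC0 : 0 ≤ C := (abs_nonneg _).trans (hC northPole)
  refine ⟨8 * C, fun l n => ?_⟩
  have h := abs_harm_le l _ hC n
  have h1 : harm l (f - lap f - lap (f - lap f)) =
      ((1 + (l : ℝ) * (l + 1)) ^ 2) • harm l f := by
    simp only [map_sub, harm_lap]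
    module
  rw [h1] at h
  change |(1 + (l : ℝ) * (l + 1)) ^ 2 * (harm l f).1 n| ≤ _ at h
  rw [abs_mul, abs_of_nonneg (by positivity)] at h
  set a := |(harm l f).1 n|
  have ha : 0 ≤ a := abs_nonneg _
  have hl : (0 : ℝ) ≤ l := by positivity
  have h2 : ((l : ℝ) + 1) ^ 2 ≤ 2 * (1 + (l : ℝ) * (l + 1)) := by nlinarith
  have h3 : ((l : ℝ) + 1) ^ 4 ≤ 4 * (1 + (l : ℝ) * (l + 1)) ^ 2 := by
    calc ((l : ℝ) + 1) ^ 4 = (((l : ℝ) + 1) ^ 2) ^ 2 := by ring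
      _ ≤ (2 * (1 + (l : ℝ) * (l + 1))) ^ 2 := by gcongr
      _ = _ := by ring
  rw [le_div_iff₀ (by positivity)]
  have h5 : ((l : ℝ) + 1) * (a * ((l : ℝ) + 1) ^ 3) ≤ ((l : ℝ) + 1) * (8 * C) := by
    calc ((l : ℝ) + 1) * (a * ((l : ℝ) + 1) ^ 3) = ((l : ℝ) + 1) ^ 4 * a := by ring
      _ ≤ 4 * (1 + (l : ℝ) * (l + 1)) ^ 2 * a := by gcongr
      _ = 4 * ((1 + (l : ℝ) * (l + 1)) ^ 2 * a) := by ring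
      _ ≤ 4 * ((2 * (l : ℝ) + 1) * C) := by gcongr
      _ ≤ ((l : ℝ) + 1) * (8 * C) := by nlinarith
  exact le_of_mul_le_mul_left h5 (by positivity)

end

end Hadamard


/-! ### Completeness of harmonics, multiplier operators and the commutator with `T_i` -/

namespace Hadamard

noncomputable section

/-! ### Completeness of spherical harmonics -/

/-- The span of all spherical harmonics. -/
def harmonics : Submodule ℝ SM := ⨆ l : ℕ, Eig l

theorem Eig_le_harmonics (l : ℕ) : Eig l ≤ harmonics := le_iSup (fun l : ℕ => Eig l) l

theorem low_mem_nat {l : ℕ} {f : SM} (hf : f ∈ Eig l) (i : Fin 3) :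
    low l i f ∈ Eig ((l - 1 : ℕ) : ℝ) := by
  cases l with
  | zero =>
    have := sphD_eq_zero_of_mem (by simpa using hf) i
    rw [low_apply, this]
    simp
  | succ l =>
    have := low_mem hf i
    push_cast at this ⊢
    rwa [add_sub_cancel_right] at this

theorem nn_mul_mem_harmonics (i : Fin 3) {f : SM} (hf : f ∈ harmonics) :
    nn i * f ∈ harmonics := by
  induction hf using Submodule.iSup_induction' with
  | mem l h hh =>
    have h1 := raise_mem hh (by positivity) i
    have h2 : nn i * h = (nn i * h - (2 * (l : ℝ) + 1)⁻¹ • low l i h) +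
      (2 * (l : ℝ) + 1)⁻¹ • low l i h := by abel
    rw [h2]
    refine add_mem (Eig_le_harmonics (l + 1) (by push_cast; exact h1))
      (Submodule.smul_mem _ _ (Eig_le_harmonics (l - 1) (low_mem_nat hh i)))
  | zero => simp
  | add f g _ _ hf hg => rw [mul_add]; exact add_mem hf hg

theorem adjoin_le_harmonics {a : SM} (ha : a ∈ Algebra.adjoin ℝ (Set.range nn)) :
    a ∈ harmonics := by
  have h : ∀ f ∈ harmonics, a * f ∈ harmonics := by
    induction ha using Algebra.adjoin_induction with
    | mem x hx =>
      obtain ⟨i, rfl⟩ := hx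
      exact fun f hf => nn_mul_mem_harmonics i hf
    | algebraMap r =>
      intro f hf
      rw [← Algebra.smul_def]
      exact Submodule.smul_mem _ _ hf
    | add a b _ _ ha hb =>
      intro f hf
      rw [add_mul]
      exact add_mem (ha f hf) (hb f hf)
    | mul a b _ _ ha hb =>
      intro f hf
      rw [mul_assoc]
      exact ha _ (hb f hf)
  have h1 : (1 : SM) ∈ harmonics := by
    refine Eig_le_harmonics 0 ?_
    have := algebraMap_mem_Eig 1
    simpa using this
  simpa using h 1 h1

/-- Smooth functions as continuous functions. -/
def toC : SM →ₐ[ℝ] C(S2, ℝ) where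
  toFun f := ⟨f.1, f.continuous⟩
  map_one' := rfl
  map_mul' _ _ := rfl
  map_zero' := rfl
  map_add' _ _ := rfl
  commutes' _ := rfl

/-- By Stone–Weierstrass `f` is a uniform limit of polynomials in the coordinates. These lie in the
span of the harmonics, because multiplication by a coordinate preserves it, so `∫ f ^ 2` is a limit
of zeros. -/
theorem eq_zero_of_forall_Eig {f : SM} (hf : ∀ l : ℕ, ∀ h ∈ Eig l, sInt (f * h) = 0) : f = 0 := by
  have hf' : ∀ h ∈ harmonics, sInt (f * h) = 0 := by
    intro h hh
    induction hh using Submodule.iSup_induction' with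
    | mem l h hh => exact hf l h hh
    | zero => simp
    | add g h _ _ hg hh => rw [mul_add, map_add, hg, hh, add_zero]
  refine sInt_mul_self_eq_zero ?_
  obtain ⟨C, hC⟩ := f.exists_bound
  have hC0 : 0 ≤ C := (abs_nonneg _).trans (hC northPole)
  have hsep : ((Algebra.adjoin ℝ (Set.range nn)).map toC).SeparatesPoints := by
    intro x y hxy
    by_contra! hcon
    refine hxy (Subtype.ext ?_)
    ext i
    exact hcon _ ⟨toC (nn i), ⟨nn i, Algebra.subset_adjoin ⟨i, rfl⟩, rfl⟩, rfl⟩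
  have key : ∀ ε > 0, |sInt (f * f)| ≤ 4 * Real.pi * (C * ε) := by
    intro ε hε
    obtain ⟨⟨b, hb⟩, hg⟩ :=
      ContinuousMap.exists_mem_subalgebra_near_continuousMap_of_separatesPoints _ hsep (toC f) ε hε
    obtain ⟨a, ha, hab⟩ := Subalgebra.mem_map.1 hb
    change ‖b - toC f‖ < ε at hg
    rw [← hab, ← map_sub] at hg
    have h0 : sInt (f * f) = sInt (f * (f - a)) := by
      rw [mul_sub, map_sub, hf' a (adjoin_le_harmonics ha), sub_zero]
    rw [h0]
    refine abs_sInt_le _ fun n => ?_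
    change |f.1 n * (f.1 n - a.1 n)| ≤ _
    rw [abs_mul]
    refine mul_le_mul (hC n) ?_ (abs_nonneg _) hC0
    have := ContinuousMap.norm_coe_le_norm (toC (a - f)) n
    rw [abs_sub_comm]
    exact this.trans hg.le
  by_contra hne
  have hpos : 0 < |sInt (f * f)| := abs_pos.2 hne
  have h1 := key (|sInt (f * f)| / (8 * Real.pi * (C + 1))) (by positivity)
  have h2 : 4 * Real.pi * (C * (|sInt (f * f)| / (8 * Real.pi * (C + 1)))) =
      (C / (C + 1)) * (|sInt (f * f)| / 2) := by
    field_simp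
    ring
  have h3 : C / (C + 1) ≤ 1 := by
    rw [div_le_one (by positivity)]
    linarith
  nlinarith

/-! ### Rotation invariant operators -/

/-- Sequences of multipliers of at most linear growth. -/
def Multiplier : Submodule ℝ (ℕ → ℝ) where
  carrier := {w | ∃ C, ∀ l, |w l| ≤ C * ((l : ℝ) + 1)}
  zero_mem' := ⟨0, by simp⟩
  add_mem' := by
    rintro v w ⟨C, hC⟩ ⟨D, hD⟩
    refine ⟨C + D, fun l => (abs_add_le _ _).trans ?_⟩
    rw [add_mul]
    exact add_le_add (hC l) (hD l)
  smul_mem' := by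
    rintro c w ⟨C, hC⟩
    refine ⟨|c| * C, fun l => ?_⟩
    rw [Pi.smul_apply, smul_eq_mul, abs_mul, mul_assoc]
    exact mul_le_mul_of_nonneg_left (hC l) (abs_nonneg _)

theorem summable_sq_shift (C : ℝ) : Summable fun l : ℕ => C / ((l : ℝ) + 1) ^ 2 := by
  have h := (summable_nat_add_iff 1).2 (Real.summable_one_div_nat_pow.2 one_lt_two)
  simpa [div_eq_mul_inv] using h.mul_left C

theorem exists_mul_harm_le (w : Multiplier) (f : SM) :
    ∃ C, ∀ l n, |w.1 l * (harm l f).1 n| ≤ C / ((l : ℝ) + 1) ^ 2 := by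
  obtain ⟨C, hC⟩ := w.2
  obtain ⟨D, hD⟩ := exists_harm_le f
  refine ⟨C * D, fun l n => ?_⟩
  rw [abs_mul]
  have h1 : 0 ≤ C * ((l : ℝ) + 1) := (abs_nonneg _).trans (hC l)
  calc |w.1 l| * |(harm l f).1 n| ≤ C * ((l : ℝ) + 1) * (D / ((l : ℝ) + 1) ^ 3) :=
        mul_le_mul (hC l) (hD l n) (abs_nonneg _) h1
    _ = C * D / ((l : ℝ) + 1) ^ 2 := by field_simp

theorem summable_mul_harm (w : Multiplier) (f : SM) (n : S2) :
    Summable fun l => w.1 l * (harm l f).1 n := by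
  obtain ⟨C, hC⟩ := exists_mul_harm_le w f
  exact Summable.of_norm_bounded (summable_sq_shift C) fun l => hC l n

/-- The sum of the series of the multiples of the spherical harmonics of `f`. -/
def opFun (w : Multiplier) (f : SM) (n : S2) : ℝ := ∑' l, w.1 l * (harm l f).1 n

/-- The coordinate functionals. -/
abbrev prj (j : Fin 3) : E →L[ℝ] ℝ := EuclideanSpace.proj j

theorem hasFDerivAt_sphere (h : SM) {x : E} (hx : x ≠ 0) :
    HasFDerivAt (fun x => h.1 (dir x))
      (∑ j, (‖x‖⁻¹ * (sphD j h).1 (dir x)) • prj j) x := by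
  refine (h.differentiableAt hx).hasFDerivAt.congr_fderiv ?_
  ext v
  conv_lhs => rw [← sum_smul_ee v]
  rw [map_sum, _root_.sum_apply]
  refine Finset.sum_congr rfl fun j _ => ?_
  rw [map_smul, fderiv_sphD h hx]
  simp [mul_comm]

theorem abs_coord_le (n : S2) (i : Fin 3) : |(nn i).1 n| ≤ 1 := by
  have := PiLp.norm_apply_le (n : E) i
  rw [norm_sphere] at this
  exact this

theorem norm_proj_le (j : Fin 3) :
    ‖prj j‖ ≤ 1 :=
  ContinuousLinearMap.opNorm_le_bound _ zero_le_one fun v => by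
    rw [one_mul]
    exact PiLp.norm_apply_le v j

theorem harm_sphD_val (l : ℕ) (f : SM) (j : Fin 3) (n : S2) :
    (sphD j (harm l f)).1 n = ∑ i, (nn i).1 n * (harm l (rotL i j f)).1 n := by
  have := congrArg (evalAt n) (sphD_eq_sum_rotL j (harm l f))
  simp only [map_sum, map_mul, ← harm_rotL] at this
  exact this

/-- Termwise differentiation. Through rotation generators the gradient of the harmonics of `f` is
expressed by the harmonics of `rotL i j f`, which decay equally fast, and the derivative is again
built from such series. -/
theorem hasFDerivAt_opFun (w : Multiplier) (f : SM) {x : E} (hx : x ≠ 0) :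
    HasFDerivAt (fun x => opFun w f (dir x))
      (∑ j, (‖x‖⁻¹ * ∑ i, (nn i).1 (dir x) * opFun w (rotL i j f) (dir x)) •
        prj j) x := by
  choose C hC using fun i j => exists_mul_harm_le w (rotL i j f)
  set A : ℝ := ∑ j, ∑ i, C i j with hA
  have hxpos : 0 < ‖x‖ := norm_pos_iff.2 hx
  have hball : ∀ y ∈ Metric.ball x (‖x‖ / 2), y ≠ 0 ∧ ‖y‖⁻¹ ≤ 2 / ‖x‖ := by
    intro y hy
    rw [mem_ball_iff_norm] at hy
    have h1 : ‖x‖ / 2 < ‖y‖ := by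
      have := norm_sub_norm_le x y
      rw [norm_sub_rev] at this
      linarith
    refine ⟨norm_pos_iff.1 (by linarith), ?_⟩
    rw [show 2 / ‖x‖ = (‖x‖ / 2)⁻¹ by field_simp]
    exact inv_anti₀ (by positivity) h1.le
  -- On the ball of radius `‖x‖ / 2` the factor `‖y‖⁻¹` is at most `2 / ‖x‖`, so the bounds are
  -- uniform there.
  have hder := hasFDerivAt_tsum_of_isPreconnected (𝕜 := ℝ)
    (u := fun l : ℕ => 2 / ‖x‖ * A / ((l : ℝ) + 1) ^ 2)
    (f := fun l y => w.1 l * (harm l f).1 (dir y))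
    (f' := fun l y => w.1 l • ∑ j, (‖y‖⁻¹ * (sphD j (harm l f)).1 (dir y)) •
      prj j) (s := Metric.ball x (‖x‖ / 2))
    (x₀ := x) (x := x) (summable_sq_shift _) Metric.isOpen_ball
    (convex_ball x (‖x‖ / 2)).isPreconnected
    (fun l y hy => (hasFDerivAt_sphere (harm l f) (hball y hy).1).const_mul _)
    (fun l y hy => by
      obtain ⟨hy0, hyi⟩ := hball y hy
      rw [Finset.smul_sum]
      refine (norm_sum_le _ _).trans ?_
      have hj : ∀ j ∈ Finset.univ, ‖w.1 l • (‖y‖⁻¹ * (sphD j (harm l f)).1 (dir y)) •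
          prj j‖ ≤
          2 / ‖x‖ * ((∑ i, C i j) / ((l : ℝ) + 1) ^ 2) := by
        intro j _
        rw [smul_smul, norm_smul]
        refine (mul_le_of_le_one_right (norm_nonneg _) (norm_proj_le j)).trans ?_
        rw [Real.norm_eq_abs, show w.1 l * (‖y‖⁻¹ * (sphD j (harm l f)).1 (dir y)) =
          ‖y‖⁻¹ * (w.1 l * (sphD j (harm l f)).1 (dir y)) by ring, abs_mul,
          abs_of_nonneg (inv_nonneg.2 (norm_nonneg y))]
        refine mul_le_mul hyi ?_ (abs_nonneg _) (by positivity)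
        rw [harm_sphD_val, Finset.mul_sum, Finset.sum_div]
        refine (Finset.abs_sum_le_sum_abs _ _).trans (Finset.sum_le_sum fun i _ => ?_)
        rw [mul_left_comm, abs_mul]
        exact (mul_le_of_le_one_left (abs_nonneg _) (abs_coord_le _ _)).trans (hC i j l _)
      refine (Finset.sum_le_sum hj).trans (le_of_eq ?_)
      rw [← Finset.mul_sum, ← Finset.sum_div, mul_div_assoc])
    (Metric.mem_ball_self (by positivity)) (summable_mul_harm w f _)
    (Metric.mem_ball_self (by positivity))
  refine hder.congr_fderiv ?_
  have hs : ∀ j, HasSum (fun l => (w.1 l * (‖x‖⁻¹ * (sphD j (harm l f)).1 (dir x))))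
      (‖x‖⁻¹ * ∑ i, (nn i).1 (dir x) * opFun w (rotL i j f) (dir x)) := by
    intro j
    have h1 : HasSum (fun l => ∑ i, (nn i).1 (dir x) *
        (w.1 l * (harm l (rotL i j f)).1 (dir x)))
        (∑ i, (nn i).1 (dir x) * opFun w (rotL i j f) (dir x)) :=
      hasSum_sum fun i _ => (summable_mul_harm w (rotL i j f) (dir x)).hasSum.mul_left _
    refine (h1.mul_left ‖x‖⁻¹).congr_fun fun l => ?_
    rw [harm_sphD_val, mul_left_comm, Finset.mul_sum]
    congr 1
    exact Finset.sum_congr rfl fun i _ => by ring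
  refine HasSum.tsum_eq ?_
  have h2 : HasSum (fun l => ∑ j, (w.1 l * (‖x‖⁻¹ * (sphD j (harm l f)).1 (dir x))) •
      prj j)
      (∑ j, (‖x‖⁻¹ * ∑ i, (nn i).1 (dir x) * opFun w (rotL i j f) (dir x)) •
        prj j) :=
    hasSum_sum fun j _ => (hs j).smul_const _
  refine h2.congr_fun fun l => ?_
  rw [Finset.smul_sum]
  simp only [smul_smul]

/-- Bootstrap: the derivative involves series of the same kind for `rotL i j f`, hence the induction
for all `f` at once. -/
theorem contDiffOn_opFun (w : Multiplier) (m : ℕ) (f : SM) :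
    ContDiffOn ℝ m (fun x => opFun w f (dir x)) {0}ᶜ := by
  induction m generalizing f with
  | zero =>
    refine contDiffOn_zero.2 fun x hx => ?_
    exact (hasFDerivAt_opFun w f hx).continuousAt.continuousWithinAt
  | succ m ih =>
    push_cast
    rw [contDiffOn_succ_iff_fderiv_of_isOpen isOpen_punctured]
    refine ⟨fun x hx => (hasFDerivAt_opFun w f hx).differentiableAt.differentiableWithinAt,
      by simp, ?_⟩
    have h : ContDiffOn ℝ m (fun x : E => ∑ j, (‖x‖ ^ (-1 : ℤ) * ∑ i, (nn i).1 (dir x) *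
        opFun w (rotL i j f) (dir x)) •
          prj j) {0}ᶜ := by
      have hm : (m : WithTop ℕ∞) ≤ ∞ := WithTop.coe_le_coe.2 le_top
      refine ContDiffOn.sum fun j _ => ContDiffOn.smul (ContDiffOn.mul
        ((contDiffOn_norm_zpow (-1)).of_le hm) (ContDiffOn.sum fun i _ => ContDiffOn.mul
          ((nn i).2.of_le hm) (ih _))) contDiffOn_const
    refine h.congr fun x hx => ?_
    rw [(hasFDerivAt_opFun w f hx).fderiv]
    simp only [zpow_neg_one]

/-- The rotation invariant operator with the given multipliers. -/
def op (w : Multiplier) : SM →ₗ[ℝ] SM where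
  toFun f := ⟨opFun w f, contDiffOn_infty.2 fun m => contDiffOn_opFun w m f⟩
  map_add' f g := SM.ext' fun n => by
    have := (summable_mul_harm w f n).tsum_add (summable_mul_harm w g n)
    refine Eq.trans (tsum_congr fun l => ?_) this
    rw [map_add]
    exact mul_add _ _ _
  map_smul' c f := SM.ext' fun n => by
    refine Eq.trans (tsum_congr fun l => ?_) (tsum_mul_left (a := c))
    rw [map_smul]
    exact mul_left_comm _ _ _

theorem hasSum_op_val (w : Multiplier) (f : SM) (n : S2) :
    HasSum (fun l => w.1 l * (harm l f).1 n) ((op w f).1 n) :=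
  (summable_mul_harm w f n).hasSum

theorem hasSum_sInt_op (w : Multiplier) (f g : SM) :
    HasSum (fun l => w.1 l * sInt (harm l f * g)) (sInt (op w f * g)) := by
  obtain ⟨C, hC⟩ := exists_mul_harm_le w f
  obtain ⟨D, hD⟩ := g.exists_bound
  have hint : ∀ l, Integrable (fun n => w.1 l * (harm l f).1 n * g.1 n) sigma := fun l =>
    integrable_sphere ((continuous_const.mul (harm l f).continuous).mul g.continuous)
  have h := hasSum_integral_of_summable_integral_norm (μ := sigma) hint (by
    refine Summable.of_nonneg_of_le (fun l => integral_nonneg fun n => norm_nonneg _) (fun l => ?_)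
      (summable_sq_shift (4 * Real.pi * (C * D)))
    have h1 := integral_mono (hint l).norm (integrable_const (C * D / ((l : ℝ) + 1) ^ 2))
      (fun n => by
        rw [norm_mul, Real.norm_eq_abs, Real.norm_eq_abs, mul_div_right_comm]
        exact mul_le_mul (hC l n) (hD n) (abs_nonneg _) ((abs_nonneg _).trans (hC l n)))
    refine h1.trans (le_of_eq ?_)
    rw [integral_const, sigma_univ, smul_eq_mul, ← mul_div_assoc])
  have e1 : ∀ l, ∫ n, w.1 l * (harm l f).1 n * g.1 n ∂sigma = w.1 l * sInt (harm l f * g) := by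
    intro l
    rw [sInt_apply, ← integral_const_mul]
    refine integral_congr_ae (Eventually.of_forall fun n => ?_)
    exact mul_assoc _ _ _
  have e2 : ∫ n, ∑' l, w.1 l * (harm l f).1 n * g.1 n ∂sigma = sInt (op w f * g) := by
    rw [sInt_apply]
    refine integral_congr_ae (Eventually.of_forall fun n => ?_)
    exact tsum_mul_right
  simpa only [e1, e2] using h

theorem op_of_mem (w : Multiplier) {l : ℕ} {f : SM} (hf : f ∈ Eig l) : op w f = w.1 l • f := by
  refine SM.ext' fun n => ?_
  refine (hasSum_op_val w f n).unique ?_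
  have h := hasSum_single (f := fun m => w.1 m * (harm m f).1 n) l (fun m hm => by
    rw [harm_of_mem_ne hm hf]
    exact mul_zero _)
  rwa [harm_of_mem hf] at h

theorem sInt_op_symm (w : Multiplier) (f g : SM) : sInt (op w f * g) = sInt (f * op w g) := by
  refine (hasSum_sInt_op w f g).unique ?_
  rw [mul_comm f]
  refine (hasSum_sInt_op w g f).congr_fun fun l => ?_
  rw [sInt_harm_symm, mul_comm (harm l g)]

theorem op_comp (w : Multiplier) (R : E ≃ₗᵢ[ℝ] E) (f : SM) :
    op w (comp R f) = comp R (op w f) := by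
  refine SM.ext' fun n => tsum_congr fun l => ?_
  rw [harm_comp]
  rfl

theorem op_one (w : Multiplier) (hw : ∀ l, w.1 l = 1) (f : SM) : op w f = f := by
  rw [← sub_eq_zero]
  refine eq_zero_of_forall_Eig fun l h hh => ?_
  rw [sub_mul, map_sub, sInt_op_symm, op_of_mem w hh, hw, one_smul, sub_self]

theorem hasSum_sInt_harm (f g : SM) : HasSum (fun l => sInt (harm l f * g)) (sInt (f * g)) := by
  have hw : (fun _ => 1 : ℕ → ℝ) ∈ Multiplier := ⟨1, fun l => by
    simp⟩
  have h := hasSum_sInt_op ⟨_, hw⟩ f g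
  rw [op_one ⟨_, hw⟩ (fun _ => rfl)] at h
  simpa using h

/-- The harmonic numbers `1 + 1/2 + ⋯ + 1/l`. -/
def hnum (l : ℕ) : ℝ := ∑ j ∈ Finset.range l, 1 / ((j : ℝ) + 1)

theorem hnum_succ (l : ℕ) : hnum (l + 1) = hnum l + 1 / ((l : ℝ) + 1) :=
  Finset.sum_range_succ _ _

theorem hnum_mem : hnum ∈ Multiplier := by
  refine ⟨1, fun l => ?_⟩
  rw [abs_of_nonneg (Finset.sum_nonneg fun j _ => by positivity), one_mul]
  have : hnum l ≤ ∑ j ∈ Finset.range l, (1 : ℝ) := Finset.sum_le_sum fun j _ => by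
    rw [div_le_one (by positivity)]
    have : (0 : ℝ) ≤ j := by positivity
    linarith
  simp at this
  linarith

/-- The operator with the harmonic numbers as multipliers. -/
def hop : SM →ₗ[ℝ] SM := op ⟨hnum, hnum_mem⟩

/-- Multiplication by `n_i` connects only neighbouring degrees. Between degrees `l` and `l + 1` the
matrix element of `sphT i` is, up to sign, `l + 1` times that of `n_i`, and the harmonic numbers
differ by exactly `1 / (l + 1)`. All other matrix elements give 0 on both sides. -/
theorem sInt_sphT_hop_of_mem {l m : ℕ} (i : Fin 3) {f g : SM} (hf : f ∈ Eig l) (hg : g ∈ Eig m) :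
    (hnum m - hnum l) * sInt (f * sphT i g) = sInt (nn i * f * g) := by
  -- On degree `l`, `sphT i` is the lowering operator minus `(l + 1) n_i`; against degree `l + 1`
  -- only the second part is seen.
  have adj : ∀ {l : ℕ} {f g : SM}, f ∈ Eig ((l + 1 : ℕ) : ℝ) → g ∈ Eig (l : ℝ) →
      -sInt (f * sphT i g) = ((l : ℝ) + 1) * sInt (nn i * f * g) := by
    intro l f g hf hg
    have h1 : sInt (f * low l i g) = 0 := by
      refine sInt_Eig_orth ?_ hf (low_mem_nat hg i)
      exact natDegree_ne (by omega)
    have h2 : sphT i g = low l i g - ((l : ℝ) + 1) • (nn i * g) := by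
      rw [sphT_apply, low_apply]
      module
    rw [h2, mul_sub, mul_smul_comm, map_sub, map_smul, h1,
      show f * (nn i * g) = nn i * f * g by ring, smul_eq_mul]
    ring
  have hraise : ∀ {m : ℕ} {g : SM}, g ∈ Eig (m : ℝ) → nn i * g - (2 * (m : ℝ) + 1)⁻¹ • low m i g ∈
      Eig ((m + 1 : ℕ) : ℝ) := by
    intro m g hg
    push_cast
    exact raise_mem hg (by positivity) i
  by_cases h1 : l = m + 1
  · subst h1
    have := adj hf hg
    rw [hnum_succ]
    have hm : (m : ℝ) + 1 ≠ 0 := by positivity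
    field_simp
    linarith
  by_cases h2 : m = l + 1
  · subst h2
    have := adj hg hf
    rw [hnum_succ, mul_comm f, sInt_sphT_mul, this, show nn i * f * g = nn i * g * f by ring]
    have hm : (l : ℝ) + 1 ≠ 0 := by positivity
    field_simp
    ring
  have hlow : sInt (f * low m i g) = 0 ∨ (l = 0 ∧ m = 0) := by
    by_cases h0 : l = m - 1
    · right
      omega
    · left
      exact sInt_Eig_orth (natDegree_ne h0) hf (low_mem_nat hg i)
  have hlow' : sInt (f * low m i g) = 0 := by
    rcases hlow with h | ⟨rfl, rfl⟩
    · exact h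
    · rw [low_apply, sphD_eq_zero_of_mem (by simpa using hg)]
      simp
  have h3 : sInt (nn i * f * g) = 0 := by
    have h4 := sInt_Eig_orth (natDegree_ne h1) hf (hraise hg)
    rw [mul_sub, mul_smul_comm, map_sub, map_smul, hlow', smul_zero, sub_zero] at h4
    rw [show nn i * f * g = f * (nn i * g) by ring, h4]
  have h5 : sphT i g = low m i g - ((m : ℝ) + 1) • (nn i * g) := by
    rw [sphT_apply, low_apply]
    module
  rw [h3, h5, mul_sub, mul_smul_comm, map_sub, map_smul, hlow',
    show f * (nn i * g) = nn i * f * g by ring, h3]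
  simp

/-- The commutator is known on pairs of harmonics. As `sphT i` is antisymmetric and `hop` symmetric,
the commutator is symmetric, so completeness can be used in each argument in turn without any
continuity of the operators. -/
theorem sphT_hop (i : Fin 3) (f : SM) : sphT i (hop f) - hop (sphT i f) = nn i * f := by
  have key : ∀ {m : ℕ} {g : SM}, g ∈ Eig (m : ℝ) → ∀ {l : ℕ} {f : SM}, f ∈ Eig (l : ℝ) →
      sInt ((sphT i (hop f) - hop (sphT i f)) * g) = sInt (nn i * f * g) := by
    intro m g hg l f hf
    rw [sub_mul, map_sub, sInt_sphT_mul, hop, op_of_mem _ hf, sInt_op_symm, op_of_mem _ hg,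
      mul_smul_comm, smul_mul_assoc, map_smul, map_smul, sInt_sphT_mul,
      ← sInt_sphT_hop_of_mem i hf hg]
    simp only [smul_eq_mul]
    ring
  have symm : ∀ f g : SM, sInt ((sphT i (hop f) - hop (sphT i f)) * g) =
      sInt (f * (sphT i (hop g) - hop (sphT i g))) := by
    intro f g
    rw [sub_mul, mul_sub, map_sub, map_sub, sInt_sphT_mul, hop, sInt_op_symm, sInt_op_symm,
      sInt_sphT_mul]
    ring
  have h1 : ∀ {m : ℕ} {g : SM}, g ∈ Eig (m : ℝ) → sphT i (hop g) - hop (sphT i g) = nn i * g := by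
    intro m g hg
    rw [← sub_eq_zero]
    refine eq_zero_of_forall_Eig fun l h hh => ?_
    rw [sub_mul, map_sub, key hh hg, sub_self]
  rw [← sub_eq_zero]
  refine eq_zero_of_forall_Eig fun l h hh => ?_
  rw [sub_mul, map_sub, symm, h1 hh, show f * (nn i * h) = nn i * f * h by ring, sub_self]

end

end Hadamard


/-! ### Laurent expansions at a singular point -/

namespace Hadamard

noncomputable section

/-! ### Expansions with bounded coefficients -/

theorem tendsto_norm_sub_punctured (y : E) :
    Tendsto (fun x => ‖x - y‖) (𝓝[≠] y) (𝓝[>] 0) := by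
  refine tendsto_nhdsWithin_iff.2 ⟨?_, ?_⟩
  · have : Continuous fun x : E => ‖x - y‖ := by fun_prop
    have h := this.tendsto y
    simp only [sub_self, norm_zero] at h
    exact h.mono_left nhdsWithin_le_nhds
  · filter_upwards [self_mem_nhdsWithin] with x hx
    exact norm_pos_iff.2 (sub_ne_zero.2 hx)

theorem exists_punctured_ball {y : E} {P : E → Prop} (h : ∀ᶠ x in 𝓝[≠] y, P x) :
    ∃ δ > 0, ∀ x, x ≠ 0 → ‖x‖ < δ → P (y + x) := by
  rw [eventually_nhdsWithin_iff, Metric.eventually_nhds_iff] at h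
  obtain ⟨δ, hδ, h⟩ := h
  refine ⟨δ, hδ, fun x hx hxδ => h ?_ ?_⟩
  · simpa using hxδ
  · simpa using hx

theorem zpow_isBigO (y : E) {a b : ℤ} (h : a ≤ b) :
    (fun x : E => ‖x - y‖ ^ b) =O[𝓝[≠] y] fun x => ‖x - y‖ ^ a := by
  refine IsBigO.of_bound 1 ?_
  have h1 : ∀ᶠ x in 𝓝[≠] y, ‖x - y‖ < 1 :=
    (tendsto_nhdsWithin_iff.1 (tendsto_norm_sub_punctured y)).1.eventually (gt_mem_nhds zero_lt_one)
  filter_upwards [h1, self_mem_nhdsWithin] with x hx hxy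
  have hpos : 0 < ‖x - y‖ := norm_pos_iff.2 (sub_ne_zero.2 hxy)
  rw [norm_zpow, norm_zpow, norm_norm, one_mul]
  exact zpow_le_zpow_right_of_le_one₀ hpos hx.le h

theorem zpow_isLittleO (y : E) {a b : ℤ} (h : a < b) :
    (fun x : E => ‖x - y‖ ^ b) =o[𝓝[≠] y] fun x => ‖x - y‖ ^ a := by
  have h1 : (fun x : E => ‖x - y‖) =o[𝓝[≠] y] fun _ => (1 : ℝ) :=
    (isLittleO_one_iff ℝ).2 (tendsto_nhdsWithin_iff.1 (tendsto_norm_sub_punctured y)).1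
  have h2 := h1.mul_isBigO (zpow_isBigO y (show a ≤ b - 1 by omega))
  refine h2.congr' ?_ (by simp)
  filter_upwards [self_mem_nhdsWithin] with x hxy
  have hpos : ‖x - y‖ ≠ 0 := (norm_pos_iff.2 (sub_ne_zero.2 hxy)).ne'
  rw [← zpow_one_add₀ hpos]
  congr 1
  ring

/-- Boundedness of a function on the sphere. -/
def Bdd (f : S2 → ℝ) : Prop := ∃ C, ∀ n, |f n| ≤ C

theorem hom_isBigO (y : E) {f : S2 → ℝ} (hf : Bdd f) {a k : ℤ} (h : a ≤ k) :
    (fun x => hom k f (x - y)) =O[𝓝[≠] y] fun x => ‖x - y‖ ^ a := by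
  obtain ⟨C, hC⟩ := hf
  refine IsBigO.trans (IsBigO.of_bound C (Eventually.of_forall fun x => ?_)) (zpow_isBigO y h)
  rw [hom, norm_mul, mul_comm]
  exact mul_le_mul_of_nonneg_right (hC _) (norm_nonneg _)

/-- An expansion with bounded coefficients, from the order `m` on. -/
structure Tame (y : E) (F : E → ℝ) (f : ℤ → S2 → ℝ) (m : ℤ) : Prop where
  low : ∀ k < m, f k = 0
  bdd : ∀ k, Bdd (f k)
  exp : ∀ K : ℤ, (fun x => F x - ∑ k ∈ Finset.Ico m K, hom k (f k) (x - y)) =O[𝓝[≠] y]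
    fun x => ‖x - y‖ ^ K

theorem Tame.hasExpansion {y : E} {F : E → ℝ} {f : ℤ → S2 → ℝ} {m : ℤ} (h : Tame y F f m) :
    HasExpansion y F f := by
  refine ⟨m, h.low, fun N => ?_⟩
  have h1 := (h.exp (N + 1)).trans_isLittleO (zpow_isLittleO y (show (N : ℤ) < N + 1 by omega))
  simp only [zpow_natCast] at h1
  refine h1.congr_left fun x => ?_
  rfl

theorem Tame.of_le {y : E} {F : E → ℝ} {f : ℤ → S2 → ℝ} {m m' : ℤ} (h : Tame y F f m)
    (hm : m' ≤ m) : Tame y F f m' := by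
  refine ⟨fun k hk => h.low k (by omega), h.bdd, fun K => ?_⟩
  refine (h.exp K).congr_left fun x => ?_
  congr 1
  refine Finset.sum_subset (Finset.Ico_subset_Ico_left hm) fun k hk hk' => ?_
  have : k < m := by
    simp only [Finset.mem_Ico] at hk hk'
    omega
  simp [h.low k this, hom]

/-- Orders between `K` and `N` may be dropped because bounded coefficients make each of them `O(r ^
K)`; this turns estimates for natural `N` into estimates for every integer order. -/
theorem tame_of_exp {y : E} {F : E → ℝ} {f : ℤ → S2 → ℝ} {m : ℤ} (h0 : ∀ k < m, f k = 0)
    (hb : ∀ k, Bdd (f k))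
    (h : ∀ N : ℕ,
      (fun x => F x - ∑ k ∈ Finset.Icc m (N : ℤ), ‖x - y‖ ^ k * f k (dir (x - y)))
        =o[𝓝[≠] y] fun x => ‖x - y‖ ^ N) : Tame y F f m := by
  refine ⟨h0, hb, fun K => ?_⟩
  set N : ℕ := (max K m).toNat with hN
  have hNK : K ≤ N := (le_max_left K m).trans (Int.self_le_toNat _)
  have h1 : (fun x => F x - ∑ k ∈ Finset.Icc m (N : ℤ), hom k (f k) (x - y)) =O[𝓝[≠] y]
      fun x => ‖x - y‖ ^ K := by
    have := (h N).isBigO.trans ((zpow_isBigO y hNK).congr_left fun x => zpow_natCast _ _)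
    exact this
  have h2 : (fun x => ∑ k ∈ (Finset.Icc m (N : ℤ)).filter (K ≤ ·), hom k (f k) (x - y))
      =O[𝓝[≠] y] fun x => ‖x - y‖ ^ K :=
    IsBigO.fun_sum fun k hk => hom_isBigO y (hb k) (Finset.mem_filter.1 hk).2
  refine (h1.add h2).congr_left fun x => ?_
  have h3 : ∑ k ∈ Finset.Icc m (N : ℤ), hom k (f k) (x - y) =
      ∑ k ∈ Finset.Ico m K, hom k (f k) (x - y) +
        ∑ k ∈ (Finset.Icc m (N : ℤ)).filter (K ≤ ·), hom k (f k) (x - y) := by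
    rw [← Finset.sum_filter_not_add_sum_filter _ (K ≤ ·)]
    congr 1
    refine Finset.sum_congr ?_ fun _ _ => rfl
    ext k
    simp only [Finset.mem_filter, Finset.mem_Icc, Finset.mem_Ico]
    omega
  rw [h3]
  ring

theorem sum_Icc_int {M : Type*} [AddCommMonoid M] (m N : ℤ) (g : ℤ → M) :
    ∑ k ∈ Finset.Icc m N, g k = ∑ j ∈ Finset.range (N + 1 - m).toNat, g (m + j) := by
  refine Finset.sum_bij' (fun k _ => (k - m).toNat) (fun j _ => m + j) ?_ ?_ ?_ ?_ ?_
  · intro k hk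
    simp only [Finset.mem_Icc, Finset.mem_range] at *
    omega
  · intro j hj
    simp only [Finset.mem_Icc, Finset.mem_range] at *
    omega
  · intro k hk
    simp only [Finset.mem_Icc] at hk
    rw [Int.toNat_of_nonneg (by omega)]
    ring
  · intro j _
    simp
  · intro k hk
    simp only [Finset.mem_Icc] at hk
    rw [Int.toNat_of_nonneg (by omega)]
    congr 1
    ring

/-- Comparing the polynomial at `r` and at `2 r` eliminates its top coefficient, and the others are
multiplied by the nonzero numbers `2 ^ j - 2 ^ J`. -/
theorem bdd_coeffs (J : ℕ) : ∀ (a : ℕ → S2 → ℝ) (δ : ℝ), 0 < δ →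
    (∀ r, 0 < r → r < δ → Bdd fun n => ∑ j ∈ Finset.range J, r ^ j * a j n) →
    ∀ j < J, Bdd (a j) := by
  induction J with
  | zero => intro a δ _ _ j hj; omega
  | succ J ih =>
    intro a δ hδ h
    have h1 : ∀ j < J, Bdd (a j) := by
      have := ih (fun j n => (2 ^ j - 2 ^ J) * a j n) (δ / 2) (by positivity) (by
        intro r hr hrδ
        obtain ⟨C, hC⟩ := h r hr (by linarith)
        obtain ⟨D, hD⟩ := h (2 * r) (by linarith) (by linarith)
        refine ⟨D + 2 ^ J * C, fun n => ?_⟩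
        have e : ∑ j ∈ Finset.range J, r ^ j * ((2 ^ j - 2 ^ J) * a j n) =
            ∑ j ∈ Finset.range (J + 1), (2 * r) ^ j * a j n -
              2 ^ J * ∑ j ∈ Finset.range (J + 1), r ^ j * a j n := by
          rw [Finset.sum_range_succ, Finset.sum_range_succ, mul_add, Finset.mul_sum]
          have : ∀ j, r ^ j * ((2 ^ j - 2 ^ J) * a j n) =
            (2 * r) ^ j * a j n - 2 ^ J * (r ^ j * a j n) := by
            intro j
            rw [mul_pow]
            ring
          simp only [this, Finset.sum_sub_distrib]
          rw [mul_pow]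
          ring
        beta_reduce
        rw [e]
        refine (abs_sub _ _).trans (add_le_add (hD n) ?_)
        rw [abs_mul, abs_of_nonneg (by positivity)]
        exact mul_le_mul_of_nonneg_left (hC n) (by positivity))
      intro j hj
      obtain ⟨C, hC⟩ := this j hj
      have hne : (2 : ℝ) ^ j - 2 ^ J ≠ 0 := by
        have : (2 : ℝ) ^ j < 2 ^ J := pow_lt_pow_right₀ one_lt_two hj
        linarith
      refine ⟨C / |2 ^ j - 2 ^ J|, fun n => ?_⟩
      rw [le_div_iff₀ (abs_pos.2 hne), mul_comm, ← abs_mul]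
      exact hC n
    intro j hj
    rcases Nat.lt_succ_iff_lt_or_eq.1 hj with hj | rfl
    · exact h1 j hj
    · obtain ⟨C, hC⟩ := h (δ / 2) (by positivity) (by linarith)
      choose! B hB using h1
      refine ⟨(C + ∑ i ∈ Finset.range j, (δ / 2) ^ i * B i) / (δ / 2) ^ j, fun n => ?_⟩
      have hp : 0 < (δ / 2) ^ j := by positivity
      rw [le_div_iff₀ hp, mul_comm, ← abs_of_pos hp, ← abs_mul]
      have := hC n
      beta_reduce at this
      rw [Finset.sum_range_succ] at this
      have e : (δ / 2) ^ j * a j n = (∑ i ∈ Finset.range j, (δ / 2) ^ i * a i n +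
        (δ / 2) ^ j * a j n) - ∑ i ∈ Finset.range j, (δ / 2) ^ i * a i n := by ring
      rw [e]
      refine (abs_sub _ _).trans (add_le_add this ?_)
      refine (Finset.abs_sum_le_sum_abs _ _).trans (Finset.sum_le_sum fun i hi => ?_)
      rw [abs_mul, abs_of_nonneg (by positivity)]
      exact mul_le_mul_of_nonneg_left (hB i (Finset.mem_range.1 hi) n) (by positivity)

/-- The definition of an expansion does not ask for bounded coefficients. They are bounded because
the partial sums, at a fixed small radius, differ little from a function that is bounded on that
sphere. -/
theorem HasExpansion.exists_tame {y : E} {F : E → ℝ} {f : ℤ → S2 → ℝ} (h : HasExpansion y F f)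
    (hF : ∃ δ : ℝ, 0 < δ ∧ ∀ r : ℝ, 0 < r → r < δ → Bdd fun n : S2 => F (y + r • (n : E))) :
    ∃ m, Tame y F f m := by
  obtain ⟨m, h0, h⟩ := h
  refine ⟨m, tame_of_exp h0 (fun k => ?_) h⟩
  by_cases hk : k < m
  · exact ⟨0, fun n => by simp [h0 k hk]⟩
  push Not at hk
  set N : ℕ := k.toNat with hN
  have hNk : k ≤ N := Int.self_le_toNat _
  have h1 := (h N).bound one_pos
  obtain ⟨δ, hδ, h1⟩ := exists_punctured_ball h1
  obtain ⟨δ', hδ', hF⟩ := hF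
  set J := ((N : ℤ) + 1 - m).toNat with hJ
  have key := bdd_coeffs J (fun j => f (m + j)) (min δ δ') (lt_min hδ hδ') (by
    intro r hr hrδ
    obtain ⟨C, hC⟩ := hF r hr (hrδ.trans_le (min_le_right _ _))
    refine ⟨(r ^ m)⁻¹ * (r ^ N + C), fun n => ?_⟩
    have hnorm : ‖r • (n : E)‖ = r := by
      rw [norm_smul, norm_sphere, Real.norm_of_nonneg hr.le, mul_one]
    have h2 := h1 (r • (n : E)) (smul_ne_zero hr.ne' (sphere_ne_zero n))
      (by rw [hnorm]; exact hrδ.trans_le (min_le_left _ _))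
    rw [add_sub_cancel_left, hnorm, dir_smul_sphere hr, one_mul, sum_Icc_int, ← hJ] at h2
    have hrm : 0 < r ^ m := zpow_pos hr m
    have e : ∑ j ∈ Finset.range J, r ^ j * f (m + j) n =
        (r ^ m)⁻¹ * ∑ j ∈ Finset.range J, r ^ (m + j) * f (m + j) n := by
      rw [Finset.mul_sum]
      refine Finset.sum_congr rfl fun j _ => ?_
      rw [zpow_add₀ hr.ne', zpow_natCast]
      field_simp
    beta_reduce
    rw [e, abs_mul, abs_of_pos (inv_pos.2 hrm)]
    refine mul_le_mul_of_nonneg_left ?_ (inv_pos.2 hrm).le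
    rw [Real.norm_eq_abs, norm_pow, Real.norm_of_nonneg hr.le] at h2
    set s := ∑ j ∈ Finset.range J, r ^ (m + (j : ℤ)) * f (m + j) n with hs
    have e2 : s = F (y + r • (n : E)) - (F (y + r • (n : E)) - s) := by ring
    rw [e2]
    refine (abs_sub _ _).trans ?_
    rw [add_comm]
    exact add_le_add h2 (hC n))
  have := key (k - m).toNat (by omega)
  beta_reduce at this
  rwa [show m + ((k - m).toNat : ℤ) = k by omega] at this

theorem hom_smul (k : ℤ) (f : S2 → ℝ) {c : ℝ} (hc : 0 < c) (x : E) :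
    hom k f (c • x) = c ^ k * hom k f x := by
  rw [hom, hom, dir_smul hc, norm_smul, Real.norm_of_nonneg hc.le, mul_zpow, mul_assoc]

/-- On a fixed ray, divide the difference of the two expansions by `r ^ k`, where `k` is the first
order not yet compared, and let `r` tend to 0. -/
theorem Tame.unique {y : E} {F : E → ℝ} {f g : ℤ → S2 → ℝ} (hf : HasExpansion y F f)
    (hg : HasExpansion y F g) : f = g := by
  obtain ⟨m₁, h0, h⟩ := hf
  obtain ⟨m₂, h0', h'⟩ := hg
  set m := min m₁ m₂
  have e1 := HasExpansion.of_le (min_le_left m₁ m₂) h0 h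
  have e2 := HasExpansion.of_le (min_le_right m₁ m₂) h0' h'
  have main : ∀ j : ℕ, ∀ k < m + j, f k = g k := by
    intro j
    induction j with
    | zero =>
      intro k hk
      rw [h0 k (by omega), h0' k (by omega)]
    | succ j ih =>
      intro k hk
      by_cases hk' : k < m + j
      · exact ih k hk'
      have hkj : k = m + j := by push_cast at hk; omega
      funext n
      set N : ℕ := k.toNat with hN
      have hNk : k ≤ N := Int.self_le_toNat _
      set d : ℤ → ℝ := fun i => f i n - g i n with hd
      have hlim : Tendsto (fun r : ℝ => ∑ i ∈ Finset.Icc k (N : ℤ), r ^ (i - k) * d i) (𝓝[>] 0)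
          (𝓝 (∑ i ∈ Finset.Icc k (N : ℤ), if i = k then d i else 0)) := by
        refine tendsto_finsetSum _ fun i hi => ?_
        split_ifs with hik
        · subst hik
          simp
        · have hpos : 0 < i - k := by
            rw [Finset.mem_Icc] at hi
            omega
          have h3 : Tendsto (fun r : ℝ => r ^ (i - k).toNat) (𝓝[>] 0) (𝓝 0) := by
            have : Continuous fun r : ℝ => r ^ (i - k).toNat := by fun_prop
            have h4 := this.tendsto 0
            rw [zero_pow (by omega)] at h4
            exact h4.mono_left nhdsWithin_le_nhds
          have h5 := h3.mul_const (d i)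
          rw [zero_mul] at h5
          refine h5.congr fun r => ?_
          rw [← zpow_natCast, Int.toNat_of_nonneg hpos.le]
      rw [Finset.sum_ite_eq' (Finset.Icc k (N : ℤ)) k, if_pos (by simp [hNk])] at hlim
      have hsmall : Tendsto (fun r : ℝ => ∑ i ∈ Finset.Icc k (N : ℤ), r ^ (i - k) * d i) (𝓝[>] 0)
          (𝓝 0) := by
        have hdiff : (fun x : E => ∑ i ∈ Finset.Icc m (N : ℤ), ‖x - y‖ ^ i *
            (f i (dir (x - y)) - g i (dir (x - y)))) =o[𝓝[≠] y] fun x => ‖x - y‖ ^ N := by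
          refine ((e2 N).sub (e1 N)).congr_left fun x => ?_
          simp only [mul_sub, Finset.sum_sub_distrib]
          ring
        have hray : Tendsto (fun r : ℝ => y + r • (n : E)) (𝓝[>] 0) (𝓝[≠] y) := by
          refine tendsto_nhdsWithin_iff.2 ⟨?_, ?_⟩
          · have : Continuous fun r : ℝ => y + r • (n : E) := by fun_prop
            have h4 := this.tendsto 0
            simp only [zero_smul, add_zero] at h4
            exact h4.mono_left nhdsWithin_le_nhds
          · filter_upwards [self_mem_nhdsWithin] with r hr
            have : r • (n : E) ≠ 0 := smul_ne_zero (ne_of_gt hr) (sphere_ne_zero n)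
            simpa using this
        have h6 := hdiff.comp_tendsto hray
        have h7 : (fun r : ℝ => ∑ i ∈ Finset.Icc k (N : ℤ), r ^ (i - k) * d i) =o[𝓝[>] 0]
            fun r : ℝ => (r ^ ((N : ℤ) - k) : ℝ) := by
          have h8 := (isBigO_refl (fun r : ℝ => r ^ (-k)) (𝓝[>] 0)).mul_isLittleO h6
          refine h8.congr' ?_ ?_
          · filter_upwards [self_mem_nhdsWithin] with r hr
            have hr' : (0 : ℝ) < r := hr
            have hnorm : ‖r • (n : E)‖ = r := by
              rw [norm_smul, norm_sphere, Real.norm_of_nonneg hr'.le, mul_one]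
            simp only [Function.comp, add_sub_cancel_left, hnorm, dir_smul_sphere hr',
              Finset.mul_sum]
            symm
            refine Eq.trans (Finset.sum_congr rfl fun i _ => ?_)
              (Finset.sum_subset (Finset.Icc_subset_Icc_left (show m ≤ k by omega)) ?_)
            · change _ = r ^ (-k) * (r ^ i * d i)
              rw [← mul_assoc, ← zpow_add₀ hr'.ne']
              congr 2
              ring
            · intro i hi hi'
              have hik : i < m + j := by
                simp only [Finset.mem_Icc] at hi hi'
                omega
              change r ^ (-k) * (r ^ i * (f i n - g i n)) = 0
              rw [ih i hik]
              simp
          · filter_upwards [self_mem_nhdsWithin] with r hr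
            have hr' : (0 : ℝ) < r := hr
            have hnorm : ‖r • (n : E)‖ = r := by
              rw [norm_smul, norm_sphere, Real.norm_of_nonneg hr'.le, mul_one]
            simp only [Function.comp, add_sub_cancel_left, hnorm]
            rw [← zpow_natCast, ← zpow_add₀ hr'.ne']
            congr 1
            ring
        refine (isLittleO_one_iff ℝ).1 (h7.trans_isBigO ?_)
        refine IsBigO.of_bound 1 ?_
        filter_upwards [self_mem_nhdsWithin, nhdsWithin_le_nhds (gt_mem_nhds (zero_lt_one' ℝ))]
          with r hr hr1
        have hr' : (0 : ℝ) < r := hr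
        rw [norm_zpow, Real.norm_of_nonneg hr'.le, norm_one, one_mul]
        exact zpow_le_one₀ hr' hr1.le (by omega)
      have := tendsto_nhds_unique hlim hsmall
      rw [hd] at this
      simp only at this
      linarith
  funext k
  exact main (k - m + 1).toNat k (by omega)

theorem coef_eq {y : E} {F : E → ℝ} {f : ℤ → S2 → ℝ} (h : HasExpansion y F f) (k : ℤ) :
    coef y F k = f k := by
  have hex : ∃ f, HasExpansion y F f := ⟨f, h⟩
  unfold coef
  rw [dif_pos hex, Tame.unique hex.choose_spec h]

theorem hasExpansion_coef {y : E} {F : E → ℝ} (h : ∃ f, HasExpansion y F f) :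
    HasExpansion y F (coef y F) := by
  obtain ⟨f, hf⟩ := h
  have : coef y F = f := funext fun k => coef_eq hf k
  rwa [this]

theorem HasExpansion.congr' {y : E} {F G : E → ℝ} {f : ℤ → S2 → ℝ} (h : HasExpansion y F f)
    (hFG : F =ᶠ[𝓝[≠] y] G) : HasExpansion y G f := by
  obtain ⟨m, h0, h⟩ := h
  refine ⟨m, h0, fun N => (h N).congr' ?_ EventuallyEq.rfl⟩
  filter_upwards [hFG] with x hx
  rw [hx]

end

end Hadamard


namespace Hadamard

noncomputable section

/-! ### Differentiation of expansions -/

theorem Tame.error {y : E} {F : E → ℝ} {f : ℤ → S2 → ℝ} {m : ℤ} (h : Tame y F f m) (K : ℤ) :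
    ∃ C δ : ℝ, 0 < δ ∧ ∀ z : E, z ≠ 0 → ‖z‖ < δ →
      |F (y + z) - ∑ k ∈ Finset.Ico m K, hom k (f k) z| ≤ C * ‖z‖ ^ K := by
  obtain ⟨C, hC⟩ := (h.exp K).bound
  obtain ⟨δ, hδ, hC⟩ := exists_punctured_ball hC
  refine ⟨C, δ, hδ, fun z hz hzδ => ?_⟩
  have := hC z hz hzδ
  rw [add_sub_cancel_left, Real.norm_eq_abs, norm_zpow, norm_norm] at this
  exact this

/-- Blow-up at `y`: after removal of lower orders, the rescaled function converges to its term of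
order `k`. The convergence is joint in the radius and the point, hence locally uniform off the
origin. -/
theorem Tame.scaled {y : E} {F : E → ℝ} {f : ℤ → S2 → ℝ} {m : ℤ} (h : Tame y F f m) {k : ℤ}
    (hk : m ≤ k) {x₀ : E} (hx₀ : x₀ ≠ 0) :
    Tendsto (fun q : ℝ × E => q.1 ^ (-k) * (F (y + q.1 • q.2) -
      ∑ j ∈ Finset.Ico m k, q.1 ^ j * hom j (f j) q.2) - hom k (f k) q.2)
      (𝓝[>] 0 ×ˢ 𝓝 x₀) (𝓝 0) := by
  obtain ⟨C, δ, hδ, hC⟩ := h.error (k + 1)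
  have hlim : Tendsto (fun q : ℝ × E => q.1 * (C * ‖q.2‖ ^ (k + 1))) (𝓝[>] 0 ×ˢ 𝓝 x₀) (𝓝 0) := by
    have h1 : Tendsto (fun q : ℝ × E => q.1) (𝓝[>] 0 ×ˢ 𝓝 x₀) (𝓝 0) :=
      (tendsto_id.mono_left nhdsWithin_le_nhds).comp tendsto_fst
    have h2 : Tendsto (fun q : ℝ × E => C * ‖q.2‖ ^ (k + 1)) (𝓝[>] 0 ×ˢ 𝓝 x₀)
        (𝓝 (C * ‖x₀‖ ^ (k + 1))) :=
      ((tendsto_snd.norm).zpow₀ (k + 1) (Or.inl (norm_ne_zero_iff.2 hx₀))).const_mul C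
    simpa using h1.mul h2
  refine squeeze_zero_norm' ?_ hlim
  have hball : ∀ᶠ q : ℝ × E in 𝓝[>] 0 ×ˢ 𝓝 x₀, ‖q.1 • q.2‖ < δ := by
    have h1 : Tendsto (fun q : ℝ × E => q.1 • q.2) (𝓝[>] 0 ×ˢ 𝓝 x₀) (𝓝 ((0 : ℝ) • x₀)) :=
      ((tendsto_id.mono_left nhdsWithin_le_nhds).comp tendsto_fst).smul tendsto_snd
    rw [zero_smul] at h1
    have := h1.norm
    rw [norm_zero] at this
    exact this.eventually (gt_mem_nhds hδ)
  have hpos : ∀ᶠ q : ℝ × E in 𝓝[>] 0 ×ˢ 𝓝 x₀, 0 < q.1 :=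
    (eventually_nhdsWithin_of_forall fun r (hr : r ∈ Set.Ioi (0 : ℝ)) => hr).prod_inl _
  have hne : ∀ᶠ q : ℝ × E in 𝓝[>] (0 : ℝ) ×ˢ 𝓝 x₀, q.2 ≠ 0 :=
    Filter.Eventually.prod_inr (isOpen_ne.mem_nhds hx₀) _
  filter_upwards [hball, hpos, hne] with q h1 h2 h3
  have h4 := hC (q.1 • q.2) (smul_ne_zero h2.ne' h3) h1
  rw [← Finset.sum_Ico_add_eq_sum_Ico_add_one hk, hom_smul k _ h2, norm_smul,
    Real.norm_of_nonneg h2.le,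
    Finset.sum_congr rfl fun j _ => hom_smul j (f j) h2 q.2] at h4
  have e : q.1 ^ (-k) * (F (y + q.1 • q.2) -
      ∑ j ∈ Finset.Ico m k, q.1 ^ j * hom j (f j) q.2) - hom k (f k) q.2 =
      q.1 ^ (-k) * (F (y + q.1 • q.2) - (∑ j ∈ Finset.Ico m k, q.1 ^ j * hom j (f j) q.2 +
        q.1 ^ k * hom k (f k) q.2)) := by
    have : q.1 ^ (-k) * q.1 ^ k = 1 := by
      rw [← zpow_add₀ h2.ne']
      simp
    linear_combination (hom k (f k) q.2) * this
  rw [e, norm_mul, norm_zpow, Real.norm_of_nonneg h2.le]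
  refine (mul_le_mul_of_nonneg_left h4 (zpow_pos h2 _).le).trans_eq ?_
  rw [mul_zpow, zpow_add₀ h2.ne', zpow_neg, zpow_one]
  have := (zpow_pos h2 k).ne'
  field_simp

/-- Nothing is assumed about differentiability of coefficients. The blow-ups of `F` converge to its
term of order `k`, and their derivatives, which are blow-ups of the `G i`, converge locally
uniformly, so the limit is differentiable with the limit as its derivative. Induction on `k`
supplies the derivatives of the lower terms that were removed. -/
theorem hasFDerivAt_coeff {y : E} {F : E → ℝ} {G : Fin 3 → E → ℝ} {f : ℤ → S2 → ℝ}
    {g : Fin 3 → ℤ → S2 → ℝ} {m : ℤ} (hF : Tame y F f m) (hG : ∀ i, Tame y (G i) (g i) (m - 1))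
    (hFG : ∀ᶠ x in 𝓝[≠] y, HasFDerivAt F (∑ i, G i x • prj i) x) (k : ℤ) :
    ∀ x : E, x ≠ 0 → HasFDerivAt (hom k (f k)) (∑ i, hom (k - 1) (g i (k - 1)) x • prj i) x := by
  have main : ∀ N : ℕ, ∀ k < m + N, ∀ x : E, x ≠ 0 →
      HasFDerivAt (hom k (f k)) (∑ i, hom (k - 1) (g i (k - 1)) x • prj i) x := by
    intro N
    induction N with
    | zero =>
      intro k hk x _
      have e1 : hom k (f k) = fun _ => 0 := by
        funext z
        simp [hF.low k (by omega), hom]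
      have e2 : ∀ i, hom (k - 1) (g i (k - 1)) x = 0 := fun i => by
        simp [(hG i).low (k - 1) (by omega), hom]
      simp only [e1, e2, zero_smul, Finset.sum_const_zero]
      exact hasFDerivAt_const _ _
    | succ N ih =>
      intro k hk x₀ hx₀
      by_cases hk' : k < m + N
      · exact ih k hk' x₀ hx₀
      have hmk : m ≤ k := by push_cast at hk; omega
      set Φ : ℝ → E → ℝ := fun r x => r ^ (-k) * (F (y + r • x) -
        ∑ j ∈ Finset.Ico m k, r ^ j * hom j (f j) x) with hΦ
      set Φ' : ℝ → E → (E →L[ℝ] ℝ) := fun r x => ∑ i, (r ^ (-(k - 1)) * (G i (y + r • x) -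
        ∑ j ∈ Finset.Ico (m - 1) (k - 1), r ^ j * hom j (g i j) x)) • prj i with hΦ'
      refine hasFDerivAt_of_tendstoUniformlyOnFilter (l := 𝓝[>] (0 : ℝ)) (f := Φ) (f' := Φ')
        (g' := fun x => ∑ i, hom (k - 1) (g i (k - 1)) x • prj i) ?_ ?_ ?_
      · rw [Metric.tendstoUniformlyOnFilter_iff]
        intro ε hε
        have h1 : Tendsto (fun q : ℝ × E => ∑ i, (q.1 ^ (-(k - 1)) * (G i (y + q.1 • q.2) -
            ∑ j ∈ Finset.Ico (m - 1) (k - 1), q.1 ^ j * hom j (g i j) q.2) -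
              hom (k - 1) (g i (k - 1)) q.2) • prj i) (𝓝[>] 0 ×ˢ 𝓝 x₀)
            (𝓝 (∑ i : Fin 3, (0 : ℝ) • prj i)) :=
          tendsto_finsetSum _ fun i _ => ((hG i).scaled (by omega) hx₀).smul_const _
        simp only [zero_smul, Finset.sum_const_zero] at h1
        filter_upwards [Metric.tendsto_nhds.1 h1 ε hε] with q hq
        rw [dist_comm, dist_eq_norm]
        rw [dist_zero_right] at hq
        refine lt_of_eq_of_lt (congrArg norm ?_) hq
        rw [← Finset.sum_sub_distrib]
        exact Finset.sum_congr rfl fun i _ => (sub_smul _ _ _).symm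
      · obtain ⟨δ, hδ, hFG⟩ := exists_punctured_ball hFG
        have hball : ∀ᶠ q : ℝ × E in 𝓝[>] 0 ×ˢ 𝓝 x₀, ‖q.1 • q.2‖ < δ := by
          have h1 : Tendsto (fun q : ℝ × E => q.1 • q.2) (𝓝[>] 0 ×ˢ 𝓝 x₀) (𝓝 ((0 : ℝ) • x₀)) :=
            ((tendsto_id.mono_left nhdsWithin_le_nhds).comp tendsto_fst).smul tendsto_snd
          rw [zero_smul] at h1
          have := h1.norm
          rw [norm_zero] at this
          exact this.eventually (gt_mem_nhds hδ)
        have hpos : ∀ᶠ q : ℝ × E in 𝓝[>] 0 ×ˢ 𝓝 x₀, 0 < q.1 :=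
          (eventually_nhdsWithin_of_forall fun r (hr : r ∈ Set.Ioi (0 : ℝ)) => hr).prod_inl _
        have hne : ∀ᶠ q : ℝ × E in 𝓝[>] (0 : ℝ) ×ˢ 𝓝 x₀, q.2 ≠ 0 :=
          Filter.Eventually.prod_inr (isOpen_ne.mem_nhds hx₀) _
        filter_upwards [hball, hpos, hne] with q h1 h2 h3
        have h4 := hFG (q.1 • q.2) (smul_ne_zero h2.ne' h3) h1
        have h5 : HasFDerivAt (fun x : E => F (y + q.1 • x))
            ((∑ i, G i (y + q.1 • q.2) • prj i).comp (q.1 • ContinuousLinearMap.id ℝ E)) q.2 :=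
          h4.comp q.2 (((hasFDerivAt_id q.2).const_smul q.1).const_add y)
        have h6 : HasFDerivAt (fun x : E => ∑ j ∈ Finset.Ico m k, q.1 ^ j * hom j (f j) x)
            (∑ j ∈ Finset.Ico m k, q.1 ^ j •
              ∑ i, hom (j - 1) (g i (j - 1)) q.2 • prj i) q.2 := by
          refine HasFDerivAt.fun_sum fun j hj => ?_
          refine (ih j ?_ q.2 h3).const_mul (q.1 ^ j)
          rw [Finset.mem_Ico] at hj
          push_cast at hk
          omega
        have h7 := (h5.sub h6).const_mul (q.1 ^ (-k))
        refine h7.congr_fderiv ?_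
        ext v
        simp only [hΦ', _root_.smul_apply, _root_.sub_apply, _root_.sum_apply, smul_eq_mul,
          ContinuousLinearMap.comp_apply, ContinuousLinearMap.id_apply, map_smul]
        rw [Finset.sum_congr rfl fun j _ => Finset.mul_sum _ _ _,
          Finset.sum_comm, Finset.mul_sum, ← Finset.sum_sub_distrib, Finset.mul_sum]
        refine Finset.sum_congr rfl fun i _ => ?_
        have e1 : ∑ j ∈ Finset.Ico m k, q.1 ^ j * (hom (j - 1) (g i (j - 1)) q.2 * prj i v) =
            q.1 * (∑ j ∈ Finset.Ico (m - 1) (k - 1), q.1 ^ j * hom j (g i j) q.2) * prj i v := by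
          rw [Finset.mul_sum, Finset.sum_mul]
          refine Finset.sum_bij' (fun j _ => j - 1) (fun j _ => j + 1) ?_ ?_ ?_ ?_ ?_
          · intro j hj
            simp only [Finset.mem_Ico] at *
            omega
          · intro j hj
            simp only [Finset.mem_Ico] at *
            omega
          · intro j _
            ring
          · intro j _
            ring
          · intro j _
            rw [zpow_sub_one₀ h2.ne']
            field_simp
        rw [e1, show -(k - 1) = -k + 1 by ring, zpow_add_one₀ h2.ne']
        ring
      · filter_upwards [isOpen_ne.mem_nhds hx₀] with x hx
        have h1 := hF.scaled hmk (x₀ := x) hx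
        have h2 : Tendsto (fun r : ℝ => (r, x)) (𝓝[>] 0) (𝓝[>] 0 ×ˢ 𝓝 x) :=
          tendsto_id.prodMk tendsto_const_nhds
        have h3 := (h1.comp h2).add_const (hom k (f k) x)
        rw [zero_add] at h3
        refine h3.congr fun r => ?_
        simp [hΦ]
  exact main (k - m + 1).toNat k (by omega)

/-! ### Laurent series of the singular functions -/

/-- A singular point. -/
abbrev SPt (y₁ y₂ : E) : Type := {y : E // y = y₁ ∨ y = y₂}

variable {y₁ y₂ : E}

theorem eventually_regular (y y₁ y₂ : E) : ∀ᶠ x in 𝓝[≠] y, ¬ (x = y₁ ∨ x = y₂) := by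
  have h : ∀ z : E, ∀ᶠ x in 𝓝[≠] y, x ≠ z := by
    intro z
    by_cases hz : y = z
    · subst hz
      exact self_mem_nhdsWithin
    · exact nhdsWithin_le_nhds (isOpen_ne.mem_nhds hz)
  filter_upwards [h y₁, h y₂] with x h1 h2
  tauto

theorem ContDiffOn.exists_tame {y : E} {F : E → ℝ} {f : ℤ → S2 → ℝ}
    (hF : ContDiffOn ℝ ∞ F {x | ¬ (x = y₁ ∨ x = y₂)}) (h : HasExpansion y F f) :
    ∃ m, Tame y F f m := by
  refine h.exists_tame ?_
  obtain ⟨δ, hδ, h1⟩ := exists_punctured_ball (eventually_regular y y₁ y₂)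
  refine ⟨δ, hδ, fun r hr hrδ => ?_⟩
  have hc : Continuous fun n : S2 => F (y + r • (n : E)) := by
    refine hF.continuousOn.comp_continuous (by fun_prop) fun n => h1 _ ?_ ?_
    · exact smul_ne_zero hr.ne' (sphere_ne_zero n)
    · rwa [norm_smul, norm_sphere, Real.norm_of_nonneg hr.le, mul_one]
  obtain ⟨C, hC⟩ := (isCompact_univ (X := S2)).exists_bound_of_continuousOn hc.continuousOn
  exact ⟨C, fun n => hC n (Set.mem_univ n)⟩

theorem exists_hasExpansion (p : SPt y₁ y₂) (F : singularSpace y₁ y₂) (L : List (Fin 3)) :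
    ∃ f, HasExpansion p.1 (pdL y₁ y₂ L F) f := by
  obtain ⟨p, rfl | rfl⟩ := p
  · exact (F.2.2 L).1
  · exact (F.2.2 L).2

theorem exists_tame_pdL (p : SPt y₁ y₂) (F : singularSpace y₁ y₂) (L : List (Fin 3)) :
    ∃ m, Tame p.1 (pdL y₁ y₂ L F) (coef p.1 (pdL y₁ y₂ L F)) m :=
  ContDiffOn.exists_tame (contDiffOn_pdL L F.2.1) (hasExpansion_coef (exists_hasExpansion p F L))

theorem hasFDerivAt_pd {F : E → ℝ} (hF : ContDiffOn ℝ ∞ F {x | ¬ (x = y₁ ∨ x = y₂)}) {x : E}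
    (hx : ¬ (x = y₁ ∨ x = y₂)) : HasFDerivAt F (∑ i, pd y₁ y₂ i F x • prj i) x := by
  refine (differentiableAt_regular hF hx).hasFDerivAt.congr_fderiv ?_
  ext v
  simp only [_root_.sum_apply, _root_.smul_apply, smul_eq_mul, pd, if_neg hx]
  conv_lhs => rw [← sum_smul_ee v, map_sum]
  refine Finset.sum_congr rfl fun i _ => ?_
  rw [map_smul, smul_eq_mul, mul_comm]
  rfl

theorem hasFDerivAt_hom_coef (p : SPt y₁ y₂) (F : singularSpace y₁ y₂) (L : List (Fin 3)) (k : ℤ)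
    {x : E} (hx : x ≠ 0) : HasFDerivAt (hom k (coef p.1 (pdL y₁ y₂ L F) k))
      (∑ i, hom (k - 1) (coef p.1 (pdL y₁ y₂ (i :: L) F) (k - 1)) x • prj i) x := by
  obtain ⟨m₀, h₀⟩ := exists_tame_pdL p F L
  choose m' h' using fun i => exists_tame_pdL p F (i :: L)
  obtain ⟨m, hm⟩ : ∃ m, m ≤ m₀ ∧ ∀ i, m - 1 ≤ m' i :=
    ⟨min m₀ (min (m' 0) (min (m' 1) (m' 2))), by omega, Fin.forall_fin_succ.2
      ⟨by omega, Fin.forall_fin_two.2 ⟨by change _ ≤ m' 1; omega, by change _ ≤ m' 2; omega⟩⟩⟩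
  refine hasFDerivAt_coeff (h₀.of_le hm.1) (fun i => (h' i).of_le (hm.2 i)) ?_ k x hx
  filter_upwards [eventually_regular p.1 y₁ y₂] with x hx
  exact hasFDerivAt_pd (contDiffOn_pdL L F.2.1) hx

/-- Bootstrap: the derivative of each term of an expansion is a term of the expansion of a partial
derivative of `F`. -/
theorem contDiffOn_hom_coef (p : SPt y₁ y₂) (F : singularSpace y₁ y₂) (N : ℕ) :
    ∀ (L : List (Fin 3)) (k : ℤ), ContDiffOn ℝ N (hom k (coef p.1 (pdL y₁ y₂ L F) k)) {0}ᶜ := by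
  induction N with
  | zero =>
    intro L k
    rw [Nat.cast_zero, contDiffOn_zero]
    exact fun x hx => (hasFDerivAt_hom_coef p F L k hx).continuousAt.continuousWithinAt
  | succ N ih =>
    intro L k
    rw [Nat.cast_succ, contDiffOn_succ_iff_fderiv_of_isOpen isOpen_punctured]
    refine ⟨fun x hx => (hasFDerivAt_hom_coef p F L k hx).differentiableAt.differentiableWithinAt,
      by simp, ?_⟩
    have h : ContDiffOn ℝ N (fun x => ∑ i, hom (k - 1) (coef p.1 (pdL y₁ y₂ (i :: L) F) (k - 1)) x •
        prj i) {0}ᶜ :=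
      ContDiffOn.sum fun i _ => (ih (i :: L) (k - 1)).smul contDiffOn_const
    exact h.congr fun x hx => (hasFDerivAt_hom_coef p F L k hx).fderiv

theorem coef_mem (p : SPt y₁ y₂) (F : singularSpace y₁ y₂) (k : ℤ) :
    coef p.1 F k ∈ smoothSphere := by
  have h : ContDiffOn ℝ ∞ (hom k (coef p.1 F k)) {0}ᶜ :=
    contDiffOn_infty.2 fun N => contDiffOn_hom_coef p F N [] k
  have h2 := (contDiffOn_norm_zpow (-k)).mul h
  refine h2.congr fun x hx => ?_
  change _ = ‖x‖ ^ (-k) * (‖x‖ ^ k * coef p.1 F k (dir x))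
  rw [← mul_assoc, ← zpow_add₀ (norm_ne_zero_iff.2 hx)]
  simp

/-- `A` is the Laurent series of `F` at `y`. -/
def HasLS (y : E) (F : E → ℝ) (A : HahnSeries ℤ SM) : Prop :=
  ∃ m, Tame y F (fun k => (A.coeff k).1) m

theorem HasLS.coef_eq {y : E} {F : E → ℝ} {A : HahnSeries ℤ SM} (h : HasLS y F A) (k : ℤ) :
    coef y F k = (A.coeff k).1 := by
  obtain ⟨m, h⟩ := h
  exact Hadamard.coef_eq h.hasExpansion k

theorem HasLS.unique {y : E} {F : E → ℝ} {A B : HahnSeries ℤ SM} (h : HasLS y F A)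
    (h' : HasLS y F B) : A = B := by
  ext1
  funext k
  apply Subtype.ext
  rw [← h.coef_eq, ← h'.coef_eq]

theorem HasExpansion.hasLS {y : E} {F : E → ℝ} {A : HahnSeries ℤ SM}
    (h : HasExpansion y F fun k => (A.coeff k).1) : HasLS y F A := by
  obtain ⟨m, h0, h⟩ := h
  refine ⟨m, tame_of_exp h0 (fun k => ?_) h⟩
  obtain ⟨C, hC⟩ := (A.coeff k).exists_bound
  exact ⟨C, hC⟩

theorem HasLS.hasExpansion {y : E} {F : E → ℝ} {A : HahnSeries ℤ SM} (h : HasLS y F A) :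
    HasExpansion y F fun k => (A.coeff k).1 :=
  h.choose_spec.hasExpansion

theorem HasLS.add {y : E} {F G : E → ℝ} {A B : HahnSeries ℤ SM} (hF : HasLS y F A)
    (hG : HasLS y G B) : HasLS y (F + G) (A + B) :=
  HasExpansion.hasLS (hF.hasExpansion.add hG.hasExpansion)

theorem HasLS.smul {y : E} {F : E → ℝ} {A : HahnSeries ℤ SM} (c : ℝ) (hF : HasLS y F A) :
    HasLS y (c • F) (c • A) :=
  HasExpansion.hasLS (hF.hasExpansion.smul c)

theorem HasLS.congr' {y : E} {F G : E → ℝ} {A : HahnSeries ℤ SM} (hF : HasLS y F A)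
    (h : F =ᶠ[𝓝[≠] y] G) : HasLS y G A :=
  HasExpansion.hasLS (hF.hasExpansion.congr' h)

theorem hasLS_zero (y : E) : HasLS y 0 0 := HasExpansion.hasLS (hasExpansion_zero y)

theorem HasLS.sum {ι : Type*} (s : Finset ι) {y : E} {F : ι → E → ℝ} {A : ι → HahnSeries ℤ SM}
    (h : ∀ i ∈ s, HasLS y (F i) (A i)) : HasLS y (∑ i ∈ s, F i) (∑ i ∈ s, A i) := by
  classical
  induction s using Finset.induction_on with
  | empty => simpa using hasLS_zero y
  | insert i s hi ih =>
    rw [Finset.sum_insert hi, Finset.sum_insert hi]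
    exact (h i (Finset.mem_insert_self i s)).add
      (ih fun j hj => h j (Finset.mem_insert_of_mem hj))

theorem hasLS_hom (y : E) (k : ℤ) (f : SM) :
    HasLS y (fun x => hom k f.1 (x - y)) (HahnSeries.single k f) := by
  refine ⟨k, fun j hj => ?_, fun j => ?_, fun K => ?_⟩
  · rw [HahnSeries.coeff_single_of_ne (by omega)]
    rfl
  · obtain ⟨C, hC⟩ := ((HahnSeries.single k f).coeff j).exists_bound
    exact ⟨C, hC⟩
  · by_cases hK : k < K
    · have : ∀ x, hom k f.1 (x - y) - ∑ j ∈ Finset.Ico k K,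
          hom j ((HahnSeries.single k f).coeff j).1 (x - y) = 0 := by
        intro x
        rw [Finset.sum_eq_single k, HahnSeries.coeff_single_same, sub_self]
        · intro j _ hj
          rw [HahnSeries.coeff_single_of_ne hj]
          exact mul_zero _
        · intro h
          exact absurd (Finset.left_mem_Ico.2 hK) h
      simp only [this]
      exact isBigO_zero _ _
    · rw [Finset.Ico_eq_empty hK]
      simp only [Finset.sum_empty, sub_zero]
      obtain ⟨C, hC⟩ := f.exists_bound
      exact hom_isBigO y ⟨C, hC⟩ (not_lt.1 hK)

theorem coeff_mul_eq {A B : HahnSeries ℤ SM} {m m' : ℤ} (hA : ∀ k < m, A.coeff k = 0)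
    (hB : ∀ k < m', B.coeff k = 0) (k : ℤ) :
    (A * B).coeff k = ∑ i ∈ Finset.Ico m (k - m' + 1), A.coeff i * B.coeff (k - i) := by
  rw [HahnSeries.coeff_mul]
  refine Finset.sum_of_injOn (fun ij => ij.1) ?_ ?_ ?_ ?_
  · rintro ⟨a, b⟩ h ⟨c, d⟩ h' (hac : a = c)
    simp only [Finset.mem_coe, Finset.mem_antidiagonal] at h h'
    ext
    · exact hac
    · change b = d
      have h1 : a + b = k := h.2.2
      have h2 : c + d = k := h'.2.2
      omega
  · rintro ⟨a, b⟩ h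
    simp only [Finset.mem_coe, Finset.mem_antidiagonal, HahnSeries.mem_support] at h
    simp only [Finset.coe_Ico, Set.mem_Ico]
    have h1 : m ≤ a := by
      by_contra hc
      exact h.1 (hA a (by omega))
    have h2 : m' ≤ b := by
      by_contra hc
      exact h.2.1 (hB b (by omega))
    omega
  · intro i _ hi
    by_contra hne
    refine hi ⟨(i, k - i), ?_, rfl⟩
    simp only [Finset.mem_coe, Finset.mem_antidiagonal, HahnSeries.mem_support]
    exact ⟨left_ne_zero_of_mul hne, right_ne_zero_of_mul hne, by ring⟩
  · rintro ⟨a, b⟩ h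
    simp only [Finset.mem_antidiagonal] at h
    rw [show b = k - a by omega]

theorem HasLS.mul {y : E} {F G : E → ℝ} {A B : HahnSeries ℤ SM} (hF : HasLS y F A)
    (hG : HasLS y G B) : HasLS y (F * G) (A * B) := by
  obtain ⟨m, hF⟩ := hF
  obtain ⟨m', hG⟩ := hG
  have hA : ∀ k < m, A.coeff k = 0 := fun k hk => Subtype.ext (hF.low k hk)
  have hB : ∀ k < m', B.coeff k = 0 := fun k hk => Subtype.ext (hG.low k hk)
  refine ⟨m + m', fun k hk => ?_, fun k => ?_, fun K => ?_⟩
  · rw [coeff_mul_eq hA hB, Finset.Ico_eq_empty (by omega)]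
    rfl
  · obtain ⟨C, hC⟩ := ((A * B).coeff k).exists_bound
    exact ⟨C, hC⟩
  set a : ℤ → E → ℝ := fun i x => hom i (A.coeff i).1 (x - y) with ha
  set b : ℤ → E → ℝ := fun i x => hom i (B.coeff i).1 (x - y) with hb
  have hpow : ∀ {u v w : ℤ}, u + v = w → ∀ {f g : E → ℝ}, (f =O[𝓝[≠] y] fun x => ‖x - y‖ ^ u) →
      (g =O[𝓝[≠] y] fun x => ‖x - y‖ ^ v) →
      (fun x => f x * g x) =O[𝓝[≠] y] fun x => ‖x - y‖ ^ w := by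
    intro u v w huv f g hf hg
    refine (hf.mul hg).trans_eventuallyEq ?_
    filter_upwards [self_mem_nhdsWithin] with x hx
    rw [← huv, zpow_add₀ (norm_ne_zero_iff.2 (sub_ne_zero.2 hx))]
  have hG0 : G =O[𝓝[≠] y] fun x => ‖x - y‖ ^ m' := by
    have := hG.exp m'
    simpa using this
  have hS : (fun x => ∑ i ∈ Finset.Ico m (K - m'), a i x) =O[𝓝[≠] y] fun x => ‖x - y‖ ^ m :=
    IsBigO.fun_sum fun i hi => hom_isBigO y (hF.bdd i) (Finset.mem_Ico.1 hi).1
  have h1 := hpow (show (K - m') + m' = K by ring) (hF.exp (K - m')) hG0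
  have h2 := hpow (show m + (K - m) = K by ring) hS (hG.exp (K - m))
  -- The error is `(F - S) G + S (G - S')` plus the products of terms of `S` and `S'` of total order
  -- at least `K`; these last products are collected here.
  have h3 : (fun x => ∑ q ∈ (Finset.Ico m (K - m') ×ˢ Finset.Ico m' (K - m)).filter
      (fun q => ¬ q.1 + q.2 < K), a q.1 x * b q.2 x) =O[𝓝[≠] y] fun x => ‖x - y‖ ^ K := by
    refine IsBigO.fun_sum fun q hq => ?_
    have hq2 := (Finset.mem_filter.1 hq).2
    exact (hpow rfl (hom_isBigO y (hF.bdd q.1) le_rfl) (hom_isBigO y (hG.bdd q.2) le_rfl)).trans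
      (zpow_isBigO y (not_lt.1 hq2))
  refine ((h1.add h2).add h3).congr' ?_ EventuallyEq.rfl
  filter_upwards [self_mem_nhdsWithin] with x hx
  have hxy : ‖x - y‖ ≠ 0 := norm_ne_zero_iff.2 (sub_ne_zero.2 hx)
  have e1 : ∑ k ∈ Finset.Ico (m + m') K, hom k ((A * B).coeff k).1 (x - y) =
      ∑ q ∈ (Finset.Ico m (K - m') ×ˢ Finset.Ico m' (K - m)).filter (fun q => q.1 + q.2 < K),
        a q.1 x * b q.2 x := by
    have e2 : ∀ k ∈ Finset.Ico (m + m') K, hom k ((A * B).coeff k).1 (x - y) =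
        ∑ i ∈ Finset.Ico m (k - m' + 1), a i x * b (k - i) x := by
      intro k _
      rw [coeff_mul_eq hA hB, hom, ← evalAt_apply (dir (x - y)), map_sum, Finset.mul_sum]
      refine Finset.sum_congr rfl fun i _ => ?_
      rw [map_mul, ha, hb]
      simp only [hom, evalAt_apply]
      rw [show ‖x - y‖ ^ k = ‖x - y‖ ^ i * ‖x - y‖ ^ (k - i) by
        rw [← zpow_add₀ hxy, add_sub_cancel]]
      ring
    rw [Finset.sum_congr rfl e2, Finset.sum_sigma']
    refine Finset.sum_bij' (fun q _ => (q.2, q.1 - q.2)) (fun q _ => ⟨q.1 + q.2, q.1⟩) ?_ ?_ ?_ ?_ ?_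
    · rintro ⟨k, i⟩ h
      simp only [Finset.mem_sigma, Finset.mem_filter, Finset.mem_product, Finset.mem_Ico] at *
      omega
    · rintro ⟨k, i⟩ h
      simp only [Finset.mem_sigma, Finset.mem_filter, Finset.mem_product, Finset.mem_Ico] at *
      omega
    · rintro ⟨k, i⟩ _
      simp
    · rintro ⟨k, i⟩ _
      simp
    · rintro ⟨k, i⟩ _
      rfl
  have e3 := Finset.sum_filter_add_sum_filter_not
    (Finset.Ico m (K - m') ×ˢ Finset.Ico m' (K - m)) (fun q => q.1 + q.2 < K)
    (fun q => a q.1 x * b q.2 x)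
  rw [Finset.sum_product] at e3
  dsimp only at e3
  rw [← Finset.sum_mul_sum] at e3
  change (F x - ∑ i ∈ Finset.Ico m (K - m'), a i x) * G x +
    (∑ i ∈ Finset.Ico m (K - m'), a i x) * (G x - ∑ i ∈ Finset.Ico m' (K - m), b i x) + _ =
      F x * G x - _
  rw [e1]
  linear_combination e3

end

end Hadamard


namespace Hadamard

noncomputable section

variable {y₁ y₂ : E}

theorem exists_hasLS (p : SPt y₁ y₂) (F : singularSpace y₁ y₂) :
    ∃ A : HahnSeries ℤ SM, HasLS p.1 F A := by
  obtain ⟨m, h⟩ := exists_tame_pdL p F []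
  refine ⟨HahnSeries.ofSuppBddBelow (fun k => ⟨coef p.1 F k, coef_mem p F k⟩)
    ⟨m, fun k hk => not_lt.1 fun hkm => hk (Subtype.ext (h.low k hkm))⟩, m, ?_⟩
  exact h

/-- The Laurent series of a singular function at a singular point. -/
def ls (p : SPt y₁ y₂) : singularSpace y₁ y₂ →ₗ[ℝ] HahnSeries ℤ SM where
  toFun F := (exists_hasLS p F).choose
  map_add' F G := ((exists_hasLS p (F + G)).choose_spec).unique
    ((exists_hasLS p F).choose_spec.add (exists_hasLS p G).choose_spec)
  map_smul' c F := ((exists_hasLS p (c • F)).choose_spec).unique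
    ((exists_hasLS p F).choose_spec.smul c)

theorem hasLS_ls (p : SPt y₁ y₂) (F : singularSpace y₁ y₂) : HasLS p.1 F (ls p F) :=
  (exists_hasLS p F).choose_spec

theorem HasLS.ls_eq {p : SPt y₁ y₂} {F : singularSpace y₁ y₂} {A : HahnSeries ℤ SM}
    (h : HasLS p.1 F A) : ls p F = A :=
  (hasLS_ls p F).unique h

theorem coef_ls (p : SPt y₁ y₂) (F : singularSpace y₁ y₂) (k : ℤ) :
    coef p.1 F k = ((ls p F).coeff k).1 :=
  (hasLS_ls p F).coef_eq k

theorem ls_ordDeriv (p : SPt y₁ y₂) (i : Fin 3) (F : singularSpace y₁ y₂) (k : ℤ) :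
    (ls p (ordDeriv [i] F)).coeff k = low ((k + 1 : ℤ) : ℝ) i ((ls p F).coeff (k + 1)) := by
  refine SM.ext' fun n => ?_
  have h := (hasFDerivAt_hom_coef p F [] (k + 1) (sphere_ne_zero n)).fderiv
  have h1 : coef p.1 (pdL y₁ y₂ [] F) (k + 1) = ((ls p F).coeff (k + 1)).1 := coef_ls p F (k + 1)
  have h2 := congrArg (fun L => L (ee i)) h
  rw [h1] at h2
  beta_reduce at h2
  rw [fderiv_hom _ _ (sphere_ne_zero n), _root_.sum_apply,
    Finset.sum_eq_single i (fun j _ hj => by simp [hj.symm]) (by simp)] at h2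
  have h3 : coef p.1 (pdL y₁ y₂ [i] F) (k + 1 - 1) = ((ls p (ordDeriv [i] F)).coeff k).1 := by
    rw [add_sub_cancel_right]
    exact coef_ls p (ordDeriv [i] F) k
  rw [h3] at h2
  simpa [hom, dir_sphere, low_apply] using h2.symm

/-! ### Products -/

theorem pd_mul {F G : E → ℝ} (i : Fin 3) (hF : ContDiffOn ℝ ∞ F {x | ¬ (x = y₁ ∨ x = y₂)})
    (hG : ContDiffOn ℝ ∞ G {x | ¬ (x = y₁ ∨ x = y₂)}) :
    pd y₁ y₂ i (F * G) = pd y₁ y₂ i F * G + F * pd y₁ y₂ i G := by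
  funext x
  by_cases hx : x = y₁ ∨ x = y₂
  · simp [pd, hx]
  · simp only [pd, if_neg hx, Pi.add_apply, Pi.mul_apply]
    rw [fderiv_mul (differentiableAt_regular hF hx) (differentiableAt_regular hG hx)]
    simp only [_root_.add_apply, _root_.smul_apply, smul_eq_mul]
    ring

theorem pdL_append (P Q : List (Fin 3)) (F : E → ℝ) :
    pdL y₁ y₂ (P ++ Q) F = pdL y₁ y₂ P (pdL y₁ y₂ Q F) := by
  simp [pdL, List.foldr_append]

theorem exists_hasExpansion_pdL_mul (p : SPt y₁ y₂) (L : List (Fin 3)) :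
    ∀ F G : singularSpace y₁ y₂, ∃ f, HasExpansion p.1 (pdL y₁ y₂ L ((F : E → ℝ) * G)) f := by
  -- The innermost derivative is taken off first, so that Leibniz's rule gives products of two
  -- elements of the class, to which the hypothesis applies.
  induction L using List.reverseRecOn with
  | nil => exact fun F G => ⟨_, ((hasLS_ls p F).mul (hasLS_ls p G)).hasExpansion⟩
  | append_singleton L i ih =>
    intro F G
    obtain ⟨f, hf⟩ := ih (ordDeriv [i] F) G
    obtain ⟨g, hg⟩ := ih F (ordDeriv [i] G)
    have e : pdL y₁ y₂ [i] ((F : E → ℝ) * G) = (ordDeriv [i] F : E → ℝ) * G +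
        (F : E → ℝ) * ordDeriv [i] G := pd_mul i F.2.1 G.2.1
    have e2 := pdL_add L (F := (ordDeriv [i] F : E → ℝ) * G) (G := (F : E → ℝ) * ordDeriv [i] G)
      ((ordDeriv [i] F).2.1.mul G.2.1) (F.2.1.mul (ordDeriv [i] G).2.1)
    rw [pdL_append, e, e2]
    exact ⟨_, hf.add hg⟩

theorem mul_mem_singularSpace (F G : singularSpace y₁ y₂) :
    (F : E → ℝ) * G ∈ singularSpace y₁ y₂ :=
  ⟨F.2.1.mul G.2.1, fun L => ⟨exists_hasExpansion_pdL_mul ⟨y₁, Or.inl rfl⟩ L F G,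
    exists_hasExpansion_pdL_mul ⟨y₂, Or.inr rfl⟩ L F G⟩⟩

instance : Mul (singularSpace y₁ y₂) := ⟨fun F G => ⟨(F : E → ℝ) * G, mul_mem_singularSpace F G⟩⟩

theorem ls_mul (p : SPt y₁ y₂) (F G : singularSpace y₁ y₂) : ls p (F * G) = ls p F * ls p G :=
  HasLS.ls_eq ((hasLS_ls p F).mul (hasLS_ls p G))

theorem pfAt_of_hasLS {y : E} {F : E → ℝ} {A : HahnSeries ℤ SM} (h : HasLS y F A) :
    pfAt y F = (4 * Real.pi)⁻¹ * sInt (A.coeff 0) := by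
  rw [pfAt, sphereAvg, h.coef_eq]
  rfl

theorem pfAt_mul (p : SPt y₁ y₂) (F G : singularSpace y₁ y₂) :
    pfAt p.1 ((F : E → ℝ) * G) = (4 * Real.pi)⁻¹ * sInt ((ls p F * ls p G).coeff 0) :=
  pfAt_of_hasLS ((hasLS_ls p F).mul (hasLS_ls p G))

/-! ### Derivatives of singular functions -/

/-- The ordinary partial derivative on singular functions. -/
def dd (i : Fin 3) : singularSpace y₁ y₂ →ₗ[ℝ] singularSpace y₁ y₂ where
  toFun F := ordDeriv [i] F
  map_add' F G := Subtype.ext (pd_add i F.2.1 G.2.1)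
  map_smul' c F := Subtype.ext (pd_smul i c F.2.1)

theorem ls_dd (p : SPt y₁ y₂) (i : Fin 3) (F : singularSpace y₁ y₂) (k : ℤ) :
    (ls p (dd i F)).coeff k = low ((k + 1 : ℤ) : ℝ) i ((ls p F).coeff (k + 1)) :=
  ls_ordDeriv p i F k

theorem ordDeriv_nil (F : singularSpace y₁ y₂) : ordDeriv [] F = F := rfl

theorem ordDeriv_cons (i : Fin 3) (L : List (Fin 3)) (F : singularSpace y₁ y₂) :
    ordDeriv (i :: L) F = dd i (ordDeriv L F) := rfl

/-- The ordinary multiple derivative as a linear map. -/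
def ddL : List (Fin 3) → singularSpace y₁ y₂ →ₗ[ℝ] singularSpace y₁ y₂
  | [] => LinearMap.id
  | i :: L => dd i ∘ₗ ddL L

theorem ddL_apply (L : List (Fin 3)) (F : singularSpace y₁ y₂) : ddL L F = ordDeriv L F := by
  induction L with
  | nil => rfl
  | cons i L ih => rw [ordDeriv_cons, ← ih]; rfl

theorem dd_mul (i : Fin 3) (F G : singularSpace y₁ y₂) :
    dd i (F * G) = dd i F * G + F * dd i G :=
  Subtype.ext (pd_mul i F.2.1 G.2.1)

theorem dd_comm (i j : Fin 3) (F : singularSpace y₁ y₂) : dd i (dd j F) = dd j (dd i F) := by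
  refine Subtype.ext (funext fun x => ?_)
  change pd y₁ y₂ i (pd y₁ y₂ j F) x = pd y₁ y₂ j (pd y₁ y₂ i F) x
  by_cases hx : x = y₁ ∨ x = y₂
  · simp [pd, hx]
  have hF := (F.2.1.contDiffAt ((isOpen_regular y₁ y₂).mem_nhds hx))
  have h1 : ∀ i j : Fin 3, pd y₁ y₂ i (pd y₁ y₂ j F) x =
      fderiv ℝ (fderiv ℝ (F : E → ℝ)) x (ee i) (ee j) := by
    intro i j
    have h2 : pd y₁ y₂ j F =ᶠ[𝓝 x] fun z => fderiv ℝ (F : E → ℝ) z (ee j) := by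
      filter_upwards [(isOpen_regular y₁ y₂).mem_nhds hx] with z hz
      have hz' : ¬ (z = y₁ ∨ z = y₂) := hz
      rw [pd, if_neg hz']
    rw [pd, if_neg hx, h2.fderiv_eq]
    have h3 : DifferentiableAt ℝ (fderiv ℝ (F : E → ℝ)) x :=
      (hF.fderiv_right (m := 1) (by norm_cast)).differentiableAt (by simp)
    rw [(h3.hasFDerivAt.clm_apply (hasFDerivAt_const (ee j) x)).fderiv]
    simp
  rw [h1, h1]
  exact (hF.isSymmSndFDerivAt (by rw [minSmoothness_of_isRCLikeNormedField]; norm_cast)) _ _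

theorem ordDeriv_perm {L L' : List (Fin 3)} (h : L.Perm L') (F : singularSpace y₁ y₂) :
    ordDeriv L F = ordDeriv L' F := by
  induction h with
  | nil => rfl
  | cons i _ ih => rw [ordDeriv_cons, ih, ← ordDeriv_cons]
  | swap i j L => exact dd_comm j i (ordDeriv L F)
  | trans _ _ ih ih' => exact ih.trans ih'

/-! ### Realization of Laurent monomials -/

theorem pd_eventuallyEq_hom {F : E → ℝ} {y : E} {k : ℤ} {g : SM} (i : Fin 3)
    (h : F =ᶠ[𝓝[≠] y] fun x => hom k g.1 (x - y)) :
    pd y₁ y₂ i F =ᶠ[𝓝[≠] y] fun x => hom (k - 1) (low k i g).1 (x - y) := by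
  have h2 := eventually_eventually_nhdsWithin.2 h
  filter_upwards [h2, self_mem_nhdsWithin, eventually_regular y y₁ y₂] with x h3 hx hr
  have h4 : F =ᶠ[𝓝 x] fun x => hom k g.1 (x - y) := by
    rwa [isOpen_compl_singleton.nhdsWithin_eq hx] at h3
  rw [pd, if_neg hr, h4.fderiv_eq, fderiv_comp_sub, low_apply]
  exact fderiv_hom k g (sub_ne_zero.2 hx) i

theorem pdL_eventuallyEq_hom {F : E → ℝ} {y : E} {k : ℤ} {g : SM} (L : List (Fin 3))
    (h : F =ᶠ[𝓝[≠] y] fun x => hom k g.1 (x - y)) :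
    ∃ (k' : ℤ) (g' : SM), pdL y₁ y₂ L F =ᶠ[𝓝[≠] y] fun x => hom k' g'.1 (x - y) := by
  induction L with
  | nil => exact ⟨k, g, h⟩
  | cons i L ih =>
    obtain ⟨k', g', h'⟩ := ih
    exact ⟨_, _, pd_eventuallyEq_hom i h'⟩

theorem mem_singularSpace_of_hom {F : E → ℝ}
    (hF : ContDiffOn ℝ ∞ F {x | ¬ (x = y₁ ∨ x = y₂)})
    (h : ∀ p : SPt y₁ y₂, ∃ (k : ℤ) (g : SM), F =ᶠ[𝓝[≠] p.1] fun x => hom k g.1 (x - p.1)) :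
    F ∈ singularSpace y₁ y₂ := by
  have key : ∀ (p : SPt y₁ y₂) (L : List (Fin 3)), ∃ f, HasExpansion p.1 (pdL y₁ y₂ L F) f := by
    intro p L
    obtain ⟨k, g, h⟩ := h p
    obtain ⟨k', g', h'⟩ := pdL_eventuallyEq_hom (y₁ := y₁) (y₂ := y₂) L h
    exact ⟨_, ((hasLS_hom p.1 k' g').congr' h'.symm).hasExpansion⟩
  exact ⟨hF, fun L => ⟨key ⟨y₁, Or.inl rfl⟩ L, key ⟨y₂, Or.inr rfl⟩ L⟩⟩

/-- A cutoff function at a singular point. -/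
def cut (hy : y₁ ≠ y₂) (p : E) : ContDiffBump p :=
  ⟨dist y₁ y₂ / 4, dist y₁ y₂ / 2, by have := dist_pos.2 hy; positivity,
    by have := dist_pos.2 hy; linarith⟩

theorem cut_eventuallyEq_one (hy : y₁ ≠ y₂) (p : E) : (cut hy p : E → ℝ) =ᶠ[𝓝 p] 1 :=
  (cut hy p).eventuallyEq_one

theorem cut_eventuallyEq_zero (hy : y₁ ≠ y₂) {p q : SPt y₁ y₂} (hpq : q ≠ p) :
    (cut hy p.1 : E → ℝ) =ᶠ[𝓝 q.1] 0 := by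
  have hd : dist q.1 p.1 = dist y₁ y₂ := by
    obtain ⟨p, rfl | rfl⟩ := p <;> obtain ⟨q, rfl | rfl⟩ := q
    · exact absurd rfl hpq
    · exact dist_comm _ _
    · rfl
    · exact absurd rfl hpq
  have hpos := dist_pos.2 hy
  have h1 : Metric.ball q.1 (dist y₁ y₂ / 2) ∈ 𝓝 q.1 := Metric.ball_mem_nhds _ (by positivity)
  filter_upwards [h1] with x hx
  refine (cut hy p.1).zero_of_le_dist ?_
  change dist y₁ y₂ / 2 ≤ dist x p.1
  have h2 := dist_triangle q.1 x p.1
  rw [Metric.mem_ball, dist_comm] at hx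
  linarith

theorem mono_mem (hy : y₁ ≠ y₂) (p : SPt y₁ y₂) (k : ℤ) (f : SM) :
    (fun x => cut hy p.1 x * hom k f.1 (x - p.1)) ∈ singularSpace y₁ y₂ := by
  refine mem_singularSpace_of_hom ?_ fun q => ?_
  · refine (cut hy p.1).contDiff.contDiffOn.mul ((contDiffOn_hom k f).comp
      (contDiff_id.sub contDiff_const).contDiffOn fun x hx => ?_)
    have hx' : ¬ (x = y₁ ∨ x = y₂) := hx
    refine sub_ne_zero.2 fun h => hx' ?_
    rcases p.2 with h' | h'
    · exact Or.inl (h.trans h')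
    · exact Or.inr (h.trans h')
  · by_cases hq : q = p
    · subst hq
      refine ⟨k, f, ?_⟩
      filter_upwards [nhdsWithin_le_nhds (cut_eventuallyEq_one hy q.1)] with x hx
      rw [hx, Pi.one_apply, one_mul]
    · refine ⟨0, 0, ?_⟩
      filter_upwards [nhdsWithin_le_nhds (cut_eventuallyEq_zero hy hq)] with x hx
      rw [hx, Pi.zero_apply, zero_mul]
      exact (mul_zero _).symm

/-- The function `r ^ k * f (n)` near a singular point `p`, cut off away from `p`. -/
def mono (hy : y₁ ≠ y₂) (p : SPt y₁ y₂) (k : ℤ) : SM →ₗ[ℝ] singularSpace y₁ y₂ where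
  toFun f := ⟨fun x => cut hy p.1 x * hom k f.1 (x - p.1), mono_mem hy p k f⟩
  map_add' f g := by
    refine Subtype.ext (funext fun x => ?_)
    change _ * (_ * (f.1 _ + g.1 _)) = _ * (_ * f.1 _) + _ * (_ * g.1 _)
    ring
  map_smul' c f := by
    refine Subtype.ext (funext fun x => ?_)
    change _ * (_ * (c * f.1 _)) = c * (_ * (_ * f.1 _))
    ring

/-- Every Laurent monomial at one point is realized by a compactly supported element of the class
with zero series at the other point. Identities between bilinear forms can thus be tested one order
at a time, with no condition at infinity. -/
theorem ls_mono_self (hy : y₁ ≠ y₂) (p : SPt y₁ y₂) (k : ℤ) (f : SM) :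
    ls p (mono hy p k f) = HahnSeries.single k f := by
  refine HasLS.ls_eq ((hasLS_hom p.1 k f).congr' ?_)
  filter_upwards [nhdsWithin_le_nhds (cut_eventuallyEq_one hy p.1)] with x hx
  change _ = cut hy p.1 x * hom k f.1 (x - p.1)
  rw [hx, Pi.one_apply, one_mul]

theorem ls_mono_of_ne (hy : y₁ ≠ y₂) {p q : SPt y₁ y₂} (hpq : q ≠ p) (k : ℤ) (f : SM) :
    ls q (mono hy p k f) = 0 := by
  refine HasLS.ls_eq ((hasLS_zero q.1).congr' ?_)
  filter_upwards [nhdsWithin_le_nhds (cut_eventuallyEq_zero hy hpq)] with x hx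
  change _ = cut hy p.1 x * hom k f.1 (x - p.1)
  rw [hx, Pi.zero_apply, zero_mul]

theorem mono_cocompact (hy : y₁ ≠ y₂) (p : SPt y₁ y₂) (k : ℤ) (f : SM) :
    (mono hy p k f : E → ℝ) =ᶠ[cocompact E] 0 := by
  have h : (Metric.closedBall p.1 (dist y₁ y₂ / 2))ᶜ ∈ cocompact E :=
    (isCompact_closedBall _ _).compl_mem_cocompact
  filter_upwards [h] with x hx
  change cut hy p.1 x * hom k f.1 (x - p.1) = 0
  rw [(cut hy p.1).zero_of_le_dist, zero_mul]
  simp only [Set.mem_compl_iff, Metric.mem_closedBall, not_le] at hx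
  exact hx.le

theorem pdL_cocompact {F : E → ℝ} (h : F =ᶠ[cocompact E] 0) (L : List (Fin 3)) :
    pdL y₁ y₂ L F =ᶠ[cocompact E] 0 := by
  induction L with
  | nil => exact h
  | cons i L ih =>
    obtain ⟨r, -, hr⟩ := ((Metric.hasBasis_cobounded_compl_closedBall (0 : E)).eventually_iff).1
      (Metric.cobounded_eq_cocompact (α := E) ▸ ih)
    have h : (Metric.closedBall (0 : E) r)ᶜ ∈ cocompact E :=
      (isCompact_closedBall _ _).compl_mem_cocompact
    filter_upwards [h] with x hx
    change pd y₁ y₂ i (pdL y₁ y₂ L F) x = 0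
    have h1 : pdL y₁ y₂ L F =ᶠ[𝓝 x] fun _ => 0 := by
      filter_upwards [Metric.isClosed_closedBall.isOpen_compl.mem_nhds hx] with z hz
      exact hr hz
    rw [pd, h1.fderiv_eq]
    simp

end

end Hadamard


/-! ### Gauss's theorem for the partie finie -/

namespace Hadamard

noncomputable section

/-! ### Integrals outside a ball -/

theorem integral_outside {y : E} {w : E → ℝ} {s : ℝ} (hs : 0 < s)
    (hw : IntegrableOn w (Metric.closedBall y s)ᶜ) :
    IntegrableOn (fun r : ℝ => r ^ 2 * ∫ n : S2, w (y + r • (n : E)) ∂sigma) (Set.Ioi s) ∧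
      ∫ x in (Metric.closedBall y s)ᶜ, w x =
        ∫ r in Set.Ioi s, r ^ 2 * ∫ n : S2, w (y + r • (n : E)) ∂sigma := by
  have hmeas : MeasurableSet (Metric.closedBall y s)ᶜ := Metric.isClosed_closedBall.measurableSet.compl
  set v : E → ℝ := fun x => (Metric.closedBall y s)ᶜ.indicator w (y + x) with hv
  have hvi : Integrable v := (hw.integrable_indicator hmeas).comp_add_left y
  have hmean : ∀ r ∈ Set.Ioi (0 : ℝ), r ^ 2 * ∫ n : S2, v (r • (n : E)) ∂sigma =
      (Set.Ioi s).indicator (fun r => r ^ 2 * ∫ n : S2, w (y + r • (n : E)) ∂sigma) r := by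
    intro r hr
    have hnorm : ∀ n : S2, dist (y + r • (n : E)) y = r := fun n => by
      rw [dist_eq_norm, add_sub_cancel_left, norm_smul, norm_sphere,
        Real.norm_of_nonneg (le_of_lt hr), mul_one]
    by_cases hrs : s < r
    · rw [Set.indicator_of_mem (Set.mem_Ioi.2 hrs)]
      congr 1
      refine integral_congr_ae (Eventually.of_forall fun n => ?_)
      rw [hv]
      refine Set.indicator_of_mem ?_ _
      simpa [hnorm n] using hrs
    · rw [Set.indicator_of_notMem (by simpa using hrs)]
      have : ∀ n : S2, v (r • (n : E)) = 0 := fun n => by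
        rw [hv]
        refine Set.indicator_of_notMem ?_ _
        simpa [hnorm n] using hrs
      simp [this]
  have hsub : Set.Ioi (0 : ℝ) ∩ Set.Ioi s = Set.Ioi s :=
    Set.inter_eq_right.2 fun r hr => hs.trans hr
  constructor
  · have h1 := (integrableOn_polar hvi).congr_fun hmean measurableSet_Ioi
    have h2 := (integrableOn_indicator_iff measurableSet_Ioi).1 h1
    rwa [Set.inter_comm, hsub] at h2
  · rw [← integral_indicator hmeas, ← integral_add_left_eq_self _ y]
    change ∫ x, v x = _
    rw [integral_polar hvi, setIntegral_congr_fun measurableSet_Ioi hmean,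
      setIntegral_indicator measurableSet_Ioi, hsub]

theorem Tame.mean_expansion {y : E} {F : E → ℝ} {A : HahnSeries ℤ SM} {m : ℤ}
    (h : Tame y F (fun k => (A.coeff k).1) m) (g : SM)
    (hc : ∃ δ : ℝ, 0 < δ ∧ ∀ r, 0 < r → r < δ → Continuous fun n : S2 => F (y + r • (n : E)))
    (K : ℤ) :
    (fun r : ℝ => ∫ n : S2, g.1 n * F (y + r • (n : E)) ∂sigma -
      ∑ k ∈ Finset.Ico m K, r ^ k * sInt (g * A.coeff k)) =O[𝓝[>] 0] fun r => r ^ K := by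
  obtain ⟨C, δ, hδ, hC⟩ := h.error K
  obtain ⟨δ', hδ', hc⟩ := hc
  obtain ⟨B, hB⟩ := g.exists_bound
  refine IsBigO.of_bound (B * C * (4 * Real.pi)) ?_
  filter_upwards [self_mem_nhdsWithin, nhdsWithin_le_nhds (gt_mem_nhds (lt_min hδ hδ'))] with r hr hr2
  have hr' : (0 : ℝ) < r := hr
  have e : ∫ n : S2, g.1 n * F (y + r • (n : E)) ∂sigma -
      ∑ k ∈ Finset.Ico m K, r ^ k * sInt (g * A.coeff k) =
      ∫ n : S2, g.1 n * (F (y + r • (n : E)) -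
        ∑ k ∈ Finset.Ico m K, hom k (A.coeff k).1 (r • (n : E))) ∂sigma := by
    simp only [mul_sub, hom_smul_sphere _ _ hr', Finset.mul_sum]
    rw [integral_sub, integral_finsetSum]
    · congr 1
      refine Finset.sum_congr rfl fun k _ => ?_
      rw [sInt_apply, ← integral_const_mul]
      refine integral_congr_ae (Eventually.of_forall fun n => ?_)
      change r ^ k * (g.1 n * _) = g.1 n * (r ^ k * _)
      ring
    · exact fun k _ => integrable_sphere
        (g.continuous.mul (continuous_const.mul (A.coeff k).continuous))
    · exact integrable_sphere (g.continuous.mul (hc r hr' (hr2.trans_le (min_le_right _ _))))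
    · exact integrable_finsetSum _ fun k _ => integrable_sphere
        (g.continuous.mul (continuous_const.mul (A.coeff k).continuous))
  rw [e]
  have h2 := norm_integral_le_of_norm_le_const (μ := sigma) (C := B * (C * r ^ K))
    (f := fun n : S2 => g.1 n * (F (y + r • (n : E)) -
        ∑ k ∈ Finset.Ico m K, hom k (A.coeff k).1 (r • (n : E))))
    (Eventually.of_forall fun n => by
      have hnorm : ‖r • (n : E)‖ = r := by
        rw [norm_smul, norm_sphere, Real.norm_of_nonneg hr'.le, mul_one]
      have h3 := hC (r • (n : E)) (smul_ne_zero hr'.ne' (sphere_ne_zero n))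
        (by rw [hnorm]; exact hr2.trans_le (min_le_left _ _))
      rw [hnorm] at h3
      rw [norm_mul]
      exact mul_le_mul (hB n) h3 (norm_nonneg _) ((abs_nonneg _).trans (hB n)))
  rw [sigma_univ] at h2
  rw [norm_zpow, Real.norm_of_nonneg hr'.le]
  linarith

/-! ### The finite part of a radial integral -/

/-- Split the radial integral at a small `δ`. Below `δ` the listed powers are integrated explicitly
and their divergence at `s` is exactly what the counterterms cancel; the remainder is bounded, hence
integrable down to 0. -/
theorem tendsto_finite_part {b : ℝ → ℝ} {c : ℤ → ℝ} {m : ℤ} (hm : m ≤ -3)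
    (hb : ∀ s > 0, IntegrableOn b (Set.Ioi s))
    (hexp : (fun r => b r - ∑ k ∈ Finset.Ico m (-2), r ^ (k + 2) * c k) =O[𝓝[>] 0]
      fun _ => (1 : ℝ)) {s₀ : ℝ} (hs₀ : 0 < s₀) :
    ∃ l, Tendsto (fun s => (∫ r in Set.Ioi s, b r) +
      ((∑ k ∈ Finset.Ico m (-3), s ^ (k + 3) / ((k : ℝ) + 3) * c k) + Real.log (s / s₀) * c (-3)))
      (𝓝[>] 0) (𝓝 l) := by
  obtain ⟨C, hC⟩ := hexp.bound
  rw [eventually_nhdsWithin_iff, Metric.eventually_nhds_iff] at hC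
  obtain ⟨δ₁, hδ₁, hC⟩ := hC
  set δ := δ₁ / 2 with hδdef
  have hδ : 0 < δ := by positivity
  set e : ℝ → ℝ := fun r => b r - ∑ k ∈ Finset.Ico m (-2), r ^ (k + 2) * c k with he
  have heC : ∀ r, 0 < r → r ≤ δ → ‖e r‖ ≤ C := fun r hr hrδ => by
    have := hC (y := r) (by rw [Real.dist_eq, sub_zero, abs_of_pos hr]; linarith) hr
    simpa using this
  have hpint : ∀ s, 0 < s → ∀ k : ℤ, IntervalIntegrable (fun r : ℝ => r ^ k) volume s δ := by
    intro s hs k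
    refine intervalIntegral.intervalIntegrable_zpow (Or.inr ?_)
    rw [Set.mem_uIcc]
    rintro (h | h) <;> linarith [h.1, h.2]
  have hsumint : ∀ s, 0 < s → IntervalIntegrable
      (fun r : ℝ => ∑ k ∈ Finset.Ico m (-2), r ^ (k + 2) * c k) volume s δ := fun s hs => by
    have h := IntervalIntegrable.sum (Finset.Ico m (-2)) (f := fun k r => r ^ (k + 2) * c k)
      fun k _ => (hpint s hs (k + 2)).mul_const (c k)
    rwa [Finset.sum_fn] at h
  have hbint : ∀ s, 0 < s → IntervalIntegrable b volume s δ := fun s hs => by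
    rw [intervalIntegrable_iff]
    refine (hb (min s δ / 2) (by positivity)).mono_set fun r hr => ?_
    rw [Set.mem_uIoc] at hr
    have := min_le_left s δ
    have := min_le_right s δ
    have : 0 < min s δ := lt_min hs hδ
    rw [Set.mem_Ioi]
    rcases hr with h | h <;> linarith [h.1]
  have heint : ∀ s, 0 < s → IntervalIntegrable e volume s δ := fun s hs =>
    (hbint s hs).sub (hsumint s hs)
  -- The intervals `(δ / (n + 2), δ]` exhaust `(0, δ]`, and the integral of the norm over each is at
  -- most `C δ`.
  have heint0 : IntegrableOn e (Set.Ioc 0 δ) := by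
    refine integrableOn_Ioc_of_intervalIntegral_norm_bounded_left (ι := ℕ) (l := atTop)
      (a := fun n => δ / (n + 2)) (I := C * δ) (fun n => ?_) ?_ (Eventually.of_forall fun n => ?_)
    · exact (heint _ (by positivity)).1
    · have := tendsto_const_div_atTop_nhds_zero_nat δ
      have h2 := this.comp (tendsto_add_atTop_nat 2)
      refine h2.congr fun n => ?_
      simp
    · have hle : δ / (n + 2) ≤ δ := div_le_self hδ.le (by linarith [n.cast_nonneg (α := ℝ)])
      have hpos : 0 < δ / ((n : ℝ) + 2) := by positivity
      have h1 := norm_setIntegral_le_of_norm_le_const (μ := volume)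
        (s := Set.Ioc (δ / ((n : ℝ) + 2)) δ) (f := fun r => ‖e r‖) (C := C) (by simp)
        (fun r hr => by rw [norm_norm]; exact heC r (hpos.trans hr.1) hr.2)
      rw [Real.volume_real_Ioc_of_le hle] at h1
      have hC0 : 0 ≤ C := (norm_nonneg _).trans (heC δ hδ le_rfl)
      refine (le_abs_self _).trans (h1.trans ?_)
      exact mul_le_mul_of_nonneg_left (by linarith) hC0
  have hlim : Tendsto (fun s => ∫ r in s..δ, e r) (𝓝[>] 0) (𝓝 (∫ r in (0 : ℝ)..δ, e r)) := by
    have h1 := intervalIntegral.continuousOn_primitive_interval_left (a := 0) (b := δ) (f := e)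
      (μ := volume) (by
        rw [Set.uIcc_of_le hδ.le]
        rwa [integrableOn_Icc_iff_integrableOn_Ioc])
    have h2 := h1 0 Set.left_mem_uIcc
    refine h2.mono_left ?_
    rw [Set.uIcc_of_le hδ.le]
    have : 𝓝[>] (0 : ℝ) = 𝓝[Set.Ioc 0 δ] 0 := (nhdsWithin_Ioc_eq_nhdsGT hδ).symm
    rw [this]
    exact nhdsWithin_mono _ Set.Ioc_subset_Icc_self
  refine ⟨(∫ r in (0 : ℝ)..δ, e r) + ((∫ r in Set.Ioi δ, b r) +
    ∑ k ∈ Finset.Ico m (-3), c k * (δ ^ (k + 3) / ((k : ℝ) + 3)) + c (-3) * Real.log (δ / s₀)), ?_⟩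
  refine (hlim.add_const _).congr' ?_
  filter_upwards [self_mem_nhdsWithin] with s hs
  have hs' : (0 : ℝ) < s := hs
  have h0 : (0 : ℝ) ∉ Set.uIcc s δ := by
    rw [Set.mem_uIcc]
    rintro (h | h) <;> linarith [h.1, h.2]
  have e1 := intervalIntegral.integral_interval_add_Ioi (hb s hs') (hb δ hδ)
  have e2 : ∫ r in s..δ, b r = (∫ r in s..δ, e r) +
      ∑ k ∈ Finset.Ico m (-2), (∫ r in s..δ, r ^ (k + 2)) * c k := by
    rw [← Finset.sum_congr rfl fun k _ => intervalIntegral.integral_mul_const _ _,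
      ← intervalIntegral.integral_finsetSum fun k _ => (hpint s hs' _).mul_const _,
      ← intervalIntegral.integral_add (heint s hs') (hsumint s hs')]
    refine intervalIntegral.integral_congr fun r _ => ?_
    simp [he]
  have e3 : ∑ k ∈ Finset.Ico m (-2), (∫ r in s..δ, r ^ (k + 2)) * c k =
      ∑ k ∈ Finset.Ico m (-3), (δ ^ (k + 3) - s ^ (k + 3)) / ((k : ℝ) + 3) * c k +
        Real.log (δ / s) * c (-3) := by
    rw [show (-2 : ℤ) = -3 + 1 by norm_num, ← Finset.sum_Ico_add_eq_sum_Ico_add_one hm]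
    congr 1
    · refine Finset.sum_congr rfl fun k hk => ?_
      rw [Finset.mem_Ico] at hk
      rw [integral_zpow (Or.inr ⟨by omega, h0⟩)]
      push_cast
      rw [add_assoc, add_assoc]
      norm_num
    · congr 1
      rw [← integral_inv_of_pos hs' hδ]
      norm_num
  rw [← e1, e2, e3, Real.log_div hδ.ne' hs'.ne', Real.log_div hδ.ne' hs₀.ne',
    Real.log_div hs'.ne' hs₀.ne']
  have e4 : ∑ k ∈ Finset.Ico m (-3), (δ ^ (k + 3) - s ^ (k + 3)) / ((k : ℝ) + 3) * c k =
      ∑ k ∈ Finset.Ico m (-3), c k * (δ ^ (k + 3) / ((k : ℝ) + 3)) -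
        ∑ k ∈ Finset.Ico m (-3), s ^ (k + 3) / ((k : ℝ) + 3) * c k := by
    rw [← Finset.sum_sub_distrib]
    refine Finset.sum_congr rfl fun k _ => ?_
    ring
  rw [e4]
  ring

/-! ### The flux through a sphere -/

theorem hasFDerivAt_dir (n : S2) : HasFDerivAt (fun x : E => (dir x : E))
    (ContinuousLinearMap.id ℝ E - (innerSL ℝ (n : E)).smulRight (n : E)) n := by
  have hn := sphere_ne_zero n
  have h1 := (hasDerivAt_inv (norm_ne_zero_iff.2 hn)).comp_hasFDerivAt (n : E) (hasFDerivAt_norm' hn)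
  have h2 := h1.smul (hasFDerivAt_id (𝕜 := ℝ) (n : E))
  have h3 : (fun x : E => (dir x : E)) =ᶠ[𝓝 (n : E)] fun x => ‖x‖⁻¹ • x := by
    filter_upwards [isOpen_ne.mem_nhds hn] with x hx
    exact dir_coe hx
  refine (h2.congr_of_eventuallyEq h3).congr_fderiv ?_
  ext v : 1
  simp [sub_eq_add_neg]

variable {U : E → ℝ}

theorem contDiffOn_scaled (hU : ContDiffOn ℝ ∞ U {0}ᶜ) {r : ℝ} (hr : 0 < r) :
    (fun n : S2 => U (r • (n : E))) ∈ smoothSphere :=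
  hU.comp (contDiffOn_dir.const_smul r) fun _ _ =>
    smul_ne_zero hr.ne' (sphere_ne_zero _)

theorem fderiv_scaled (hU : ContDiffOn ℝ ∞ U {0}ᶜ) {r : ℝ} (hr : 0 < r) (i : Fin 3) (n : S2) :
    r * fderiv ℝ U (r • (n : E)) (ee i) =
      r * ((n : E) i * fderiv ℝ U (r • (n : E)) n) +
        (sphD i ⟨_, contDiffOn_scaled hU hr⟩).1 n := by
  have hx : r • (n : E) ≠ 0 := smul_ne_zero hr.ne' (sphere_ne_zero n)
  have h1 := (differentiableAt_of_contDiffOn hU hx).hasFDerivAt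
  have h2 : HasFDerivAt (fun x : E => U (r • (dir x : E)))
      ((fderiv ℝ U (r • (n : E))).comp (r • (ContinuousLinearMap.id ℝ E -
        (innerSL ℝ (n : E)).smulRight (n : E)))) n := by
    rw [← dir_sphere n] at h1
    have := h1.comp (n : E) ((hasFDerivAt_dir n).const_smul r)
    rwa [dir_sphere] at this
  have h3 : (sphD i ⟨_, contDiffOn_scaled hU hr⟩).1 n =
      fderiv ℝ (fun x : E => U (r • (dir x : E))) n (ee i) := rfl
  rw [h3, h2.fderiv]
  simp [EuclideanSpace.inner_single_right]
  ring

/-- Decompose the gradient into radial and tangential parts. The radial part is the derivative of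
the spherical mean, and by `sInt_sphD` the tangential part contributes the derivative `2 r` of the
area factor. -/
theorem hasDerivAt_flux (hU : ContDiffOn ℝ ∞ U {0}ᶜ) {r : ℝ} (hr : 0 < r) (i : Fin 3) :
    HasDerivAt (fun r : ℝ => r ^ 2 * ∫ n : S2, (nn i).1 n * U (r • (n : E)) ∂sigma)
      (r ^ 2 * ∫ n : S2, fderiv ℝ U (r • (n : E)) (ee i) ∂sigma) r := by
  have hU' : ContinuousOn (fderiv ℝ U) {0}ᶜ :=
    (hU.fderiv_of_isOpen isOpen_punctured (m := ∞) (by simp)).continuousOn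
  have hcont : ∀ s : ℝ, 0 < s → Continuous fun n : S2 => (nn i).1 n * U (s • (n : E)) :=
    fun s hs => (nn i).continuous.mul (SM.continuous ⟨_, contDiffOn_scaled hU hs⟩)
  have hcont1 : Continuous fun n : S2 => fderiv ℝ U (r • (n : E)) :=
    hU'.comp_continuous (by fun_prop) fun n => smul_ne_zero hr.ne' (sphere_ne_zero n)
  obtain ⟨C, hC⟩ := ((isCompact_closedBall (0 : E) (2 * r)).diff
    (Metric.isOpen_ball (x := (0 : E)) (ε := r / 2))).exists_bound_of_continuousOn
      (hU'.mono fun x hx => by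
        rintro rfl
        exact hx.2 (Metric.mem_ball_self (by positivity)))
  have key := hasDerivAt_integral_of_dominated_loc_of_deriv_le (μ := sigma)
    (F := fun s (n : S2) => (nn i).1 n * U (s • (n : E)))
    (F' := fun s (n : S2) => (nn i).1 n * fderiv ℝ U (s • (n : E)) n) (bound := fun _ => C)
    (x₀ := r) (s := Set.Ioo (r / 2) (2 * r)) (Ioo_mem_nhds (by linarith) (by linarith))
    (by
      filter_upwards [lt_mem_nhds hr] with s hs
      exact (hcont s hs).aestronglyMeasurable)
    (integrable_sphere (hcont r hr))
    ((nn i).continuous.mul (hcont1.clm_apply continuous_subtype_val)).aestronglyMeasurable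
    (Eventually.of_forall fun n s hs => by
      have hs0 : 0 < s := by linarith [hs.1]
      have hnorm : ‖s • (n : E)‖ = s := by
        rw [norm_smul, norm_sphere, Real.norm_of_nonneg hs0.le, mul_one]
      have h1 := hC (s • (n : E)) ⟨by
        rw [mem_closedBall_zero_iff, hnorm]
        exact hs.2.le, by
        rw [mem_ball_zero_iff, hnorm]
        linarith [hs.1]⟩
      have h2 := (fderiv ℝ U (s • (n : E))).le_opNorm n
      rw [norm_sphere, mul_one] at h2
      have h3 : ‖(nn i).1 n‖ ≤ 1 := by
        have := EuclideanSpace.norm_eq (n : E)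
        have h4 := PiLp.norm_apply_le (n : E) i
        rw [norm_sphere] at h4
        exact h4
      rw [norm_mul]
      calc _ ≤ 1 * C := mul_le_mul h3 (h2.trans h1) (norm_nonneg _) zero_le_one
        _ = C := one_mul C)
    (integrable_const C)
    (Eventually.of_forall fun n s hs => by
      have hs0 : 0 < s := by linarith [hs.1]
      have hx : s • (n : E) ≠ 0 := smul_ne_zero hs0.ne' (sphere_ne_zero n)
      have h1 := (differentiableAt_of_contDiffOn hU hx).hasFDerivAt.comp_hasDerivAt s
        ((hasDerivAt_id s).smul_const (n : E))
      simp only [one_smul] at h1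
      exact h1.const_mul _)
  have h2 := (hasDerivAt_pow 2 r).mul key.2
  refine h2.congr_deriv ?_
  have h3 : ∀ n : S2, fderiv ℝ U (r • (n : E)) (ee i) = (nn i).1 n * fderiv ℝ U (r • (n : E)) n +
      r⁻¹ * (sphD i ⟨_, contDiffOn_scaled hU hr⟩).1 n := by
    intro n
    have := fderiv_scaled hU hr i n
    change _ = (n : E) i * _ + _
    field_simp
    linarith
  rw [integral_congr_ae (Eventually.of_forall h3), integral_add key.1
    ((integrable_sphere (SM.continuous _)).const_mul _), integral_const_mul, ← sInt_apply,
    sInt_sphD, sInt_apply]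
  change 2 * r ^ 1 * (∫ n : S2, (nn i).1 n * U (r • (n : E)) ∂sigma) + _ =
    r ^ 2 * (_ + r⁻¹ * (2 * ∫ n : S2, (nn i).1 n * U (r • (n : E)) ∂sigma))
  field_simp
  ring

/-! ### Vanishing of the flux at infinity -/

/-- Integrate by parts against a cutoff `η(x / N)`. Its gradient is `O(N⁻¹)` and lives where `N ≤
‖x‖ ≤ 2N`, a region of volume `O(N ^ 3)`, on which `w` is `o(N⁻²)`. -/
theorem integral_fderiv_eq_zero_of_isLittleO {w : E → ℝ} (hw : ContDiff ℝ 1 w) (v : E)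
    (hi : Integrable fun x => fderiv ℝ w x v)
    (ho : w =o[cocompact E] fun x => ‖x‖ ^ (-2 : ℤ)) : ∫ x, fderiv ℝ w x v = 0 := by
  set η : ContDiffBump (0 : E) := ⟨1, 2, one_pos, one_lt_two⟩ with hη
  have hη1 : ContDiff ℝ 1 η := η.contDiff
  have hηN : ∀ N : ℝ, ContDiff ℝ 1 fun x : E => η (N⁻¹ • x) := fun N =>
    hη1.comp (contDiff_const_smul _)
  obtain ⟨B, hB⟩ := (hη1.continuous_fderiv (by simp)).bounded_above_of_compact_support
    (η.hasCompactSupport.fderiv (𝕜 := ℝ))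
  have hfd : ∀ N : ℝ, 0 < N → ∀ x : E, fderiv ℝ (fun x : E => η (N⁻¹ • x)) x v =
      N⁻¹ * fderiv ℝ η (N⁻¹ • x) v := by
    intro N hN x
    have h1 := ((hη1.differentiable (by simp)) (N⁻¹ • x)).hasFDerivAt.comp x
      ((hasFDerivAt_id (𝕜 := ℝ) x).const_smul N⁻¹)
    have h2 := h1.fderiv
    rw [Function.comp_def] at h2
    change fderiv ℝ (fun x : E => η (N⁻¹ • x)) x = _ at h2
    rw [h2]
    simp
  have hcs : ∀ N : ℝ, 0 < N → HasCompactSupport fun x : E => η (N⁻¹ • x) := fun N hN => by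
    refine HasCompactSupport.intro (isCompact_closedBall (0 : E) (2 * N)) fun x hx => ?_
    refine η.zero_of_le_dist ?_
    rw [mem_closedBall_zero_iff, not_le] at hx
    change 2 ≤ dist (N⁻¹ • x) 0
    rw [dist_zero_right, norm_smul, norm_inv, Real.norm_of_nonneg hN.le, inv_mul_eq_div,
      le_div_iff₀ hN]
    exact hx.le
  have hparts : ∀ N : ℝ, 0 < N → ∫ x, η (N⁻¹ • x) * fderiv ℝ w x v =
      -∫ x, fderiv ℝ (fun x : E => η (N⁻¹ • x)) x v * w x := by
    intro N hN
    refine integral_mul_fderiv_eq_neg_fderiv_mul_of_integrable ?_ ?_ ?_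
      (fun x _ => (hηN N).differentiable (by simp) x) (fun x _ => hw.differentiable (by simp) x)
    · exact ((((hηN N).continuous_fderiv (by simp)).clm_apply continuous_const).mul
        hw.continuous).integrable_of_hasCompactSupport
          (((hcs N hN).fderiv_apply (𝕜 := ℝ) v).mul_right)
    · exact ((hηN N).continuous.mul ((hw.continuous_fderiv (by simp)).clm_apply
        continuous_const)).integrable_of_hasCompactSupport ((hcs N hN).mul_right)
    · exact ((hηN N).continuous.mul hw.continuous).integrable_of_hasCompactSupport
        ((hcs N hN).mul_right)
  have hL : Tendsto (fun N : ℝ => ∫ x, η (N⁻¹ • x) * fderiv ℝ w x v) atTop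
      (𝓝 (∫ x, fderiv ℝ w x v)) := by
    refine tendsto_integral_filter_of_dominated_convergence (fun x => ‖fderiv ℝ w x v‖)
      (Eventually.of_forall fun N => ?_) (Eventually.of_forall fun N => Eventually.of_forall
        fun x => ?_) hi.norm (Eventually.of_forall fun x => ?_)
    · exact ((hηN N).continuous.mul ((hw.continuous_fderiv (by simp)).clm_apply
        continuous_const)).aestronglyMeasurable
    · rw [norm_mul, Real.norm_of_nonneg η.nonneg]
      exact mul_le_of_le_one_left (norm_nonneg _) η.le_one
    · refine tendsto_const_nhds.congr' ?_
      filter_upwards [eventually_ge_atTop ‖x‖, eventually_gt_atTop 0] with N hN hN0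
      rw [η.one_of_mem_closedBall, one_mul]
      rw [mem_closedBall_zero_iff, norm_smul, norm_inv, Real.norm_of_nonneg hN0.le, inv_mul_eq_div]
      exact (div_le_one hN0).2 hN
  have hR : Tendsto (fun N : ℝ => -∫ x, fderiv ℝ (fun x : E => η (N⁻¹ • x)) x v * w x) atTop
      (𝓝 0) := by
    rw [Metric.tendsto_atTop]
    intro ε hε
    set V := volume.real (Metric.ball (0 : E) 1) with hV
    set D := B * ‖v‖ * (8 * V) + 1 with hD
    have hB0 : 0 ≤ B := (norm_nonneg _).trans (hB 0)
    have hV0 : 0 ≤ V := measureReal_nonneg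
    have hDpos : 0 < D := by positivity
    have h1 := ho.bound (show 0 < ε / (2 * D) by positivity)
    obtain ⟨R, -, hR⟩ := ((Metric.hasBasis_cobounded_compl_closedBall (0 : E)).eventually_iff).1
      (Metric.cobounded_eq_cocompact (α := E) ▸ h1)
    refine ⟨max (R + 1) 1, fun N hN => ?_⟩
    have hN1 : 1 ≤ N := (le_max_right _ _).trans hN
    have hNR : R < N := by linarith [(le_max_left (R + 1) 1).trans hN]
    have hN0 : 0 < N := by linarith
    have hpt : ∀ x : E, ‖fderiv ℝ (fun x : E => η (N⁻¹ • x)) x v * w x‖ ≤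
        N⁻¹ * (B * ‖v‖) * (ε / (2 * D) * N ^ (-2 : ℤ)) := by
      intro x
      by_cases hx : ‖x‖ < N
      · have : (fun x : E => η (N⁻¹ • x)) =ᶠ[𝓝 x] fun _ => 1 := by
          filter_upwards [Metric.isOpen_ball.mem_nhds (mem_ball_zero_iff.2 hx)] with z hz
          refine η.one_of_mem_closedBall ?_
          rw [mem_closedBall_zero_iff, norm_smul, norm_inv, Real.norm_of_nonneg hN0.le,
            inv_mul_eq_div]
          exact (div_le_one hN0).2 (mem_ball_zero_iff.1 hz).le
        rw [this.fderiv_eq]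
        rw [fderiv_fun_const, Pi.zero_apply, _root_.zero_apply, zero_mul, norm_zero]
        positivity
      · push Not at hx
        have hwx := hR (x := x) (by simpa using hNR.trans_le hx)
        rw [norm_zpow, norm_norm] at hwx
        have hz : ‖x‖ ^ (-2 : ℤ) ≤ N ^ (-2 : ℤ) := by
          rw [zpow_neg, zpow_neg]
          refine inv_anti₀ (by positivity) ?_
          exact_mod_cast pow_le_pow_left₀ hN0.le hx 2
        rw [hfd N hN0, norm_mul, norm_mul, norm_inv, Real.norm_of_nonneg hN0.le]
        refine mul_le_mul (mul_le_mul_of_nonneg_left ?_ (by positivity)) (hwx.trans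
          (mul_le_mul_of_nonneg_left hz (by positivity))) (norm_nonneg _) (by positivity)
        exact ((fderiv ℝ η (N⁻¹ • x)).le_opNorm v).trans
          (mul_le_mul_of_nonneg_right (hB _) (norm_nonneg _))
    have hset : ∫ x, fderiv ℝ (fun x : E => η (N⁻¹ • x)) x v * w x =
        ∫ x in Metric.closedBall (0 : E) (2 * N),
          fderiv ℝ (fun x : E => η (N⁻¹ • x)) x v * w x := by
      symm
      refine setIntegral_eq_integral_of_forall_compl_eq_zero fun x hx => ?_
      have : (fun x : E => η (N⁻¹ • x)) =ᶠ[𝓝 x] fun _ => 0 := by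
        filter_upwards [Metric.isClosed_closedBall.isOpen_compl.mem_nhds hx] with z hz
        refine η.zero_of_le_dist ?_
        rw [Set.mem_compl_iff, mem_closedBall_zero_iff, not_le] at hz
        change 2 ≤ dist (N⁻¹ • z) 0
        rw [dist_zero_right, norm_smul, norm_inv, Real.norm_of_nonneg hN0.le, inv_mul_eq_div,
          le_div_iff₀ hN0]
        exact hz.le
      rw [this.fderiv_eq]
      simp
    have hbd := norm_setIntegral_le_of_norm_le_const (μ := (volume : Measure E))
      (s := Metric.closedBall (0 : E) (2 * N)) measure_closedBall_lt_top fun x _ => hpt x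
    rw [Measure.addHaar_real_closedBall _ _ (by positivity), ← hset, finrank_euclideanSpace_fin,
      ← hV] at hbd
    rw [dist_zero_right, norm_neg]
    refine hbd.trans_lt ?_
    -- The powers `N⁻¹`, `N⁻²` and `N ^ 3` cancel exactly, leaving `ε / (2 D)` times a number
    -- smaller than `D`.
    have e1 : N⁻¹ * (B * ‖v‖) * (ε / (2 * D) * N ^ (-2 : ℤ)) * ((2 * N) ^ 3 * V) =
        (B * ‖v‖ * (8 * V)) * (ε / (2 * D)) := by
      rw [zpow_neg, zpow_ofNat]
      field_simp
      ring
    rw [e1]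
    have : B * ‖v‖ * (8 * V) < D := by linarith
    calc _ ≤ D * (ε / (2 * D)) := mul_le_mul_of_nonneg_right this.le (by positivity)
      _ = ε / 2 := by field_simp
      _ < ε := by linarith
  refine tendsto_nhds_unique (hL.congr' ?_) hR
  filter_upwards [eventually_gt_atTop 0] with N hN
  exact hparts N hN

end

end Hadamard


namespace Hadamard

noncomputable section

variable {y₁ y₂ : E}

/-! ### The partie finie of an integral -/

/-- The complement of the balls of radius `s` about the singular points. -/
def outer (y₁ y₂ : E) (s : ℝ) : Set E := (Metric.closedBall y₁ s ∪ Metric.closedBall y₂ s)ᶜ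

/-- The partie finie of the integral of `X` exists and equals `l`. -/
def HasPf (y₁ y₂ : E) (s₁ s₂ : ℝ) (X : E → ℝ) (l : ℝ) : Prop :=
  Tendsto (fun s => (∫ x in outer y₁ y₂ s, X x) + divergentPart y₁ s₁ X s + divergentPart y₂ s₂ X s)
    (𝓝[>] 0) (𝓝 l)

theorem HasPf.pfIntegral_eq {s₁ s₂ : ℝ} {X : E → ℝ} {l : ℝ} (h : HasPf y₁ y₂ s₁ s₂ X l) :
    pfIntegral y₁ y₂ s₁ s₂ X = l :=
  Tendsto.limUnder_eq h

theorem divergentPart_eq (p : SPt y₁ y₂) (s₀ : ℝ) (X : singularSpace y₁ y₂) {m : ℤ}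
    (hm : ∀ k < m, (ls p X).coeff k = 0) (s : ℝ) :
    divergentPart p.1 s₀ X s =
      (∑ k ∈ Finset.Ico m (-3), s ^ (k + 3) / ((k : ℝ) + 3) * sInt ((ls p X).coeff k)) +
        Real.log (s / s₀) * sInt ((ls p X).coeff (-3)) := by
  have h1 : ∀ k, sphereInt (coef p.1 X k) = sInt ((ls p X).coeff k) := fun k => by
    rw [coef_ls]
    rfl
  unfold divergentPart
  simp only [h1, finsum_eq_if]
  congr 1
  rw [finsum_eq_sum_of_support_subset (s := Finset.Ico m (-3))]
  · refine Finset.sum_congr rfl fun k hk => ?_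
    rw [Finset.mem_Ico] at hk
    rw [if_pos (by omega)]
  · intro k hk
    rw [Function.mem_support] at hk
    rw [Finset.coe_Ico, Set.mem_Ico]
    refine ⟨?_, ?_⟩
    · by_contra hlt
      refine hk ?_
      rw [hm k (by omega), map_zero, mul_zero, ite_self]
    · by_contra hlt
      exact hk (if_neg (by omega))

theorem exists_low (A : HahnSeries ℤ SM) (m₀ : ℤ) : ∃ m ≤ m₀, ∀ k < m, A.coeff k = 0 :=
  ⟨min m₀ A.order, min_le_left _ _, fun _ hk =>
    HahnSeries.coeff_eq_zero_of_lt_order (hk.trans_le (min_le_right _ _))⟩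

theorem divergentPart_add (p : SPt y₁ y₂) (s₀ : ℝ) (X Y : singularSpace y₁ y₂) (s : ℝ) :
    divergentPart p.1 s₀ (X + Y : singularSpace y₁ y₂) s =
      divergentPart p.1 s₀ X s + divergentPart p.1 s₀ Y s := by
  obtain ⟨m, -, hm⟩ := exists_low (ls p X) 0
  obtain ⟨m', hm'm, hm'⟩ := exists_low (ls p Y) m
  have hX : ∀ k < m', (ls p X).coeff k = 0 := fun k hk => hm k (by omega)
  rw [divergentPart_eq p s₀ X hX, divergentPart_eq p s₀ Y hm', divergentPart_eq p s₀ (X + Y)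
    (m := m') (fun k hk => by rw [map_add, HahnSeries.coeff_add, hX k hk, hm' k hk, add_zero])]
  simp only [map_add, HahnSeries.coeff_add, mul_add, Finset.sum_add_distrib]
  ring

theorem divergentPart_of_ls_eq_zero (p : SPt y₁ y₂) (s₀ : ℝ) {X : singularSpace y₁ y₂}
    (h : ls p X = 0) (s : ℝ) : divergentPart p.1 s₀ X s = 0 := by
  rw [divergentPart_eq p s₀ X (m := 0) (fun k _ => by rw [h]; rfl), h]
  simp

theorem integrableOn_outer {X : E → ℝ} (hX : ContDiffOn ℝ ∞ X {x | ¬ (x = y₁ ∨ x = y₂)})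
    (hi : IntegrableAtFilter X (cocompact E)) {s : ℝ} (hs : 0 < s) :
    IntegrableOn X (outer y₁ y₂ s) := by
  obtain ⟨t, ht, hi⟩ := hi
  obtain ⟨K, hK, hKt⟩ := mem_cocompact.1 ht
  have h1 : IntegrableOn X (K \ (Metric.ball y₁ s ∪ Metric.ball y₂ s)) := by
    refine ContinuousOn.integrableOn_compact (hK.diff (Metric.isOpen_ball.union Metric.isOpen_ball))
      (hX.continuousOn.mono fun x hx => ?_)
    rintro (rfl | rfl)
    · exact hx.2 (Or.inl (Metric.mem_ball_self hs))
    · exact hx.2 (Or.inr (Metric.mem_ball_self hs))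
  refine (h1.union hi).mono_set fun x hx => ?_
  by_cases hxK : x ∈ K
  · refine Or.inl ⟨hxK, fun h => hx ?_⟩
    exact h.imp (fun h => Metric.ball_subset_closedBall h) fun h => Metric.ball_subset_closedBall h
  · exact Or.inr (hKt hxK)

theorem HasPf.add {s₁ s₂ : ℝ} {X Y : singularSpace y₁ y₂} {l l' : ℝ}
    (hX : HasPf y₁ y₂ s₁ s₂ X l) (hY : HasPf y₁ y₂ s₁ s₂ Y l')
    (hXi : IntegrableAtFilter (X : E → ℝ) (cocompact E))
    (hYi : IntegrableAtFilter (Y : E → ℝ) (cocompact E)) :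
    HasPf y₁ y₂ s₁ s₂ (X + Y : singularSpace y₁ y₂) (l + l') := by
  refine (Tendsto.add hX hY).congr' ?_
  filter_upwards [self_mem_nhdsWithin] with s hs
  have h1 := divergentPart_add ⟨y₁, Or.inl rfl⟩ s₁ X Y s
  have h2 := divergentPart_add ⟨y₂, Or.inr rfl⟩ s₂ X Y s
  have h3 : ∫ x in outer y₁ y₂ s, (X + Y : singularSpace y₁ y₂).1 x =
      (∫ x in outer y₁ y₂ s, X.1 x) + ∫ x in outer y₁ y₂ s, Y.1 x :=
    integral_add (integrableOn_outer X.2.1 hXi hs) (integrableOn_outer Y.2.1 hYi hs)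
  rw [h3]
  simp only at h1 h2
  rw [h1, h2]
  ring

/-! ### Functions vanishing near the singular points -/

/-- `R` vanishes near the singular points. -/
def Flat (y₁ y₂ : E) (R : E → ℝ) : Prop :=
  ∀ p : SPt y₁ y₂, ∀ x ∈ Metric.ball p.1 (dist y₁ y₂ / 4), R x = 0

theorem Flat.ls_eq_zero (hy : y₁ ≠ y₂) {R : singularSpace y₁ y₂} (h : Flat y₁ y₂ R)
    (p : SPt y₁ y₂) : ls p R = 0 := by
  refine HasLS.ls_eq ((hasLS_zero p.1).congr' ?_)
  have hpos := dist_pos.2 hy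
  filter_upwards [nhdsWithin_le_nhds (Metric.ball_mem_nhds p.1 (show 0 < dist y₁ y₂ / 4 by positivity))]
    with x hx
  exact (h p x hx).symm

theorem Flat.dd {R : singularSpace y₁ y₂} (h : Flat y₁ y₂ R) (i : Fin 3) :
    Flat y₁ y₂ (dd i R) := by
  intro p x hx
  change pd y₁ y₂ i R x = 0
  have : (R : E → ℝ) =ᶠ[𝓝 x] fun _ => 0 := by
    filter_upwards [Metric.isOpen_ball.mem_nhds hx] with z hz
    exact h p z hz
  rw [pd, this.fderiv_eq]
  simp

theorem Flat.contDiff (hy : y₁ ≠ y₂) {R : singularSpace y₁ y₂} (h : Flat y₁ y₂ R) :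
    ContDiff ℝ ∞ (R : E → ℝ) := by
  rw [contDiff_iff_contDiffAt]
  intro x
  by_cases hx : x = y₁ ∨ x = y₂
  · have hpos := dist_pos.2 hy
    have : (R : E → ℝ) =ᶠ[𝓝 x] fun _ => 0 := by
      filter_upwards [Metric.ball_mem_nhds x (show 0 < dist y₁ y₂ / 4 by positivity)] with z hz
      exact h ⟨x, hx⟩ z hz
    exact contDiffAt_const.congr_of_eventuallyEq this
  · exact R.2.1.contDiffAt ((isOpen_regular y₁ y₂).mem_nhds hx)

theorem Flat.support_subset {R : E → ℝ} (h : Flat y₁ y₂ R) {s : ℝ} (hs : s < dist y₁ y₂ / 4) :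
    Function.support R ⊆ outer y₁ y₂ s := by
  intro x hx hx'
  rcases hx' with hx' | hx'
  · exact hx (h ⟨y₁, Or.inl rfl⟩ x (Metric.closedBall_subset_ball hs hx'))
  · exact hx (h ⟨y₂, Or.inr rfl⟩ x (Metric.closedBall_subset_ball hs hx'))

theorem Flat.integrable (hy : y₁ ≠ y₂) {R : singularSpace y₁ y₂} (h : Flat y₁ y₂ R)
    (hi : IntegrableAtFilter (R : E → ℝ) (cocompact E)) : Integrable (R : E → ℝ) := by
  have hpos := dist_pos.2 hy
  exact (integrableOn_iff_integrable_of_support_subset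
    (h.support_subset (show dist y₁ y₂ / 8 < dist y₁ y₂ / 4 by linarith))).1
      (integrableOn_outer R.2.1 hi (by positivity))

theorem Flat.hasPf (hy : y₁ ≠ y₂) (s₁ s₂ : ℝ) {R : singularSpace y₁ y₂} (h : Flat y₁ y₂ R) :
    HasPf y₁ y₂ s₁ s₂ R (∫ x, R.1 x) := by
  have hpos := dist_pos.2 hy
  refine tendsto_const_nhds.congr' ?_
  filter_upwards [nhdsWithin_le_nhds (gt_mem_nhds (show 0 < dist y₁ y₂ / 4 by positivity))] with s hs
  have h1 := divergentPart_of_ls_eq_zero ⟨y₁, Or.inl rfl⟩ s₁ (h.ls_eq_zero hy ⟨y₁, Or.inl rfl⟩) s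
  have h2 := divergentPart_of_ls_eq_zero ⟨y₂, Or.inr rfl⟩ s₂ (h.ls_eq_zero hy ⟨y₂, Or.inr rfl⟩) s
  simp only at h1 h2
  rw [h1, h2, add_zero, add_zero, setIntegral_eq_integral_of_forall_compl_eq_zero]
  intro x hx
  by_contra hne
  exact hx (h.support_subset hs hne)

theorem Flat.hasPf_dd (hy : y₁ ≠ y₂) (s₁ s₂ : ℝ) {R : singularSpace y₁ y₂} (h : Flat y₁ y₂ R)
    (i : Fin 3) (hi : IntegrableAtFilter (Hadamard.dd i R : E → ℝ) (cocompact E))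
    (ho : (R : E → ℝ) =o[cocompact E] fun x => ‖x‖ ^ (-2 : ℤ)) :
    HasPf y₁ y₂ s₁ s₂ (Hadamard.dd i R) 0 := by
  have h1 := (h.dd i).hasPf hy s₁ s₂
  have e : ((Hadamard.dd i R : singularSpace y₁ y₂) : E → ℝ) =
      fun x => fderiv ℝ (R : E → ℝ) x (ee i) := by
    funext x
    change pd y₁ y₂ i R x = _
    by_cases hx : x = y₁ ∨ x = y₂
    · have hpos := dist_pos.2 hy
      have : (R : E → ℝ) =ᶠ[𝓝 x] fun _ => 0 := by
        filter_upwards [Metric.ball_mem_nhds x (show 0 < dist y₁ y₂ / 4 by positivity)] with z hz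
        exact h ⟨x, hx⟩ z hz
      rw [pd, if_pos hx, this.fderiv_eq]
      simp
    · rw [pd, if_neg hx]
  have h2 := (h.dd i).integrable hy hi
  rw [e] at h2 h1 ⊢
  rwa [integral_fderiv_eq_zero_of_isLittleO ((h.contDiff hy).of_le (WithTop.coe_le_coe.2 le_top))
    (ee i) h2 ho] at h1

/-! ### Functions supported near one singular point -/

/-- `V` vanishes far from `p`. -/
def Near (y₁ y₂ : E) (p : E) (V : E → ℝ) : Prop := ∀ x, dist y₁ y₂ / 2 < dist x p → V x = 0

theorem Near.cocompact {p : E} {V : E → ℝ} (h : Near y₁ y₂ p V) : V =ᶠ[cocompact E] 0 := by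
  filter_upwards [(isCompact_closedBall p (dist y₁ y₂ / 2)).compl_mem_cocompact] with x hx
  refine h x ?_
  simpa using hx

theorem IntegrableAtFilter.congr_cocompact {X Y : E → ℝ} (h : IntegrableAtFilter X (cocompact E))
    (hXY : X =ᶠ[cocompact E] Y) : IntegrableAtFilter Y (cocompact E) := by
  obtain ⟨t, ht, hi⟩ := h
  obtain ⟨K, hK, hKt⟩ := mem_cocompact.1 (inter_mem ht hXY)
  refine ⟨Kᶜ, hK.compl_mem_cocompact, (hi.mono_set fun x hx => (hKt hx).1).congr_fun
    (fun x hx => (hKt hx).2) hK.isClosed.measurableSet.compl⟩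

theorem integrableAtFilter_of_eq_zero {V : E → ℝ} (h : V =ᶠ[cocompact E] 0) :
    IntegrableAtFilter V (cocompact E) :=
  IntegrableAtFilter.congr_cocompact ⟨Set.univ, univ_mem, integrable_zero _ _ _⟩ h.symm

theorem Near.dd {p : E} {V : singularSpace y₁ y₂} (h : Near y₁ y₂ p V) (i : Fin 3) :
    Near y₁ y₂ p (dd i V) := by
  intro x hx
  change pd y₁ y₂ i V x = 0
  have : (V : E → ℝ) =ᶠ[𝓝 x] fun _ => 0 := by
    have ho : IsOpen {x : E | dist y₁ y₂ / 2 < dist x p} :=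
      isOpen_lt continuous_const (continuous_id.dist continuous_const)
    filter_upwards [ho.mem_nhds hx] with z hz
    exact h z hz
  rw [pd, this.fderiv_eq]
  simp

theorem dist_SPt {p q : SPt y₁ y₂} (hpq : q ≠ p) : dist q.1 p.1 = dist y₁ y₂ := by
  obtain ⟨p, rfl | rfl⟩ := p <;> obtain ⟨q, rfl | rfl⟩ := q
  · exact absurd rfl hpq
  · exact dist_comm _ _
  · rfl
  · exact absurd rfl hpq

theorem Near.eq_zero {p q : SPt y₁ y₂} (hpq : q ≠ p) {V : E → ℝ} (h : Near y₁ y₂ p.1 V)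
    {x : E} (hx : dist x q.1 < dist y₁ y₂ / 2) : V x = 0 := by
  refine h x ?_
  have h1 := dist_triangle q.1 x p.1
  rw [dist_SPt hpq, dist_comm q.1 x] at h1
  linarith

theorem Near.ls_eq_zero (hy : y₁ ≠ y₂) {p q : SPt y₁ y₂} (hpq : q ≠ p) {V : singularSpace y₁ y₂}
    (h : Near y₁ y₂ p.1 V) : ls q V = 0 := by
  refine HasLS.ls_eq ((hasLS_zero q.1).congr' ?_)
  have hpos := dist_pos.2 hy
  filter_upwards [nhdsWithin_le_nhds (Metric.ball_mem_nhds q.1 (show 0 < dist y₁ y₂ / 2 by positivity))]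
    with x hx
  exact (h.eq_zero hpq hx).symm

theorem Near.contDiffOn (hy : y₁ ≠ y₂) {p : SPt y₁ y₂} {V : singularSpace y₁ y₂}
    (h : Near y₁ y₂ p.1 V) : ContDiffOn ℝ ∞ (fun x => V.1 (p.1 + x)) {0}ᶜ := by
  have h1 : ContDiffOn ℝ ∞ V.1 {p.1}ᶜ := by
    intro x hx
    refine ContDiffAt.contDiffWithinAt ?_
    by_cases hx' : x = y₁ ∨ x = y₂
    · have hpos := dist_pos.2 hy
      have : V.1 =ᶠ[𝓝 x] fun _ => 0 := by
        filter_upwards [Metric.ball_mem_nhds x (show 0 < dist y₁ y₂ / 2 by positivity)] with z hz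
        exact h.eq_zero (q := ⟨x, hx'⟩) (fun e => hx (congrArg Subtype.val e)) hz
      exact contDiffAt_const.congr_of_eventuallyEq this
    · exact V.2.1.contDiffAt ((isOpen_regular y₁ y₂).mem_nhds hx')
  exact h1.comp (contDiff_const.add contDiff_id).contDiffOn fun x hx => by
    simpa using hx

/-- The finite part contributed by the singular point `p`. -/
def HasPfAt (p : E) (s₀ : ℝ) (V : E → ℝ) (l : ℝ) : Prop :=
  Tendsto (fun s => (∫ x in (Metric.closedBall p s)ᶜ, V x) + divergentPart p s₀ V s) (𝓝[>] 0) (𝓝 l)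

theorem Near.integral_outer {p q : SPt y₁ y₂} (hpq : q ≠ p) {V : E → ℝ}
    (h : Near y₁ y₂ p.1 V) {s : ℝ} (hs : s < dist y₁ y₂ / 2) :
    ∫ x in (Metric.closedBall p.1 s)ᶜ, V x =
      ∫ x in (Metric.closedBall p.1 s ∪ Metric.closedBall q.1 s)ᶜ, V x := by
  refine setIntegral_eq_of_subset_of_forall_sdiff_eq_zero
    Metric.isClosed_closedBall.measurableSet.compl
    (Set.compl_subset_compl.2 Set.subset_union_left) fun x hx => ?_
  have hxq : x ∈ Metric.closedBall q.1 s := by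
    by_contra hxq
    exact hx.2 fun h => h.elim hx.1 hxq
  exact h.eq_zero hpq (lt_of_le_of_lt hxq hs)

theorem HasPfAt.hasPf_fst (hy : y₁ ≠ y₂) (s₁ s₂ : ℝ) {V : singularSpace y₁ y₂} {l : ℝ}
    (h : Near y₁ y₂ y₁ V) (hl : HasPfAt y₁ s₁ V l) : HasPf y₁ y₂ s₁ s₂ V l := by
  have hpos := dist_pos.2 hy
  have hne : (⟨y₂, Or.inr rfl⟩ : SPt y₁ y₂) ≠ ⟨y₁, Or.inl rfl⟩ :=
    fun e => hy (congrArg Subtype.val e).symm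
  refine Tendsto.congr' ?_ hl
  filter_upwards [nhdsWithin_le_nhds (gt_mem_nhds (show 0 < dist y₁ y₂ / 2 by positivity))] with s hs
  have h1 := Near.integral_outer hne h hs
  have h2 := divergentPart_of_ls_eq_zero ⟨y₂, Or.inr rfl⟩ s₂
    (Near.ls_eq_zero hy hne h) s
  simp only at h1 h2
  rw [h1, h2, add_zero]
  rfl

theorem HasPfAt.hasPf_snd (hy : y₁ ≠ y₂) (s₁ s₂ : ℝ) {V : singularSpace y₁ y₂} {l : ℝ}
    (h : Near y₁ y₂ y₂ V) (hl : HasPfAt y₂ s₂ V l) : HasPf y₁ y₂ s₁ s₂ V l := by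
  have hpos := dist_pos.2 hy
  have hne : (⟨y₁, Or.inl rfl⟩ : SPt y₁ y₂) ≠ ⟨y₂, Or.inr rfl⟩ :=
    fun e => hy (congrArg Subtype.val e)
  refine Tendsto.congr' ?_ hl
  filter_upwards [nhdsWithin_le_nhds (gt_mem_nhds (show 0 < dist y₁ y₂ / 2 by positivity))] with s hs
  have h1 := Near.integral_outer hne h hs
  have h2 := divergentPart_of_ls_eq_zero ⟨y₁, Or.inl rfl⟩ s₁
    (Near.ls_eq_zero hy hne h) s
  simp only at h1 h2
  rw [h1, h2, add_zero, Set.union_comm]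
  rfl

theorem Near.integrableOn (hy : y₁ ≠ y₂) {p : SPt y₁ y₂} {V : singularSpace y₁ y₂}
    (h : Near y₁ y₂ p.1 V) {s : ℝ} (hs : 0 < s) : IntegrableOn V.1 (Metric.closedBall p.1 s)ᶜ := by
  have hc : ContinuousOn V.1 {p.1}ᶜ := by
    have := (h.contDiffOn hy).continuousOn.comp (continuous_id.sub continuous_const).continuousOn
      (s := {p.1}ᶜ) (f := fun x : E => x - p.1) fun x hx => sub_ne_zero.2 hx
    refine this.congr fun x _ => ?_
    simp
  have h1 : IntegrableOn V.1 (Metric.closedBall p.1 (dist y₁ y₂ / 2) \ Metric.ball p.1 s) := by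
    refine ContinuousOn.integrableOn_compact ((isCompact_closedBall _ _).diff Metric.isOpen_ball)
      (hc.mono fun x hx => ?_)
    rintro rfl
    exact hx.2 (Metric.mem_ball_self hs)
  have h2 : IntegrableOn V.1 (Metric.ball p.1 s)ᶜ := by
    refine h1.of_forall_sdiff_eq_zero Metric.isOpen_ball.measurableSet.compl fun x hx => ?_
    refine h x ?_
    by_contra hx'
    exact hx.2 ⟨not_lt.1 hx', hx.1⟩
  exact h2.mono_set (Set.compl_subset_compl.2 Metric.ball_subset_closedBall)

theorem Near.integral_eq (hy : y₁ ≠ y₂) {p : SPt y₁ y₂} {V : singularSpace y₁ y₂}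
    (h : Near y₁ y₂ p.1 V) {s : ℝ} (hs : 0 < s) :
    ∫ x in (Metric.closedBall p.1 s)ᶜ, V.1 x =
      ∫ r in Set.Ioi s, r ^ 2 * ∫ n : S2, V.1 (p.1 + r • (n : E)) ∂sigma :=
  (integral_outside hs (h.integrableOn hy hs)).2

theorem Near.mean_expansion (hy : y₁ ≠ y₂) {p : SPt y₁ y₂} {V : singularSpace y₁ y₂}
    (h : Near y₁ y₂ p.1 V) (g : SM) {m : ℤ} (hm : ∀ k < m, (ls p V).coeff k = 0) (K : ℤ) :
    (fun r : ℝ => ∫ n : S2, g.1 n * V.1 (p.1 + r • (n : E)) ∂sigma -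
      ∑ k ∈ Finset.Ico m K, r ^ k * sInt (g * (ls p V).coeff k)) =O[𝓝[>] 0] fun r => r ^ K := by
  obtain ⟨m₀, hV⟩ := hasLS_ls p V
  have hT : Tame p.1 V (fun k => ((ls p V).coeff k).1) m := by
    have h1 := hV.of_le (min_le_right m m₀)
    refine ⟨fun k hk => by rw [hm k hk]; rfl, hV.bdd, fun K => (h1.exp K).congr_left fun x => ?_⟩
    congr 1
    refine (Finset.sum_subset (Finset.Ico_subset_Ico_left (min_le_left m m₀)) fun k hk hk' => ?_).symm
    have : k < m := by
      simp only [Finset.mem_Ico] at hk hk'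
      omega
    rw [hm k this]
    exact mul_zero _
  refine hT.mean_expansion g ⟨1, one_pos, fun r hr _ => ?_⟩ K
  exact SM.continuous ⟨_, contDiffOn_scaled (h.contDiffOn hy) hr⟩

theorem Near.exists_hasPfAt (hy : y₁ ≠ y₂) {p : SPt y₁ y₂} {V : singularSpace y₁ y₂}
    (h : Near y₁ y₂ p.1 V) {s₀ : ℝ} (hs₀ : 0 < s₀) : ∃ l, HasPfAt p.1 s₀ V l := by
  obtain ⟨m, hm3, hm⟩ := exists_low (ls p V) (-3)
  have hexp := h.mean_expansion hy 1 hm (-2)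
  obtain ⟨l, hl⟩ := tendsto_finite_part (b := fun r => r ^ 2 * ∫ n : S2, V.1 (p.1 + r • (n : E)) ∂sigma)
    (c := fun k => sInt ((ls p V).coeff k)) hm3
    (fun s hs => (integral_outside hs (h.integrableOn hy hs)).1) (by
      have h1 := (isBigO_refl (fun r : ℝ => r ^ 2) (𝓝[>] 0)).mul hexp
      refine h1.congr' ?_ ?_
      · filter_upwards [self_mem_nhdsWithin] with r hr
        have hr' : (0 : ℝ) < r := hr
        rw [mul_sub, Finset.mul_sum]
        congr 1
        · congr 1
          refine integral_congr_ae (Eventually.of_forall fun n => ?_)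
          exact one_mul _
        · refine Finset.sum_congr rfl fun k _ => ?_
          rw [one_mul, zpow_add₀ hr'.ne', zpow_ofNat]
          ring
      · filter_upwards [self_mem_nhdsWithin] with r hr
        have hr' : (0 : ℝ) < r := hr
        rw [zpow_neg, zpow_ofNat]
        field_simp) hs₀
  refine ⟨l, hl.congr' ?_⟩
  filter_upwards [self_mem_nhdsWithin] with s hs
  rw [h.integral_eq hy hs, divergentPart_eq p s₀ V hm]

theorem sInt_low (k : ℝ) (i : Fin 3) (f : SM) : sInt (low k i f) = (k + 2) * sInt (nn i * f) := by
  rw [low_apply, map_add, map_smul, sInt_sphD, smul_eq_mul]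
  ring

/-- Outside the ball of radius `s` the integral of the derivative is minus the flux through the
sphere. The counterterms cancel the divergent powers of the flux, no logarithm occurs, so the length
`s₀` is irrelevant, and what survives is the flux of order `s ^ 0`, coming from the coefficient of
order -2. -/
theorem Near.hasPfAt_dd (hy : y₁ ≠ y₂) {p : SPt y₁ y₂} {V : singularSpace y₁ y₂}
    (h : Near y₁ y₂ p.1 V) (s₀ : ℝ) (i : Fin 3) :
    HasPfAt p.1 s₀ (Hadamard.dd i V) (-sInt (nn i * (ls p V).coeff (-2))) := by
  obtain ⟨m, hm3, hm⟩ := exists_low (ls p V) (-2)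
  have hm' : ∀ k < m - 1, (ls p (Hadamard.dd i V)).coeff k = 0 := fun k hk => by
    rw [ls_dd, hm (k + 1) (by omega), map_zero]
  set U : E → ℝ := fun x => V.1 (p.1 + x) with hU
  have hUs : ContDiffOn ℝ ∞ U {0}ᶜ := h.contDiffOn hy
  set Ψ : ℝ → ℝ := fun r => r ^ 2 * ∫ n : S2, (nn i).1 n * U (r • (n : E)) ∂sigma with hΨ
  have hflux : ∀ s, 0 < s → ∫ x in (Metric.closedBall p.1 s)ᶜ, (Hadamard.dd i V).1 x = -Ψ s := by
    intro s hs
    have h1 := integral_outside hs ((h.dd i).integrableOn hy hs)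
    have hmean : ∀ r ∈ Set.Ioi s, r ^ 2 * ∫ n : S2, (Hadamard.dd i V).1 (p.1 + r • (n : E)) ∂sigma =
        r ^ 2 * ∫ n : S2, fderiv ℝ U (r • (n : E)) (ee i) ∂sigma := by
      intro r hr
      have hr0 : (0 : ℝ) < r := hs.trans hr
      congr 1
      refine integral_congr_ae (Eventually.of_forall fun n => ?_)
      change pd y₁ y₂ i V (p.1 + r • (n : E)) = fderiv ℝ U (r • (n : E)) (ee i)
      have hfd : fderiv ℝ U (r • (n : E)) = fderiv ℝ V.1 (p.1 + r • (n : E)) :=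
        fderiv_comp_add_left p.1
      by_cases hx : p.1 + r • (n : E) = y₁ ∨ p.1 + r • (n : E) = y₂
      · have hpos := dist_pos.2 hy
        have : V.1 =ᶠ[𝓝 (p.1 + r • (n : E))] fun _ => 0 := by
          filter_upwards [Metric.ball_mem_nhds _ (show 0 < dist y₁ y₂ / 2 by positivity)] with z hz
          refine h.eq_zero (q := ⟨_, hx⟩) (fun e => ?_) hz
          have e2 := congrArg Subtype.val e
          exact smul_ne_zero hr0.ne' (sphere_ne_zero n) (by simpa using e2)
        rw [pd, if_pos hx, hfd, this.fderiv_eq]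
        simp
      · rw [pd, if_neg hx, hfd]
    rw [h1.2, setIntegral_congr_fun measurableSet_Ioi hmean]
    have hlim : Tendsto Ψ atTop (𝓝 0) := by
      refine tendsto_const_nhds.congr' ?_
      filter_upwards [eventually_gt_atTop (dist y₁ y₂ / 2), eventually_gt_atTop 0] with r hr hr0
      have : ∀ n : S2, U (r • (n : E)) = 0 := fun n => h _ (by
        rw [dist_eq_norm (p.1 + _), add_sub_cancel_left, norm_smul, norm_sphere,
          Real.norm_of_nonneg hr0.le, mul_one]
        exact hr)
      simp [hΨ, this]
    rw [integral_Ioi_of_hasDerivAt_of_tendsto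
      (hasDerivAt_flux hUs hs i).continuousAt.continuousWithinAt
      (fun r hr => hasDerivAt_flux hUs (hs.trans hr) i)
      (h1.1.congr_fun hmean measurableSet_Ioi) hlim, zero_sub]
  have hexp := h.mean_expansion hy (nn i) hm (-1)
  have hlim : Tendsto (fun s => Ψ s - ∑ k ∈ Finset.Ico m (-1), s ^ (k + 2) *
      sInt (nn i * (ls p V).coeff k)) (𝓝[>] 0) (𝓝 0) := by
    have h1 := (isBigO_refl (fun r : ℝ => r ^ 2) (𝓝[>] 0)).mul hexp
    have h2 : (fun s => Ψ s - ∑ k ∈ Finset.Ico m (-1), s ^ (k + 2) *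
        sInt (nn i * (ls p V).coeff k)) =O[𝓝[>] 0] fun s => s := by
      refine h1.congr' ?_ ?_
      · filter_upwards [self_mem_nhdsWithin] with r hr
        have hr' : (0 : ℝ) < r := hr
        rw [mul_sub, Finset.mul_sum]
        congr 1
        refine Finset.sum_congr rfl fun k _ => ?_
        rw [zpow_add₀ hr'.ne', zpow_ofNat]
        ring
      · filter_upwards [self_mem_nhdsWithin] with r hr
        have hr' : (0 : ℝ) < r := hr
        rw [zpow_neg, zpow_one]
        field_simp
    exact h2.trans_tendsto (tendsto_id.mono_left nhdsWithin_le_nhds)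
  have hlim2 := (hlim.neg).add_const (-sInt (nn i * (ls p V).coeff (-2)))
  rw [neg_zero, zero_add] at hlim2
  refine hlim2.congr' ?_
  filter_upwards [self_mem_nhdsWithin] with s hs
  have hs' : (0 : ℝ) < s := hs
  rw [hflux s hs', divergentPart_eq p s₀ (Hadamard.dd i V) hm']
  -- By `sInt_low` the mean of the coefficient of order `k` of the derivative has the factor `k +
  -- 3`, which cancels the denominator.
  have e1 : ∑ k ∈ Finset.Ico (m - 1) (-3), s ^ (k + 3) / ((k : ℝ) + 3) *
      sInt ((ls p (Hadamard.dd i V)).coeff k) =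
      ∑ k ∈ Finset.Ico m (-2), s ^ (k + 2) * sInt (nn i * (ls p V).coeff k) := by
    refine Finset.sum_bij' (fun k _ => k + 1) (fun k _ => k - 1) ?_ ?_ ?_ ?_ ?_
    · intro j hj
      simp only [Finset.mem_Ico] at *
      omega
    · intro j hj
      simp only [Finset.mem_Ico] at *
      omega
    · intro j _
      ring
    · intro j _
      ring
    · intro k hk
      rw [Finset.mem_Ico] at hk
      have hk0 : (k : ℝ) + 3 ≠ 0 := by
        have : k + 3 ≠ 0 := by omega
        exact_mod_cast this
      rw [ls_dd, sInt_low, show k + 1 + 2 = k + 3 by ring]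
      push_cast
      field_simp
      ring
  -- At order -3 that factor is 0, which removes the logarithm.
  have e2 : sInt ((ls p (Hadamard.dd i V)).coeff (-3)) = 0 := by
    rw [ls_dd, sInt_low]
    norm_num
  rw [e1, e2, show (-1 : ℤ) = -2 + 1 by norm_num, ← Finset.sum_Ico_add_eq_sum_Ico_add_one hm3]
  norm_num
  ring

/-! ### Existence of the partie finie, and the partie finie of a derivative -/

/-- The part of `X` near the singular point `p`. -/
def core (hy : y₁ ≠ y₂) (p : SPt y₁ y₂) : singularSpace y₁ y₂ →ₗ[ℝ] singularSpace y₁ y₂ where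
  toFun X := mono hy p 0 1 * X
  map_add' _ _ := Subtype.ext (mul_add _ _ _)
  map_smul' _ _ := Subtype.ext (mul_smul_comm _ _ _)

theorem core_apply (hy : y₁ ≠ y₂) (p : SPt y₁ y₂) (X : singularSpace y₁ y₂) (x : E) :
    (core hy p X).1 x = cut hy p.1 x * X.1 x := by
  change cut hy p.1 x * (‖x - p.1‖ ^ (0 : ℤ) * 1) * X.1 x = _
  simp

theorem core_near (hy : y₁ ≠ y₂) (p : SPt y₁ y₂) (X : singularSpace y₁ y₂) :
    Near y₁ y₂ p.1 (core hy p X) := by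
  intro x hx
  rw [core_apply, (cut hy p.1).zero_of_le_dist (by exact hx.le), zero_mul]

theorem ls_core (hy : y₁ ≠ y₂) (p : SPt y₁ y₂) (X : singularSpace y₁ y₂) :
    ls p (core hy p X) = ls p X := by
  refine HasLS.ls_eq ((hasLS_ls p X).congr' ?_)
  filter_upwards [nhdsWithin_le_nhds (cut_eventuallyEq_one hy p.1)] with x hx
  rw [core_apply, hx, Pi.one_apply, one_mul]

/-- The part of `X` away from the singular points. -/
def rest (hy : y₁ ≠ y₂) (X : singularSpace y₁ y₂) : singularSpace y₁ y₂ :=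
  X - core hy ⟨y₁, Or.inl rfl⟩ X - core hy ⟨y₂, Or.inr rfl⟩ X

theorem rest_apply (hy : y₁ ≠ y₂) (X : singularSpace y₁ y₂) (x : E) :
    (rest hy X).1 x = X.1 x - cut hy y₁ x * X.1 x - cut hy y₂ x * X.1 x := by
  have h1 := core_apply hy ⟨y₁, Or.inl rfl⟩ X x
  have h2 := core_apply hy ⟨y₂, Or.inr rfl⟩ X x
  change X.1 x - (core hy ⟨y₁, Or.inl rfl⟩ X).1 x - (core hy ⟨y₂, Or.inr rfl⟩ X).1 x = _
  rw [h1, h2]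

theorem rest_flat (hy : y₁ ≠ y₂) (X : singularSpace y₁ y₂) : Flat y₁ y₂ (rest hy X) := by
  have hpos := dist_pos.2 hy
  have hone : ∀ p x : E, x ∈ Metric.ball p (dist y₁ y₂ / 4) → cut hy p x = 1 := fun p x hx =>
    (cut hy p).one_of_mem_closedBall (Metric.ball_subset_closedBall hx)
  have hzero : ∀ p x : E, dist y₁ y₂ / 2 ≤ dist x p → cut hy p x = 0 := fun p x hx =>
    (cut hy p).zero_of_le_dist hx
  rintro ⟨p, rfl | rfl⟩ x hx
  · have h1 := dist_triangle_left p y₂ x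
    rw [rest_apply, hone _ x hx, hzero y₂ x (by rw [Metric.mem_ball] at hx; linarith)]
    ring
  · have h1 := dist_triangle_left y₁ p x
    rw [rest_apply, hone _ x hx, hzero y₁ x (by rw [Metric.mem_ball] at hx; linarith)]
    ring

theorem rest_add_core (hy : y₁ ≠ y₂) (X : singularSpace y₁ y₂) :
    X = rest hy X + (core hy ⟨y₁, Or.inl rfl⟩ X + core hy ⟨y₂, Or.inr rfl⟩ X) := by
  rw [rest]
  abel

theorem rest_cocompact (hy : y₁ ≠ y₂) (X : singularSpace y₁ y₂) :
    (X : E → ℝ) =ᶠ[cocompact E] rest hy X := by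
  filter_upwards [(core_near hy ⟨y₁, Or.inl rfl⟩ X).cocompact,
    (core_near hy ⟨y₂, Or.inr rfl⟩ X).cocompact] with x h1 h2
  change X.1 x = X.1 x - (core hy ⟨y₁, Or.inl rfl⟩ X).1 x - (core hy ⟨y₂, Or.inr rfl⟩ X).1 x
  rw [h1, h2]
  simp

theorem exists_hasPf (hy : y₁ ≠ y₂) {s₁ s₂ : ℝ} (hs₁ : 0 < s₁) (hs₂ : 0 < s₂)
    (X : singularSpace y₁ y₂) (hX : IntegrableAtFilter (X : E → ℝ) (cocompact E)) :
    ∃ l, HasPf y₁ y₂ s₁ s₂ X l := by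
  have n1 := core_near hy ⟨y₁, Or.inl rfl⟩ X
  have n2 := core_near hy ⟨y₂, Or.inr rfl⟩ X
  obtain ⟨l₁, h₁⟩ := n1.exists_hasPfAt hy hs₁
  obtain ⟨l₂, h₂⟩ := n2.exists_hasPfAt hy hs₂
  have i1 := integrableAtFilter_of_eq_zero n1.cocompact
  have i2 := integrableAtFilter_of_eq_zero n2.cocompact
  have h12 := (HasPfAt.hasPf_fst hy s₁ s₂ n1 h₁).add (HasPfAt.hasPf_snd hy s₁ s₂ n2 h₂) i1 i2
  have h := ((rest_flat hy X).hasPf hy s₁ s₂).add h12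
    (IntegrableAtFilter.congr_cocompact hX (rest_cocompact hy X)) (i1.add i2)
  rw [← rest_add_core hy X] at h
  exact ⟨_, h⟩

theorem pfIntegral_add (hy : y₁ ≠ y₂) {s₁ s₂ : ℝ} (hs₁ : 0 < s₁) (hs₂ : 0 < s₂)
    (X Y : singularSpace y₁ y₂) (hX : IntegrableAtFilter (X : E → ℝ) (cocompact E))
    (hY : IntegrableAtFilter (Y : E → ℝ) (cocompact E)) :
    pfIntegral y₁ y₂ s₁ s₂ (X + Y : singularSpace y₁ y₂) =
      pfIntegral y₁ y₂ s₁ s₂ X + pfIntegral y₁ y₂ s₁ s₂ Y := by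
  obtain ⟨l, h⟩ := exists_hasPf hy hs₁ hs₂ X hX
  obtain ⟨l', h'⟩ := exists_hasPf hy hs₁ hs₂ Y hY
  rw [(h.add h' hX hY).pfIntegral_eq, h.pfIntegral_eq, h'.pfIntegral_eq]

/-- A cutoff at each singular point isolates its contribution, and the remaining smooth part has no
flux at infinity by `ho`. This nonzero value is the obstruction to integration by parts that the
distributional terms have to compensate. -/
theorem pfIntegral_dd (hy : y₁ ≠ y₂) (s₁ s₂ : ℝ) (i : Fin 3)
    (X : singularSpace y₁ y₂) (hX : IntegrableAtFilter (dd i X : E → ℝ) (cocompact E))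
    (ho : (X : E → ℝ) =o[cocompact E] fun x => ‖x‖ ^ (-2 : ℤ)) :
    pfIntegral y₁ y₂ s₁ s₂ (dd i X) =
      -(sInt (nn i * (ls ⟨y₁, Or.inl rfl⟩ X).coeff (-2)) +
        sInt (nn i * (ls ⟨y₂, Or.inr rfl⟩ X).coeff (-2))) := by
  have n1 := core_near hy ⟨y₁, Or.inl rfl⟩ X
  have n2 := core_near hy ⟨y₂, Or.inr rfl⟩ X
  have i1 := integrableAtFilter_of_eq_zero (n1.dd i).cocompact
  have i2 := integrableAtFilter_of_eq_zero (n2.dd i).cocompact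
  have h12 := (HasPfAt.hasPf_fst hy s₁ s₂ (n1.dd i) (n1.hasPfAt_dd hy s₁ i)).add
    (HasPfAt.hasPf_snd hy s₁ s₂ (n2.dd i) (n2.hasPfAt_dd hy s₂ i)) i1 i2
  have hr : (dd i X : E → ℝ) =ᶠ[cocompact E] dd i (rest hy X) := by
    have e : dd i X = dd i (rest hy X) + (dd i (core hy ⟨y₁, Or.inl rfl⟩ X) +
        dd i (core hy ⟨y₂, Or.inr rfl⟩ X)) := by
      conv_lhs => rw [rest_add_core hy X]
      rw [map_add, map_add]
    filter_upwards [(n1.dd i).cocompact, (n2.dd i).cocompact] with x h1 h2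
    rw [e]
    change (dd i (rest hy X)).1 x + ((dd i (core hy ⟨y₁, Or.inl rfl⟩ X)).1 x +
        (dd i (core hy ⟨y₂, Or.inr rfl⟩ X)).1 x) = _
    rw [h1, h2]
    simp
  have ir := IntegrableAtFilter.congr_cocompact hX hr
  have h := ((rest_flat hy X).hasPf_dd hy s₁ s₂ i ir
    (ho.congr' (rest_cocompact hy X) EventuallyEq.rfl)).add h12 ir (i1.add i2)
  rw [← map_add, ← map_add, ← rest_add_core hy X] at h
  rw [h.pfIntegral_eq, ls_core, ls_core]
  ring

end

end Hadamard


/-! ### Construction of the derivative operators and of their multi-derivatives -/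

namespace Hadamard

noncomputable section

variable {y₁ y₂ : E}

theorem hahn_smul_mul (c : ℝ) (A B : HahnSeries ℤ SM) : (c • A) * B = c • (A * B) := by
  obtain ⟨m, -, hA⟩ := exists_low A 0
  obtain ⟨m', -, hB⟩ := exists_low B 0
  ext1
  funext k
  rw [HahnSeries.coeff_smul, coeff_mul_eq (m := m) (m' := m') (fun k hk => by
    rw [HahnSeries.coeff_smul, hA k hk, smul_zero]) hB, coeff_mul_eq hA hB, Finset.smul_sum]
  exact Finset.sum_congr rfl fun j _ => by rw [HahnSeries.coeff_smul, smul_mul_assoc]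

theorem hahn_mul_smul (c : ℝ) (A B : HahnSeries ℤ SM) : A * (c • B) = c • (A * B) := by
  rw [mul_comm, hahn_smul_mul, mul_comm]

theorem hahn_sub_mul (A A' B : HahnSeries ℤ SM) : (A - A') * B = A * B - A' * B :=
  sub_mul A A' B

theorem sum_Ico_split {a b c : ℤ} (hab : a ≤ b) (hbc : b ≤ c) (g : ℤ → ℝ) :
    ∑ k ∈ Finset.Ico a c, g k = ∑ k ∈ Finset.Ico a b, g k + ∑ k ∈ Finset.Ico b c, g k := by
  rw [← Finset.Ico_union_Ico_eq_Ico hab hbc,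
    Finset.sum_union (Finset.Ico_disjoint_Ico_consecutive a b c)]

/-! ### The operators acting on the coefficient of `1 / r` -/

/-- The operator `n_i - T_i (K - 1 + H)`, where `H` multiplies the harmonics of degree `l` by the
harmonic number of `l`. -/
def bop (K : ℝ) (i : Fin 3) : SM →ₗ[ℝ] SM :=
  LinearMap.mulLeft ℝ (nn i) - sphT i ∘ₗ ((K - 1) • LinearMap.id + hop)

theorem bop_apply (K : ℝ) (i : Fin 3) (f : SM) :
    bop K i f = nn i * f - (K - 1) • sphT i f - sphT i (hop f) := by
  change nn i * f - sphT i ((K - 1) • f + hop f) = _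
  rw [map_add, map_smul]
  abel

/-- Since `sphT i` is antisymmetric and `hop` symmetric, the part with `K - 1` drops out of the sum
of `bop K i` and its adjoint, which becomes `2 n_i` minus the commutator `[T_i, H] = n_i`. -/
theorem sInt_bop_add (K : ℝ) (i : Fin 3) (f g : SM) :
    sInt (bop K i f * g) + sInt (bop K i g * f) = sInt (nn i * (f * g)) := by
  have h1 := sInt_sphT_mul i f g
  have h2 := sInt_sphT_mul i (hop g) f
  have h3 := sInt_op_symm ⟨hnum, hnum_mem⟩ g (sphT i f)
  change sInt (hop g * sphT i f) = sInt (g * hop (sphT i f)) at h3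
  have h4 : sInt (sphT i (hop f) * g) - sInt (g * hop (sphT i f)) = sInt (nn i * (f * g)) := by
    rw [mul_comm g, ← map_sub, ← sub_mul, sphT_hop, mul_assoc]
  simp only [bop_apply, sub_mul, map_sub, smul_mul_assoc, map_smul, smul_eq_mul]
  rw [mul_comm f] at h1
  rw [show nn i * f * g = nn i * (f * g) by ring, show nn i * g * f = nn i * (f * g) by ring]
  linear_combination -(K - 1) * h1 - h2 + h3 - h4

/-- By the commutator relation `bop K i` also equals `-(K - 1 + H) T_i`, and `T_i ∂_j f` is
symmetric in the two indices by `sphT_sphD_symm`. -/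
theorem bop_sphD_symm (K : ℝ) (i j : Fin 3) (f : SM) : bop K i (sphD j f) = bop K j (sphD i f) := by
  have h1 := sphT_hop i (sphD j f)
  have h2 := sphT_hop j (sphD i f)
  have h3 := sphT_sphD_symm f j i
  rw [← h3] at h2
  rw [bop_apply, bop_apply, ← h3, ← h1, ← h2]
  abel

theorem bop_comp (K : ℝ) (R : E ≃ₗᵢ[ℝ] E) (i : Fin 3) (f : SM) :
    comp R (bop K i f) = ∑ j, R (ee j) i • bop K j (comp R f) := by
  have h1 := sphT_comp R i f
  have h2 := sphT_comp R i (hop f)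
  have h3 : hop (comp R f) = comp R (hop f) := op_comp _ R f
  simp only [bop_apply, smul_sub, Finset.sum_sub_distrib, h3, h2, smul_comm _ (K - 1),
    ← Finset.smul_sum, h1, map_sub, map_mul, map_smul, nn_comp, Finset.sum_mul, smul_mul_assoc]

/-! ### The local form of the distributional term -/

/-- The local form of the distributional term, in terms of the Laurent series. -/
def locForm (K : ℝ) (i : Fin 3) (A B : HahnSeries ℤ SM) : ℝ :=
  sInt (nn i * (HahnSeries.truncLT (-1 : ℤ) A * B).coeff (-2)) +
    sInt (bop K i (A.coeff (-1)) * B.coeff (-1))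

theorem locForm_add_left (K : ℝ) (i : Fin 3) (A A' B : HahnSeries ℤ SM) :
    locForm K i (A + A') B = locForm K i A B + locForm K i A' B := by
  simp only [locForm, HahnSeries.truncLT_add, add_mul, HahnSeries.coeff_add, mul_add, map_add]
  ring

theorem locForm_smul_left (K : ℝ) (i : Fin 3) (c : ℝ) (A B : HahnSeries ℤ SM) :
    locForm K i (c • A) B = c * locForm K i A B := by
  simp only [locForm, HahnSeries.truncLT_smul, hahn_smul_mul, HahnSeries.coeff_smul,
    mul_smul_comm, map_smul, smul_mul_assoc, smul_eq_mul]
  ring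

theorem locForm_add_right (K : ℝ) (i : Fin 3) (A B B' : HahnSeries ℤ SM) :
    locForm K i A (B + B') = locForm K i A B + locForm K i A B' := by
  simp only [locForm, mul_add, HahnSeries.coeff_add, map_add]
  ring

theorem locForm_smul_right (K : ℝ) (i : Fin 3) (c : ℝ) (A B : HahnSeries ℤ SM) :
    locForm K i A (c • B) = c * locForm K i A B := by
  simp only [locForm, hahn_mul_smul, HahnSeries.coeff_smul, mul_smul_comm, map_smul, smul_eq_mul]
  ring

/-- The distributional term contributed by the singular point `p`. -/
def locD (K : ℝ) (p : SPt y₁ y₂) (i : Fin 3) : singularSpace y₁ y₂ →ₗ[ℝ] Form y₁ y₂ :=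
  LinearMap.mk₂ ℝ (fun F G => locForm K i (ls p F) (ls p G))
    (fun F F' G => by rw [map_add, locForm_add_left])
    (fun c F G => by rw [map_smul, locForm_smul_left, smul_eq_mul])
    (fun F G G' => by rw [map_add, locForm_add_right])
    (fun c F G => by rw [map_smul, locForm_smul_right, smul_eq_mul])

theorem locD_apply (K : ℝ) (p : SPt y₁ y₂) (i : Fin 3) (F G : singularSpace y₁ y₂) :
    locD K p i F G = locForm K i (ls p F) (ls p G) := rfl

theorem locForm_congr (K : ℝ) (i : Fin 3) {A A' : HahnSeries ℤ SM}
    (h : ∀ k < 0, A.coeff k = A'.coeff k) (B : HahnSeries ℤ SM) :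
    locForm K i A B = locForm K i A' B := by
  have h1 : HahnSeries.truncLT (-1 : ℤ) A = HahnSeries.truncLT (-1 : ℤ) A' := by
    ext1
    funext k
    rw [HahnSeries.coeff_truncLT, HahnSeries.coeff_truncLT]
    split_ifs with hk
    · exact h k (by omega)
    · rfl
  rw [locForm, locForm, h1, h (-1) (by norm_num)]

theorem locForm_eq (K : ℝ) (i : Fin 3) {A B : HahnSeries ℤ SM} {m : ℤ} (hm : m ≤ 0)
    (hA : ∀ k < m, A.coeff k = 0) (hB : ∀ k < m, B.coeff k = 0) :
    locForm K i A B = ∑ k ∈ Finset.Ico m (-1), sInt (nn i * (A.coeff k * B.coeff (-2 - k))) +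
      sInt (bop K i (A.coeff (-1)) * B.coeff (-1)) := by
  have hA' : ∀ k < m, (HahnSeries.truncLT (-1 : ℤ) A).coeff k = 0 := fun k hk => by
    rw [HahnSeries.coeff_truncLT, hA k hk, ite_self]
  rw [locForm, coeff_mul_eq hA' hB, Finset.mul_sum, map_sum]
  congr 1
  symm
  refine Finset.sum_subset_zero_on_sdiff (Finset.Ico_subset_Ico_right (by omega)) ?_ ?_
  · intro k hk
    rw [Finset.mem_sdiff, Finset.mem_Ico, Finset.mem_Ico] at hk
    rw [HahnSeries.coeff_truncLT_of_le (by omega)]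
    simp
  · intro k hk
    rw [Finset.mem_Ico] at hk
    rw [HahnSeries.coeff_truncLT_of_lt hk.2]

theorem sum_Ico_reflect (c a b : ℤ) (g : ℤ → ℝ) :
    ∑ k ∈ Finset.Ico a b, g (c - k) = ∑ k ∈ Finset.Ico (c - b + 1) (c - a + 1), g k := by
  refine Finset.sum_bij' (fun k _ => c - k) (fun k _ => c - k) ?_ ?_ ?_ ?_ ?_
  · intro j hj
    simp only [Finset.mem_Ico] at *
    omega
  · intro j hj
    simp only [Finset.mem_Ico] at *
    omega
  · intro j _
    ring
  · intro j _
    ring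
  · intro j _
    rfl

theorem sum_Ico_shift (c a b : ℤ) (g : ℤ → ℝ) :
    ∑ k ∈ Finset.Ico a b, g (k + c) = ∑ k ∈ Finset.Ico (a + c) (b + c), g k := by
  refine Finset.sum_bij' (fun k _ => k + c) (fun k _ => k - c) ?_ ?_ ?_ ?_ ?_
  · intro j hj
    simp only [Finset.mem_Ico] at *
    omega
  · intro j hj
    simp only [Finset.mem_Ico] at *
    omega
  · intro j _
    ring
  · intro j _
    ring
  · intro j _
    rfl

theorem exists_low_pair (A B : HahnSeries ℤ SM) :
    ∃ m ≤ (-1 : ℤ), (∀ k < m, A.coeff k = 0) ∧ ∀ k < m, B.coeff k = 0 := by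
  obtain ⟨m, hm, hA⟩ := exists_low A (-1)
  obtain ⟨m', hm', hB⟩ := exists_low B m
  exact ⟨m', by omega, fun k hk => hA k (by omega), hB⟩

/-- Orders of `A` up to -2 meet orders of `B` from 0 on; the swapped term supplies the complementary
half of the product. The middle term, with both orders equal to -1, is `sInt_bop_add`. -/
theorem locForm_add_swap (K : ℝ) (i : Fin 3) (A B : HahnSeries ℤ SM) :
    locForm K i A B + locForm K i B A = sInt (nn i * (A * B).coeff (-2)) := by
  obtain ⟨m, hm, hA, hB⟩ := exists_low_pair A B
  rw [locForm_eq K i (by omega) hA hB, locForm_eq K i (by omega) hB hA, coeff_mul_eq hA hB,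
    Finset.mul_sum, map_sum, sum_Ico_split (show m ≤ 0 by omega)
      (show 0 ≤ -2 - m + 1 by omega), show (0 : ℤ) = -1 + 1 by norm_num,
    ← Finset.sum_Ico_add_eq_sum_Ico_add_one hm]
  have h1 := sum_Ico_reflect (-2) m (-1)
    (fun k => sInt (nn i * (A.coeff k * B.coeff (-2 - k))))
  rw [show (-2 : ℤ) - -1 + 1 = -1 + 1 by norm_num] at h1
  rw [← h1]
  have h2 := sInt_bop_add K i (A.coeff (-1)) (B.coeff (-1))
  have h3 : ∑ k ∈ Finset.Ico m (-1), sInt (nn i * (B.coeff k * A.coeff (-2 - k))) =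
      ∑ k ∈ Finset.Ico m (-1), sInt (nn i * (A.coeff (-2 - k) * B.coeff (-2 - (-2 - k)))) := by
    refine Finset.sum_congr rfl fun k _ => ?_
    rw [show -2 - (-2 - k) = k by ring, mul_comm (B.coeff k)]
  rw [h3, show (-2 : ℤ) - -1 = -1 by norm_num]
  linear_combination h2

/-- The coefficient of order -1 of a derivative is the tangential gradient of the coefficient of
order 0, so the terms with `bop` cancel by `bop_sphD_symm`. In the others the part proportional to
`n_i n_j` cancels and a rotation generator remains. -/
theorem locForm_antisymm (K : ℝ) (p : SPt y₁ y₂) (i j : Fin 3) (F G : singularSpace y₁ y₂) {m : ℤ}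
    (hm : m ≤ -1) (hF : ∀ k < m, (ls p F).coeff k = 0) (hG : ∀ k < m, (ls p G).coeff k = 0) :
    locForm K i (ls p (dd j F)) (ls p G) - locForm K j (ls p (dd i F)) (ls p G) =
      ∑ k ∈ Finset.Ico m 0, sInt (rotL i j ((ls p F).coeff k) * (ls p G).coeff (-1 - k)) := by
  have hd : ∀ i, ∀ k < m - 1, (ls p (dd i F)).coeff k = 0 := fun i k hk => by
    rw [ls_dd, hF (k + 1) (by omega), map_zero]
  have hG' : ∀ k < m - 1, (ls p G).coeff k = 0 := fun k hk => hG k (by omega)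
  have h0 : ∀ i, (ls p (dd i F)).coeff (-1) = sphD i ((ls p F).coeff 0) := fun i => by
    rw [ls_dd, low_apply]
    norm_num
  rw [locForm_eq K i (by omega) (hd j) hG', locForm_eq K j (by omega) (hd i) hG', h0, h0,
    bop_sphD_symm, add_sub_add_right_eq_sub, ← Finset.sum_sub_distrib]
  have h1 := sum_Ico_shift 1 (m - 1) (-1)
    (fun k => sInt (rotL i j ((ls p F).coeff k) * (ls p G).coeff (-1 - k)))
  rw [sub_add_cancel, neg_add_cancel] at h1
  rw [← h1]
  refine Finset.sum_congr rfl fun k _ => ?_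
  rw [← map_sub, ls_dd, ls_dd, low_apply, low_apply, rotL_apply,
    show (-1 : ℤ) - (k + 1) = -2 - k by ring]
  congr 1
  simp only [add_mul, mul_add, sub_mul, smul_mul_assoc, mul_smul_comm]
  rw [show nn i * (nn j * (ls p F).coeff (k + 1) * (ls p G).coeff (-2 - k)) =
    nn j * (nn i * (ls p F).coeff (k + 1) * (ls p G).coeff (-2 - k)) by ring]
  ring

theorem sInt_mul_dd_antisymm (p : SPt y₁ y₂) (i j : Fin 3) (F G : singularSpace y₁ y₂) {m : ℤ}
    (hF : ∀ k < m, (ls p F).coeff k = 0) (hG : ∀ k < m, (ls p G).coeff k = 0) :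
    sInt (nn i * (ls p F * ls p (dd j G)).coeff (-2)) -
      sInt (nn j * (ls p F * ls p (dd i G)).coeff (-2)) =
      -∑ k ∈ Finset.Ico m (-m), sInt (rotL i j ((ls p F).coeff k) * (ls p G).coeff (-1 - k)) := by
  have hd : ∀ i, ∀ k < m - 1, (ls p (dd i G)).coeff k = 0 := fun i k hk => by
    rw [ls_dd, hG (k + 1) (by omega), map_zero]
  rw [coeff_mul_eq hF (hd j), coeff_mul_eq hF (hd i), Finset.mul_sum, Finset.mul_sum, map_sum,
    map_sum, ← Finset.sum_sub_distrib, ← Finset.sum_neg_distrib,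
    show -2 - (m - 1) + 1 = -m by ring]
  refine Finset.sum_congr rfl fun k _ => ?_
  rw [← map_sub, sInt_rotL_mul, neg_neg, ls_dd, ls_dd, low_apply, low_apply, rotL_apply,
    show (-2 : ℤ) - k + 1 = -1 - k by ring]
  congr 1
  simp only [mul_add, mul_sub, mul_smul_comm]
  rw [show nn i * ((ls p F).coeff k * (nn j * (ls p G).coeff (-1 - k))) =
    nn j * ((ls p F).coeff k * (nn i * (ls p G).coeff (-1 - k))) by ring]
  ring

/-- The sum rule turns derivatives of `G` into first arguments. Everything then reduces to `∫ (rotL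
i j f_k) g_{-1-k}`: the antisymmetrized derivatives of `F` give the orders `k < 0`, those of `G`
give `k ≥ 0` after reflection, and the terms `∫ n_i (F ∂_j G)_{-2}` give minus the full sum. -/
theorem locD_comm (K : ℝ) (p : SPt y₁ y₂) (i j : Fin 3) (F G : singularSpace y₁ y₂) :
    locD K p i (dd j F) G - locD K p j F (dd i G) =
      locD K p j (dd i F) G - locD K p i F (dd j G) := by
  simp only [locD_apply]
  obtain ⟨m, hm, hF, hG⟩ := exists_low_pair (ls p F) (ls p G)
  have h1 := locForm_antisymm K p i j F G hm hF hG
  have h2 := locForm_antisymm K p j i G F hm hG hF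
  have h3 := sInt_mul_dd_antisymm p i j F G hF hG
  have h4 := locForm_add_swap K j (ls p F) (ls p (dd i G))
  have h5 := locForm_add_swap K i (ls p F) (ls p (dd j G))
  rw [sum_Ico_split (show m ≤ 0 by omega) (show 0 ≤ -m by omega)] at h3
  have h6 := sum_Ico_reflect (-1) m 0
    (fun k => sInt (rotL i j ((ls p F).coeff k) * (ls p G).coeff (-1 - k)))
  rw [show (-1 : ℤ) - 0 + 1 = 0 by norm_num, show -1 - m + 1 = -m by ring] at h6
  have h7 : ∑ k ∈ Finset.Ico m 0, sInt (rotL j i ((ls p G).coeff k) * (ls p F).coeff (-1 - k)) =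
      ∑ k ∈ Finset.Ico m 0,
        sInt (rotL i j ((ls p F).coeff (-1 - k)) * (ls p G).coeff (-1 - (-1 - k))) := by
    refine Finset.sum_congr rfl fun k _ => ?_
    rw [show -1 - (-1 - k) = k by ring, sInt_rotL_mul, ← map_neg]
    congr 1
    rw [rotL_apply, rotL_apply]
    ring
  rw [h7, h6] at h2
  linear_combination h1 + h2 + h3 - h4 + h5

/-! ### Dirac pseudo-functions -/

/-- The linear forms `Pf(H δ_p)`. -/
def IsDirac (p : SPt y₁ y₂) (T : Form y₁ y₂) : Prop :=
  ∃ H : singularSpace y₁ y₂, ∀ G : singularSpace y₁ y₂, T G = pfAt p.1 ((H : E → ℝ) * G)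

theorem IsDirac.zero (p : SPt y₁ y₂) : IsDirac p (0 : Form y₁ y₂) :=
  ⟨0, fun G => by rw [pfAt_mul, map_zero, zero_mul]; simp⟩

theorem IsDirac.sub {p : SPt y₁ y₂} {T T' : Form y₁ y₂} (h : IsDirac p T) (h' : IsDirac p T') :
    IsDirac p (T - T') := by
  obtain ⟨H, hH⟩ := h
  obtain ⟨H', hH'⟩ := h'
  refine ⟨H - H', fun G => ?_⟩
  rw [LinearMap.sub_apply, hH, hH', pfAt_mul, pfAt_mul, pfAt_mul, map_sub, hahn_sub_mul,
    HahnSeries.coeff_sub, map_sub]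
  ring

/-- Leibniz's rule moves the derivative onto `H`, up to the mean of the coefficient of order 0 of
`∂_i (H G)`, which is a Dirac term again. -/
theorem IsDirac.transpose (hy : y₁ ≠ y₂) {p : SPt y₁ y₂} {T : Form y₁ y₂} (h : IsDirac p T)
    (i : Fin 3) : IsDirac p (T ∘ₗ dd i) := by
  obtain ⟨H, hH⟩ := h
  -- By `sInt_low` in degree 1 that mean is `3 ∫ n_i (HG)_1`, hence the factor `3 n_i / r`.
  refine ⟨mono hy p (-1) ((3 : ℝ) • nn i) * H - dd i H, fun G => ?_⟩
  rw [LinearMap.comp_apply, hH, pfAt_mul, pfAt_mul, map_sub, ls_mul, ls_mono_self, hahn_sub_mul,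
    HahnSeries.coeff_sub, map_sub, mul_assoc, ← ls_mul, ← ls_mul, ← ls_mul]
  have h1 : ls p (H * dd i G) = ls p (dd i (H * G)) - ls p (dd i H * G) := by
    rw [dd_mul, map_add]
    exact (add_sub_cancel_left (ls p (dd i H * G)) (ls p (H * dd i G))).symm
  have h2 := HahnSeries.coeff_single_mul_add (r := (3 : ℝ) • nn i) (x := ls p (H * G)) (a := 1)
    (b := (-1 : ℤ))
  rw [add_neg_cancel] at h2
  rw [h1, h2, HahnSeries.coeff_sub, map_sub, ls_dd, sInt_low, smul_mul_assoc, map_smul]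
  norm_num

theorem IsDirac.locD (hy : y₁ ≠ y₂) (K : ℝ) (p : SPt y₁ y₂) (i : Fin 3) (F : singularSpace y₁ y₂) :
    IsDirac p (locD K p i F) := by
  obtain ⟨m, hm, hF⟩ := exists_low (ls p F) (-1)
  have hpi : (4 * Real.pi) ≠ 0 := by positivity
  -- The monomial `r ^ (k + 2)` selects the coefficient of order `-2 - k` of `G`, and `r` selects
  -- that of order -1. Only finitely many `k` occur because the series of `F` is bounded below; `4π`
  -- undoes the average.
  refine ⟨(4 * Real.pi) • (∑ k ∈ Finset.Ico m (-1), mono hy p (k + 2) (nn i * (ls p F).coeff k) +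
    mono hy p 1 (bop K i ((ls p F).coeff (-1)))), fun G => ?_⟩
  obtain ⟨m', hm', hG⟩ := exists_low (ls p G) m
  have hF' : ∀ k < m', (ls p F).coeff k = 0 := fun k hk => hF k (by omega)
  rw [locD_apply, locForm_eq K i (by omega) hF' hG, pfAt_mul, map_smul, map_add, map_sum,
    ls_mono_self, hahn_smul_mul, HahnSeries.coeff_smul, map_smul, smul_eq_mul,
    inv_mul_cancel_left₀ hpi, add_mul, HahnSeries.coeff_add, map_add, Finset.sum_mul,
    HahnSeries.coeff_sum, map_sum]
  have hs : ∀ (k : ℤ) (f : SM), (HahnSeries.single k f * ls p G).coeff 0 =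
      f * (ls p G).coeff (-k) := fun k f => by
    have := HahnSeries.coeff_single_mul_add (r := f) (x := ls p G) (a := -k) (b := k)
    rwa [neg_add_cancel] at this
  rw [hs]
  congr 1
  refine (Finset.sum_subset_zero_on_sdiff (Finset.Ico_subset_Ico_left hm') ?_ ?_).symm
  · intro k hk
    rw [Finset.mem_sdiff, Finset.mem_Ico, Finset.mem_Ico] at hk
    rw [hF k (by omega)]
    simp
  · intro k _
    rw [ls_mono_self, hs, show -(k + 2) = -2 - k by ring, mul_assoc]

/-! ### Locality of the distributional term -/

theorem isLocalTerm_locD (hy : y₁ ≠ y₂) (K : ℝ) (p : SPt y₁ y₂) :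
    IsLocalTerm p.1 (locD (y₁ := y₁) (y₂ := y₂) K p) where
  dirac i F := IsDirac.locD hy K p i F
  singular F F' h i := by
    refine LinearMap.ext fun G => ?_
    refine locForm_congr K i (fun k hk => Subtype.ext ?_) _
    rw [← coef_ls, ← coef_ls, h k hk]
  covariant R c hc F F' G G' hF hG i := by
    have hF' : ∀ k < 0, comp R ((ls p F').coeff k) = c ^ (-k) • (ls p F).coeff k := fun k hk => by
      refine SM.ext' fun n => ?_
      have := hF k hk n (rot R n) rfl
      rwa [coef_ls, coef_ls] at this
    have hG' : ∀ k, comp R ((ls p G').coeff k) = c ^ (-k) • (ls p G).coeff k := fun k => by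
      refine SM.ext' fun n => ?_
      have := hG k n (rot R n) rfl
      rwa [coef_ls, coef_ls] at this
    obtain ⟨m₁, hm₁, hF1, hG1⟩ := exists_low_pair (ls p F) (ls p G)
    obtain ⟨m₂, hm₂, hF2, hG2⟩ := exists_low_pair (ls p F') (ls p G')
    set m := min m₁ m₂
    simp only [locD_apply]
    rw [locForm_eq K i (m := m) (by omega) (fun k hk => hF2 k (by omega))
      (fun k hk => hG2 k (by omega)), Finset.sum_congr rfl fun j _ => congrArg _ (locForm_eq K j
        (m := m) (by omega) (fun k hk => hF1 k (by omega)) (fun k hk => hG1 k (by omega)))]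
    simp only [mul_add, Finset.sum_add_distrib]
    congr 1
    · rw [Finset.sum_congr rfl fun j _ => Finset.mul_sum _ _ _, Finset.sum_comm, Finset.mul_sum]
      refine Finset.sum_congr rfl fun k hk => ?_
      rw [Finset.mem_Ico] at hk
      rw [← sInt_comp R, map_mul (comp R), map_mul (comp R), hF' k (by omega), hG', nn_comp, Finset.sum_mul, map_sum,
        Finset.mul_sum]
      refine Finset.sum_congr rfl fun j _ => ?_
      rw [smul_mul_smul_comm, ← zpow_add₀ hc.ne', show -k + -(-2 - k) = 2 by ring, smul_mul_smul_comm,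
        map_smul, smul_eq_mul, zpow_ofNat]
      ring
    · rw [← sInt_comp R, map_mul (comp R), bop_comp, hF' (-1) (by norm_num), hG', Finset.sum_mul, map_sum,
        Finset.mul_sum]
      refine Finset.sum_congr rfl fun j _ => ?_
      rw [map_smul, smul_mul_smul_comm, smul_mul_assoc, map_smul, map_smul, smul_eq_mul, smul_eq_mul]
      norm_num
      ring

/-! ### Multi-derivatives -/

/-- The distributional terms of the multi-derivatives obtained by iterating the rule of
integration by parts. -/
def multi (D : Fin 3 → singularSpace y₁ y₂ →ₗ[ℝ] Form y₁ y₂) :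
    List (Fin 3) → singularSpace y₁ y₂ →ₗ[ℝ] Form y₁ y₂
  | [] => 0
  | i :: L => D i ∘ₗ ddL L - Module.Dual.transpose (dd i) ∘ₗ multi D L

theorem multi_cons (D : Fin 3 → singularSpace y₁ y₂ →ₗ[ℝ] Form y₁ y₂) (i : Fin 3)
    (L : List (Fin 3)) (F G : singularSpace y₁ y₂) :
    multi D (i :: L) F G = D i (ordDeriv L F) G - multi D L F (dd i G) := by
  rw [← ddL_apply]
  rfl

theorem isMultiDeriv_multi (hy : y₁ ≠ y₂) {D T₁ T₂ : Fin 3 → singularSpace y₁ y₂ →ₗ[ℝ] Form y₁ y₂}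
    (h₁ : IsLocalTerm y₁ T₁) (h₂ : IsLocalTerm y₂ T₂) (hD : ∀ i F, D i F = T₁ i F + T₂ i F) :
    IsMultiDeriv D (multi D) where
  nil := rfl
  single i := by
    refine LinearMap.ext fun F => LinearMap.ext fun G => ?_
    rw [multi_cons, ordDeriv_nil]
    exact sub_zero _
  dirac L := by
    have key : ∀ F, ∃ T₁ T₂ : Form y₁ y₂, IsDirac ⟨y₁, Or.inl rfl⟩ T₁ ∧
        IsDirac ⟨y₂, Or.inr rfl⟩ T₂ ∧ multi D L F = T₁ + T₂ := by
      induction L with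
      | nil => exact fun F => ⟨0, 0, IsDirac.zero _, IsDirac.zero _, (add_zero _).symm⟩
      | cons i L ih =>
        intro F
        obtain ⟨U₁, U₂, hU₁, hU₂, hU⟩ := ih F
        refine ⟨T₁ i (ordDeriv L F) - U₁ ∘ₗ dd i, T₂ i (ordDeriv L F) - U₂ ∘ₗ dd i,
          IsDirac.sub (h₁.dirac i _) (hU₁.transpose hy i),
          IsDirac.sub (h₂.dirac i _) (hU₂.transpose hy i), LinearMap.ext fun G => ?_⟩
        rw [multi_cons, hD, hU]
        simp only [LinearMap.add_apply, LinearMap.sub_apply, LinearMap.comp_apply]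
        ring
    intro F
    obtain ⟨U₁, U₂, ⟨H₁, hU₁⟩, ⟨H₂, hU₂⟩, hU⟩ := key F
    refine ⟨H₁, H₂, fun G => ?_⟩
    rw [hU, LinearMap.add_apply, hU₁, hU₂]

/-- Permutations are generated by adjacent transpositions; exchanging the two outermost indices is
the hypothesis applied to the derivative of `F` by the remaining ones. -/
theorem commuting_multi {D : Fin 3 → singularSpace y₁ y₂ →ₗ[ℝ] Form y₁ y₂}
    (hD : ∀ i j F G, D i (dd j F) G - D j F (dd i G) = D j (dd i F) G - D i F (dd j G)) :
    Commuting (multi D) := by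
  intro L L' h
  induction h with
  | nil => rfl
  | cons i hp ih =>
    refine LinearMap.ext fun F => LinearMap.ext fun G => ?_
    rw [multi_cons, multi_cons, ih, ordDeriv_perm hp]
  | swap i j L =>
    refine LinearMap.ext fun F => LinearMap.ext fun G => ?_
    simp only [multi_cons, ordDeriv_cons]
    rw [dd_comm i j G]
    linear_combination hD j i (ordDeriv L F) G
  | trans _ _ ih ih' => exact ih.trans ih'

/-- The symmetry of the distributional term which expresses the rule of integration by parts. -/
def SumRule (D : Fin 3 → singularSpace y₁ y₂ →ₗ[ℝ] Form y₁ y₂) : Prop :=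
  ∀ i F G, D i F G + D i G F = sInt (nn i * (ls ⟨y₁, Or.inl rfl⟩ F * ls ⟨y₁, Or.inl rfl⟩ G).coeff (-2)) +
    sInt (nn i * (ls ⟨y₂, Or.inr rfl⟩ F * ls ⟨y₂, Or.inr rfl⟩ G).coeff (-2))

theorem pfIntegral_mul_dd (hy : y₁ ≠ y₂) {s₁ s₂ : ℝ} (hs₁ : 0 < s₁) (hs₂ : 0 < s₂) (i : Fin 3)
    (U V : singularSpace y₁ y₂)
    (h1 : IntegrableAtFilter (((dd i U : singularSpace y₁ y₂) : E → ℝ) * (V : E → ℝ)) (cocompact E))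
    (h2 : IntegrableAtFilter ((U : E → ℝ) * ((dd i V : singularSpace y₁ y₂) : E → ℝ)) (cocompact E))
    (ho : ((U : E → ℝ) * (V : E → ℝ)) =o[cocompact E] fun x => ‖x‖ ^ (-2 : ℤ)) :
    pfIntegral y₁ y₂ s₁ s₂ (((dd i U : singularSpace y₁ y₂) : E → ℝ) * (V : E → ℝ)) +
        pfIntegral y₁ y₂ s₁ s₂ ((U : E → ℝ) * ((dd i V : singularSpace y₁ y₂) : E → ℝ)) =
      -(sInt (nn i * (ls ⟨y₁, Or.inl rfl⟩ U * ls ⟨y₁, Or.inl rfl⟩ V).coeff (-2)) +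
        sInt (nn i * (ls ⟨y₂, Or.inr rfl⟩ U * ls ⟨y₂, Or.inr rfl⟩ V).coeff (-2))) := by
  have e := pfIntegral_add hy hs₁ hs₂ (dd i U * V) (U * dd i V) h1 h2
  have e2 := pfIntegral_dd hy s₁ s₂ i (U * V) (by
    rw [dd_mul]
    exact IntegrableAtFilter.add h1 h2) ho
  rw [dd_mul] at e2
  rw [← ls_mul, ← ls_mul, ← e2]
  exact e.symm

/-- The boundary terms produced by the partie finie cancel those of the sum rule for the derivatives
of `F` and `G`. Iteration gives the rule for every number of derivatives. -/
theorem bracket_cons (hy : y₁ ≠ y₂) {s₁ s₂ : ℝ} (hs₁ : 0 < s₁) (hs₂ : 0 < s₂)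
    {D : Fin 3 → singularSpace y₁ y₂ →ₗ[ℝ] Form y₁ y₂} (hD : SumRule D) (i : Fin 3)
    (P Q : List (Fin 3)) (F G : singularSpace y₁ y₂)
    (h1 : IntegrableAtFilter (pdL y₁ y₂ (i :: P) F * pdL y₁ y₂ Q G) (cocompact E))
    (h2 : IntegrableAtFilter (pdL y₁ y₂ P F * pdL y₁ y₂ (i :: Q) G) (cocompact E))
    (ho : (pdL y₁ y₂ P F * pdL y₁ y₂ Q G) =o[cocompact E] fun x => ‖x‖ ^ (-2 : ℤ)) :
    bracket s₁ s₂ (multi D) (i :: P) F Q G = -bracket s₁ s₂ (multi D) P F (i :: Q) G := by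
  have e := pfIntegral_mul_dd hy hs₁ hs₂ i (ordDeriv P F) (ordDeriv Q G) h1 h2 ho
  have e2 := hD i (ordDeriv P F) (ordDeriv Q G)
  rw [bracket, bracket, multi_cons, multi_cons, ordDeriv_cons, ordDeriv_cons]
  change pfIntegral y₁ y₂ s₁ s₂ (pdL y₁ y₂ (i :: P) F * pdL y₁ y₂ Q G) +
    pfIntegral y₁ y₂ s₁ s₂ (pdL y₁ y₂ P F * pdL y₁ y₂ (i :: Q) G) = _ at e
  linear_combination e + e2

theorem byPartsAll_multi (hy : y₁ ≠ y₂) {s₁ s₂ : ℝ} (hs₁ : 0 < s₁) (hs₂ : 0 < s₂)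
    {D : Fin 3 → singularSpace y₁ y₂ →ₗ[ℝ] Form y₁ y₂} (hD : SumRule D) :
    ByPartsAll s₁ s₂ (multi D) := by
  rintro L k - hk F G
  induction k with
  | zero =>
    intro _ _
    simp
  | succ k ih =>
    intro h1 h2
    rw [ih (by omega) (fun j hj => h1 j (by omega)) fun j hj => h2 j (by omega)]
    have hlt : k < L.length := hk
    have e1 : L.drop k = L[k] :: L.drop (k + 1) := List.drop_eq_getElem_cons hlt
    have e2 : (L.take (k + 1)).reverse = L[k] :: (L.take k).reverse := by
      rw [List.take_succ_eq_append_getElem hlt, List.reverse_append]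
      rfl
    have i1 := h1 k (by omega)
    have i2 := h1 (k + 1) le_rfl
    have o := h2 k (by omega)
    rw [e1] at i1
    rw [e2] at i2
    rw [e1, e2, bracket_cons hy hs₁ hs₂ hD _ _ _ F G i1 i2 o, pow_succ]
    ring

end

end Hadamard


/-! ### The series in spherical harmonics -/

namespace Hadamard

noncomputable section

variable {y₁ y₂ : E}

/-! ### The series for the distributional term -/

theorem Ccoef_eq (K : ℝ) (l : ℕ) : Ccoef K l = ((l : ℝ) + 1) * (K - 1 + hnum (l + 1)) := by
  have h : hnum (l + 1) = 1 + ∑ j ∈ Finset.Icc 1 l, 1 / ((j : ℝ) + 1) := by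
    induction l with
    | zero => simp [hnum]
    | succ l ih =>
      rw [hnum_succ, ih, Finset.sum_Icc_succ_top (by omega)]
      ring
  rw [Ccoef, h]
  ring

theorem stfCoef_eq (p : SPt y₁ y₂) (F : singularSpace y₁ y₂) (a : ℤ) (l : ℕ) (I : Fin l → Fin 3) :
    stfCoef p.1 F a l I = fhat l ((ls p F).coeff a) I := by
  rw [stfCoef, fhat_apply, coef_ls, sphereAvg, sInt_apply]
  simp only [stf_nPow_apply]
  rfl

theorem pol_contr_fhat (l : ℕ) (i : Fin 3) (f : SM) :
    ((l : ℝ) + 1) • pol (contr i (fhat (l + 1) f)) = low ((l : ℝ) + 1) i (harm (l + 1) f) :=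
  (low_pol (fhat_mem (l + 1) f) i).symm

theorem hasLS_derivTerm (p : SPt y₁ y₂) (K : ℝ) (i : Fin 3) (F : singularSpace y₁ y₂) (l : ℕ)
    {N : ℕ} (hN : ∀ k < -1 - (N : ℤ), (ls p F).coeff k = 0) :
    HasLS p.1 (derivTerm p.1 K i F l)
      (HahnSeries.single 1 (Ccoef K l • (nn i * harm l ((ls p F).coeff (-1)) -
        pol (contr i (fhat (l + 1) ((ls p F).coeff (-1)))))) +
      ∑ k ∈ Finset.range N,
        HahnSeries.single (-(k : ℤ)) (nn i * harm l ((ls p F).coeff (-2 - (k : ℤ))))) := by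
  refine ((hasLS_hom p.1 1 _).add (HasLS.sum (Finset.range N)
    fun k _ => hasLS_hom p.1 (-(k : ℤ)) _)).congr' (Eventually.of_forall fun x => ?_)
  have hv : ∀ f : SM, ∀ n : S2, (nn i * harm l f).1 n = ∑ I : Fin l → Fin 3,
      (n : E) i * nPow l n I * fhat l f I := fun f n => by
    change (n : E) i * (pol (fhat l f)).1 n = _
    rw [pol_val, Finset.mul_sum]
    exact Finset.sum_congr rfl fun I _ => (mul_assoc _ _ _).symm
  rw [derivTerm]
  simp only [stfCoef_eq, Pi.add_apply, Finset.sum_apply]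
  congr 1
  · have e : (Ccoef K l • (nn i * harm l ((ls p F).coeff (-1)) -
        pol (contr i (fhat (l + 1) ((ls p F).coeff (-1)))))).1 (dir (x - p.1)) =
        Ccoef K l * ((nn i * harm l ((ls p F).coeff (-1))).1 (dir (x - p.1)) -
          (pol (contr i (fhat (l + 1) ((ls p F).coeff (-1))))).1 (dir (x - p.1))) := rfl
    rw [hom, e, hv, pol_val, zpow_one, mul_comm]
    rfl
  · symm
    rw [finsum_eq_sum_of_support_subset]
    · refine Finset.sum_congr rfl fun k _ => ?_
      rw [hom, hv, Finset.mul_sum]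
      refine Finset.sum_congr rfl fun I _ => ?_
      rw [zpow_neg, zpow_natCast]
      ring
    · intro k hk
      by_contra hkN
      rw [Finset.coe_range, Set.mem_Iio, not_lt] at hkN
      refine hk ?_
      beta_reduce
      rw [hN (-2 - (k : ℤ)) (by omega), map_zero]
      simp

theorem pfAt_derivTerm (p : SPt y₁ y₂) (K : ℝ) (i : Fin 3) (F G : singularSpace y₁ y₂) (l : ℕ)
    {N : ℕ} (hN : ∀ k < -1 - (N : ℤ), (ls p F).coeff k = 0) :
    4 * Real.pi * pfAt p.1 (derivTerm p.1 K i F l * (G : E → ℝ)) =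
      Ccoef K l * sInt ((nn i * harm l ((ls p F).coeff (-1)) -
        pol (contr i (fhat (l + 1) ((ls p F).coeff (-1))))) * (ls p G).coeff (-1)) +
      ∑ k ∈ Finset.range N,
        sInt (harm l ((ls p F).coeff (-2 - (k : ℤ))) * (nn i * (ls p G).coeff (k : ℤ))) := by
  have hpi : (4 * Real.pi) ≠ 0 := by positivity
  have hs : ∀ (k : ℤ) (f : SM), (HahnSeries.single k f * ls p G).coeff 0 =
      f * (ls p G).coeff (-k) := fun k f => by
    have := HahnSeries.coeff_single_mul_add (r := f) (x := ls p G) (a := -k) (b := k)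
    rwa [neg_add_cancel] at this
  rw [pfAt_of_hasLS ((hasLS_derivTerm p K i F l hN).mul (hasLS_ls p G)), mul_inv_cancel_left₀ hpi,
    add_mul, HahnSeries.coeff_add, map_add, Finset.sum_mul, HahnSeries.coeff_sum, map_sum, hs,
    smul_mul_assoc, map_smul, smul_eq_mul]
  congr 1
  refine Finset.sum_congr rfl fun k _ => ?_
  rw [hs, neg_neg]
  congr 1
  ring

theorem div_succ_mem {s : ℕ → ℝ} (hs : s ∈ Multiplier) :
    (fun l => s l / ((l : ℝ) + 1)) ∈ Multiplier := by
  obtain ⟨C, hC⟩ := hs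
  refine ⟨C, fun l => ?_⟩
  have hl : (0 : ℝ) < (l : ℝ) + 1 := by positivity
  have hC0 : 0 ≤ C := by simpa using (abs_nonneg _).trans (hC 0)
  rw [abs_div, abs_of_pos hl, div_le_iff₀ hl]
  refine (hC l).trans (le_mul_of_one_le_right (by positivity) ?_)
  linarith [(Nat.cast_nonneg l : (0 : ℝ) ≤ l)]

theorem summable_mul_sInt_harm {s : ℕ → ℝ} (hs : s ∈ Multiplier) (f g : SM) :
    Summable fun l => s l * sInt (harm l f * g) :=
  (hasSum_sInt_op ⟨s, hs⟩ f g).summable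

/-- The total growth may be quadratic, beyond the class of multipliers. Replacing `f` by `lap f`
absorbs a factor `l (l + 1)` and leaves the multiplier `s l / (l + 1)`. -/
theorem summable_mul_mul_sInt_harm {s : ℕ → ℝ} (hs : s ∈ Multiplier) (f g : SM) :
    Summable fun l : ℕ => s l * (l * sInt (harm l f * g)) := by
  refine (summable_mul_sInt_harm (div_succ_mem hs) (lap f) g).neg.congr fun l => ?_
  have hl : (l : ℝ) + 1 ≠ 0 := by positivity
  rw [harm_lap, smul_mul_assoc, map_smul, smul_eq_mul]
  field_simp

/-- On the harmonics `f_l` of degree `l`, `sphT i` is the lowering operator minus `(l + 1) n_i`. So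
`n_i f_l` gets the factor `1 + (l + 1) (K - 1 + hnum l)`, which equals `Ccoef K l`, while the
lowered part of `f_{l+1}` gets `-(K - 1 + hnum (l + 1))`, which becomes `-Ccoef K l` in terms of the
contracted tensor. The stated series groups these two; it differs from the expansion by degree of
`f` by a telescoping sum. -/
theorem hasSum_bop (K : ℝ) (i : Fin 3) (f g : SM) :
    HasSum (fun l => Ccoef K l * sInt ((nn i * harm l f - pol (contr i (fhat (l + 1) f))) * g))
      (sInt (bop K i f * g)) := by
  have hs : (fun l => K - 1 + hnum l) ∈ Multiplier :=
    add_mem (show (fun _ => K - 1) ∈ Multiplier from ⟨|K - 1|, fun l =>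
      le_mul_of_one_le_right (abs_nonneg _) (by linarith [(Nat.cast_nonneg l : (0 : ℝ) ≤ l)])⟩)
      hnum_mem
  set u : ℕ → ℝ := fun l => sInt (harm l f * (nn i * g)) with hu
  set t : ℕ → ℝ := fun l => sInt (harm l f * sphT i g) with ht
  -- By `hlow`, `w l` is `K - 1 + hnum l` times the pairing of the lowered `harm l f` with `g`: the
  -- quantity whose index is shifted.
  set w : ℕ → ℝ := fun l => (K - 1 + hnum l) * (u l - t l + l * u l) with hw
  have hlow : ∀ l : ℕ, sInt (low l i (harm l f) * g) = u l - t l + l * u l := fun l => by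
    have h := sInt_sphT_mul i (harm l f) g
    rw [sphT_apply, sub_mul, map_sub] at h
    rw [low_apply, add_mul, map_add, smul_mul_assoc, map_smul, smul_eq_mul]
    have e : nn i * harm l f * g = harm l f * (nn i * g) := by ring
    rw [e] at h ⊢
    linear_combination h
  have hterm : ∀ l, Ccoef K l * sInt ((nn i * harm l f - pol (contr i (fhat (l + 1) f))) * g) =
      u l + (K - 1) * t l + hnum l * t l + (w l - w (l + 1)) := fun l => by
    have h := hlow (l + 1)
    push_cast at h
    have hl : (l : ℝ) + 1 ≠ 0 := by positivity
    rw [← pol_contr_fhat, smul_mul_assoc, map_smul, smul_eq_mul] at h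
    have hC := Ccoef_eq K l
    have e : nn i * harm l f * g = harm l f * (nn i * g) := by ring
    rw [sub_mul, map_sub, e, hC]
    simp only [hw]
    push_cast
    rw [← h]
    have hh : ((l : ℝ) + 1) * hnum (l + 1) = ((l : ℝ) + 1) * hnum l + 1 := by
      rw [hnum_succ]
      field_simp
    simp only [hu]
    linear_combination (sInt (harm l f * (nn i * g))) * hh
  -- The lowering operator kills constants, so the shift has no boundary term at 0; at infinity it
  -- has none because `w` is summable.
  have hw0 : w 0 = 0 := by
    have h := hlow 0
    have h0 : low ((0 : ℕ) : ℝ) i (harm 0 f) = 0 := by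
      rw [low_apply, sphD_eq_zero_of_mem (by simpa using harm_mem 0 f)]
      simp
    rw [h0, zero_mul, map_zero] at h
    simp only [hw, ← h, mul_zero]
  have hsum : Summable w := by
    refine (((summable_mul_sInt_harm hs f (nn i * g)).sub
      (summable_mul_sInt_harm hs f (sphT i g))).add
      (summable_mul_mul_sInt_harm hs f (nn i * g))).congr fun l => ?_
    simp only [hw, hu, ht]
    ring
  have hdiff : HasSum (fun l => w l - w (l + 1)) 0 := by
    have h1 := (hasSum_nat_add_iff' 1).2 hsum.hasSum
    rw [Finset.sum_range_one, hw0, sub_zero] at h1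
    simpa using hsum.hasSum.sub h1
  have hmain := ((hasSum_sInt_harm f (nn i * g)).add
    ((hasSum_sInt_harm f (sphT i g)).mul_left (K - 1))).add
    (hasSum_sInt_op ⟨hnum, hnum_mem⟩ f (sphT i g))
  have hall := hmain.add hdiff
  simp only [hterm]
  convert hall using 1
  have h1 := sInt_sphT_mul i f g
  have h2 := sInt_sphT_mul i (hop f) g
  change _ = sInt (f * (nn i * g)) + (K - 1) * sInt (f * sphT i g) + sInt (hop f * sphT i g) + 0
  rw [bop_apply, sub_mul, sub_mul, map_sub, map_sub, smul_mul_assoc, map_smul, smul_eq_mul, h1, h2,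
    show nn i * f * g = f * (nn i * g) by ring]
  ring

theorem hasSum_pfAt_derivTerm (K : ℝ) (p : SPt y₁ y₂) (i : Fin 3) (F G : singularSpace y₁ y₂) :
    HasSum (fun l => 4 * Real.pi * pfAt p.1 (derivTerm p.1 K i F l * (G : E → ℝ)))
      (locD K p i F G) := by
  obtain ⟨m, hm, hF, hG⟩ := exists_low_pair (ls p F) (ls p G)
  obtain ⟨N, hN⟩ : ∃ N : ℕ, m = -1 - (N : ℤ) := ⟨(-1 - m).toNat, by omega⟩
  have hN' : ∀ k < -1 - (N : ℤ), (ls p F).coeff k = 0 := fun k hk => hF k (by omega)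
  simp only [pfAt_derivTerm p K i F G _ hN']
  have h := (hasSum_bop K i ((ls p F).coeff (-1)) ((ls p G).coeff (-1))).add
    (hasSum_sum fun k (_ : k ∈ Finset.range N) =>
      hasSum_sInt_harm ((ls p F).coeff (-2 - (k : ℤ))) (nn i * (ls p G).coeff (k : ℤ)))
  convert h using 1
  rw [locD_apply, locForm_eq K i (by omega) hF hG, add_comm]
  congr 1
  -- The pole of order `k ≤ -2` is indexed in the series by the natural number `-2 - k`.
  refine Finset.sum_bij' (fun k _ => (-2 - k).toNat) (fun k _ => -2 - (k : ℤ)) ?_ ?_ ?_ ?_ ?_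
  · intro k hk
    rw [Finset.mem_Ico] at hk
    rw [Finset.mem_range]
    omega
  · intro k hk
    rw [Finset.mem_range] at hk
    rw [Finset.mem_Ico]
    omega
  · intro k hk
    rw [Finset.mem_Ico] at hk
    omega
  · intro k hk
    omega
  · intro k hk
    rw [Finset.mem_Ico] at hk
    have e : (((-2 - k).toNat : ℕ) : ℤ) = -2 - k := by omega
    rw [e, show -2 - (-2 - k) = k by ring]
    congr 1
    ring

theorem isGivenBy_iff {D : Fin 3 → singularSpace y₁ y₂ →ₗ[ℝ] Form y₁ y₂} {K₁ K₂ : ℝ} :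
    IsGivenBy D K₁ K₂ ↔
      D = fun i => locD K₁ ⟨y₁, Or.inl rfl⟩ i + locD K₂ ⟨y₂, Or.inr rfl⟩ i := by
  have h : ∀ (i : Fin 3) (F G : singularSpace y₁ y₂),
      HasSum (fun l : ℕ => 4 * Real.pi *
        (pfAt y₁ (derivTerm y₁ K₁ i F l * (G : E → ℝ)) +
          pfAt y₂ (derivTerm y₂ K₂ i F l * (G : E → ℝ))))
        (locD K₁ ⟨y₁, Or.inl rfl⟩ i F G + locD K₂ ⟨y₂, Or.inr rfl⟩ i F G) := fun i F G => by
    simp only [mul_add]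
    exact (hasSum_pfAt_derivTerm K₁ ⟨y₁, Or.inl rfl⟩ i F G).add
      (hasSum_pfAt_derivTerm K₂ ⟨y₂, Or.inr rfl⟩ i F G)
  constructor
  · intro hD
    funext i
    exact LinearMap.ext fun F => LinearMap.ext fun G => (hD i F G).unique (h i F G)
  · rintro rfl
    exact h

end

end Hadamard


/-! ### Uniqueness of the operators on the sphere -/

namespace Hadamard

noncomputable section

variable {y₁ y₂ : E}

/-! ### Operators on the sphere which commute with the orthogonal group -/

theorem exists_swap (e m : S2) : ∃ R : E ≃ₗᵢ[ℝ] E, rot R e = m ∧ rot R m = e := by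
  have h : ‖(e : E)‖ = ‖(m : E)‖ := by rw [norm_sphere, norm_sphere]
  have h1 := Submodule.reflection_sub h
  refine ⟨Submodule.reflection (ℝ ∙ ((e : E) - m))ᗮ, Subtype.ext h1, Subtype.ext ?_⟩
  change Submodule.reflection (ℝ ∙ ((e : E) - m))ᗮ (m : E) = e
  have h2 := congrArg (Submodule.reflection (ℝ ∙ ((e : E) - m))ᗮ) h1
  rw [Submodule.reflection_reflection] at h2
  exact h2.symm

theorem comp_zonal (l : ℕ) (R : E ≃ₗᵢ[ℝ] E) (e : S2) :
    comp R (zonal l (rot R e)) = zonal l e := by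
  refine eq_of_mem_Eig (comp_mem_Eig (zonal_mem _ _) R) (zonal_mem _ _) fun u hu => ?_
  rw [sInt_zonal_mul e hu, ← comp_comp_symm R u, ← map_mul (comp R), sInt_comp,
    sInt_zonal_mul _ (comp_mem_Eig hu R.symm)]
  rfl

/-- A reflection exchanging two directions shows that the value at `m` of the image of the zonal
harmonic with axis `e` is symmetric in `e` and `m`. For fixed `e` it is therefore a linear function
of the projection of `n^L` at `m`, that is, a harmonic of degree `l`. No continuity of `S` is
involved. -/
theorem map_zonal_mem {S : SM →ₗ[ℝ] SM} (hS : ∀ R f, comp R (S f) = S (comp R f)) (l : ℕ) (e : S2) :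
    S (zonal l e) ∈ Eig l := by
  have hsymm : ∀ m, (S (zonal l e)).1 m = (S (zonal l m)).1 e := fun m => by
    obtain ⟨R, h1, h2⟩ := exists_swap e m
    have h := congrArg (evalAt m) (hS R (zonal l m))
    rw [← h1, comp_zonal, h1] at h
    rw [← evalAt_apply, ← h, ← h2]
    rfl
  let T : Tensor l →ₗ[ℝ] ℝ := (evalAt e).toLinearMap ∘ₗ S ∘ₗ pol ∘ₗ stfL l
  let U : Tensor l := (InnerProductSpace.toDual ℝ (Tensor l)).symm (LinearMap.toContinuousLinearMap T)
  have hU : ∀ V, inner ℝ U V = (S (pol (stf V))).1 e := fun V => by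
    simp only [U, InnerProductSpace.toDual_symm_apply]
    rfl
  have hmem : U ∈ stfSubspace l := by
    have : stf U = U := ext_inner_right ℝ fun V => by
      rw [inner_stf_left, hU, hU, stf_of_mem (stf_mem V)]
    rw [← this]
    exact stf_mem U
  have : S (zonal l e) = pol U := SM.ext' fun m => by
    rw [hsymm, pol_val_inner, real_inner_comm, hU, zonal]
  rw [this]
  exact pol_mem_Eig hmem

/-- Zonal harmonics span: a symmetric trace-free tensor orthogonal to every `n^L` has vanishing
polynomial, so it is 0. -/
theorem map_mem_Eig {S : SM →ₗ[ℝ] SM} (hS : ∀ R f, comp R (S f) = S (comp R f)) {l : ℕ} {f : SM}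
    (hf : f ∈ Eig l) : S f ∈ Eig l := by
  obtain ⟨T, hT, rfl⟩ := exists_pol_eq hf
  let W : Submodule ℝ (Tensor l) := ((Eig l).comap S).comap (pol ∘ₗ stfL l)
  have htop : ∀ W : Submodule ℝ (Tensor l), Wᗮ ≤ ⊥ → W = ⊤ := fun W h =>
    Submodule.orthogonal_eq_bot_iff.1 (eq_bot_iff.2 h)
  have hW : W = ⊤ := by
    refine htop W ?_
    intro U hU
    rw [Submodule.mem_orthogonal] at hU
    have h1 : U ∈ stfSubspace l := by
      rw [← Submodule.orthogonal_orthogonal (stfSubspace l), Submodule.mem_orthogonal]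
      intro V hV
      refine hU V ?_
      have h0 : stf V = 0 := (Submodule.starProjection_apply_eq_zero_iff _).2 hV
      change S (pol (stf V)) ∈ Eig l
      rw [h0, map_zero, map_zero]
      exact zero_mem _
    refine pol_injOn h1 (SM.ext' fun e => ?_)
    rw [pol_val_inner]
    exact hU _ (map_zonal_mem hS l e)
  have h2 : T ∈ W := hW ▸ Submodule.mem_top
  change S (pol (stf T)) ∈ Eig l at h2
  rwa [stf_of_mem hT] at h2

/-- Schur's lemma would give a scalar in each degree; the antisymmetry of `sphT i ∘ S` links
neighbouring degrees. If `S` is `c` in degree `l`, then `S f - c f` for `f` of degree `l + 1` is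
orthogonal to every `sphT i g` with `g` of degree `l`, and this already forces it to vanish. -/
theorem exists_map_eq_smul {S : SM →ₗ[ℝ] SM} (hS : ∀ R f, comp R (S f) = S (comp R f))
    (hanti : ∀ i f g, sInt (S f * sphT i g) = -sInt (S g * sphT i f)) :
    ∃ c : ℝ, ∀ l : ℕ, ∀ f ∈ Eig l, S f = c • f := by
  have h1 : S 1 ∈ Eig ((0 : ℕ) : ℝ) := map_mem_Eig hS (by
    have := algebraMap_mem_Eig 1
    rw [map_one] at this
    exact_mod_cast this)
  let n₀ : S2 := dir 0
  refine ⟨(S 1).1 n₀, fun l => ?_⟩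
  induction l with
  | zero =>
    intro f hf
    rw [Nat.cast_zero] at hf h1
    rw [eq_algebraMap_of_mem hf n₀, Algebra.algebraMap_eq_smul_one, map_smul,
      smul_comm]
    congr 1
    conv_lhs => rw [eq_algebraMap_of_mem h1 n₀,
      Algebra.algebraMap_eq_smul_one]
  | succ l ih =>
    intro f hf
    set c := (S 1).1 n₀
    set h := S f - c • f with hh
    have hmem : h ∈ Eig ((l + 1 : ℕ) : ℝ) := sub_mem (map_mem_Eig hS hf) (Submodule.smul_mem _ _ hf)
    -- `sphT i g` is a lowered function, orthogonal to `h` for reasons of degree, minus `(l + 1) n_i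
    -- g`; so orthogonality passes to `n_i g`.
    have h2 : ∀ i, ∀ g ∈ Eig (l : ℝ), sInt (h * (nn i * g)) = 0 := by
      intro i g hg
      have e1 := hanti i f g
      have e2 := sInt_sphT_mul i g f
      have e0 : sInt (h * sphT i g) = 0 := by
        rw [ih g hg, smul_mul_assoc, map_smul, smul_eq_mul] at e1
        rw [mul_comm (sphT i g)] at e2
        rw [hh, sub_mul, map_sub, smul_mul_assoc, map_smul, smul_eq_mul, e2]
        linear_combination e1
      have e3 : sInt (h * low l i g) = 0 :=
        sInt_Eig_orth (natDegree_ne (by omega)) hmem (low_mem_nat hg i)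
      have e4 : sphT i g = low l i g - ((l : ℝ) + 1) • (nn i * g) := by
        rw [sphT_apply, low_apply]
        module
      rw [e4, mul_sub, map_sub, e3, mul_smul_comm, map_smul, smul_eq_mul, zero_sub,
        neg_eq_zero] at e0
      exact (mul_eq_zero.1 e0).resolve_left (by positivity)
    -- Euler's relation writes `h` as a multiple of `∑ n_i (low i h)`, where the lowered functions
    -- have degree `l`.
    have h3 : sInt (h * h) = 0 := by
      have e := sum_nn_mul_low ((l + 1 : ℕ) : ℝ) h
      have e5 : sInt (h * ∑ i, nn i * low ((l + 1 : ℕ) : ℝ) i h) = 0 := by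
        rw [Finset.mul_sum, map_sum]
        exact Finset.sum_eq_zero fun i _ => h2 i _ (by simpa using low_mem_nat hmem i)
      rw [e, mul_smul_comm, map_smul, smul_eq_mul] at e5
      exact (mul_eq_zero.1 e5).resolve_left (by positivity)
    exact sub_eq_zero.1 (sInt_mul_self_eq_zero h3)

theorem sInt_mul_sphD (i : Fin 3) (f u : SM) :
    sInt (f * sphD i u) = -sInt ((sphD i f - 2 * (nn i * f)) * u) := by
  have h := sInt_sphT_mul i f u
  rw [sphT_apply, sphT_apply, sub_mul, mul_sub, map_sub, map_sub] at h
  have e : sInt ((sphD i f - 2 * (nn i * f)) * u) =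
      sInt (sphD i f * u) - sInt (nn i * f * u) - sInt (f * (nn i * u)) := by
    rw [← map_sub, ← map_sub]
    congr 1
    ring
  rw [e]
  linear_combination h

/-- The hypothesis says that the field `x_i / r ^ 2` is curl-free. Being homogeneous of degree -2,
it has a potential `u / r` of degree -1, and Euler's relation gives `u = -∑ n_j x_j`; finally `∂_i
(u / r) = (T_i u) / r ^ 2`. -/
theorem eq_sphT_of_curl_eq_zero (x : Fin 3 → SM)
    (h : ∀ i j, sphD j (x i) - 2 * (nn j * x i) = sphD i (x j) - 2 * (nn i * x j)) (i : Fin 3) :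
    x i = sphT i (-∑ j, nn j * x j) := by
  have h1 : ∑ j, nn j * (sphD j (x i) - 2 * (nn j * x i)) =
      ∑ j, nn j * (sphD i (x j) - 2 * (nn i * x j)) :=
    Finset.sum_congr rfl fun j _ => by rw [h i j]
  have h2 : ∑ j, nn j * (sphD j (x i) - 2 * (nn j * x i)) = -2 * x i := by
    have e1 := sum_nn_sphD (x i)
    have e2 := congrArg (fun u => -2 * x i * u) sum_nn_sq
    simp only [Finset.mul_sum] at e2
    rw [mul_one] at e2
    rw [← e2, ← zero_add (∑ j, -2 * x i * (nn j * nn j)), ← e1, ← Finset.sum_add_distrib]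
    exact Finset.sum_congr rfl fun j _ => by ring
  have h3 : sphD i (∑ j, nn j * x j) = x i + ∑ j, nn j * (sphD i (x j) - nn i * x j) := by
    rw [map_sum]
    simp only [sphD_nn_mul]
    have e : ∑ j, (if i = j then (1 : ℝ) else 0) • x j = x i := by simp
    rw [← e, ← Finset.sum_add_distrib]
    exact Finset.sum_congr rfl fun j _ => by ring
  have h4 : ∑ j, nn j * (sphD i (x j) - 2 * (nn i * x j)) =
      ∑ j, nn j * (sphD i (x j) - nn i * x j) - nn i * ∑ j, nn j * x j := by
    rw [Finset.mul_sum, ← Finset.sum_sub_distrib]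
    exact Finset.sum_congr rfl fun j _ => by ring
  rw [sphT_apply, map_neg, h3]
  rw [h2, h4] at h1
  linear_combination -h1

/-- Taking adjoints in `hsymm` by means of `hanti` shows that the functions `X i f` form a curl-free
field, so `X i = sphT i ∘ S` with `S = -∑ n_j X_j`. Covariance makes `S` commute with isometries,
and it is then one scalar on all harmonics. -/
theorem exists_eq_smul_sphT (X : Fin 3 → SM →ₗ[ℝ] SM)
    (hanti : ∀ i f g, sInt (X i f * g) = -sInt (X i g * f))
    (hsymm : ∀ i j f, X i (sphD j f) = X j (sphD i f))
    (hcomp : ∀ R i f, comp R (X i f) = ∑ j, R (ee j) i • X j (comp R f)) :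
    ∃ c : ℝ, ∀ i f, X i f = c • sphT i f := by
  let S : SM →ₗ[ℝ] SM := -∑ j, LinearMap.mulLeft ℝ (nn j) ∘ₗ X j
  have hSapp : ∀ f, S f = -∑ j, nn j * X j f := fun f => by
    simp only [S, LinearMap.neg_apply, LinearMap.sum_apply]
    rfl
  have hX : ∀ i f, X i f = sphT i (S f) := fun i f => by
    rw [hSapp]
    refine eq_sphT_of_curl_eq_zero (fun i => X i f) (fun i j => sInt_eq_of_forall fun u => ?_) i
    rw [← neg_inj, ← sInt_mul_sphD, ← sInt_mul_sphD, hanti, hanti j, hsymm]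
  have hS : ∀ R f, comp R (S f) = S (comp R f) := fun R f => by
    rw [hSapp, hSapp, map_neg, map_sum]
    congr 1
    simp only [map_mul, nn_comp, hcomp, Finset.sum_mul_sum, smul_mul_smul_comm]
    have ho : ∀ a b, ∑ j, R (ee a) j * R (ee b) j = if a = b then 1 else 0 := fun a b => by
      have h := R.inner_map_map (ee a) (ee b)
      rw [PiLp.inner_apply] at h
      simp only [RCLike.inner_apply, conj_trivial] at h
      rw [Finset.sum_congr rfl fun j _ => mul_comm (R (ee a) j) (R (ee b) j), h]
      simp [ee, EuclideanSpace.inner_single_left]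
    rw [Finset.sum_comm]
    refine Finset.sum_congr rfl fun a _ => ?_
    rw [Finset.sum_comm]
    simp only [← Finset.sum_smul, ho]
    simp
  obtain ⟨c, hc⟩ := exists_map_eq_smul hS fun i f g => by
    have h := hanti i f g
    rw [hX, hX, sInt_sphT_mul, sInt_sphT_mul] at h
    linarith
  -- For general `f`, antisymmetry moves `X i` onto the harmonic test function, where it is already
  -- known.
  refine ⟨c, fun i f => sub_eq_zero.1 (eq_zero_of_forall_Eig fun l h hh => ?_)⟩
  rw [sub_mul, map_sub, hanti, hX, hc l h hh, map_smul, smul_mul_assoc, smul_mul_assoc, map_smul,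
    map_smul, sInt_sphT_mul, mul_comm h, smul_neg, neg_neg, sub_self]

end

end Hadamard


/-! ### Reduction of local terms to the coefficient of `1 / r` -/

namespace Hadamard

noncomputable section

variable {y₁ y₂ : E}

/-! ### The structure of local terms -/

theorem coeff_sum_single (A : HahnSeries ℤ SM) (s : Finset ℤ) (k : ℤ) :
    (∑ j ∈ s, HahnSeries.single j (A.coeff j)).coeff k = if k ∈ s then A.coeff k else 0 := by
  rw [HahnSeries.coeff_sum]
  simp only [HahnSeries.coeff_single]
  convert Finset.sum_ite_eq s k A.coeff

theorem comp_refl (f : SM) : comp (LinearIsometryEquiv.refl ℝ E) f = f := SM.ext' fun _ => rfl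

variable {p : SPt y₁ y₂} {T : Fin 3 → singularSpace y₁ y₂ →ₗ[ℝ] Form y₁ y₂}

theorem IsLocalTerm.congr_left (hT : IsLocalTerm p.1 T) {F F' : singularSpace y₁ y₂}
    (h : ∀ k < 0, (ls p F).coeff k = (ls p F').coeff k) (i : Fin 3) : T i F = T i F' :=
  hT.singular F F' (fun k hk => by rw [coef_ls, coef_ls, h k hk]) i

theorem IsLocalTerm.eq_zero_left (hT : IsLocalTerm p.1 T) {F : singularSpace y₁ y₂}
    (h : ∀ k < 0, (ls p F).coeff k = 0) (i : Fin 3) : T i F = 0 := by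
  rw [hT.congr_left (F' := 0) (fun k hk => by rw [h k hk, map_zero]; rfl), map_zero]

theorem IsLocalTerm.mono_eq_zero (hT : IsLocalTerm p.1 T) (hy : y₁ ≠ y₂) {k : ℤ} (hk : 0 ≤ k)
    (f : SM) (i : Fin 3) : T i (mono hy p k f) = 0 :=
  hT.eq_zero_left (fun j hj => by
    rw [ls_mono_self, HahnSeries.coeff_single_of_ne (by omega)]) i

theorem IsLocalTerm.mono_covariant (hT : IsLocalTerm p.1 T) (hy : y₁ ≠ y₂) (R : E ≃ₗᵢ[ℝ] E) {c : ℝ}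
    (hc : 0 < c) (k m : ℤ) (f g : SM) (i : Fin 3) :
    T i (mono hy p k f) (mono hy p m g) = c ^ 2 * c ^ k * c ^ m *
      ∑ j, R (ee j) i * T j (mono hy p k (comp R f)) (mono hy p m (comp R g)) := by
  have key : ∀ (k : ℤ) (f : SM) (j : ℤ) (n n' : S2), (n' : E) = R n →
      coef p.1 (mono hy p k f) j n' = c ^ (-j) * coef p.1 (mono hy p k (c ^ k • comp R f)) j n := by
    intro k f j n n' hn
    obtain rfl : n' = rot R n := Subtype.ext hn
    rw [coef_ls, coef_ls, ls_mono_self, ls_mono_self]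
    by_cases hj : j = k
    · subst hj
      rw [HahnSeries.coeff_single_same, HahnSeries.coeff_single_same]
      change f.1 (rot R n) = c ^ (-j) * (c ^ j * f.1 (rot R n))
      rw [zpow_neg, inv_mul_cancel_left₀ (zpow_ne_zero _ hc.ne')]
    · rw [HahnSeries.coeff_single_of_ne hj, HahnSeries.coeff_single_of_ne hj]
      change (0 : ℝ) = _ * 0
      rw [mul_zero]
  rw [hT.covariant R c hc (mono hy p k (c ^ k • comp R f)) (mono hy p k f)
    (mono hy p m (c ^ m • comp R g)) (mono hy p m g) (fun j _ => key k f j) (key m g) i,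
    Finset.mul_sum, Finset.mul_sum]
  refine Finset.sum_congr rfl fun j _ => ?_
  rw [map_smul, map_smul, map_smul, map_smul, LinearMap.smul_apply, smul_eq_mul, smul_eq_mul]
  ring

/-- A dilation by 2 multiplies the value by `2 ^ (2 + k + m)`, which differs from 1. -/
theorem IsLocalTerm.mono_mono_eq_zero (hT : IsLocalTerm p.1 T) (hy : y₁ ≠ y₂) {k m : ℤ}
    (hkm : k + m ≠ -2) (f g : SM) (i : Fin 3) : T i (mono hy p k f) (mono hy p m g) = 0 := by
  have h := hT.mono_covariant hy (LinearIsometryEquiv.refl ℝ E) (two_pos (α := ℝ)) k m f g i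
  have hs : ∑ j, (LinearIsometryEquiv.refl ℝ E) (ee j) i *
      T j (mono hy p k (comp (LinearIsometryEquiv.refl ℝ E) f))
        (mono hy p m (comp (LinearIsometryEquiv.refl ℝ E) g)) =
      T i (mono hy p k f) (mono hy p m g) := by
    simp only [comp_refl, LinearIsometryEquiv.coe_refl, id_eq]
    rw [Finset.sum_eq_single i]
    · simp
    · intro j _ hj
      simp [hj.symm]
    · simp
  have h2 : (2 : ℝ) ^ 2 * 2 ^ k * 2 ^ m = 2 ^ (2 + k + m) := by
    rw [zpow_add₀ two_ne_zero, zpow_add₀ two_ne_zero]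
    norm_num
  rw [hs, h2] at h
  have h3 : (2 : ℝ) ^ (2 + k + m) ≠ 1 := by
    rw [Ne, zpow_eq_one_iff_right₀ (by norm_num) (by norm_num)]
    omega
  have h4 : ((2 : ℝ) ^ (2 + k + m) - 1) * T i (mono hy p k f) (mono hy p m g) = 0 := by linarith
  exact (mul_eq_zero.1 h4).resolve_left (sub_ne_zero.2 h3)

/-- The Dirac form is essential here: it makes the pairing depend on finitely many coefficients of
`G`, so that `G` may be replaced by a finite sum of monomials, to which scaling applies. -/
theorem IsLocalTerm.mono_apply (hT : IsLocalTerm p.1 T) (hy : y₁ ≠ y₂) (k : ℤ) (f : SM)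
    (G : singularSpace y₁ y₂) (i : Fin 3) :
    T i (mono hy p k f) G = T i (mono hy p k f) (mono hy p (-2 - k) ((ls p G).coeff (-2 - k))) := by
  obtain ⟨H, hH⟩ := hT.dirac i (mono hy p k f)
  obtain ⟨m, hm, hH0⟩ := exists_low (ls p H) 0
  obtain ⟨a, ha, hG⟩ := exists_low (ls p G) (-2 - k)
  -- The series of `H` starts at order `m` or later, so a remainder of order at least `1 - m`
  -- contributes nothing at order 0.
  obtain ⟨N, hN1, hN2⟩ : ∃ N : ℤ, 1 - m ≤ N ∧ -2 - k < N :=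
    ⟨max (1 - m) (-2 - k + 1), le_max_left _ _, by omega⟩
  set G₀ := ∑ j ∈ Finset.Ico a N, mono hy p j ((ls p G).coeff j) with hG₀
  have h0 : ∀ j < N, (ls p (G - G₀)).coeff j = 0 := fun j hj => by
    rw [map_sub, HahnSeries.coeff_sub, hG₀, map_sum]
    simp only [ls_mono_self]
    rw [coeff_sum_single]
    split_ifs with h
    · rw [sub_self]
    · rw [Finset.mem_Ico] at h
      rw [hG j (by omega), sub_zero]
  have h1 : T i (mono hy p k f) (G - G₀) = 0 := by
    rw [hH, pfAt_mul, coeff_mul_eq hH0 h0, Finset.Ico_eq_empty (by omega), Finset.sum_empty,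
      map_zero, mul_zero]
  rw [map_sub, sub_eq_zero] at h1
  rw [h1, hG₀, map_sum]
  refine Finset.sum_eq_single (-2 - k) (fun j _ hj => hT.mono_mono_eq_zero hy (by omega) _ _ i)
    fun h => absurd (Finset.mem_Ico.2 ⟨ha, hN2⟩) h

theorem IsLocalTerm.apply_eq_sum (hT : IsLocalTerm p.1 T) (hy : y₁ ≠ y₂) {F : singularSpace y₁ y₂}
    {a : ℤ} (ha : ∀ k < a, (ls p F).coeff k = 0) (G : singularSpace y₁ y₂) (i : Fin 3) :
    T i F G = ∑ k ∈ Finset.Ico a 0, T i (mono hy p k ((ls p F).coeff k))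
      (mono hy p (-2 - k) ((ls p G).coeff (-2 - k))) := by
  rw [hT.congr_left (F' := ∑ k ∈ Finset.Ico a 0, mono hy p k ((ls p F).coeff k)) fun k hk => by
    rw [map_sum]
    simp only [ls_mono_self]
    rw [coeff_sum_single]
    split_ifs with h
    · rfl
    · rw [Finset.mem_Ico] at h
      exact ha k (by omega), map_sum, LinearMap.sum_apply]
  exact Finset.sum_congr rfl fun k _ => hT.mono_apply hy k _ G i

/-- The coefficient of order 1 of `H` is the smooth representative. It is determined by its
pairings, hence depends linearly on `f`, although `H` itself is only chosen. -/
theorem IsLocalTerm.exists_operator (hT : IsLocalTerm p.1 T) (hy : y₁ ≠ y₂) :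
    ∃ B : Fin 3 → SM →ₗ[ℝ] SM, ∀ i f g,
      T i (mono hy p (-1) f) (mono hy p (-1) g) = sInt (B i f * g) := by
  have h : ∀ i f, ∃ b : SM, ∀ g, T i (mono hy p (-1) f) (mono hy p (-1) g) = sInt (b * g) := by
    intro i f
    obtain ⟨H, hH⟩ := hT.dirac i (mono hy p (-1) f)
    refine ⟨(4 * Real.pi)⁻¹ • (ls p H).coeff 1, fun g => ?_⟩
    have e := HahnSeries.coeff_mul_single_add (r := g) (x := ls p H) (a := 1) (b := (-1 : ℤ))
    rw [add_neg_cancel] at e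
    rw [hH, pfAt_mul, ls_mono_self, e, smul_mul_assoc, map_smul, smul_eq_mul]
  choose b hb using h
  refine ⟨fun i => ⟨⟨b i, fun f f' => ?_⟩, fun c f => ?_⟩, fun i f g => hb i f g⟩
  · refine sInt_eq_of_forall fun u => ?_
    rw [← hb, map_add, map_add, LinearMap.add_apply, add_mul, map_add, hb, hb]
  · refine sInt_eq_of_forall fun u => ?_
    change sInt (b i (c • f) * u) = sInt (c • b i f * u)
    rw [← hb, map_smul, map_smul, LinearMap.smul_apply, smul_mul_assoc, map_smul, hb]

/-- The bilinear form splits by order. For `k ≤ -2` the companion monomial has order at least 0 and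
is invisible as a first argument, so `hS` fixes the value. For `k = -1` the operator satisfies the
three conditions that `bop 1` satisfies, and the difference is a multiple of `sphT`. -/
theorem IsLocalTerm.exists_eq_locD (hT : IsLocalTerm p.1 T) (hy : y₁ ≠ y₂)
    (hS : ∀ i k m f g, T i (mono hy p k f) (mono hy p m g) + T i (mono hy p m g) (mono hy p k f) =
      sInt (nn i * (HahnSeries.single k f * HahnSeries.single m g).coeff (-2)))
    (hC : ∀ i j f g, T i (dd j (mono hy p 0 f)) (mono hy p (-1) g) =
      T j (dd i (mono hy p 0 f)) (mono hy p (-1) g)) :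
    ∃ K, T = locD K p := by
  obtain ⟨B, hB⟩ := hT.exists_operator hy
  have hBS : ∀ i f g, sInt (B i f * g) + sInt (B i g * f) = sInt (nn i * (f * g)) := by
    intro i f g
    rw [← hB, ← hB, hS, HahnSeries.single_mul_single]
    norm_num
  have hdd : ∀ i j f, T i (dd j (mono hy p 0 f)) = T i (mono hy p (-1) (sphD j f)) := by
    intro i j f
    refine hT.congr_left (fun k _ => ?_) i
    rw [ls_dd, ls_mono_self, ls_mono_self]
    by_cases hk : k = -1
    · subst hk
      rw [neg_add_cancel, HahnSeries.coeff_single_same, HahnSeries.coeff_single_same, low_apply]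
      simp
    · rw [HahnSeries.coeff_single_of_ne (by omega), HahnSeries.coeff_single_of_ne hk, map_zero]
  have hBC : ∀ i j f, B i (sphD j f) = B j (sphD i f) := by
    intro i j f
    refine sInt_eq_of_forall fun u => ?_
    rw [← hB, ← hB, ← hdd, ← hdd, hC]
  have hBR : ∀ R i f, comp R (B i f) = ∑ j, R (ee j) i • B j (comp R f) := by
    intro R i f
    refine sInt_eq_of_forall fun u => ?_
    have h := hT.mono_covariant hy R one_pos (-1) (-1) f (comp R.symm u) i
    rw [comp_comp_symm, hB, ← sInt_comp R, map_mul (comp R), comp_comp_symm] at h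
    rw [h, Finset.sum_mul, map_sum]
    simp [hB]
  -- `bop 1` serves as a particular solution of the inhomogeneous condition `hBS`.
  obtain ⟨c, hc⟩ := exists_eq_smul_sphT (fun i => B i - bop 1 i)
    (fun i f g => by
      have h1 := hBS i f g
      have h2 := sInt_bop_add 1 i f g
      rw [LinearMap.sub_apply, LinearMap.sub_apply, sub_mul, sub_mul, map_sub, map_sub]
      linarith)
    (fun i j f => by
      rw [LinearMap.sub_apply, LinearMap.sub_apply, hBC, bop_sphD_symm])
    (fun R i f => by
      simp only [LinearMap.sub_apply, map_sub, smul_sub, Finset.sum_sub_distrib, hBR, bop_comp])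
  have hB' : ∀ i f, B i f = bop (1 - c) i f := fun i f => by
    have h := hc i f
    rw [LinearMap.sub_apply, sub_eq_iff_eq_add] at h
    rw [h, bop_apply, bop_apply]
    module
  -- In `bop K` the operator `sphT i` has the coefficient `-(K - 1)`, so adding `c • sphT i` to `bop
  -- 1` gives `K = 1 - c`.
  refine ⟨1 - c, funext fun i => LinearMap.ext fun F => LinearMap.ext fun G => ?_⟩
  obtain ⟨m, hm, hF, hG⟩ := exists_low_pair (ls p F) (ls p G)
  rw [hT.apply_eq_sum hy hF, locD_apply, locForm_eq _ i (by omega) hF hG,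
    show (0 : ℤ) = -1 + 1 by norm_num, ← Finset.sum_Ico_add_eq_sum_Ico_add_one hm, ← hB', ← hB,
    show (-2 : ℤ) - -1 = -1 by norm_num]
  congr 1
  refine Finset.sum_congr rfl fun k hk => ?_
  rw [Finset.mem_Ico] at hk
  have h := hS i k (-2 - k) ((ls p F).coeff k) ((ls p G).coeff (-2 - k))
  rw [hT.mono_eq_zero hy (k := -2 - k) (by omega), LinearMap.zero_apply, add_zero,
    HahnSeries.single_mul_single, show k + (-2 - k) = -2 by ring,
    HahnSeries.coeff_single_same] at h
  exact h

/-! ### Consequences of the rule of integration by parts -/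

theorem mul_cocompact {F G : E → ℝ} (h : G =ᶠ[cocompact E] 0) : F * G =ᶠ[cocompact E] 0 := by
  filter_upwards [h] with x hx
  simp [hx]

variable {D : Fin 3 → singularSpace y₁ y₂ →ₗ[ℝ] Form y₁ y₂}
  {M : List (Fin 3) → singularSpace y₁ y₂ →ₗ[ℝ] Form y₁ y₂}

theorem byParts_cocompact {s₁ s₂ : ℝ} (hM : ByPartsFirst s₁ s₂ M) (i : Fin 3) (L : List (Fin 3))
    (F : singularSpace y₁ y₂) {G : singularSpace y₁ y₂} (hG : (G : E → ℝ) =ᶠ[cocompact E] 0) :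
    bracket s₁ s₂ M (i :: L) F [] G = -bracket s₁ s₂ M L F [i] G := by
  have h := hM (i :: L) (List.cons_ne_nil _ _) F G
    (fun j _ => integrableAtFilter_of_eq_zero (mul_cocompact (pdL_cocompact hG _)))
    (fun j _ => (isLittleO_zero _ _).congr' (mul_cocompact (pdL_cocompact hG _)).symm
      EventuallyEq.rfl)
  simpa using h

theorem pfIntegral_mul_dd_cocompact (hy : y₁ ≠ y₂) {s₁ s₂ : ℝ} (hs₁ : 0 < s₁) (hs₂ : 0 < s₂)
    (i : Fin 3) (U : singularSpace y₁ y₂) {V : singularSpace y₁ y₂}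
    (hV : (V : E → ℝ) =ᶠ[cocompact E] 0) :
    pfIntegral y₁ y₂ s₁ s₂ (((dd i U : singularSpace y₁ y₂) : E → ℝ) * (V : E → ℝ)) +
        pfIntegral y₁ y₂ s₁ s₂ ((U : E → ℝ) * ((dd i V : singularSpace y₁ y₂) : E → ℝ)) =
      -(sInt (nn i * (ls ⟨y₁, Or.inl rfl⟩ U * ls ⟨y₁, Or.inl rfl⟩ V).coeff (-2)) +
        sInt (nn i * (ls ⟨y₂, Or.inr rfl⟩ U * ls ⟨y₂, Or.inr rfl⟩ V).coeff (-2))) :=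
  pfIntegral_mul_dd hy hs₁ hs₂ i U V (integrableAtFilter_of_eq_zero (mul_cocompact hV))
    (integrableAtFilter_of_eq_zero (mul_cocompact (pdL_cocompact hV [i])))
    ((isLittleO_zero _ _).congr' (mul_cocompact hV).symm EventuallyEq.rfl)

theorem IsMultiDeriv.sumRule (hM : IsMultiDeriv D M) (hy : y₁ ≠ y₂) {s₁ s₂ : ℝ} (hs₁ : 0 < s₁)
    (hs₂ : 0 < s₂) (hP : ByPartsFirst s₁ s₂ M) (i : Fin 3) (F : singularSpace y₁ y₂)
    {G : singularSpace y₁ y₂} (hG : (G : E → ℝ) =ᶠ[cocompact E] 0) :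
    D i F G + D i G F =
      sInt (nn i * (ls ⟨y₁, Or.inl rfl⟩ F * ls ⟨y₁, Or.inl rfl⟩ G).coeff (-2)) +
        sInt (nn i * (ls ⟨y₂, Or.inr rfl⟩ F * ls ⟨y₂, Or.inr rfl⟩ G).coeff (-2)) := by
  have h1 := byParts_cocompact hP i [] F hG
  have h2 := pfIntegral_mul_dd_cocompact hy hs₁ hs₂ i F hG
  rw [bracket, bracket, hM.nil, hM.single] at h1
  change pfIntegral y₁ y₂ s₁ s₂ (((dd i F : singularSpace y₁ y₂) : E → ℝ) * (G : E → ℝ)) +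
    D i F G + 0 = -(pfIntegral y₁ y₂ s₁ s₂ ((F : E → ℝ) * ((dd i G : singularSpace y₁ y₂) : E → ℝ)) +
      0 + D i G F) at h1
  linear_combination h1 - h2

/-- Integrating by parts in `∂_i` produces `D i G (dd j F)` and boundary terms; the sum rule for `dd
j F` and `G` exchanges them for `D i (dd j F) G`. Hence second order is determined by first order.
-/
theorem IsMultiDeriv.pair_apply (hM : IsMultiDeriv D M) (hy : y₁ ≠ y₂) {s₁ s₂ : ℝ} (hs₁ : 0 < s₁)
    (hs₂ : 0 < s₂) (hP : ByPartsFirst s₁ s₂ M) (i j : Fin 3) (F : singularSpace y₁ y₂)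
    {G : singularSpace y₁ y₂} (hG : (G : E → ℝ) =ᶠ[cocompact E] 0) :
    M [i, j] F G = D i (dd j F) G - D j F (dd i G) := by
  have h1 := byParts_cocompact hP i [j] F hG
  have h2 := pfIntegral_mul_dd_cocompact hy hs₁ hs₂ i (dd j F) hG
  have h3 := hM.sumRule hy hs₁ hs₂ hP i (dd j F) hG
  rw [bracket, bracket, hM.nil, hM.single, hM.single] at h1
  change pfIntegral y₁ y₂ s₁ s₂ (((dd i (dd j F) : singularSpace y₁ y₂) : E → ℝ) * (G : E → ℝ)) +
    M [i, j] F G + 0 = -(pfIntegral y₁ y₂ s₁ s₂ (((dd j F : singularSpace y₁ y₂) : E → ℝ) *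
      ((dd i G : singularSpace y₁ y₂) : E → ℝ)) + D j F (dd i G) + D i G (dd j F)) at h1
  linear_combination h1 - h2 - h3

/-- The local term at `p` is determined up to a constant. -/
theorem IsLocalTerm.exists_eq_locD_of_byParts (hT : IsLocalTerm p.1 T) (hy : y₁ ≠ y₂) {s₁ s₂ : ℝ}
    (hs₁ : 0 < s₁) (hs₂ : 0 < s₂) (hM : IsMultiDeriv D M) (hP : ByPartsFirst s₁ s₂ M)
    (hcomm : Commuting M)
    (hD : ∀ i F, (∀ q ≠ p, ls q F = 0) → D i F = T i F) :
    ∃ K, T = locD K p := by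
  have hne : ∀ k f, ∀ q ≠ p, ls q (mono hy p k f) = 0 := fun k f q hq => ls_mono_of_ne hy hq k f
  have hned : ∀ i k f, ∀ q ≠ p, ls q (dd i (mono hy p k f)) = 0 := fun i k f q hq => by
    ext1
    funext n
    rw [ls_dd, hne k f q hq]
    exact map_zero _
  refine hT.exists_eq_locD hy (fun i k m f g => ?_) fun i j f g => ?_
  · have h := hM.sumRule hy hs₁ hs₂ hP i (mono hy p k f) (mono_cocompact hy p m g)
    rw [hD i _ (hne k f), hD i _ (hne m g)] at h
    rw [h]
    have key : ∀ q, sInt (nn i * (ls q (mono hy p k f) * ls q (mono hy p m g)).coeff (-2)) =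
        if q = p then
          sInt (nn i * (HahnSeries.single k f * HahnSeries.single m g).coeff (-2)) else 0 := by
      intro q
      split_ifs with hq
      · rw [hq, ls_mono_self, ls_mono_self]
      · rw [hne k f q hq, zero_mul]
        simp
    rw [key, key]
    obtain ⟨p, rfl | rfl⟩ := p
    · rw [if_pos rfl, if_neg fun e => hy (Subtype.ext_iff.1 e).symm, add_zero]
    · rw [if_pos rfl, if_neg fun e => hy (Subtype.ext_iff.1 e), zero_add]
  -- A function of order 0 has no singular coefficient, so `D i F` and `D j F` vanish and
  -- commutation reduces to the symmetry of `D i (dd j F)`.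
  · have h1 := hM.pair_apply hy hs₁ hs₂ hP i j (mono hy p 0 f) (mono_cocompact hy p (-1) g)
    have h2 := hM.pair_apply hy hs₁ hs₂ hP j i (mono hy p 0 f) (mono_cocompact hy p (-1) g)
    rw [hcomm [i, j] [j, i] (List.Perm.swap j i []), h2, hD i _ (hned j 0 f), hD j _ (hned i 0 f),
      hD i _ (hne 0 f), hD j _ (hne 0 f), hT.mono_eq_zero hy le_rfl, hT.mono_eq_zero hy le_rfl] at h1
    simpa using h1.symm

end

end Hadamard


/-! ### Assembly of the equivalences -/

namespace Hadamard

noncomputable section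

variable {y₁ y₂ : E}

/-! ### The classification -/

theorem ByPartsAll.first {s₁ s₂ : ℝ} {M : List (Fin 3) → singularSpace y₁ y₂ →ₗ[ℝ] Form y₁ y₂}
    (h : ByPartsAll s₁ s₂ M) : ByPartsFirst s₁ s₂ M := fun L hL =>
  h L 1 le_rfl (List.length_pos_iff.2 hL)

theorem exists_multiDeriv_locD (hy : y₁ ≠ y₂) {s₁ s₂ : ℝ} (hs₁ : 0 < s₁) (hs₂ : 0 < s₂)
    (K₁ K₂ : ℝ) :
    ∃ M, IsMultiDeriv (fun i => locD K₁ ⟨y₁, Or.inl rfl⟩ i + locD K₂ ⟨y₂, Or.inr rfl⟩ i) M ∧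
      ByPartsAll s₁ s₂ M ∧ Commuting M := by
  refine ⟨_, isMultiDeriv_multi hy (isLocalTerm_locD hy K₁ ⟨y₁, Or.inl rfl⟩)
    (isLocalTerm_locD hy K₂ ⟨y₂, Or.inr rfl⟩) fun i F => rfl,
    byPartsAll_multi hy hs₁ hs₂ fun i F G => ?_, commuting_multi fun i j F G => ?_⟩
  · have h1 := locForm_add_swap K₁ i (ls ⟨y₁, Or.inl rfl⟩ F) (ls (y₂ := y₂) ⟨y₁, Or.inl rfl⟩ G)
    have h2 := locForm_add_swap K₂ i (ls ⟨y₂, Or.inr rfl⟩ F) (ls (y₁ := y₁) ⟨y₂, Or.inr rfl⟩ G)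
    simp only [LinearMap.add_apply, locD_apply]
    linear_combination h1 + h2
  · have h1 := locD_comm K₁ ⟨y₁, Or.inl rfl⟩ i j F G
    have h2 := locD_comm K₂ ⟨y₂, Or.inr rfl⟩ i j F G
    simp only [LinearMap.add_apply]
    linear_combination h1 + h2

theorem exists_eq_locD (hy : y₁ ≠ y₂) {s₁ s₂ : ℝ} (hs₁ : 0 < s₁) (hs₂ : 0 < s₂)
    {D T₁ T₂ : Fin 3 → singularSpace y₁ y₂ →ₗ[ℝ] Form y₁ y₂} (h₁ : IsLocalTerm y₁ T₁)
    (h₂ : IsLocalTerm y₂ T₂) (hD : ∀ i F, D i F = T₁ i F + T₂ i F)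
    (hM : ∃ M, IsMultiDeriv D M ∧ ByPartsFirst s₁ s₂ M ∧ Commuting M) :
    ∃ K₁ K₂, T₁ = locD K₁ ⟨y₁, Or.inl rfl⟩ ∧ T₂ = locD K₂ ⟨y₂, Or.inr rfl⟩ := by
  obtain ⟨M, hM, hP, hC⟩ := hM
  have h₁' : IsLocalTerm (⟨y₁, Or.inl rfl⟩ : SPt y₁ y₂).1 T₁ := h₁
  have h₂' : IsLocalTerm (⟨y₂, Or.inr rfl⟩ : SPt y₁ y₂).1 T₂ := h₂
  obtain ⟨K₁, hK₁⟩ := h₁'.exists_eq_locD_of_byParts hy hs₁ hs₂ hM hP hC fun i F hF => by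
    rw [hD, h₂'.eq_zero_left (fun k _ => by
      rw [hF _ fun e => hy (Subtype.ext_iff.1 e).symm, HahnSeries.coeff_zero]), add_zero]
  obtain ⟨K₂, hK₂⟩ := h₂'.exists_eq_locD_of_byParts hy hs₁ hs₂ hM hP hC fun i F hF => by
    rw [hD, h₁'.eq_zero_left (fun k _ => by
      rw [hF _ fun e => hy (Subtype.ext_iff.1 e), HahnSeries.coeff_zero]), zero_add]
  exact ⟨K₁, K₂, hK₁, hK₂⟩

theorem locForm_congr_both {K : ℝ} {i : Fin 3} {A A' B B' : HahnSeries ℤ SM}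
    (hA : ∀ k < 0, A.coeff k = A'.coeff k) (hB : ∀ k, B.coeff k = B'.coeff k) :
    locForm K i A B = locForm K i A' B' := by
  rw [locForm_congr K i hA, HahnSeries.ext (funext hB)]

theorem singularOnlyAlike_locD (hy : y₁ ≠ y₂) (K : ℝ) :
    SingularOnlyAlike fun i =>
      locD K (⟨y₁, Or.inl rfl⟩ : SPt y₁ y₂) i + locD K ⟨y₂, Or.inr rfl⟩ i := by
  refine ⟨_, _, isLocalTerm_locD hy K ⟨y₁, Or.inl rfl⟩, isLocalTerm_locD hy K ⟨y₂, Or.inr rfl⟩,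
    fun i F => rfl, fun F F' G G' hF hG i => ?_⟩
  refine locForm_congr_both (fun k hk => Subtype.ext ?_) fun k => Subtype.ext ?_
  · rw [← coef_ls, ← coef_ls]
    exact hF k hk
  · rw [← coef_ls, ← coef_ls]
    exact hG k

theorem nn_ne_zero (i : Fin 3) : nn i ≠ 0 := by
  intro h
  have h2 := congrArg (evalAt ⟨ee i, by simp⟩) h
  rw [map_zero] at h2
  change (ee i : E) i = 0 at h2
  simp at h2

/-- The constant enters through `(K - 1) • sphT i`, which does not annihilate constants; one pair of
functions of order -1 at each point detects it. -/
theorem eq_of_locD_alike (hy : y₁ ≠ y₂) {K₁ K₂ : ℝ}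
    (h : ∀ F F' G G' : singularSpace y₁ y₂, (∀ k < 0, coef y₁ F k = coef y₂ F' k) →
      (∀ k, coef y₁ G k = coef y₂ G' k) →
      ∀ i, locD K₁ ⟨y₁, Or.inl rfl⟩ i F G = locD K₂ ⟨y₂, Or.inr rfl⟩ i F' G') : K₁ = K₂ := by
  have key : ∀ (f : SM) (k : ℤ), coef y₁ (mono hy ⟨y₁, Or.inl rfl⟩ (-1) f) k =
      coef y₂ (mono hy ⟨y₂, Or.inr rfl⟩ (-1) f) k := fun f k => by
    have e1 := coef_ls (y₁ := y₁) (y₂ := y₂) ⟨y₁, Or.inl rfl⟩ (mono hy ⟨y₁, Or.inl rfl⟩ (-1) f) k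
    have e2 := coef_ls (y₁ := y₁) (y₂ := y₂) ⟨y₂, Or.inr rfl⟩ (mono hy ⟨y₂, Or.inr rfl⟩ (-1) f) k
    rw [ls_mono_self] at e1 e2
    exact e1.trans e2.symm
  have hval : ∀ (K : ℝ) (p : SPt y₁ y₂) (f g : SM),
      locD K p 0 (mono hy p (-1) f) (mono hy p (-1) g) = sInt (bop K 0 f * g) := fun K p f g => by
    rw [locD_apply, ls_mono_self, ls_mono_self, locForm_eq (m := -1) K 0 (by norm_num)
      (fun k hk => HahnSeries.coeff_single_of_ne hk.ne)
      (fun k hk => HahnSeries.coeff_single_of_ne hk.ne), Finset.Ico_self, Finset.sum_empty, zero_add,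
      HahnSeries.coeff_single_same, HahnSeries.coeff_single_same]
  -- For the coefficients `1` and `n_0` the part depending on `K` is `(K - 1) ∫ n_0 ^ 2`, because
  -- `sphT 0 1 = -n_0`.
  have h1 := h _ _ _ _ (fun k _ => key 1 k) (key (nn 0)) 0
  rw [hval, hval] at h1
  have hT : sphT 0 1 = -nn 0 := by
    have := sphD_algebraMap 0 1
    rw [map_one] at this
    rw [sphT_apply, this, mul_one, zero_sub]
  simp only [bop_apply, sub_mul, map_sub, smul_mul_assoc, map_smul, smul_eq_mul, hT] at h1
  have hneg : sInt (-nn 0 * nn 0) = -sInt (nn 0 * nn 0) := by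
    rw [← map_neg]
    congr 1
    ring
  rw [hneg] at h1
  have h2 : sInt (nn 0 * nn 0) ≠ 0 := fun e => nn_ne_zero 0 (sInt_mul_self_eq_zero e)
  have h3 : (K₁ - K₂) * sInt (nn 0 * nn 0) = 0 := by linear_combination h1
  exact sub_eq_zero.1 ((mul_eq_zero.1 h3).resolve_right h2)

end

end Hadamard

theorem theorem4 (y₁ y₂ : E) (hy : y₁ ≠ y₂) (s₁ s₂ : ℝ) (hs₁ : 0 < s₁) (hs₂ : 0 < s₂) :
    (∀ D : Fin 3 → singularSpace y₁ y₂ →ₗ[ℝ] Form y₁ y₂,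
      [SingularOnly D ∧ ∃ M, IsMultiDeriv D M ∧ ByPartsFirst s₁ s₂ M ∧ Commuting M,
        SingularOnly D ∧ ∃ M, IsMultiDeriv D M ∧ ByPartsAll s₁ s₂ M ∧ Commuting M,
        ∃ K₁ K₂ : ℝ, IsGivenBy D K₁ K₂].TFAE ∧
      [SingularOnlyAlike D ∧ ∃ M, IsMultiDeriv D M ∧ ByPartsFirst s₁ s₂ M ∧ Commuting M,
        SingularOnlyAlike D ∧ ∃ M, IsMultiDeriv D M ∧ ByPartsAll s₁ s₂ M ∧ Commuting M,
        ∃ K : ℝ, IsGivenBy D K K].TFAE) ∧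
    ∀ K₁ K₂ : ℝ, ∃! D : Fin 3 → singularSpace y₁ y₂ →ₗ[ℝ] Form y₁ y₂, IsGivenBy D K₁ K₂ := by
  refine ⟨fun D => ⟨?_, ?_⟩, fun K₁ K₂ => ?_⟩
  · tfae_have 1 → 3 := by
      rintro ⟨⟨T₁, T₂, h₁, h₂, hD⟩, hM⟩
      obtain ⟨K₁, K₂, rfl, rfl⟩ := exists_eq_locD hy hs₁ hs₂ h₁ h₂ hD hM
      exact ⟨K₁, K₂, isGivenBy_iff.2 (funext fun i => LinearMap.ext (hD i))⟩
    tfae_have 3 → 2 := by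
      rintro ⟨K₁, K₂, h⟩
      rw [isGivenBy_iff.1 h]
      exact ⟨⟨_, _, isLocalTerm_locD hy K₁ ⟨y₁, Or.inl rfl⟩,
        isLocalTerm_locD hy K₂ ⟨y₂, Or.inr rfl⟩, fun i F => rfl⟩,
        exists_multiDeriv_locD hy hs₁ hs₂ K₁ K₂⟩
    tfae_have 2 → 1 := fun ⟨h, M, hM, hP, hC⟩ => ⟨h, M, hM, hP.first, hC⟩
    tfae_finish
  · tfae_have 1 → 3 := by
      rintro ⟨⟨T₁, T₂, h₁, h₂, hD, halike⟩, hM⟩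
      obtain ⟨K₁, K₂, rfl, rfl⟩ := exists_eq_locD hy hs₁ hs₂ h₁ h₂ hD hM
      obtain rfl := eq_of_locD_alike hy halike
      exact ⟨K₁, isGivenBy_iff.2 (funext fun i => LinearMap.ext (hD i))⟩
    tfae_have 3 → 2 := by
      rintro ⟨K, h⟩
      rw [isGivenBy_iff.1 h]
      exact ⟨singularOnlyAlike_locD hy K, exists_multiDeriv_locD hy hs₁ hs₂ K K⟩
    tfae_have 2 → 1 := fun ⟨h, M, hM, hP, hC⟩ => ⟨h, M, hM, hP.first, hC⟩
    tfae_finish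
  · exact ⟨_, isGivenBy_iff.2 rfl, fun D hD => isGivenBy_iff.1 hD⟩
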